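/- **Setting.** Let $\Omega\subset\mathbb R^3$ be a bounded domain with Lipschitz boundary, surface measure $\mathrm dA$ and outer unit normal $\mathbf n$; let $\nu\ge 2$ (constituents) and $n\ge 0$ (reactions). A state is a field $\mathbf z=(\rho_1,\dots,\rho_\nu,\mathbf M,w)$, $C^\infty$ up to the boundary of $\Omega$, with $\rho=\sum_\alpha\rho_\alpha>0$ on $\overline\Omega$ and with $(\rho_1,\dots,\rho_\nu,w)$ taking values on $\overline\Omega$ in an open set $\mathcal D\subset\mathbb R^{\nu+1}$; $\mathbf v=\mathbf M/\rho$. Two representations are considered. (E) $w=s$ is the entropy density and energy is the potential: $u=u(\rho_1,\dots,\rho_\nu,s)$, $T=\partial u/\partial s$, $\mu_\alpha=\partial u/\partial\rho_\alpha$. (S) $w=u$ is the internal energy density and entropy is the potential: $s=s(\rho_1,\dots,\rho_\nu,u)$, $1/T=\partial s/\partial u$, $-\mu_\alpha/T=\partial s/\partial\rho_\alpha$. The pressure is $p=-u+Ts+\sum_\alpha\rho_\alpha\mu_\alpha$. The potential and the coefficients $L^k,L^{kb},\zeta,\lambda,\kappa,B_\alpha,B_{\alpha\beta}$ are $C^\infty$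 functions on $\mathcal D$; $\gamma_\alpha^k$ and $m_\alpha$ are real constants, and $$\mathbb L_\alpha=\sum_k\gamma^k_\alpha m_\alpha L^k,\qquad \mathbb L_{\alpha\beta}=\sum_{k,b}\gamma_\alpha^k m_\alpha L^{kb}\gamma_\beta^b m_\beta .$$ On $\mathcal D$ it is assumed that $T>0$, $\zeta\ge0$, $\sum_\alpha\gamma^k_\alpha m_\alpha=0$, $\sum_\alpha B_\alpha=\sum_\beta B_{\alpha\beta}=0$, $B_{\alpha\beta}=B_{\beta\alpha}$, $\mathbb L_{\alpha\beta}=\mathbb L_{\beta\alpha}$, and that the quadratic forms of $$\mathbb B=\begin{pmatrix}\kappa T^2&B_\beta\\ B_\alpha&B_{\alpha\beta}\end{pmatrix}\quad\text{and}\quad\begin{pmatrix}\lambda&-\mathbb L_\beta\\ \mathbb L_\alpha&\mathbb L_{\alpha\beta}\end{pmatrix}$$ are non-negative. Put $$\mathbf q=\kappa T^2\nabla\tfrac1T-\sum_\beta B_\beta\nabla\tfrac{\mu_\beta}T,\qquad \mathbf J_\alpha=B_\alpha\nabla\tfrac1T-\sum_\beta B_{\alpha\beta}\nabla\tfrac{\mu_\beta}T,$$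 $$\mathbf D=\nabla\mathbf v+\nabla\mathbf v^\top,\qquad \mathbf T=\Big(-p+\sum_\alpha\mathbb L_\alpha\mu_\alpha+\big(\lambda-\tfrac{2\zeta}3\big)\operatorname{div}\mathbf v\Big)\mathbf I+\zeta\mathbf D,$$ $$\Lambda^k=-\sum_bL^{kb}\sum_\alpha\mu_\alpha\gamma^b_\alpha m_\alpha+L^k\operatorname{div}\mathbf v,\qquad \tau_\alpha=\sum_k\gamma_\alpha^km_\alpha\Lambda^k .$$ The field equations in $\Omega$ (no boundary conditions) are $$\partial_t\rho_\alpha=-\operatorname{div}(\rho_\alpha\mathbf v+\mathbf J_\alpha)+\tau_\alpha,\qquad \partial_t\mathbf M=-\operatorname{div}(\mathbf M\otimes\mathbf v-\mathbf T),$$ together with, in (E), $$\partial_ts=-\operatorname{div}\Big(s\mathbf v+\tfrac1T\big(\mathbf q-\sum_\alpha\mu_\alpha\mathbf J_\alpha\big)\Big)+\mathbf q\cdot\nabla\tfrac1T+\tfrac1T(\mathbf T:\nabla\mathbf v+p\operatorname{div}\mathbf v)-\sum_\alpha\Big(\mathbf J_\alpha\cdot\nabla\tfrac{\mu_\alpha}T+\tau_\alpha\tfrac{\mu_\alpha}T\Big),$$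 and, in (S), $\partial_tu=-\operatorname{div}(u\mathbf v+\mathbf q)+\mathbf T:\nabla\mathbf v$. **Observables.** A functional $A$ of the state is an observable if at each state $\mathbf z$ it has a functional derivative: a field $a=\frac{\delta A}{\delta\mathbf z}$, $C^\infty$ up to the boundary, with $A(\mathbf z+\mathbf h)=A(\mathbf z)+\int_\Omega a\cdot\mathbf h\,\mathrm dx+o(\|\mathbf h\|_{C^k(\overline\Omega)})$ for smooth $\mathbf h$ and some $k$. It is local if, for some $r$, $\frac{\delta A}{\delta\mathbf z}(x)$ is a fixed $C^\infty$ function of $x$ and of the derivatives of $\mathbf z$ at $x$ up to order $r$. The total energy and entropy are $H=\int_\Omega\big(\frac{\mathbf M\cdot\mathbf M}{2\rho}+u\big)\mathrm dx$ and $S=\int_\Omega s\,\mathrm dx$. **Brackets.** Write $a=(a_1,\dots,a_\nu,a_{\mathbf M},a_w)=\frac{\delta A}{\delta \mathbf z}$ and $b=\frac{\delta B}{\delta\mathbf z}$. Put $P=0$ in (E) and $P=p-\sum_\beta\mu_\beta\mathbb L_\beta$ in (S). The Poisson bracket and its boundary contribution are $$\begin{aligned}\{A,B\}=\int_\Omega&-\sum_\alpha\rho_\alpha\big[a_{\mathbf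 M}\cdot\nabla b_\alpha-b_{\mathbf M}\cdot\nabla a_\alpha\big]+\sum_\alpha\big[a_{\mathbf M}\cdot\nabla(b_\alpha\mathbb L_\alpha)-b_{\mathbf M}\cdot\nabla(a_\alpha\mathbb L_\alpha)\big]\\&-\mathbf M\cdot\big[(a_{\mathbf M}\cdot\nabla)b_{\mathbf M}-(b_{\mathbf M}\cdot\nabla)a_{\mathbf M}\big]-w\big[a_{\mathbf M}\cdot\nabla b_w-b_{\mathbf M}\cdot\nabla a_w\big]\\&-\big[a_{\mathbf M}\cdot\nabla(b_wP)-b_{\mathbf M}\cdot\nabla(a_wP)\big]\,\mathrm dx,\end{aligned}$$ $$\{A,B\}_{\rm boundary}=\int_{\partial\Omega}\Big(\sum_\alpha a_\alpha(\rho_\alpha-\mathbb L_\alpha)+a_{\mathbf M}\cdot\mathbf M+a_w(w+P)\Big)\,b_{\mathbf M}\cdot\mathbf n\,\mathrm dA .$$ Put $a_0=\frac1Ta_w$ and $\hat a_\alpha=a_\alpha-\frac{\mu_\alpha}Ta_w$ in (E), and $a_0=a_w$ and $\hat a_\alpha=a_\alpha$ in (S); in both cases $\hat a=(a_0,\hat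 a_1,\dots,\hat a_\nu)$, $\mathbf D_a=\nabla a_{\mathbf M}+\nabla a_{\mathbf M}^\top-a_0\mathbf D$ and $d_a=\operatorname{div}a_{\mathbf M}-a_0\operatorname{div}\mathbf v$; likewise for $b$. The dissipation bracket and its boundary contribution are $$[A,B]=\int_\Omega\frac{\zeta T}2\,\mathbf D_a:\mathbf D_b+T\Big(\lambda-\frac{2\zeta}3\Big)d_ad_b+\sum_{i,j=0}^\nu\mathbb B_{ij}\nabla\hat a_i\cdot\nabla\hat b_j+T\sum_{\alpha,\beta}\hat a_\alpha\mathbb L_{\alpha\beta}\hat b_\beta\,\mathrm dx,$$ $$[A,B]_{\rm boundary}=\int_{\partial\Omega}\zeta T\,a_{\mathbf M}\cdot\mathbf D_b\cdot\mathbf n+(a_{\mathbf M}\cdot\mathbf n)\,T\Big(\lambda-\frac{2\zeta}3\Big)d_b+\sum_{i,j=0}^\nu\hat a_i\,\mathbb B_{ij}\nabla\hat b_j\cdot\mathbf n\,\mathrm dA .$$ The bulk contributions are $\{A,B\}_{\rm bulk}=\{A,B\}-\{A,B\}_{\rm boundary}$ and $[A,B]_{\rm bulk}=[A,B]-[A,B]_{\rm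 boundary}$. **Port.** For $\mathbf u=(u_1,u_2,u_3,u_{J_1},\dots,u_{J_\nu},\mathbf u_{\mathbf S})$ on $\partial\Omega$ and a field $\varphi$ let $$\langle\varphi,\mathcal B(\mathbf z)\mathbf u\rangle=\int_{\partial\Omega}\sum_\alpha\varphi_\alpha\big((\mathbb L_\alpha-\rho_\alpha)u_2-u_{J_\alpha}\big)+\varphi_{\mathbf M}\cdot(\mathbf u_{\mathbf S}-u_2\mathbf M-u_1\mathbf n)-\varphi_w\,\ell(\mathbf u)\,\mathrm dA,$$ with $\ell(\mathbf u)=su_2+\frac1Tu_3-\sum_\alpha\frac{\mu_\alpha}Tu_{J_\alpha}$ in (E) and $\ell(\mathbf u)=(u+p-\sum_\beta\mathbb L_\beta\mu_\beta)u_2+u_3$ in (S). The port of the mixture is $$\mathbf u(\mathbf z)=\Big(\sum_\beta\mathbb L_\beta\mu_\beta,\ \mathbf v\cdot\mathbf n,\ \mathbf q\cdot\mathbf n,\ \mathbf J_1\cdot\mathbf n,\dots,\mathbf J_\nu\cdot\mathbf n,\ (\mathbf T+p\mathbf I)\cdot\mathbf n\Big)\Big|_{\partial\Omega}.$$ **Theorem.**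 In either representation the following hold. 1. $H$ and $S$ are observables. 2. For all observables, $\{A,B\}=-\{B,A\}$; the product $AB$ is an observable and $\{AB,C\}=A\{B,C\}+B\{A,C\}$. If $A,B,C$ are $C^\infty$ functions of finitely many local observables and $\{A,B\},\{B,C\},\{C,A\}$ are again observables, then $\{A,\{B,C\}\}+\{B,\{C,A\}\}+\{C,\{A,B\}\}=0$. 3. For all observables, $[A,B]=[B,A]$, $[A,A]\ge0$ and $[AB,C]=A[B,C]+B[A,C]$. 4. For every observable, $\{A,S\}_{\rm bulk}=0$ and $[A,H]_{\rm bulk}=0$. 5. For every observable and every state, $\{A,H\}_{\rm boundary}+[A,S]_{\rm boundary}=-\big\langle\frac{\delta A}{\delta\mathbf z},\mathcal B(\mathbf z)\mathbf u(\mathbf z)\big\rangle$. 6. If $\mathbf z(t)$, $t\in I$ with $I\subset\mathbb R$ open, is a family of states that is jointly $C^\infty$ in time and space up to the boundary and solves the field equations in $\Omega$, then for every observable $A$ the function $t\mapsto A(\mathbf z(t))$ is differentiable and $$\frac{\mathrm dA}{\mathrm dt}=\{A,H\}-\{A,H\}_{\rm boundary}+[A,S]-[A,S]_{\rm boundary}.$$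 -/

import Mathlib

open MeasureTheory Set
open scoped ContDiff NNReal

noncomputable section

namespace OpenMixture

/-- Physical space. -/
abbrev E : Type := EuclideanSpace ℝ (Fin 3)

/-- The plane over which the boundary of a domain is locally a graph. -/
abbrev Plane : Type := EuclideanSpace ℝ (Fin 2)

/-! ### Domains with Lipschitz boundary, surface measure, outer normal -/

/-- The point of the graph of `g` above `p`, in the Cartesian coordinate system `e`. -/
def graphPoint (e : E ≃ₗᵢ[ℝ] WithLp 2 (Plane × ℝ)) (g : Plane → ℝ) (p : Plane) : E :=
  e.symm (WithLp.toLp 2 (p, g p))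

/-- The surface element `√(1 + |∇g|²)` of the graph of `g`. -/
def areaElement (g : Plane → ℝ) (p : Plane) : ℝ :=
  Real.sqrt (1 + ‖gradient g p‖ ^ 2)

/-- The unit normal `(-∇g, 1) / √(1 + |∇g|²)` of the graph of `g`, pointing upwards. -/
def graphNormal (e : E ≃ₗᵢ[ℝ] WithLp 2 (Plane × ℝ)) (g : Plane → ℝ) (p : Plane) : E :=
  (areaElement g p)⁻¹ • e.symm (WithLp.toLp 2 (-gradient g p, 1))

/-- `Ω` is a bounded domain with Lipschitz boundary, `σ` is the surface measure of `∂Ω` and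
`nrm` is the outer unit normal field on `∂Ω`. Near each boundary point, in suitable Cartesian
coordinates, `Ω` is the set of points below the graph of a Lipschitz function; there `σ` is the
surface measure of the graph, and `nrm` is the upward unit normal of the graph (which exists
almost everywhere). -/
structure IsLipschitzDomain (Ω : Set E) (σ : Measure E) (nrm : E → E) : Prop where
  isOpen : IsOpen Ω
  isConnected : IsConnected Ω
  isBounded : Bornology.IsBounded Ω
  measure_compl : σ (frontier Ω)ᶜ = 0
  chart : ∀ x ∈ frontier Ω, ∃ (U : Set E) (e : E ≃ₗᵢ[ℝ] WithLp 2 (Plane × ℝ))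
    (g : Plane → ℝ) (K : ℝ≥0),
    IsOpen U ∧ x ∈ U ∧ LipschitzWith K g ∧
    (∀ y ∈ U, y ∈ Ω ↔ (e y).snd < g (e y).fst) ∧
    σ.restrict U =
      (((volume : Measure Plane).withDensity fun p => ENNReal.ofReal (areaElement g p)).map
        (graphPoint e g)).restrict U ∧
    ∀ᵐ p ∂(volume : Measure Plane), graphPoint e g p ∈ U →
      nrm (graphPoint e g p) = graphNormal e g p

/-! ### Vector calculus -/

/-- The matrix `(∂ⱼ φᵢ)` of a vector field. -/
def jac (φ : E → E) (x : E) : Matrix (Fin 3) (Fin 3) ℝ :=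
  Matrix.of fun i j => fderiv ℝ φ x (EuclideanSpace.single j 1) i

/-- `∇φ + ∇φᵀ`. -/
def symGrad (φ : E → E) (x : E) : Matrix (Fin 3) (Fin 3) ℝ :=
  jac φ x + (jac φ x).transpose

/-- The divergence of a vector field. -/
def div (φ : E → E) (x : E) : ℝ := (jac φ x).trace

/-- The double contraction `A : B`. -/
def contract (A B : Matrix (Fin 3) (Fin 3) ℝ) : ℝ := ∑ i, ∑ j, A i j * B i j

/-- The vector `A · v`. -/
def apply (A : Matrix (Fin 3) (Fin 3) ℝ) (v : E) : E :=
  WithLp.toLp 2 fun i => ∑ j, A i j * v j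

/-- The divergence `(∑ⱼ ∂ⱼ Aᵢⱼ)ᵢ` of a matrix field. -/
def matDiv (A : E → Matrix (Fin 3) (Fin 3) ℝ) (x : E) : E :=
  WithLp.toLp 2 fun i => ∑ j, fderiv ℝ (fun y => A y i j) x (EuclideanSpace.single j 1)

/-! ### Fields -/

/-- Values of the state `(ρ₁, …, ρ_ν, M, w)`, where the scalar `w` is the entropy density `s` or
the internal energy density `u`, according to the representation. -/
abbrev Val (ν : ℕ) : Type := (Fin ν → ℝ) × E × ℝ

/-- State fields, and functional derivatives of observables. They are given on all of space,
but only their restrictions to the closed domain matter. -/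
abbrev StateField (ν : ℕ) : Type := E → Val ν

/-- Values of the thermodynamic state variables `(ρ₁, …, ρ_ν, w)`. -/
abbrev Thermo (ν : ℕ) : Type := (Fin ν → ℝ) × ℝ

variable {ν n : ℕ}

/-- The component of a field belonging to `ρ_α`. -/
def rho (z : StateField ν) (α : Fin ν) (x : E) : ℝ := (z x).1 α

/-- The component of a field belonging to the momentum density `M`. -/
def mom (z : StateField ν) (x : E) : E := (z x).2.1

/-- The component of a field belonging to `w`. -/
def sca (z : StateField ν) (x : E) : ℝ := (z x).2.2

/-- The local thermodynamic state. -/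
def thermo (z : StateField ν) (x : E) : Thermo ν := ((z x).1, (z x).2.2)

/-- The total mass density. -/
def density (z : StateField ν) (x : E) : ℝ := ∑ α, rho z α x

/-- The barycentric velocity `v = M / ∑ ρ_α`. -/
def vel (z : StateField ν) (x : E) : E := (density z x)⁻¹ • mom z x

/-- The pairing `∫_Ω a · h dx`. -/
def pairing (Ω : Set E) (a h : StateField ν) : ℝ :=
  ∫ x in Ω, ((∑ α, rho a α x * rho h α x) + inner ℝ (mom a x) (mom h x) + sca a x * sca h x)

/-! ### The mixture -/

/-- The two representations: energy is the thermodynamic potential (and `w = s` is a state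
variable), or entropy is the thermodynamic potential (and `w = u` is a state variable). -/
inductive Potential
  | energy
  | entropy

/-- The constitutive data of a mixture of `ν` constituents with `n` chemical reactions. -/
structure Mixture (ν n : ℕ) where
  /-- the representation -/
  pot : Potential
  /-- the thermodynamic states `(ρ, w)` for which the constitutive functions are given -/
  dom : Set (Thermo ν)
  /-- the thermodynamic potential: `u(ρ, s)`, respectively `s(ρ, u)` -/
  phi : Thermo ν → ℝ
  /-- the stoichiometric coefficients -/
  stoich : Fin n → Fin ν → ℝ
  /-- the molecular masses -/
  mass : Fin ν → ℝ
  /-- the coefficients `L^k` -/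
  L₁ : Fin n → Thermo ν → ℝ
  /-- the coefficients `L^{kb}` -/
  L₂ : Fin n → Fin n → Thermo ν → ℝ
  /-- the viscosity `ζ` -/
  zeta : Thermo ν → ℝ
  /-- the viscosity `λ` -/
  lam : Thermo ν → ℝ
  /-- the heat conductivity `κ` -/
  kappa : Thermo ν → ℝ
  /-- the coefficients `B_α` -/
  B₁ : Fin ν → Thermo ν → ℝ
  /-- the coefficients `B_{αβ}` -/
  B₂ : Fin ν → Fin ν → Thermo ν → ℝ

namespace Mixture

variable (m : Mixture ν n)

/-- The derivative of the thermodynamic potential with respect to `w`. -/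
def dPhi (θ : Thermo ν) : ℝ := fderiv ℝ m.phi θ (0, 1)

/-- The derivative of the thermodynamic potential with respect to `ρ_α`. -/
def dPhiRho (α : Fin ν) (θ : Thermo ν) : ℝ := fderiv ℝ m.phi θ (Pi.single α 1, 0)

/-- The absolute temperature: `T = ∂u/∂s`, respectively `1/T = ∂s/∂u`. -/
def temp (θ : Thermo ν) : ℝ :=
  match m.pot with
  | .energy => m.dPhi θ
  | .entropy => (m.dPhi θ)⁻¹

/-- The chemical potentials: `μ_α = ∂u/∂ρ_α`, respectively `-μ_α/T = ∂s/∂ρ_α`. -/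
def mu (α : Fin ν) (θ : Thermo ν) : ℝ :=
  match m.pot with
  | .energy => m.dPhiRho α θ
  | .entropy => -(m.temp θ * m.dPhiRho α θ)

/-- The internal energy density `u`. -/
def intEnergy (θ : Thermo ν) : ℝ :=
  match m.pot with
  | .energy => m.phi θ
  | .entropy => θ.2

/-- The entropy density `s`. -/
def entropyDensity (θ : Thermo ν) : ℝ :=
  match m.pot with
  | .energy => θ.2
  | .entropy => m.phi θ

/-- The pressure `p = -u + T s + ∑ ρ_α μ_α`. -/
def press (θ : Thermo ν) : ℝ :=
  -m.intEnergy θ + m.temp θ * m.entropyDensity θ + ∑ α, θ.1 α * m.mu α θ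

/-- The coefficients `𝕃_α = ∑ₖ γ_α^k m_α L^k`. -/
def LL₁ (α : Fin ν) (θ : Thermo ν) : ℝ := ∑ k, m.stoich k α * m.mass α * m.L₁ k θ

/-- The coefficients `𝕃_{αβ} = ∑_{k,b} γ_α^k m_α L^{kb} γ_β^b m_β`. -/
def LL₂ (α β : Fin ν) (θ : Thermo ν) : ℝ :=
  ∑ k, ∑ b, m.stoich k α * m.mass α * m.L₂ k b θ * (m.stoich b β * m.mass β)

/-- `∑_β 𝕃_β μ_β`. -/
def chemPress (θ : Thermo ν) : ℝ := ∑ β, m.LL₁ β θ * m.mu β θ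

/-- The standing assumptions on the constitutive functions: smoothness, positive temperature,
the Onsager symmetries, conservation of mass by the reactions and by the diffusion, and the
inequalities imposed by the second law. -/
structure Admissible : Prop where
  isOpen_dom : IsOpen m.dom
  smooth_phi : ContDiffOn ℝ ∞ m.phi m.dom
  smooth_L₁ : ∀ k, ContDiffOn ℝ ∞ (m.L₁ k) m.dom
  smooth_L₂ : ∀ k b, ContDiffOn ℝ ∞ (m.L₂ k b) m.dom
  smooth_zeta : ContDiffOn ℝ ∞ m.zeta m.dom
  smooth_lam : ContDiffOn ℝ ∞ m.lam m.dom
  smooth_kappa : ContDiffOn ℝ ∞ m.kappa m.dom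
  smooth_B₁ : ∀ α, ContDiffOn ℝ ∞ (m.B₁ α) m.dom
  smooth_B₂ : ∀ α β, ContDiffOn ℝ ∞ (m.B₂ α β) m.dom
  temp_pos : ∀ θ ∈ m.dom, 0 < m.temp θ
  mass_reaction : ∀ k, ∑ α, m.stoich k α * m.mass α = 0
  mass_diffusion₁ : ∀ θ ∈ m.dom, ∑ α, m.B₁ α θ = 0
  mass_diffusion₂ : ∀ θ ∈ m.dom, ∀ α, ∑ β, m.B₂ α β θ = 0
  symm_B₂ : ∀ θ ∈ m.dom, ∀ α β, m.B₂ α β θ = m.B₂ β α θ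
  symm_LL₂ : ∀ θ ∈ m.dom, ∀ α β, m.LL₂ α β θ = m.LL₂ β α θ
  zeta_nonneg : ∀ θ ∈ m.dom, 0 ≤ m.zeta θ
  /-- the matrix with first row `(κT², B_β)` and further rows `(B_α, B_{αβ})` is positive
  semi-definite -/
  psd_B : ∀ θ ∈ m.dom, ∀ (c : ℝ) (y : Fin ν → ℝ),
    0 ≤ m.kappa θ * m.temp θ ^ 2 * c ^ 2 + ∑ α, c * m.B₁ α θ * y α + ∑ α, y α * m.B₁ α θ * c
      + ∑ α, ∑ β, y α * m.B₂ α β θ * y β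
  /-- the matrix with first row `(λ, -𝕃_β)` and further rows `(𝕃_α, 𝕃_{αβ})` is positive
  semi-definite -/
  psd_L : ∀ θ ∈ m.dom, ∀ (c : ℝ) (y : Fin ν → ℝ),
    0 ≤ m.lam θ * c ^ 2 - ∑ β, c * m.LL₁ β θ * y β + ∑ α, y α * m.LL₁ α θ * c
      + ∑ α, ∑ β, y α * m.LL₂ α β θ * y β

/-- The state space `𝒵`: fields, smooth up to the boundary, with positive total mass density
(hence bounded below by a positive constant, the closed domain being compact) and with values
for which the constitutive functions are given. -/
def states (Ω : Set E) : Set (StateField ν) :=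
  {z | ContDiff ℝ ∞ z ∧ ∀ x ∈ closure Ω, 0 < density z x ∧ thermo z x ∈ m.dom}

/-- The total energy `H`. -/
def energy (Ω : Set E) (z : StateField ν) : ℝ :=
  (∫ x in Ω, inner ℝ (mom z x) (mom z x) / (2 * density z x)) +
    ∫ x in Ω, m.intEnergy (thermo z x)

/-- The total entropy `S`. -/
def entropy (Ω : Set E) (z : StateField ν) : ℝ := ∫ x in Ω, m.entropyDensity (thermo z x)

end Mixture

/-! ### Functional derivatives and observables -/

/-- `a` is the functional derivative `δA/δz` of `A` at `z`: a field, smooth up to the boundary,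
such that `A(z + h) = A(z) + ∫_Ω a · h dx + o(‖h‖)` for smooth `h`, the norm being that of
`C^k(closure Ω)` for some `k`. -/
def HasVarDeriv (Ω : Set E) (A : StateField ν → ℝ) (z a : StateField ν) : Prop :=
  ContDiff ℝ ∞ a ∧ ∃ k : ℕ, ∀ ε > 0, ∃ δ > 0, ∀ h : StateField ν, ContDiff ℝ ∞ h → ∀ r ≤ δ,
    (∀ i ≤ k, ∀ x ∈ closure Ω, ‖iteratedFDeriv ℝ i h x‖ ≤ r) →
      |A (z + h) - A z - pairing Ω a h| ≤ ε * r

open Classical in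
/-- The functional derivative `δA/δz`. Its values on the closed domain are unique. -/
def varDeriv (Ω : Set E) (A : StateField ν → ℝ) (z : StateField ν) : StateField ν :=
  if h : ∃ a, HasVarDeriv Ω A z a then h.choose else 0

namespace Mixture

variable (m : Mixture ν n)

/-- Observables: functionals of the state that have a functional derivative everywhere. -/
def IsObservable (Ω : Set E) (A : StateField ν → ℝ) : Prop :=
  ∀ z ∈ m.states Ω, ∃ a, HasVarDeriv Ω A z a

/-- The `r`-jet of a field. -/
def jet (r : ℕ) (z : StateField ν) (x : E) : (i : Fin (r + 1)) → E [×(i : ℕ)]→L[ℝ] Val ν :=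
  fun i => iteratedFDeriv ℝ i z x

/-- Local observables: the functional derivative at a point is a smooth function of the point
and of finitely many derivatives of the state there, as it is for functionals
`∫_Ω a(x, z, ∇z, …) dx`. -/
def IsLocal (Ω : Set E) (A : StateField ν → ℝ) : Prop :=
  m.IsObservable Ω A ∧
  ∃ (r : ℕ) (W : Set (E × ((i : Fin (r + 1)) → E [×(i : ℕ)]→L[ℝ] Val ν)))
    (β : E × ((i : Fin (r + 1)) → E [×(i : ℕ)]→L[ℝ] Val ν) → Val ν),
    IsOpen W ∧ ContDiffOn ℝ ∞ β W ∧
    ∀ z ∈ m.states Ω, ∀ x ∈ closure Ω,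
      (x, jet r z x) ∈ W ∧ varDeriv Ω A z x = β (x, jet r z x)

/-- Smooth functions of finitely many local observables. -/
def IsLocallyGenerated (Ω : Set E) (A : StateField ν → ℝ) : Prop :=
  ∃ (N : ℕ) (F : (Fin N → ℝ) → ℝ) (ℓ : Fin N → StateField ν → ℝ),
    ContDiff ℝ ∞ F ∧ (∀ i, m.IsLocal Ω (ℓ i)) ∧ ∀ z ∈ m.states Ω, A z = F fun i => ℓ i z

/-! ### The Poisson bracket -/

/-- The pressure term of the Poisson bracket: absent in the energy representation, and
`p - ∑_β μ_β 𝕃_β` in the entropy representation. -/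
def bracketPress (θ : Thermo ν) : ℝ :=
  match m.pot with
  | .energy => 0
  | .entropy => m.press θ - m.chemPress θ

/-- The integrand of the Poisson bracket, for functional derivatives `a` and `b`. -/
def poissonDensity (z a b : StateField ν) (x : E) : ℝ :=
  -(∑ α, rho z α x * (fderiv ℝ (rho b α) x (mom a x) - fderiv ℝ (rho a α) x (mom b x)))
  + ∑ α, (fderiv ℝ (fun y => rho b α y * m.LL₁ α (thermo z y)) x (mom a x)
      - fderiv ℝ (fun y => rho a α y * m.LL₁ α (thermo z y)) x (mom b x))
  - inner ℝ (mom z x) (fderiv ℝ (mom b) x (mom a x) - fderiv ℝ (mom a) x (mom b x))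
  - sca z x * (fderiv ℝ (sca b) x (mom a x) - fderiv ℝ (sca a) x (mom b x))
  - (fderiv ℝ (fun y => sca b y * m.bracketPress (thermo z y)) x (mom a x)
      - fderiv ℝ (fun y => sca a y * m.bracketPress (thermo z y)) x (mom b x))

/-- The (full) Poisson bracket `{A, B}`. -/
def poisson (Ω : Set E) (A B : StateField ν → ℝ) (z : StateField ν) : ℝ :=
  ∫ x in Ω, m.poissonDensity z (varDeriv Ω A z) (varDeriv Ω B z) x

/-- The integrand of the boundary contribution of the Poisson bracket. -/
def poissonBdryDensity (nrm : E → E) (z a b : StateField ν) (x : E) : ℝ :=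
  ((∑ α, rho a α x * (rho z α x - m.LL₁ α (thermo z x))) + inner ℝ (mom a x) (mom z x)
    + sca a x * (sca z x + m.bracketPress (thermo z x))) * inner ℝ (mom b x) (nrm x)

/-- The boundary contribution of the Poisson bracket. -/
def poissonBdry (Ω : Set E) (σ : Measure E) (nrm : E → E) (A B : StateField ν → ℝ)
    (z : StateField ν) : ℝ :=
  ∫ x, m.poissonBdryDensity nrm z (varDeriv Ω A z) (varDeriv Ω B z) x ∂σ

/-- The bulk contribution of the Poisson bracket. -/
def poissonBulk (Ω : Set E) (σ : Measure E) (nrm : E → E) (A B : StateField ν → ℝ)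
    (z : StateField ν) : ℝ :=
  m.poisson Ω A B z - m.poissonBdry Ω σ nrm A B z

/-! ### The dissipation bracket -/

/-- The scalar that accompanies `κT²`: `(1/T) δA/δs`, respectively `δA/δu`. -/
def forceHeat (z a : StateField ν) (x : E) : ℝ :=
  match m.pot with
  | .energy => (m.temp (thermo z x))⁻¹ * sca a x
  | .entropy => sca a x

/-- The scalar that accompanies the constituent `α`: `δA/δρ_α - (μ_α/T) δA/δs`, respectively
`δA/δρ_α`. -/
def forceDiff (z a : StateField ν) (α : Fin ν) (x : E) : ℝ :=
  match m.pot with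
  | .energy => rho a α x - m.mu α (thermo z x) / m.temp (thermo z x) * sca a x
  | .entropy => rho a α x

/-- The matrix that accompanies `ζ`: `∇(δA/δM) + ∇(δA/δM)ᵀ - (∇v + ∇vᵀ) (1/T) δA/δs`,
respectively `∇(δA/δM) + ∇(δA/δM)ᵀ - (∇v + ∇vᵀ) δA/δu`. -/
def forceShear (z a : StateField ν) (x : E) : Matrix (Fin 3) (Fin 3) ℝ :=
  symGrad (mom a) x - m.forceHeat z a x • symGrad (vel z) x

/-- The scalar that accompanies `λ - 2ζ/3`: `div(δA/δM) - div(v) (1/T) δA/δs`, respectively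
`div(δA/δM) - div(v) δA/δu`. -/
def forceBulk (z a : StateField ν) (x : E) : ℝ :=
  div (mom a) x - div (vel z) x * m.forceHeat z a x

/-- The vector `κT² ∇(heat force of b) + ∑_β B_β ∇(diffusion force of b)_β`. -/
def fluxHeat (z b : StateField ν) (x : E) : E :=
  (m.kappa (thermo z x) * m.temp (thermo z x) ^ 2) • gradient (m.forceHeat z b) x
    + ∑ β, m.B₁ β (thermo z x) • gradient (m.forceDiff z b β) x

/-- The vectors `B_α ∇(heat force of b) + ∑_β B_{αβ} ∇(diffusion force of b)_β`. -/
def fluxDiff (z b : StateField ν) (α : Fin ν) (x : E) : E :=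
  m.B₁ α (thermo z x) • gradient (m.forceHeat z b) x
    + ∑ β, m.B₂ α β (thermo z x) • gradient (m.forceDiff z b β) x

/-- The integrand of the dissipation bracket, for functional derivatives `a` and `b`. -/
def dissipationDensity (z a b : StateField ν) (x : E) : ℝ :=
  m.zeta (thermo z x) * m.temp (thermo z x) / 2
      * contract (m.forceShear z a x) (m.forceShear z b x)
  + m.temp (thermo z x) * (m.lam (thermo z x) - 2 * m.zeta (thermo z x) / 3)
      * m.forceBulk z a x * m.forceBulk z b x
  + (inner ℝ (gradient (m.forceHeat z a) x) (m.fluxHeat z b x)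
      + ∑ α, inner ℝ (gradient (m.forceDiff z a α) x) (m.fluxDiff z b α x))
  + m.temp (thermo z x) * ∑ α, ∑ β,
      m.forceDiff z a α x * m.LL₂ α β (thermo z x) * m.forceDiff z b β x

/-- The (full) dissipation bracket `[A, B]`. -/
def dissipation (Ω : Set E) (A B : StateField ν → ℝ) (z : StateField ν) : ℝ :=
  ∫ x in Ω, m.dissipationDensity z (varDeriv Ω A z) (varDeriv Ω B z) x

/-- The integrand of the boundary contribution of the dissipation bracket. -/
def dissipationBdryDensity (nrm : E → E) (z a b : StateField ν) (x : E) : ℝ :=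
  m.zeta (thermo z x) * m.temp (thermo z x)
      * inner ℝ (mom a x) (apply (m.forceShear z b x) (nrm x))
  + inner ℝ (mom a x) (nrm x) * m.temp (thermo z x)
      * (m.lam (thermo z x) - 2 * m.zeta (thermo z x) / 3) * m.forceBulk z b x
  + (m.forceHeat z a x * inner ℝ (m.fluxHeat z b x) (nrm x)
      + ∑ α, m.forceDiff z a α x * inner ℝ (m.fluxDiff z b α x) (nrm x))

/-- The boundary contribution of the dissipation bracket. -/
def dissipationBdry (Ω : Set E) (σ : Measure E) (nrm : E → E) (A B : StateField ν → ℝ)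
    (z : StateField ν) : ℝ :=
  ∫ x, m.dissipationBdryDensity nrm z (varDeriv Ω A z) (varDeriv Ω B z) x ∂σ

/-- The bulk contribution of the dissipation bracket. -/
def dissipationBulk (Ω : Set E) (σ : Measure E) (nrm : E → E) (A B : StateField ν → ℝ)
    (z : StateField ν) : ℝ :=
  m.dissipation Ω A B z - m.dissipationBdry Ω σ nrm A B z

/-! ### Constitutive relations and field equations -/

/-- The heat flux `q = κT² ∇(1/T) - ∑_β B_β ∇(μ_β/T)`. -/
def heatFlux (z : StateField ν) (x : E) : E :=
  (m.kappa (thermo z x) * m.temp (thermo z x) ^ 2)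
      • gradient (fun y => (m.temp (thermo z y))⁻¹) x
    - ∑ β, m.B₁ β (thermo z x)
      • gradient (fun y => m.mu β (thermo z y) / m.temp (thermo z y)) x

/-- The diffusion fluxes `J_α = B_α ∇(1/T) - ∑_β B_{αβ} ∇(μ_β/T)`. -/
def diffFlux (z : StateField ν) (α : Fin ν) (x : E) : E :=
  m.B₁ α (thermo z x) • gradient (fun y => (m.temp (thermo z y))⁻¹) x
    - ∑ β, m.B₂ α β (thermo z x)
      • gradient (fun y => m.mu β (thermo z y) / m.temp (thermo z y)) x

/-- The viscous stress `𝐒 = (λ - 2ζ/3) div(v) I + ζ (∇v + ∇vᵀ)`. -/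
def viscousStress (z : StateField ν) (x : E) : Matrix (Fin 3) (Fin 3) ℝ :=
  ((m.lam (thermo z x) - 2 * m.zeta (thermo z x) / 3) * div (vel z) x)
      • (1 : Matrix (Fin 3) (Fin 3) ℝ)
    + m.zeta (thermo z x) • symGrad (vel z) x

/-- The stress `𝐓 = (-p + ∑_α 𝕃_α μ_α) I + 𝐒`. -/
def stress (z : StateField ν) (x : E) : Matrix (Fin 3) (Fin 3) ℝ :=
  (-m.press (thermo z x) + m.chemPress (thermo z x)) • (1 : Matrix (Fin 3) (Fin 3) ℝ)
    + m.viscousStress z x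

/-- The reaction rates `Λ^k = -∑_b L^{kb} (∑_α μ_α γ_α^b m_α) + L^k div(v)`. -/
def reactionRate (z : StateField ν) (k : Fin n) (x : E) : ℝ :=
  -(∑ b, m.L₂ k b (thermo z x) * ∑ α, m.mu α (thermo z x) * m.stoich b α * m.mass α)
    + m.L₁ k (thermo z x) * div (vel z) x

/-- The mass productions `τ_α = ∑ₖ γ_α^k m_α Λ^k`. -/
def massProduction (z : StateField ν) (α : Fin ν) (x : E) : ℝ :=
  ∑ k, m.stoich k α * m.mass α * m.reactionRate z k x

/-- The non-convective entropy flux `(q - ∑_α μ_α J_α) / T`. -/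
def entropyFlux (z : StateField ν) (x : E) : E :=
  (m.temp (thermo z x))⁻¹ •
    (m.heatFlux z x - ∑ α, m.mu α (thermo z x) • m.diffFlux z α x)

/-- The entropy production
`q·∇(1/T) + (1/T)(𝐓:∇v + p div v) - ∑_α (J_α·∇(μ_α/T) + τ_α μ_α/T)`. -/
def entropyProduction (z : StateField ν) (x : E) : ℝ :=
  inner ℝ (m.heatFlux z x) (gradient (fun y => (m.temp (thermo z y))⁻¹) x)
    + (m.temp (thermo z x))⁻¹ *
      (contract (m.stress z x) (jac (vel z) x) + m.press (thermo z x) * div (vel z) x)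
    - ∑ α, (inner ℝ (m.diffFlux z α x)
          (gradient (fun y => m.mu α (thermo z y) / m.temp (thermo z y)) x)
        + m.massProduction z α x * (m.mu α (thermo z x) / m.temp (thermo z x)))

/-- The right-hand side of the balance of `w`: the entropy balance in the energy representation,
the internal energy balance in the entropy representation. -/
def scalarRate (z : StateField ν) (x : E) : ℝ :=
  match m.pot with
  | .energy =>
      -div (fun y => sca z y • vel z y + m.entropyFlux z y) x + m.entropyProduction z x
  | .entropy =>
      -div (fun y => sca z y • vel z y + m.heatFlux z y) x
        + contract (m.stress z x) (jac (vel z) x)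

/-- `z` is a solution, smooth up to the boundary, of the field equations in `Ω` during the times
`t ∈ I`. No boundary condition is imposed: the system is open. -/
structure IsSolution (Ω : Set E) (I : Set ℝ) (z : ℝ → StateField ν) : Prop where
  smooth : ContDiffOn ℝ ∞ (fun q : ℝ × E => z q.1 q.2) (I ×ˢ univ)
  mem_states : ∀ t ∈ I, z t ∈ m.states Ω
  mass_balance : ∀ t ∈ I, ∀ x ∈ Ω, ∀ α,
    deriv (fun τ => rho (z τ) α x) t =
      -div (fun y => rho (z t) α y • vel (z t) y + m.diffFlux (z t) α y) x
        + m.massProduction (z t) α x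
  momentum_balance : ∀ t ∈ I, ∀ x ∈ Ω,
    deriv (fun τ => mom (z τ) x) t =
      -matDiv (fun y => Matrix.of (fun i j => mom (z t) y i * vel (z t) y j)
        - m.stress (z t) y) x
  scalar_balance : ∀ t ∈ I, ∀ x ∈ Ω,
    deriv (fun τ => sca (z τ) x) t = m.scalarRate (z t) x

end Mixture

/-! ### Ports -/

/-- Values of the input port on the boundary. -/
structure Port (ν : ℕ) where
  u₁ : E → ℝ
  u₂ : E → ℝ
  u₃ : E → ℝ
  uJ : Fin ν → E → ℝ
  uS : E → E

namespace Mixture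

variable (m : Mixture ν n)

/-- The part of the boundary operator that acts on the component `w`. -/
def portScalar (z : StateField ν) (u : Port ν) (x : E) : ℝ :=
  match m.pot with
  | .energy => sca z x * u.u₂ x + (m.temp (thermo z x))⁻¹ * u.u₃ x
      - ∑ α, m.mu α (thermo z x) / m.temp (thermo z x) * u.uJ α x
  | .entropy => (sca z x + m.press (thermo z x) - m.chemPress (thermo z x)) * u.u₂ x + u.u₃ x

/-- The pairing `⟨φ, 𝓑(z) u⟩` with the boundary operator. -/
def bdryOperator (σ : Measure E) (nrm : E → E) (z φ : StateField ν) (u : Port ν) : ℝ :=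
  ∫ x, ((∑ α, rho φ α x * ((m.LL₁ α (thermo z x) - rho z α x) * u.u₂ x - u.uJ α x))
    + inner ℝ (mom φ x) (u.uS x - u.u₂ x • mom z x - u.u₁ x • nrm x)
    - sca φ x * m.portScalar z u x) ∂σ

/-- The port `u = (∑_β 𝕃_β μ_β, v·n, q·n, J_α·n, (𝐓 + p I)·n)` of the mixture. -/
def port (nrm : E → E) (z : StateField ν) : Port ν where
  u₁ x := m.chemPress (thermo z x)
  u₂ x := inner ℝ (vel z x) (nrm x)
  u₃ x := inner ℝ (m.heatFlux z x) (nrm x)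
  uJ α x := inner ℝ (m.diffFlux z α x) (nrm x)
  uS x := apply (m.stress z x + m.press (thermo z x) • (1 : Matrix (Fin 3) (Fin 3) ℝ)) (nrm x)

end Mixture

end OpenMixture

end

open OpenMixture

open scoped Topology
noncomputable section
namespace OpenMixture

/-! Write y = (ρ_α − 𝕃_α, M, w + P) for the transported quantities along a state z
(`Mixture.carriedField`) and, for a functional derivative b, let θ_b be the covector field d⟨b, y⟩ −
⟨b, dz⟩ (`transport`). In both representations the integrand of the Poisson bracket is θ_a(b_M) −
θ_b(a_M) (`Mixture.poissonDensity_eq`). The product rule rewrites it as ⟨b, X_a⟩ minus the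
divergence of ⟨b, y⟩ a_M, where X_a is the Hamiltonian field `hamField` (`bracketDensity_eq`). Once
the divergence theorem is available on Lipschitz domains
(`IsLipschitzDomain.setIntegral_fderiv_eq`), such divergences are exactly the boundary
contributions.

Degeneracy. The definition of the pressure is an Euler relation: ⟨δS, y⟩ = s, hence θ of the entropy
vanishes, and δS has no momentum component. Likewise ⟨δH, y⟩ is the energy density plus p − Σ 𝕃_β
μ_β, hence θ of the energy is d(p − Σ 𝕃_β μ_β). In the dissipation bracket the energy has heat force
1, vanishing shear and bulk forces, and diffusion forces that all equal −|v|²/2; conservation of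
mass annihilates the latter. Non-negativity is pointwise: it combines the quadratic forms of the
second law with the inequality (tr D)² ≤ 3 D : D, which absorbs the term −2ζ/3.

Evolution. Paired with a functional derivative, the right-hand side of the field equations is the
contribution of −X_H plus the dissipation integrand with δS minus the divergence of its flux
(`Mixture.dot_rate`). Integration over Ω gives the brackets minus their boundary contributions
(`Mixture.pairing_rate`), and the expansion of an observable along a smooth curve of states gives
the time derivative (`HasVarDeriv.hasDerivAt_comp`). The formula with the port is an identity of
boundary integrands (`Mixture.bdryDensity_eq`).

Jacobi identity. For A = F(ℓ₁, …, ℓ_N) with local ℓᵢ, the change of δA in a direction h is a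
symmetric differential operator applied to h plus a symmetric operator of finite rank, with matrix
∂ᵢ∂ⱼF and range spanned by the δℓᵢ (`SecondVariation`). The bracket {A, {B, C}} sees D = δ{B, C}
only through ⟨D, X_a⟩ and through the flux of ⟨D, y⟩ a_M. The former is the derivative of {B, C} in
the direction X_a, boundary terms included. For the latter, directions χ y with χ compactly
supported in Ω determine ⟨D, y⟩ pointwise in Ω (`dot_varDeriv_poisson`): the differential operators
do not enlarge supports, so that only the finite rank parts meet the boundary. The result
(`poisson_poisson`) is an integral free of second variations plus a difference of two forms in the
second variations of C and B. The forms cancel in the cyclic sum, and the remaining integrands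
cancel pointwise (`bracketDensity_jacobi`), because second directional derivatives of y − z and of
the functional derivatives commute up to the commutator of the vector fields. No boundary term is
discarded anywhere. -/

/-! ### The divergence theorem -/

/-- The vertical shear along the graph of `g`. -/
def shear (g : Plane → ℝ) (hg : Continuous g) : Plane × ℝ ≃ₜ Plane × ℝ where
  toFun q := (q.1, q.2 + g q.1)
  invFun q := (q.1, q.2 - g q.1)
  left_inv q := by simp
  right_inv q := by simp
  continuous_toFun := by fun_prop
  continuous_invFun := by fun_prop

/-- By Fubini, since each vertical fibre is merely translated. -/
lemma measurePreserving_shear (g : Plane → ℝ) (hg : Continuous g) :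
    MeasurePreserving (shear g hg) volume volume := by
  refine MeasurePreserving.skew_product (g := fun p t => t + g p) (MeasurePreserving.id _) ?_ ?_
  · exact (continuous_snd.add (hg.comp continuous_fst)).measurable
  · exact Filter.Eventually.of_forall fun p => map_add_right_eq_self volume (g p)

lemma norm_gradient_le {g : Plane → ℝ} {K : ℝ≥0} (hg : LipschitzWith K g) (p : Plane) :
    ‖gradient g p‖ ≤ K := by
  rw [gradient, LinearIsometryEquiv.norm_map]
  exact norm_fderiv_le_of_lipschitz ℝ hg

lemma measurable_gradient (g : Plane → ℝ) : Measurable (gradient g) :=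
  (LinearIsometryEquiv.continuous _).measurable.comp (measurable_fderiv ℝ g)

/-- Partial integration against the constant 1. That formula reverses the direction, hence the −w in
the proof. -/
lemma integral_lineDeriv_eq_zero {f : Plane → ℝ} {C : ℝ≥0} (hf : LipschitzWith C f)
    (hc : HasCompactSupport f) (w : Plane) : ∫ p, lineDeriv ℝ f p w = 0 := by
  have h := LipschitzWith.integral_lineDeriv_mul_eq (μ := (volume : Measure Plane))
    (LipschitzWith.const (1 : ℝ)) hf hc (-w)
  have h1 : ∀ x, lineDeriv ℝ (fun _ : Plane => (1 : ℝ)) x (-w) = 0 := fun x => by simp [lineDeriv]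
  simpa [h1] using h.symm

/-- The divergence theorem for a subgraph. The shear flattens the graph to the plane t = 0.
Derivatives tangential to the shifted graphs integrate to zero over each of them, and vertical
derivatives are integrated by the fundamental theorem of calculus. -/
lemma integral_fderiv_subgraph {g : Plane → ℝ} {K : ℝ≥0} (hg : LipschitzWith K g)
    {f : Plane × ℝ → ℝ} (hf : ContDiff ℝ 1 f) (hc : HasCompactSupport f) (w : Plane) (c : ℝ) :
    ∫ q in {q : Plane × ℝ | q.2 < g q.1}, fderiv ℝ f q (w, c) =
      ∫ p, (c - inner ℝ (gradient g p) w) * f (p, g p) := by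
  have hgc := hg.continuous
  set Φ := shear g hgc with hΦ
  have hΦap : ∀ q, Φ q = (q.1, q.2 + g q.1) := fun q => rfl
  have hpre : Φ ⁻¹' {q : Plane × ℝ | q.2 < g q.1} = univ ×ˢ Iio 0 := by
    ext q; simp [hΦap]
  rw [← (measurePreserving_shear g hgc).setIntegral_preimage_emb Φ.measurableEmbedding, hpre]
  set D : Plane × ℝ → ℝ := fun q => fderiv ℝ f (Φ q) (w, c) with hD
  -- On the shifted graphs (w, c) = (w, ∇g·w) + (c − ∇g·w) (0, 1). `B` is the contribution of the
  -- vertical part, and `D - B` that of the tangential part.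
  set B : Plane × ℝ → ℝ := fun q =>
    (c - inner ℝ (gradient g q.1) w) * fderiv ℝ f (Φ q) (0, 1) with hB
  have hfd : Continuous (fderiv ℝ f) := hf.continuous_fderiv one_ne_zero
  have hint : ∀ v : Plane × ℝ, Integrable (fun q => fderiv ℝ f (Φ q) v) volume := fun v => by
    have h1 : HasCompactSupport fun q => fderiv ℝ f q v :=
      hc.fderiv_apply (𝕜 := ℝ) v
    exact ((hfd.clm_apply continuous_const).comp Φ.continuous).integrable_of_hasCompactSupport
      (h1.comp_homeomorph Φ)
  have hDi : Integrable D volume := hint _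
  have hBi : Integrable B volume := by
    refine (hint (0, 1)).bdd_mul (c := |c| + K * ‖w‖) ?_ ?_
    · exact (measurable_const.sub (((measurable_gradient g).comp measurable_fst).inner
        measurable_const)).aestronglyMeasurable
    · refine Filter.Eventually.of_forall fun q => (norm_sub_le _ _).trans ?_
      gcongr
      · exact le_rfl
      · exact (norm_inner_le_norm _ _).trans (by gcongr; exact norm_gradient_le hg _)
  have hvol : (volume : Measure (Plane × ℝ)).restrict (univ ×ˢ Iio 0) =
      (volume : Measure Plane).prod ((volume : Measure ℝ).restrict (Iio 0)) := by
    rw [Measure.volume_eq_prod, ← Measure.prod_restrict, Measure.restrict_univ]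
  have hDi' : Integrable D ((volume : Measure Plane).prod ((volume : Measure ℝ).restrict (Iio 0))) :=
    hvol ▸ hDi.restrict
  have hBi' : Integrable B ((volume : Measure Plane).prod ((volume : Measure ℝ).restrict (Iio 0))) :=
    hvol ▸ hBi.restrict
  obtain ⟨C, hC⟩ := ContDiff.lipschitzWith_of_hasCompactSupport hc hf one_ne_zero
  -- For fixed t the tangential part is, almost everywhere (Rademacher), the line derivative of the
  -- compactly supported Lipschitz function p ↦ f(p, t + g p).
  have hzero : ∫ q, (D q - B q) ∂((volume : Measure Plane).prod
      ((volume : Measure ℝ).restrict (Iio 0))) = 0 := by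
    rw [integral_prod_symm (fun q => D q - B q) (hDi'.sub hBi')]
    refine integral_eq_zero_of_ae (Filter.Eventually.of_forall fun t => ?_)
    have hL : LipschitzWith (C * max 1 (0 + K)) fun p => f (Φ (p, t)) :=
      hC.comp (LipschitzWith.id.prodMk ((LipschitzWith.const t).add hg))
    have hS : HasCompactSupport fun p => f (Φ (p, t)) := by
      have : Topology.IsClosedEmbedding fun p : Plane => Φ (p, t) :=
        Φ.isClosedEmbedding.comp (.of_continuous_injective_isClosedMap (by fun_prop)
          (fun a b h => by simpa using h) (isClosedMap_prodMk_right t))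
      exact hc.comp_isClosedEmbedding this
    rw [Pi.zero_apply, ← integral_lineDeriv_eq_zero hL hS w]
    refine integral_congr_ae ?_
    filter_upwards [hg.ae_differentiableAt (μ := volume)] with p hp
    have h1 : HasFDerivAt (fun p => Φ (p, t))
        ((ContinuousLinearMap.id ℝ Plane).prod (fderiv ℝ g p)) p :=
      (hasFDerivAt_id p).prodMk (hp.hasFDerivAt.const_add t)
    have h2 := ((hf.differentiable one_ne_zero (Φ (p, t))).hasFDerivAt.comp p h1)
    rw [show (fun p => f (Φ (p, t))) = f ∘ fun p => Φ (p, t) from rfl,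
      (h2.hasLineDerivAt w).lineDeriv]
    have h3 : inner ℝ (gradient g p) w = fderiv ℝ g p w := by
      rw [gradient, InnerProductSpace.toDual_symm_apply]
    have h4 : ((w, c) : Plane × ℝ) = (w, fderiv ℝ g p w) + (c - fderiv ℝ g p w) • (0, 1) := by
      ext <;> simp
    simp only [hD, hB, h3]
    rw [h4, map_add, map_smul]
    simp
  rw [integral_sub hDi' hBi', sub_eq_zero] at hzero
  rw [hvol]
  refine hzero.trans ?_
  rw [integral_prod _ hBi']
  refine integral_congr_ae (Filter.Eventually.of_forall fun p => ?_)
  simp only [hB]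
  rw [integral_const_mul]
  congr 1
  -- The vertical part: integrating along the fibre from −∞ to 0 leaves the value of f on the graph.
  have hcd : ContDiff ℝ 1 fun t : ℝ => f (Φ (p, t)) :=
    hf.comp (contDiff_const.prodMk (contDiff_id.add (contDiff_const (c := g p))))
  have hcs : HasCompactSupport fun t : ℝ => f (Φ (p, t)) := by
    have : Topology.IsClosedEmbedding fun t : ℝ => Φ (p, t) :=
      Φ.isClosedEmbedding.comp (.of_continuous_injective_isClosedMap (by fun_prop)
        (fun a b h => by simpa using h) (isClosedMap_prodMk_left p))
    exact hc.comp_isClosedEmbedding this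
  have := hcs.integral_Iic_deriv_eq hcd 0
  rw [integral_Iic_eq_integral_Iio] at this
  simp only [hΦap, zero_add] at this ⊢
  rw [← this]
  refine integral_congr_ae (Filter.Eventually.of_forall fun t => ?_)
  have h1 : HasDerivAt (fun t => ((p, t + g p) : Plane × ℝ)) (0, 1) t :=
    (hasDerivAt_const t p).prodMk ((hasDerivAt_id t).add_const _)
  exact (((hf.differentiable one_ne_zero (p, t + g p)).hasFDerivAt.comp_hasDerivAt t h1).deriv).symm

end OpenMixture

end

/-! ### Surface measure, normal and divergence theorem in a boundary chart. -/

noncomputable section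
namespace OpenMixture

/-- The Cartesian coordinates `e`, with values in the product `Plane × ℝ`. -/
def chartCoord (e : E ≃ₗᵢ[ℝ] WithLp 2 (Plane × ℝ)) : E ≃L[ℝ] Plane × ℝ :=
  e.toContinuousLinearEquiv.trans (WithLp.prodContinuousLinearEquiv 2 ℝ Plane ℝ)

lemma chartCoord_apply (e : E ≃ₗᵢ[ℝ] WithLp 2 (Plane × ℝ)) (y : E) :
    chartCoord e y = ((e y).fst, (e y).snd) := rfl

lemma graphPoint_eq (e : E ≃ₗᵢ[ℝ] WithLp 2 (Plane × ℝ)) (g : Plane → ℝ) (p : Plane) :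
    graphPoint e g p = (chartCoord e).symm (p, g p) := rfl

lemma measurePreserving_chartCoord (e : E ≃ₗᵢ[ℝ] WithLp 2 (Plane × ℝ)) :
    MeasurePreserving (chartCoord e) volume volume :=
  (WithLp.volume_preserving_ofLp Plane ℝ).comp e.measurePreserving

/-- A continuous injection between Polish spaces. Being an embedding, it transfers integrals and
null sets between the plane and the graph. -/
lemma measurableEmbedding_graphPoint (e : E ≃ₗᵢ[ℝ] WithLp 2 (Plane × ℝ)) {g : Plane → ℝ}
    (hg : Continuous g) : MeasurableEmbedding (graphPoint e g) := by
  have hc : Continuous (graphPoint e g) :=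
    (chartCoord e).symm.continuous.comp (continuous_id.prodMk hg)
  refine hc.measurableEmbedding fun p q h => ?_
  have := (chartCoord e).symm.injective h
  exact (Prod.ext_iff.1 this).1

lemma graphPoint_fst (e : E ≃ₗᵢ[ℝ] WithLp 2 (Plane × ℝ)) (g : Plane → ℝ) (p : Plane) :
    (e (graphPoint e g p)).fst = p := by
  simp [graphPoint]

lemma areaElement_pos (g : Plane → ℝ) (p : Plane) : 0 < areaElement g p :=
  Real.sqrt_pos.2 (by positivity)

lemma measurable_areaElement (g : Plane → ℝ) : Measurable (areaElement g) :=
  (measurable_const.add ((measurable_gradient g).norm.pow_const 2)).sqrt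

lemma areaElement_le {g : Plane → ℝ} {K : ℝ≥0} (hg : LipschitzWith K g) (p : Plane) :
    areaElement g p ≤ Real.sqrt (1 + K ^ 2) := by
  refine Real.sqrt_le_sqrt ?_
  gcongr
  exact norm_gradient_le hg p

lemma measurable_graphNormal (e : E ≃ₗᵢ[ℝ] WithLp 2 (Plane × ℝ)) (g : Plane → ℝ) :
    Measurable (graphNormal e g) := by
  refine (measurable_areaElement g).inv.smul ?_
  have h : Measurable fun p => (-gradient g p, (1 : ℝ)) :=
    (measurable_gradient g).neg.prodMk measurable_const
  exact (chartCoord e).symm.continuous.measurable.comp h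

lemma norm_graphNormal (e : E ≃ₗᵢ[ℝ] WithLp 2 (Plane × ℝ)) (g : Plane → ℝ) (p : Plane) :
    ‖graphNormal e g p‖ = 1 := by
  rw [graphNormal, norm_smul, LinearIsometryEquiv.norm_map, WithLp.prod_norm_eq_of_L2]
  have : Real.sqrt (‖-gradient g p‖ ^ 2 + ‖(1 : ℝ)‖ ^ 2) = areaElement g p := by
    rw [areaElement, norm_neg]; congr 1; simp; ring
  simp only [WithLp.toLp_fst, WithLp.toLp_snd]
  rw [this, norm_inv, Real.norm_of_nonneg (areaElement_pos g p).le,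
    inv_mul_cancel₀ (areaElement_pos g p).ne']

/-- The surface element cancels the normalisation of the normal, leaving the flux density (−∇g, 1)·w
that occurs in the formula for subgraphs. -/
lemma areaElement_mul_inner_graphNormal (e : E ≃ₗᵢ[ℝ] WithLp 2 (Plane × ℝ)) (g : Plane → ℝ)
    (p : Plane) (w : E) : areaElement g p * inner ℝ w (graphNormal e g p) =
      (chartCoord e w).2 - inner ℝ (gradient g p) (chartCoord e w).1 := by
  rw [graphNormal, inner_smul_right, ← mul_assoc, mul_inv_cancel₀ (areaElement_pos g p).ne',
    one_mul, ← LinearIsometryEquiv.inner_map_map e, LinearIsometryEquiv.apply_symm_apply,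
    WithLp.prod_inner_apply, chartCoord_apply]
  simp only [inner_neg_right, real_inner_comm (gradient g p)]
  simp
  ring

/-- A set in which `Ω` is the subgraph of a Lipschitz function. -/
structure IsGraphChart (Ω : Set E) (σ : Measure E) (nrm : E → E) (U : Set E)
    (e : E ≃ₗᵢ[ℝ] WithLp 2 (Plane × ℝ)) (g : Plane → ℝ) (K : ℝ≥0) : Prop where
  isOpen : IsOpen U
  lipschitz : LipschitzWith K g
  mem_iff : ∀ y ∈ U, y ∈ Ω ↔ (e y).snd < g (e y).fst
  restrict_eq : σ.restrict U =
      (((volume : Measure Plane).withDensity fun p => ENNReal.ofReal (areaElement g p)).map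
        (graphPoint e g)).restrict U
  normal_eq : ∀ᵐ p ∂(volume : Measure Plane), graphPoint e g p ∈ U →
      nrm (graphPoint e g p) = graphNormal e g p

namespace IsGraphChart

variable {Ω : Set E} {σ : Measure E} {nrm : E → E} {U : Set E}
  {e : E ≃ₗᵢ[ℝ] WithLp 2 (Plane × ℝ)} {g : Plane → ℝ} {K : ℝ≥0}

/-- The surface element of a Lipschitz graph is bounded, and the part of the graph in a ball
projects into a bounded set of the plane. -/
lemma finiteAt (h : IsGraphChart Ω σ nrm U e g K) {x : E} (hx : x ∈ U) :
    ∃ t ∈ 𝓝 x, σ t < ⊤ := by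
  obtain ⟨r, hr, hrU⟩ := Metric.isOpen_iff.1 h.isOpen x hx
  refine ⟨Metric.ball x r, Metric.ball_mem_nhds x hr, ?_⟩
  have hm := measurableEmbedding_graphPoint e h.lipschitz.continuous
  have h1 : σ (Metric.ball x r) = σ.restrict U (Metric.ball x r) := by
    rw [Measure.restrict_apply measurableSet_ball, inter_eq_left.2 hrU]
  have h2 : graphPoint e g ⁻¹' Metric.ball x r ⊆ (fun y => (chartCoord e y).1) '' Metric.closedBall x r := by
    intro p hp
    exact ⟨graphPoint e g p, Metric.ball_subset_closedBall hp, graphPoint_fst e g p⟩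
  have h3 : volume (graphPoint e g ⁻¹' Metric.ball x r) < ⊤ := by
    refine (measure_mono h2).trans_lt (IsCompact.measure_lt_top ?_)
    exact (isCompact_closedBall x r).image (continuous_fst.comp (chartCoord e).continuous)
  rw [h1, h.restrict_eq]
  refine (Measure.restrict_apply_le _ _).trans_lt ?_
  rw [hm.map_apply, withDensity_apply _ (hm.measurable measurableSet_ball)]
  refine (lintegral_mono fun p => ENNReal.ofReal_le_ofReal (areaElement_le h.lipschitz p)).trans_lt ?_
  rw [setLIntegral_const]
  exact ENNReal.mul_lt_top ENNReal.ofReal_lt_top h3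

/-- The field `nrm` is prescribed only almost everywhere and need not be measurable; the right-hand
side is a measurable representative. -/
lemma ae_normal (h : IsGraphChart Ω σ nrm U e g K) :
    ∀ᵐ y ∂σ.restrict U, nrm y = graphNormal e g (e y).fst := by
  have hm := measurableEmbedding_graphPoint e h.lipschitz.continuous
  rw [h.restrict_eq, ae_restrict_iff' h.isOpen.measurableSet, hm.ae_map_iff]
  refine (withDensity_absolutelyContinuous _ _).ae_le ?_
  filter_upwards [h.normal_eq] with p hp hU
  rw [hp hU, graphPoint_fst]

lemma aestronglyMeasurable_normal (h : IsGraphChart Ω σ nrm U e g K) :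
    AEStronglyMeasurable nrm (σ.restrict U) := by
  refine ⟨fun y => graphNormal e g (e y).fst, ?_, h.ae_normal⟩
  have h1 : Measurable fun y => (e y).fst :=
    (continuous_fst.comp (chartCoord e).continuous).measurable
  exact ((measurable_graphNormal e g).comp h1).stronglyMeasurable

lemma ae_norm_normal (h : IsGraphChart Ω σ nrm U e g K) :
    ∀ᵐ y ∂σ.restrict U, ‖nrm y‖ = 1 := by
  filter_upwards [h.ae_normal] with y hy
  rw [hy, norm_graphNormal]

/-- The divergence theorem for functions supported in a chart. -/
lemma setIntegral_fderiv_eq (h : IsGraphChart Ω σ nrm U e g K) (hΩ : MeasurableSet Ω) {f : E → ℝ}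
    (hf : ContDiff ℝ 1 f) (hc : HasCompactSupport f) (hU : tsupport f ⊆ U) (w : E) :
    ∫ x in Ω, fderiv ℝ f x w = ∫ x, f x * inner ℝ w (nrm x) ∂σ := by
  set c := chartCoord e with hcd
  have hm := measurableEmbedding_graphPoint e h.lipschitz.continuous
  have hf0 : ∀ x ∉ U, f x = 0 := fun x hx => image_eq_zero_of_notMem_tsupport fun h' => hx (hU h')
  have hdf0 : ∀ x ∉ U, fderiv ℝ f x w = 0 := fun x hx => by
    rw [fderiv_of_notMem_tsupport ℝ fun h' => hx (hU h')]; rfl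
  set S : Set (Plane × ℝ) := {q : Plane × ℝ | q.2 < g q.1} with hS
  have hSm : MeasurableSet S :=
    (isOpen_lt continuous_snd (h.lipschitz.continuous.comp continuous_fst)).measurableSet
  have hf' : ContDiff ℝ 1 (f ∘ c.symm) := hf.comp c.symm.contDiff
  have hc' : HasCompactSupport (f ∘ c.symm) := hc.comp_homeomorph c.symm.toHomeomorph
  have key := integral_fderiv_subgraph h.lipschitz hf' hc' (c w).1 (c w).2
  have hL : ∫ x in Ω, fderiv ℝ f x w =
      ∫ q in S, fderiv ℝ (f ∘ c.symm) q ((c w).1, (c w).2) := by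
    rw [← (measurePreserving_chartCoord e).setIntegral_preimage_emb
      c.toHomeomorph.measurableEmbedding, ← integral_indicator hΩ,
      ← integral_indicator ((measurePreserving_chartCoord e).measurable hSm)]
    refine integral_congr_ae (Filter.Eventually.of_forall fun x => ?_)
    have h1 : fderiv ℝ (f ∘ c.symm) (c x) ((c w).1, (c w).2) = fderiv ℝ f x w := by
      have h2 : HasFDerivAt f (fderiv ℝ f x) (c.symm (c x)) := by
        rw [c.symm_apply_apply]; exact (hf.differentiable one_ne_zero x).hasFDerivAt
      rw [(h2.comp (c x) c.symm.hasFDerivAt).fderiv]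
      simp
    -- Inside `U` the domain is the subgraph; outside, both integrands vanish because f is supported
    -- in `U`.
    by_cases hx : x ∈ U
    · have h3 : x ∈ Ω ↔ x ∈ chartCoord e ⁻¹' S := h.mem_iff x hx
      by_cases hxΩ : x ∈ Ω
      · rw [indicator_of_mem hxΩ, indicator_of_mem (h3.1 hxΩ), ← h1]
      · rw [indicator_of_notMem hxΩ, indicator_of_notMem (fun h' => hxΩ (h3.2 h'))]
    · have h4 : fderiv ℝ (f ∘ c.symm) (chartCoord e x) ((c w).1, (c w).2) = 0 := h1.trans (hdf0 x hx)
      have h5 : ∀ (s : Set E) (F : E → ℝ), F x = 0 → s.indicator F x = 0 :=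
        fun s F hF => indicator_apply_eq_zero.2 fun _ => hF
      rw [h5 _ _ (hdf0 x hx), h5 _ _ h4]
  have hR : ∫ x, f x * inner ℝ w (nrm x) ∂σ =
      ∫ p, ((c w).2 - inner ℝ (gradient g p) (c w).1) * (f ∘ c.symm) (p, g p) := by
    have h1 : ∫ x, f x * inner ℝ w (nrm x) ∂σ = ∫ x in U, f x * inner ℝ w (nrm x) ∂σ := by
      refine (setIntegral_eq_integral_of_forall_compl_eq_zero fun x hx => ?_).symm
      rw [hf0 x hx, zero_mul]
    rw [h1, h.restrict_eq, hm.setIntegral_map, setIntegral_withDensity_eq_setIntegral_toReal_smul₀]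
    · rw [setIntegral_eq_integral_of_forall_compl_eq_zero]
      · refine integral_congr_ae ?_
        filter_upwards [h.normal_eq] with p hp
        by_cases hpU : graphPoint e g p ∈ U
        · rw [hp hpU, ENNReal.toReal_ofReal (areaElement_pos g p).le,
            ← areaElement_mul_inner_graphNormal, smul_eq_mul, Function.comp_apply,
            ← graphPoint_eq]
          ring
        · rw [Function.comp_apply, ← graphPoint_eq, hf0 _ hpU]
          simp
      · intro p hp
        rw [hf0 _ hp]
        simp
    · exact (measurable_areaElement g).ennreal_ofReal.aemeasurable
    · exact Filter.Eventually.of_forall fun _ => ENNReal.ofReal_lt_top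
    · exact hm.measurable h.isOpen.measurableSet
  rw [hL, hR, key]

end IsGraphChart

end OpenMixture

end

/-! ### From charts to the divergence theorem on a domain with Lipschitz boundary. -/

noncomputable section
namespace OpenMixture

section LipschitzDomain

variable {Ω : Set E} {σ : Measure E} {nrm : E → E}

lemma IsLipschitzDomain.exists_chart (hΩ : IsLipschitzDomain Ω σ nrm) {x : E}
    (hx : x ∈ frontier Ω) : ∃ U e g K, x ∈ U ∧ IsGraphChart Ω σ nrm U e g K := by
  obtain ⟨U, e, g, K, h1, h2, h3, h4, h5, h6⟩ := hΩ.chart x hx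
  exact ⟨U, e, g, K, h2, ⟨h1, h3, h4, h5, h6⟩⟩

lemma isCompact_closure_of_isBounded (h : Bornology.IsBounded Ω) : IsCompact (closure Ω) :=
  Metric.isCompact_of_isClosed_isBounded isClosed_closure h.closure

lemma IsLipschitzDomain.isCompact_closure (hΩ : IsLipschitzDomain Ω σ nrm) :
    IsCompact (closure Ω) :=
  isCompact_closure_of_isBounded hΩ.isBounded

lemma IsLipschitzDomain.isCompact_frontier (hΩ : IsLipschitzDomain Ω σ nrm) :
    IsCompact (frontier Ω) :=
  hΩ.isCompact_closure.of_isClosed_subset isClosed_frontier frontier_subset_closure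

lemma IsLipschitzDomain.restrict_frontier (hΩ : IsLipschitzDomain Ω σ nrm) :
    σ.restrict (frontier Ω) = σ :=
  Measure.restrict_eq_self_of_ae_mem hΩ.measure_compl

lemma IsLipschitzDomain.ae_mem_frontier (hΩ : IsLipschitzDomain Ω σ nrm) :
    ∀ᵐ x ∂σ, x ∈ frontier Ω := hΩ.measure_compl

/-- The surface measure is carried by the compact boundary and is finite near each of its points. -/
lemma IsLipschitzDomain.isFiniteMeasure (hΩ : IsLipschitzDomain Ω σ nrm) : IsFiniteMeasure σ := by
  constructor
  rw [← hΩ.restrict_frontier, Measure.restrict_apply_univ]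
  refine hΩ.isCompact_frontier.measure_lt_top_of_nhdsWithin fun x hx => ?_
  obtain ⟨U, e, g, K, hxU, hU⟩ := hΩ.exists_chart hx
  obtain ⟨t, ht, h⟩ := hU.finiteAt hxU
  exact ⟨t, mem_nhdsWithin_of_mem_nhds ht, h⟩

/-- Both properties hold in every chart and pass to subsets and finite unions, so that compactness
of the boundary suffices. -/
lemma IsLipschitzDomain.normal_aux (hΩ : IsLipschitzDomain Ω σ nrm) :
    AEStronglyMeasurable nrm (σ.restrict (frontier Ω)) ∧
      ∀ᵐ y ∂σ.restrict (frontier Ω), ‖nrm y‖ = 1 := by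
  refine hΩ.isCompact_frontier.induction_on
    (p := fun s => AEStronglyMeasurable nrm (σ.restrict s) ∧ ∀ᵐ y ∂σ.restrict s, ‖nrm y‖ = 1)
    ?_ ?_ ?_ ?_
  · simp
  · intro s t hst h
    exact ⟨h.1.mono_measure (Measure.restrict_mono hst le_rfl), ae_restrict_of_ae_restrict_of_subset hst h.2⟩
  · intro s t hs ht
    exact ⟨aestronglyMeasurable_union_iff.2 ⟨hs.1, ht.1⟩, (ae_restrict_union_iff _ _ _).2 ⟨hs.2, ht.2⟩⟩
  · intro x hx
    obtain ⟨U, e, g, K, hxU, hU⟩ := hΩ.exists_chart hx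
    exact ⟨U, mem_nhdsWithin_of_mem_nhds (hU.isOpen.mem_nhds hxU),
      hU.aestronglyMeasurable_normal, hU.ae_norm_normal⟩

lemma IsLipschitzDomain.aestronglyMeasurable_normal (hΩ : IsLipschitzDomain Ω σ nrm) :
    AEStronglyMeasurable nrm σ := by
  simpa only [hΩ.restrict_frontier] using hΩ.normal_aux.1

lemma IsLipschitzDomain.ae_norm_normal (hΩ : IsLipschitzDomain Ω σ nrm) :
    ∀ᵐ y ∂σ, ‖nrm y‖ = 1 := by
  simpa only [hΩ.restrict_frontier] using hΩ.normal_aux.2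

/-- The flux density of a vector field that is continuous on the closed domain is integrable
on the boundary. -/
lemma IsLipschitzDomain.integrable_inner_normal (hΩ : IsLipschitzDomain Ω σ nrm) {φ : E → E}
    (hφ : ContinuousOn φ (closure Ω)) : Integrable (fun x => inner ℝ (φ x) (nrm x)) σ := by
  have := hΩ.isFiniteMeasure
  have hm : AEStronglyMeasurable φ σ := by
    have h := (hφ.mono frontier_subset_closure).aestronglyMeasurable (μ := σ)
      isClosed_frontier.measurableSet
    rwa [hΩ.restrict_frontier] at h
  obtain ⟨C, hC⟩ := hΩ.isCompact_closure.exists_bound_of_continuousOn hφ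
  refine Integrable.of_bound (hm.inner hΩ.aestronglyMeasurable_normal) C ?_
  filter_upwards [hΩ.ae_norm_normal, hΩ.ae_mem_frontier] with x hx hxf
  refine (norm_inner_le_norm _ _).trans ?_
  rw [hx, mul_one]
  exact hC x (frontier_subset_closure hxf)

lemma integrableOn_of_continuousOn_closure {F : Type*} [NormedAddCommGroup F]
    (hb : Bornology.IsBounded Ω) {f : E → F} (hf : ContinuousOn f (closure Ω)) :
    IntegrableOn f Ω :=
  (hf.integrableOn_compact (isCompact_closure_of_isBounded hb)).mono_set subset_closure

/-- A cutoff vanishing off an open set has its closed support only in the closure of that set; hence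
the intermediate set `u`, whose closure lies in `t`. -/
lemma exists_contDiff_one_nhds_of_subset {X : Type*} [NormedAddCommGroup X] [NormedSpace ℝ X]
    [FiniteDimensional ℝ X] {s t : Set X} (hs : IsClosed s) (ht : IsOpen t) (hst : s ⊆ t) :
    ∃ f : X → ℝ, ContDiff ℝ ∞ f ∧ (∀ᶠ x in 𝓝ˢ s, f x = 1) ∧ tsupport f ⊆ t := by
  obtain ⟨u, hu, hsu, hut⟩ := normal_exists_closure_subset hs ht hst
  obtain ⟨f, h1, h2, -⟩ := exists_contMDiffMap_one_nhds_of_subset_interior (n := (⊤ : ℕ∞))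
    (modelWithCornersSelf ℝ X) hs (hsu.trans hu.interior_eq.ge)
  refine ⟨f, f.contMDiff.contDiff, h1, (closure_mono ?_).trans hut⟩
  intro x hx
  by_contra hxu
  exact hx (h2 x hxu)

/-- The error term of the divergence theorem. -/
def divDefect (Ω : Set E) (σ : Measure E) (nrm : E → E) (w : E) (f : E → ℝ) : ℝ :=
  (∫ x in Ω, fderiv ℝ f x w) - ∫ x, f x * inner ℝ w (nrm x) ∂σ

lemma IsLipschitzDomain.divDefect_sub (hΩ : IsLipschitzDomain Ω σ nrm) (w : E) {f g : E → ℝ}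
    (hf : ContDiff ℝ 1 f) (hg : ContDiff ℝ 1 g) :
    divDefect Ω σ nrm w (fun x => f x - g x) = divDefect Ω σ nrm w f - divDefect Ω σ nrm w g := by
  have h1 : ∀ {f : E → ℝ}, ContDiff ℝ 1 f → IntegrableOn (fun x => fderiv ℝ f x w) Ω := fun hf =>
    integrableOn_of_continuousOn_closure hΩ.isBounded
      ((hf.continuous_fderiv one_ne_zero).clm_apply continuous_const).continuousOn
  have h2 : ∀ {f : E → ℝ}, ContDiff ℝ 1 f → Integrable (fun x => f x * inner ℝ w (nrm x)) σ :=
    fun {f} hf => by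
      have := hΩ.integrable_inner_normal (φ := fun x => f x • w)
        (hf.continuous.smul continuous_const).continuousOn
      simpa only [real_inner_smul_left] using this
  have h3 : ∀ x, fderiv ℝ (fun x => f x - g x) x w = fderiv ℝ f x w - fderiv ℝ g x w := fun x => by
    rw [fderiv_fun_sub (hf.differentiable one_ne_zero x) (hg.differentiable one_ne_zero x)]
    rfl
  simp only [divDefect, h3, sub_mul]
  rw [integral_sub (h1 hf) (h1 hg), integral_sub (h2 hf) (h2 hg)]
  ring

/-- Partial integration against the constant 1. -/
lemma integral_fderiv_eq_zero {f : E → ℝ} (hf : ContDiff ℝ 1 f) (hc : HasCompactSupport f)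
    (w : E) : ∫ x, fderiv ℝ f x w = 0 := by
  have h := integral_bilinear_hasLineDerivAt_right_eq_neg_left_of_integrable
    (μ := (volume : Measure E)) (B := ContinuousLinearMap.mul ℝ ℝ) (f := fun _ => 1)
    (f' := fun _ => 0) (g := f) (g' := fun x => fderiv ℝ f x w) (v := w) (by simp) ?_ ?_ ?_ ?_
  · simpa using h
  · simpa using ((hf.continuous_fderiv one_ne_zero).clm_apply
      continuous_const).integrable_of_hasCompactSupport (hc.fderiv_apply (𝕜 := ℝ) w)
  · simpa using hf.continuous.integrable_of_hasCompactSupport hc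
  · intro x _
    simpa using (hasFDerivAt_const (1 : ℝ) x).hasLineDerivAt w
  · intro x _
    exact (hf.differentiable one_ne_zero x).hasFDerivAt.hasLineDerivAt w

lemma setIntegral_fderiv_eq_zero {f : E → ℝ} (hf : ContDiff ℝ 1 f) (hc : HasCompactSupport f)
    (hs : tsupport f ⊆ Ω) (w : E) : ∫ x in Ω, fderiv ℝ f x w = 0 := by
  rw [setIntegral_eq_integral_of_forall_compl_eq_zero, integral_fderiv_eq_zero hf hc]
  intro x hx
  rw [fderiv_of_notMem_tsupport ℝ fun h => hx (hs h)]
  rfl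

/-- The divergence theorem, for a scalar function and a constant direction. -/
theorem IsLipschitzDomain.setIntegral_fderiv_eq (hΩ : IsLipschitzDomain Ω σ nrm) {f : E → ℝ}
    (hf : ContDiff ℝ 1 f) (w : E) :
    ∫ x in Ω, fderiv ℝ f x w = ∫ x, f x * inner ℝ w (nrm x) ∂σ := by
  -- A substitute for a partition of unity: a multiplier `h` that vanishes near the closed domain
  -- and does not change the defect. Since f h has no defect, neither has f.
  suffices H : ∃ h : E → ℝ, ContDiff ℝ 1 h ∧ (∀ᶠ x in 𝓝ˢ (closure Ω), h x = 0) ∧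
      ∀ f : E → ℝ, ContDiff ℝ 1 f →
        divDefect Ω σ nrm w f = divDefect Ω σ nrm w (fun x => f x * h x) by
    obtain ⟨h, h1, h2, h3⟩ := H
    have h4 := h3 f hf
    rw [divDefect, sub_eq_iff_eq_add] at h4
    rw [h4, add_eq_right, divDefect]
    rw [eventually_nhdsSet_iff_forall] at h2
    have h5 : ∫ x in Ω, fderiv ℝ (fun x => f x * h x) x w = 0 := by
      refine setIntegral_eq_zero_of_forall_eq_zero fun x hx => ?_
      have : (fun x => f x * h x) =ᶠ[𝓝 x] fun _ => 0 := by
        filter_upwards [h2 x (subset_closure hx)] with y hy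
        rw [hy, mul_zero]
      rw [this.fderiv_eq]
      simp
    have h6 : ∫ x, f x * h x * inner ℝ w (nrm x) ∂σ = 0 := by
      refine integral_eq_zero_of_ae ?_
      filter_upwards [hΩ.ae_mem_frontier] with x hx
      rw [(h2 x (frontier_subset_closure hx)).self_of_nhds]
      simp
    rw [h5, h6, sub_zero]
  refine hΩ.isCompact_closure.induction_on
    (p := fun s => ∃ h : E → ℝ, ContDiff ℝ 1 h ∧ (∀ᶠ x in 𝓝ˢ s, h x = 0) ∧
      ∀ f : E → ℝ, ContDiff ℝ 1 f →
        divDefect Ω σ nrm w f = divDefect Ω σ nrm w (fun x => f x * h x)) ?_ ?_ ?_ ?_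
  · exact ⟨fun _ => 1, contDiff_const, by simp, fun f _ => by simp⟩
  · rintro s t hst ⟨h, h1, h2, h3⟩
    exact ⟨h, h1, h2.filter_mono (nhdsSet_mono hst), h3⟩
  -- The product of the multipliers of two sets is a multiplier for their union.
  · rintro s t ⟨h, h1, h2, h3⟩ ⟨k, k1, k2, k3⟩
    refine ⟨fun x => h x * k x, h1.mul k1, ?_, fun f hf => ?_⟩
    · rw [nhdsSet_union, Filter.eventually_sup]
      exact ⟨h2.mono fun x hx => by simp [hx], k2.mono fun x hx => by simp [hx]⟩
    · rw [h3 f hf, k3 _ (hf.mul h1)]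
      simp only [mul_assoc]
  · intro x hx
    -- If functions supported near x have no defect, then 1 − χ is a multiplier, χ being a cutoff
    -- near x: the function f − f (1 − χ) = f χ is supported there.
    suffices H : ∃ U, IsOpen U ∧ x ∈ U ∧ ∀ f : E → ℝ, ContDiff ℝ 1 f → HasCompactSupport f →
        tsupport f ⊆ U → divDefect Ω σ nrm w f = 0 by
      obtain ⟨U, hU, hxU, H⟩ := H
      obtain ⟨r, hr, hrU⟩ := Metric.nhds_basis_closedBall.mem_iff.1 (hU.mem_nhds hxU)
      obtain ⟨χ, h1, h2, h3⟩ := exists_contDiff_one_nhds_of_subset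
        (isClosed_singleton (x := x)) Metric.isOpen_ball
        (singleton_subset_iff.2 (Metric.mem_ball_self hr))
      have h1' : ContDiff ℝ 1 χ := h1.of_le (by exact_mod_cast le_top)
      rw [nhdsSet_singleton] at h2
      have h4 := eventually_eventually_nhds.2 h2
      refine ⟨{y | ∀ᶠ z in 𝓝 y, χ z = 1}, mem_nhdsWithin_of_mem_nhds h4, fun y => 1 - χ y,
        contDiff_const.sub h1', ?_, fun f hf => ?_⟩
      · rw [eventually_nhdsSet_iff_forall]
        exact fun y hy => hy.mono fun z hz => by simp [hz]
      · have h5 : tsupport (fun x => f x * χ x) ⊆ tsupport χ := tsupport_mul_subset_right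
        have h6 := H (fun x => f x * χ x) (hf.mul h1')
          ((isCompact_closedBall x r).of_isClosed_subset (isClosed_tsupport _)
            ((h5.trans h3).trans Metric.ball_subset_closedBall))
          ((h5.trans h3).trans (Metric.ball_subset_closedBall.trans hrU))
        have h7 := hΩ.divDefect_sub w hf (hf.mul h1')
        rw [h6, sub_zero] at h7
        rw [← h7]
        simp only [mul_sub, mul_one]
    -- At an interior point `Ω` itself serves as the neighbourhood, and both integrals vanish; at a
    -- boundary point a chart is used.
    by_cases hxΩ : x ∈ Ω
    · refine ⟨Ω, hΩ.isOpen, hxΩ, fun f hf hc hs => ?_⟩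
      rw [divDefect, setIntegral_fderiv_eq_zero hf hc hs, zero_sub, neg_eq_zero]
      refine integral_eq_zero_of_ae ?_
      filter_upwards [hΩ.ae_mem_frontier] with y hy
      rw [hΩ.isOpen.frontier_eq] at hy
      rw [image_eq_zero_of_notMem_tsupport fun h => hy.2 (hs h)]
      simp
    · have hxf : x ∈ frontier Ω := by rw [hΩ.isOpen.frontier_eq]; exact ⟨hx, hxΩ⟩
      obtain ⟨U, e, g, K, hxU, hU⟩ := hΩ.exists_chart hxf
      exact ⟨U, hU.isOpen, hxU, fun f hf hc hs =>
        sub_eq_zero.2 (hU.setIntegral_fderiv_eq hΩ.isOpen.measurableSet hf hc hs w)⟩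

lemma div_eq_sum (φ : E → E) (x : E) :
    div φ x = ∑ i, fderiv ℝ φ x (EuclideanSpace.single i 1) i := rfl

/-- The divergence theorem on a domain with Lipschitz boundary. -/
theorem IsLipschitzDomain.setIntegral_div (hΩ : IsLipschitzDomain Ω σ nrm) {φ : E → E}
    (hφ : ContDiff ℝ 1 φ) : ∫ x in Ω, div φ x = ∫ x, inner ℝ (φ x) (nrm x) ∂σ := by
  have hφi : ∀ i, ContDiff ℝ 1 fun x => φ x i := fun i =>
    (EuclideanSpace.proj (𝕜 := ℝ) i).contDiff.comp hφ
  have h1 : ∀ x i, fderiv ℝ φ x (EuclideanSpace.single i 1) i =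
      fderiv ℝ (fun x => φ x i) x (EuclideanSpace.single i 1) := fun x i => by
    have h := ((EuclideanSpace.proj (𝕜 := ℝ) i).hasFDerivAt.comp x
      (hφ.differentiable one_ne_zero x).hasFDerivAt).fderiv
    exact (DFunLike.congr_fun h (EuclideanSpace.single i 1)).symm
  have h2 : ∀ x, inner ℝ (φ x) (nrm x) =
      ∑ i, φ x i * inner ℝ (EuclideanSpace.single i 1) (nrm x) := fun x => by
    simp [PiLp.inner_apply, mul_comm]
  simp only [div_eq_sum, h1, h2]
  rw [integral_finsetSum, integral_finsetSum]
  · exact Finset.sum_congr rfl fun i _ => hΩ.setIntegral_fderiv_eq (hφi i) _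
  · intro i _
    have := hΩ.integrable_inner_normal (φ := fun x => φ x i • EuclideanSpace.single i 1)
      ((hφi i).continuous.smul continuous_const).continuousOn
    simpa only [real_inner_smul_left] using this
  · intro i _
    exact integrableOn_of_continuousOn_closure hΩ.isBounded
      (((hφi i).continuous_fderiv one_ne_zero).clm_apply continuous_const).continuousOn

end LipschitzDomain

end OpenMixture

end

/-! ### Smooth extension from the closed domain. -/

noncomputable section
namespace OpenMixture

variable {ν n : ℕ}

section Extension

variable {X F : Type*} [NormedAddCommGroup X] [NormedSpace ℝ X] [FiniteDimensional ℝ X]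
  [NormedAddCommGroup F] [NormedSpace ℝ F]

/-- A function that is smooth on a neighbourhood of a closed set agrees near that set with a
globally smooth function. -/
lemma exists_contDiff_eventuallyEq {r : ℕ∞} {K V : Set X} (hK : IsClosed K) (hV : IsOpen V)
    (hKV : K ⊆ V) {f : X → F} (hf : ContDiffOn ℝ r f V) :
    ∃ g : X → F, ContDiff ℝ r g ∧ ∀ᶠ x in 𝓝ˢ K, g x = f x := by
  obtain ⟨χ, h1, h2, h3⟩ := exists_contDiff_one_nhds_of_subset hK hV hKV
  refine ⟨fun x => χ x • f x, contDiff_iff_contDiffAt.2 fun x => ?_, h2.mono fun x hx => by simp [hx]⟩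
  by_cases hx : x ∈ V
  · exact (h1.contDiffAt.of_le (by exact_mod_cast le_top)).smul (hf.contDiffAt (hV.mem_nhds hx))
  · have : χ =ᶠ[𝓝 x] 0 := notMem_tsupport_iff_eventuallyEq.1 fun h => hx (h3 h)
    refine contDiffAt_const (c := (0 : F)) |>.congr_of_eventuallyEq ?_
    filter_upwards [this] with y hy
    simp [hy]

-- The derivatives agree in the open set and extend continuously to its closure. Functional
-- derivatives are determined only on the closed domain, yet the brackets differentiate them up to
-- the boundary; this fact makes the integrands well defined there.
omit [FiniteDimensional ℝ X] in
lemma fderiv_eq_of_eqOn {Ω V : Set X} (hΩ : IsOpen Ω) (hV : IsOpen V) (hΩV : closure Ω ⊆ V)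
    {f g : X → F} (hf : ContDiffOn ℝ 1 f V) (hg : ContDiffOn ℝ 1 g V) (h : EqOn f g Ω) :
    EqOn (fderiv ℝ f) (fderiv ℝ g) (closure Ω) := by
  have h1 : EqOn (fderiv ℝ f) (fderiv ℝ g) Ω := fun x hx =>
    Filter.EventuallyEq.fderiv_eq (h.eventuallyEq_of_mem (hΩ.mem_nhds hx))
  exact h1.of_subset_closure ((hf.continuousOn_fderiv_of_isOpen hV le_rfl).mono hΩV)
    ((hg.continuousOn_fderiv_of_isOpen hV le_rfl).mono hΩV) subset_closure le_rfl

end Extension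

/-- The divergence theorem for a vector field that is smooth near the closed domain. -/
theorem IsLipschitzDomain.setIntegral_div_of_contDiffOn {Ω : Set E} {σ : Measure E} {nrm : E → E}
    (hΩ : IsLipschitzDomain Ω σ nrm) {V : Set E} (hV : IsOpen V) (hΩV : closure Ω ⊆ V) {φ : E → E}
    (hφ : ContDiffOn ℝ 1 φ V) : ∫ x in Ω, div φ x = ∫ x, inner ℝ (φ x) (nrm x) ∂σ := by
  obtain ⟨ψ, h1, h2⟩ := exists_contDiff_eventuallyEq (r := 1) isClosed_closure hV hΩV hφ
  rw [eventually_nhdsSet_iff_forall] at h2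
  have h3 := hΩ.setIntegral_div h1
  rw [setIntegral_congr_fun (g := div ψ) hΩ.isOpen.measurableSet, h3]
  · refine integral_congr_ae ?_
    filter_upwards [hΩ.ae_mem_frontier] with x hx
    rw [(h2 x (frontier_subset_closure hx)).self_of_nhds]
  · intro x hx
    have : φ =ᶠ[𝓝 x] ψ := (h2 x (subset_closure hx)).mono fun y hy => hy.symm
    simp only [div_eq_sum, this.fderiv_eq]

/-! ### The pairing -/

/-- The component of a value that belongs to `ρ_α`. -/
def rhoL (α : Fin ν) : Val ν →L[ℝ] ℝ :=
  (ContinuousLinearMap.proj α).comp (ContinuousLinearMap.fst ℝ (Fin ν → ℝ) (E × ℝ))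

/-- The component of a value that belongs to the momentum density. -/
def momL : Val ν →L[ℝ] E :=
  (ContinuousLinearMap.fst ℝ E ℝ).comp (ContinuousLinearMap.snd ℝ (Fin ν → ℝ) (E × ℝ))

/-- The component of a value that belongs to `w`. -/
def scaL : Val ν →L[ℝ] ℝ :=
  (ContinuousLinearMap.snd ℝ E ℝ).comp (ContinuousLinearMap.snd ℝ (Fin ν → ℝ) (E × ℝ))

/-- The thermodynamic part of a value. -/
def thermoL : Val ν →L[ℝ] Thermo ν :=
  (ContinuousLinearMap.fst ℝ (Fin ν → ℝ) (E × ℝ)).prod scaL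

@[simp] lemma rhoL_apply (α : Fin ν) (v : Val ν) : rhoL α v = v.1 α := rfl
@[simp] lemma momL_apply (v : Val ν) : momL v = v.2.1 := rfl
@[simp] lemma scaL_apply (v : Val ν) : scaL v = v.2.2 := rfl
@[simp] lemma thermoL_apply (v : Val ν) : thermoL v = (v.1, v.2.2) := rfl

/-- The pointwise pairing of values. -/
def dot : Val ν →L[ℝ] Val ν →L[ℝ] ℝ :=
  (∑ α, (ContinuousLinearMap.mul ℝ ℝ).bilinearComp (rhoL α) (rhoL α)) +
    (∑ i : Fin 3, (ContinuousLinearMap.mul ℝ ℝ).bilinearComp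
      ((EuclideanSpace.proj i : E →L[ℝ] ℝ).comp momL)
      ((EuclideanSpace.proj i : E →L[ℝ] ℝ).comp momL)) +
    (ContinuousLinearMap.mul ℝ ℝ).bilinearComp scaL scaL

lemma dot_apply (a b : Val ν) :
    dot a b = (∑ α, a.1 α * b.1 α) + inner ℝ a.2.1 b.2.1 + a.2.2 * b.2.2 := by
  simp [dot, PiLp.inner_apply, mul_comm]

lemma dot_comm (a b : Val ν) : dot a b = dot b a := by
  simp only [dot_apply, real_inner_comm, mul_comm]

lemma dot_self_nonneg (a : Val ν) : 0 ≤ dot a a := by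
  rw [dot_apply]
  have := Finset.sum_nonneg fun α (_ : α ∈ Finset.univ) => mul_self_nonneg (a.1 α)
  have := real_inner_self_nonneg (x := a.2.1)
  have := mul_self_nonneg a.2.2
  positivity

lemma eq_zero_of_dot_self {a : Val ν} (h : dot a a = 0) : a = 0 := by
  rw [dot_apply] at h
  have h1 := Finset.sum_nonneg fun α (_ : α ∈ Finset.univ) => mul_self_nonneg (a.1 α)
  have h2 := real_inner_self_nonneg (x := a.2.1)
  have h3 := mul_self_nonneg a.2.2
  have h4 : ∑ α, a.1 α * a.1 α = 0 := by linarith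
  have h5 : inner ℝ a.2.1 a.2.1 = 0 := by linarith
  have h6 : a.2.2 * a.2.2 = 0 := by linarith
  rw [Finset.sum_eq_zero_iff_of_nonneg fun α _ => mul_self_nonneg _] at h4
  refine Prod.ext (funext fun α => mul_self_eq_zero.1 (h4 α (Finset.mem_univ α)))
    (Prod.ext (inner_self_eq_zero.1 h5) (mul_self_eq_zero.1 h6))

lemma pairing_eq (Ω : Set E) (a h : StateField ν) : pairing Ω a h = ∫ x in Ω, dot (a x) (h x) := by
  simp only [dot_apply]; rfl

section Fields

variable {Ω : Set E}

lemma integrableOn_dot (hb : Bornology.IsBounded Ω) {a h : E → Val ν} (ha : Continuous a)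
    (hh : Continuous h) : IntegrableOn (fun x => dot (a x) (h x)) Ω :=
  integrableOn_of_continuousOn_closure hb (by fun_prop : Continuous _).continuousOn

lemma pairing_comm (a h : E → Val ν) : pairing Ω a h = pairing Ω h a := by
  simp only [pairing_eq, dot_comm]

lemma pairing_add (hb : Bornology.IsBounded Ω) {a h k : E → Val ν} (ha : Continuous a)
    (hh : Continuous h) (hk : Continuous k) :
    pairing Ω a (h + k) = pairing Ω a h + pairing Ω a k := by
  simp only [pairing_eq, Pi.add_apply, map_add]
  exact integral_add (integrableOn_dot hb ha hh) (integrableOn_dot hb ha hk)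

lemma pairing_smul (a h : E → Val ν) (c : ℝ) : pairing Ω a (c • h) = c * pairing Ω a h := by
  simp only [pairing_eq, Pi.smul_apply, map_smul, smul_eq_mul]
  exact integral_const_mul _ _

lemma add_pairing (hb : Bornology.IsBounded Ω) {a h k : E → Val ν} (ha : Continuous a)
    (hh : Continuous h) (hk : Continuous k) :
    pairing Ω (h + k) a = pairing Ω h a + pairing Ω k a := by
  simp only [pairing_comm _ a, pairing_add hb ha hh hk]

lemma smul_pairing (a h : E → Val ν) (c : ℝ) : pairing Ω (c • h) a = c * pairing Ω h a := by
  simp only [pairing_comm _ a, pairing_smul]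

/-- A continuous non-negative integrand with vanishing integral is zero. -/
lemma eqOn_zero_of_pairing_self (hΩ : IsOpen Ω) (hb : Bornology.IsBounded Ω) {d : E → Val ν}
    (hd : Continuous d) (h : pairing Ω d d = 0) : EqOn d 0 Ω := by
  rw [pairing_eq, setIntegral_eq_zero_iff_of_nonneg_ae
    (Filter.Eventually.of_forall fun x => dot_self_nonneg _) (integrableOn_dot hb hd hd)] at h
  have h1 := Measure.eqOn_open_of_ae_eq h hΩ (by fun_prop) continuousOn_const
  exact fun x hx => eq_zero_of_dot_self (h1 hx)

end Fields

end OpenMixture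

end

noncomputable section
namespace OpenMixture

variable {ν n : ℕ}

/-! ### Calculus of functional derivatives -/

section VarDeriv

variable {Ω : Set E} {A : (E → Val ν) → ℝ} {z a b : E → Val ν}

/-- The filter of smooth fields whose `C^k` norm on the closed domain tends to zero, together with
a bound of that norm. -/
def jetFilter (ν : ℕ) (Ω : Set E) (k : ℕ) : Filter ((E → Val ν) × ℝ) :=
  Filter.comap Prod.snd (𝓝 0) ⊓ Filter.principal
    {q | ContDiff ℝ ∞ q.1 ∧ ∀ i ≤ k, ∀ x ∈ closure Ω, ‖iteratedFDeriv ℝ i q.1 x‖ ≤ q.2}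

lemma jetFilter_anti {k l : ℕ} (h : k ≤ l) : jetFilter ν Ω l ≤ jetFilter ν Ω k := by
  refine inf_le_inf_left _ (Filter.principal_mono.2 fun q hq => ⟨hq.1, fun i hi => hq.2 i (hi.trans h)⟩)

lemma eventually_jetFilter {k : ℕ} {P : (E → Val ν) × ℝ → Prop} :
    (∀ᶠ q in jetFilter ν Ω k, P q) ↔ ∃ δ > 0, ∀ h : E → Val ν, ∀ r, |r| < δ →
      ContDiff ℝ ∞ h → (∀ i ≤ k, ∀ x ∈ closure Ω, ‖iteratedFDeriv ℝ i h x‖ ≤ r) → P (h, r) := by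
  rw [jetFilter, Filter.eventually_inf_principal, Filter.eventually_comap, Metric.eventually_nhds_iff]
  refine exists_congr fun δ => and_congr_right fun _ => ⟨fun H h r hr h1 h2 => ?_, fun H r hr q hq h => ?_⟩
  · exact H (by simpa using hr) (h, r) rfl ⟨h1, h2⟩
  · exact H q.1 q.2 (by simpa [hq] using hr) h.1 h.2

/-- The `r` of the definition is an arbitrary bound of the norm, so that the expansion becomes a
Landau symbol along `jetFilter`. As Ω has a point, every such bound is non-negative, and `r` may be
replaced by `|r|`. -/
lemma hasVarDeriv_iff (hne : Ω.Nonempty) : HasVarDeriv Ω A z a ↔ ContDiff ℝ ∞ a ∧ ∃ k,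
    (fun q : (E → Val ν) × ℝ => A (z + q.1) - A z - pairing Ω a q.1) =o[jetFilter ν Ω k]
      fun q => q.2 := by
  obtain ⟨x₀, hx₀⟩ := hne
  refine and_congr_right fun _ => exists_congr fun k => ?_
  rw [Asymptotics.isLittleO_iff]
  have hpos : ∀ (h : E → Val ν) (r : ℝ),
      (∀ i ≤ k, ∀ x ∈ closure Ω, ‖iteratedFDeriv ℝ i h x‖ ≤ r) → 0 ≤ r := fun h r hr =>
    (norm_nonneg _).trans (hr 0 (Nat.zero_le _) x₀ (subset_closure hx₀))
  constructor
  · intro H c hc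
    obtain ⟨δ, hδ, H⟩ := H c hc
    refine eventually_jetFilter.2 ⟨δ, hδ, fun h r hr h1 h2 => ?_⟩
    rw [Real.norm_eq_abs, Real.norm_of_nonneg (hpos h r h2)]
    exact H h h1 r ((le_abs_self r).trans hr.le) h2
  · intro H ε hε
    obtain ⟨δ, hδ, H⟩ := eventually_jetFilter.1 (H hε)
    -- The definition allows r = δ, whereas the filter gives a strict bound; halving reconciles
    -- them.
    refine ⟨δ / 2, by positivity, fun h h1 r hr h2 => ?_⟩
    have h0 := hpos h r h2
    have := H h r (by rw [abs_of_nonneg h0]; linarith) h1 h2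
    rwa [Real.norm_eq_abs, Real.norm_of_nonneg h0] at this

lemma norm_le_of_jet_le {k : ℕ} {h : E → Val ν} {r : ℝ}
    (hr : ∀ i ≤ k, ∀ x ∈ closure Ω, ‖iteratedFDeriv ℝ i h x‖ ≤ r) {x : E} (hx : x ∈ closure Ω) :
    ‖h x‖ ≤ r := by
  simpa using hr 0 (Nat.zero_le _) x hx

lemma pairing_isBigO (hb : Bornology.IsBounded Ω) (ha : Continuous a) (k : ℕ) :
    (fun q : (E → Val ν) × ℝ => pairing Ω a q.1) =O[jetFilter ν Ω k] fun q => q.2 := by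
  obtain ⟨C, hC⟩ := (isCompact_closure_of_isBounded hb).exists_bound_of_continuousOn
    ha.continuousOn
  refine Asymptotics.IsBigO.of_bound (‖(dot : Val ν →L[ℝ] Val ν →L[ℝ] ℝ)‖ * C * volume.real Ω) ?_
  refine eventually_jetFilter.2 ⟨1, one_pos, fun h r _ _ h2 => ?_⟩
  have hfin : volume Ω < ⊤ := hb.measure_lt_top
  rw [pairing_eq]
  refine (norm_setIntegral_le_of_norm_le_const (C := ‖(dot : Val ν →L[ℝ] Val ν →L[ℝ] ℝ)‖ * C * |r|)
    hfin fun x hx => ?_).trans (le_of_eq (by rw [Real.norm_eq_abs]; ring))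
  have h3 := norm_le_of_jet_le h2 (subset_closure hx)
  have h4 := hC x (subset_closure hx)
  refine (ContinuousLinearMap.le_opNorm₂ _ _ _).trans ?_
  have : 0 ≤ C := (norm_nonneg _).trans h4
  gcongr
  exact h3.trans (le_abs_self r)

lemma HasVarDeriv.isBigO (hne : Ω.Nonempty) (hb : Bornology.IsBounded Ω) (h : HasVarDeriv Ω A z a) :
    ∃ k, (fun q : (E → Val ν) × ℝ => A (z + q.1) - A z) =O[jetFilter ν Ω k] fun q => q.2 := by
  obtain ⟨ha, k, hk⟩ := (hasVarDeriv_iff hne).1 h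
  refine ⟨k, ?_⟩
  simpa using hk.isBigO.add (pairing_isBigO hb ha.continuous k)

lemma tendsto_snd_jetFilter (k : ℕ) : Filter.Tendsto Prod.snd (jetFilter ν Ω k) (𝓝 0) :=
  Filter.tendsto_comap.mono_left inf_le_left

/-- The chain rule for functional derivatives. -/
lemma HasVarDeriv.chain (hne : Ω.Nonempty) (hb : Bornology.IsBounded Ω) {N : ℕ}
    {F : (Fin N → ℝ) → ℝ} {ℓ : Fin N → (E → Val ν) → ℝ} {e : Fin N → E → Val ν}
    {F' : (Fin N → ℝ) →L[ℝ] ℝ} (hF : HasFDerivAt F F' fun i => ℓ i z)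
    (hℓ : ∀ i, HasVarDeriv Ω (ℓ i) z (e i)) {k₀ : ℕ} (hA₀ : A z = F fun i => ℓ i z)
    (hA : ∀ᶠ q in jetFilter ν Ω k₀, A (z + q.1) = F fun i => ℓ i (z + q.1)) :
    HasVarDeriv Ω A z fun x => ∑ i, F' (Pi.single i 1) • e i x := by
  have hℓ' := fun i => (hasVarDeriv_iff hne).1 (hℓ i)
  choose hs k hk using hℓ'
  choose l hl using fun i => (hℓ i).isBigO hne hb
  -- One order of differentiation that serves all the expansions.
  obtain ⟨K, hK⟩ : ∃ K, k₀ ≤ K ∧ ∀ i, k i ≤ K ∧ l i ≤ K := by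
    refine ⟨k₀ + ∑ i, (k i + l i), Nat.le_add_right _ _, fun i => ?_⟩
    have := Finset.single_le_sum (f := fun i => k i + l i) (fun _ _ => Nat.zero_le _) (Finset.mem_univ i)
    omega
  refine (hasVarDeriv_iff hne).2 ⟨?_, K, ?_⟩
  · exact ContDiff.sum fun i _ => (contDiff_const (c := F' (Pi.single i 1))).smul (hs i)
  have h1 : (fun q : (E → Val ν) × ℝ => (fun i => ℓ i (z + q.1)) - fun i => ℓ i z)
      =O[jetFilter ν Ω K] fun q => q.2 :=
    Asymptotics.isBigO_pi.2 fun i => (hl i).mono (jetFilter_anti (hK.2 i).2)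
  have h2 : Filter.Tendsto (fun q : (E → Val ν) × ℝ => fun i => ℓ i (z + q.1)) (jetFilter ν Ω K)
      (𝓝 fun i => ℓ i z) := by
    have := h1.trans_tendsto (tendsto_snd_jetFilter K)
    simpa using this.add_const fun i => ℓ i z
  -- The remainder of the outer function; `h4` below collects the remainders of the inner
  -- functionals.
  have h3 := (hF.isLittleO.comp_tendsto h2).trans_isBigO h1
  have h4 : (fun q : (E → Val ν) × ℝ => ∑ i, F' (Pi.single i 1) *
      (ℓ i (z + q.1) - ℓ i z - pairing Ω (e i) q.1)) =o[jetFilter ν Ω K] fun q => q.2 :=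
    Asymptotics.IsLittleO.fun_sum fun i _ => ((hk i).mono (jetFilter_anti (hK.2 i).1)).const_mul_left _
  refine (h3.add h4).congr' ?_ Filter.EventuallyEq.rfl
  have h5 : ∀ᶠ q in jetFilter ν Ω K, ContDiff ℝ ∞ q.1 :=
    eventually_jetFilter.2 ⟨1, one_pos, fun h r _ h _ => h⟩
  filter_upwards [hA.filter_mono (jetFilter_anti hK.1), h5] with q hq hq5
  have h6 : ∀ v : Fin N → ℝ, F' v = ∑ i, F' (Pi.single i 1) * v i := fun v => by
    rw [← F'.coe_coe, LinearMap.pi_apply_eq_sum_univ]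
    exact Finset.sum_congr rfl fun i _ => by
      rw [smul_eq_mul, mul_comm]; congr 2; ext j; simp [Pi.single_apply, eq_comm]
  have h7 : pairing Ω (fun x => ∑ i, F' (Pi.single i 1) • e i x) q.1 =
      ∑ i, F' (Pi.single i 1) * pairing Ω (e i) q.1 := by
    simp only [pairing_eq, map_sum, map_smul, sum_apply, smul_apply, smul_eq_mul]
    rw [integral_finsetSum]
    · simp only [integral_const_mul]
    · exact fun i _ => (integrableOn_dot hb (hs i).continuous hq5.continuous).const_mul _
  simp only [Function.comp_apply]
  rw [hq, hA₀, h7, h6]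
  simp only [Pi.sub_apply, mul_sub, Finset.sum_sub_distrib]
  ring

lemma HasVarDeriv.mul (hne : Ω.Nonempty) (hb : Bornology.IsBounded Ω)
    {B : (E → Val ν) → ℝ} (hA : HasVarDeriv Ω A z a) (hB : HasVarDeriv Ω B z b) :
    HasVarDeriv Ω (A * B) z (A z • b + B z • a) := by
  have hF : HasFDerivAt (fun v : Fin 2 → ℝ => v 0 * v 1)
      (A z • (ContinuousLinearMap.proj 1 : (Fin 2 → ℝ) →L[ℝ] ℝ) +
        B z • (ContinuousLinearMap.proj 0 : (Fin 2 → ℝ) →L[ℝ] ℝ))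
      (fun i => (![A, B] : Fin 2 → (E → Val ν) → ℝ) i z) := by
    exact (hasFDerivAt_apply (𝕜 := ℝ) (0 : Fin 2) (fun i => (![A, B] : Fin 2 → (E → Val ν) → ℝ) i z)).mul
      (hasFDerivAt_apply (𝕜 := ℝ) (1 : Fin 2) (fun i => (![A, B] : Fin 2 → (E → Val ν) → ℝ) i z))
  have h := HasVarDeriv.chain (A := A * B) (e := ![a, b]) (k₀ := 0) hne hb hF
    (fun i => by fin_cases i <;> simpa) (by simp) (Filter.Eventually.of_forall fun q => by simp)
  convert h using 1
  ext1 x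
  simp [Fin.sum_univ_two, add_comm]

/-- For families of fields that are O(‖p‖) in the norm; C ‖p‖ is the bound that accompanies the
field in the filter. -/
lemma tendsto_jetFilter {P : Type*} [NormedAddCommGroup P] {k : ℕ} {h : P → E → Val ν}
    (hs : ∀ᶠ p in 𝓝 0, ContDiff ℝ ∞ (h p)) {C : ℝ}
    (hC : ∀ᶠ p in 𝓝 0, ∀ i ≤ k, ∀ x ∈ closure Ω, ‖iteratedFDeriv ℝ i (h p) x‖ ≤ C * ‖p‖) :
    Filter.Tendsto (fun p => (h p, C * ‖p‖)) (𝓝 0) (jetFilter ν Ω k) := by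
  refine Filter.tendsto_inf.2 ⟨Filter.tendsto_comap_iff.2 ?_, Filter.tendsto_principal.2 ?_⟩
  · have : Continuous fun p : P => C * ‖p‖ := by fun_prop
    have h0 := this.tendsto 0
    rw [norm_zero, mul_zero] at h0
    exact h0
  · filter_upwards [hs, hC] with p h1 h2 using ⟨h1, h2⟩

/-- The expansion of a functional along a family of fields. -/
lemma HasVarDeriv.isLittleO_family {P : Type*} [NormedAddCommGroup P] (hne : Ω.Nonempty)
    (hA : HasVarDeriv Ω A z a) {h : P → E → Val ν} (hs : ∀ᶠ p in 𝓝 0, ContDiff ℝ ∞ (h p))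
    (hC : ∀ k : ℕ, ∃ C : ℝ, ∀ᶠ p in 𝓝 0, ∀ i ≤ k, ∀ x ∈ closure Ω,
      ‖iteratedFDeriv ℝ i (h p) x‖ ≤ C * ‖p‖) :
    (fun p => A (z + h p) - A z - pairing Ω a (h p)) =o[𝓝 0] fun p : P => p := by
  obtain ⟨-, k, hk⟩ := (hasVarDeriv_iff hne).1 hA
  obtain ⟨C, hC⟩ := hC k
  have := hk.comp_tendsto (tendsto_jetFilter hs hC)
  exact this.trans_isBigO (Asymptotics.IsBigO.of_bound |C| (Filter.Eventually.of_forall fun p => by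
    simp))

lemma exists_jet_bound (hb : Bornology.IsBounded Ω) {h : E → Val ν} (hh : ContDiff ℝ ∞ h) (k : ℕ) :
    ∃ C : ℝ, 0 ≤ C ∧ ∀ i ≤ k, ∀ x ∈ closure Ω, ‖iteratedFDeriv ℝ i h x‖ ≤ C := by
  have h1 : ∀ i : ℕ, ∃ C, ∀ x ∈ closure Ω, ‖iteratedFDeriv ℝ i h x‖ ≤ C := fun i =>
    (isCompact_closure_of_isBounded hb).exists_bound_of_continuousOn
      (hh.continuous_iteratedFDeriv (m := i) (by exact_mod_cast le_top)).continuousOn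
  choose C hC using h1
  refine ⟨∑ i ∈ Finset.range (k + 1), |C i|, Finset.sum_nonneg fun _ _ => abs_nonneg _,
    fun i hi x hx => ((hC i x hx).trans (le_abs_self _)).trans ?_⟩
  exact Finset.single_le_sum (f := fun i => |C i|) (fun _ _ => abs_nonneg _)
    (Finset.mem_range.2 (Nat.lt_succ_of_le hi))

/-- The plane of fields spanned by two directions. -/
def span2 (h k : E → Val ν) (p : ℝ × ℝ) : E → Val ν := p.1 • h + p.2 • k

lemma contDiff_span2 {h k : E → Val ν} (hh : ContDiff ℝ ∞ h) (hk : ContDiff ℝ ∞ k) (p : ℝ × ℝ) :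
    ContDiff ℝ ∞ (span2 h k p) := by
  unfold span2
  exact (contDiff_const (c := p.1)).smul hh |>.add ((contDiff_const (c := p.2)).smul hk)

lemma span2_jet_bound (hb : Bornology.IsBounded Ω) {h k : E → Val ν} (hh : ContDiff ℝ ∞ h)
    (hk : ContDiff ℝ ∞ k) (l : ℕ) : ∃ C : ℝ, ∀ p : ℝ × ℝ, ∀ i ≤ l, ∀ x ∈ closure Ω,
      ‖iteratedFDeriv ℝ i (span2 h k p) x‖ ≤ C * ‖p‖ := by
  obtain ⟨C, hC0, hC⟩ := exists_jet_bound hb hh l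
  obtain ⟨D, hD0, hD⟩ := exists_jet_bound hb hk l
  refine ⟨C + D, fun p i hi x hx => ?_⟩
  have hh' : ContDiffAt ℝ i h x := (hh.of_le (by exact_mod_cast le_top)).contDiffAt
  have hk' : ContDiffAt ℝ i k x := (hk.of_le (by exact_mod_cast le_top)).contDiffAt
  have h0 : span2 h k p = (fun y => p.1 • h y) + fun y => p.2 • k y := rfl
  rw [h0, iteratedFDeriv_add_apply (hh'.const_smul p.1) (hk'.const_smul p.2),
    iteratedFDeriv_const_smul_apply' hh', iteratedFDeriv_const_smul_apply' hk']
  refine (norm_add_le _ _).trans ?_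
  rw [norm_smul, norm_smul, add_mul]
  have h1 := norm_fst_le p
  have h2 := norm_snd_le p
  have h3 := hC i hi x hx
  have h4 := hD i hi x hx
  have h5 := norm_nonneg p.1
  have h6 := norm_nonneg p.2
  nlinarith [mul_le_mul h1 h3 (norm_nonneg _) (norm_nonneg p),
    mul_le_mul h2 h4 (norm_nonneg _) (norm_nonneg p)]

/-- The derivative of a functional along a plane of fields. -/
lemma HasVarDeriv.hasFDerivAt_span2 (hne : Ω.Nonempty) (hb : Bornology.IsBounded Ω)
    {h k : E → Val ν} (hh : ContDiff ℝ ∞ h) (hk : ContDiff ℝ ∞ k) {p : ℝ × ℝ}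
    (hA : HasVarDeriv Ω A (z + span2 h k p) a) :
    HasFDerivAt (fun p => A (z + span2 h k p))
      (pairing Ω a h • ContinuousLinearMap.fst ℝ ℝ ℝ + pairing Ω a k • ContinuousLinearMap.snd ℝ ℝ ℝ)
      p := by
  have h1 := hA.isLittleO_family hne (h := span2 h k) (P := ℝ × ℝ)
    (Filter.Eventually.of_forall fun p => contDiff_span2 hh hk p)
    (fun l => (span2_jet_bound hb hh hk l).imp fun C hC => Filter.Eventually.of_forall hC)
  rw [hasFDerivAt_iff_isLittleO_nhds_zero]
  refine h1.congr_left fun q => ?_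
  have h2 : z + span2 h k p + span2 h k q = z + span2 h k (p + q) := by
    simp only [span2, Prod.fst_add, Prod.snd_add, add_smul]; abel
  have hac := hA.1.continuous
  have h3 : pairing Ω a (span2 h k q) = q.1 * pairing Ω a h + q.2 * pairing Ω a k := by
    rw [span2, pairing_add hb hac (hh.continuous.const_smul _) (hk.continuous.const_smul _),
      pairing_smul, pairing_smul]
  rw [h2, h3]
  simp [mul_comm]

/-- Functional derivatives are unique on the closed domain. -/
lemma HasVarDeriv.unique (hne : Ω.Nonempty) (hΩ : IsOpen Ω) (hb : Bornology.IsBounded Ω)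
    (ha : HasVarDeriv Ω A z a) (hb' : HasVarDeriv Ω A z b) : EqOn a b (closure Ω) := by
  -- The derivative of A in the direction h determines the pairing with every smooth h; below, h is
  -- the difference a − b itself.
  have h1 : ∀ h : E → Val ν, ContDiff ℝ ∞ h → pairing Ω a h = pairing Ω b h := fun h hh => by
    have e : z + span2 h h 0 = z := by simp [span2]
    have h2 := (HasVarDeriv.hasFDerivAt_span2 hne hb hh hh (p := 0) (e.symm ▸ ha)).unique
      (HasVarDeriv.hasFDerivAt_span2 hne hb hh hh (p := 0) (e.symm ▸ hb'))
    simpa using DFunLike.congr_fun h2 ((1 : ℝ), (0 : ℝ))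
  have hd : ContDiff ℝ ∞ (a - b) := ha.1.sub hb'.1
  have h3 : pairing Ω (a - b) (a - b) = 0 := by
    have h4 : pairing Ω (a - b) (a - b) = pairing Ω a (a - b) + pairing Ω ((-1 : ℝ) • b) (a - b) := by
      rw [← add_pairing hb hd.continuous ha.1.continuous (hb'.1.continuous.const_smul _)]
      congr 1; simp [sub_eq_add_neg]
    rw [h4, smul_pairing, h1 _ hd]; ring
  have h5 := eqOn_zero_of_pairing_self hΩ hb hd.continuous h3
  have h6 : EqOn a b Ω := fun x hx => sub_eq_zero.1 (h5 hx)
  exact h6.of_subset_closure ha.1.continuous.continuousOn hb'.1.continuous.continuousOn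
    subset_closure le_rfl

lemma hasVarDeriv_varDeriv (h : ∃ a, HasVarDeriv Ω A z a) : HasVarDeriv Ω A z (varDeriv Ω A z) := by
  rw [varDeriv, dif_pos h]
  exact h.choose_spec

lemma HasVarDeriv.varDeriv_eqOn (hne : Ω.Nonempty) (hΩ : IsOpen Ω) (hb : Bornology.IsBounded Ω)
    (ha : HasVarDeriv Ω A z a) : EqOn (varDeriv Ω A z) a (closure Ω) :=
  (hasVarDeriv_varDeriv ⟨a, ha⟩).unique hne hΩ hb ha

lemma contDiff_varDeriv (h : ∃ a, HasVarDeriv Ω A z a) : ContDiff ℝ ∞ (varDeriv Ω A z) :=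
  (hasVarDeriv_varDeriv h).1

end VarDeriv

/-! ### The state space -/

namespace Mixture

variable (m : Mixture ν n)

/-- The values that a state may take. -/
def valDom : Set (Val ν) := {v | 0 < ∑ α, v.1 α ∧ (v.1, v.2.2) ∈ m.dom}

lemma isOpen_valDom (hm : m.Admissible) : IsOpen m.valDom := by
  have h : Continuous fun v : Val ν => ∑ α, v.1 α :=
    continuous_finsetSum _ fun α _ => (rhoL α).continuous
  exact (isOpen_lt continuous_const h).inter (hm.isOpen_dom.preimage thermoL.continuous)

variable {m} {Ω : Set E} {z : E → Val ν}

/-- The points at which the values of a field are admissible. -/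
def regular (m : Mixture ν n) (z : E → Val ν) : Set E := z ⁻¹' m.valDom

lemma isOpen_regular (hm : m.Admissible) (hz : z ∈ m.states Ω) : IsOpen (m.regular z) :=
  (m.isOpen_valDom hm).preimage hz.1.continuous

lemma closure_subset_regular (hz : z ∈ m.states Ω) : closure Ω ⊆ m.regular z := hz.2

/-- Small perturbations of a state are states. -/
lemma eventually_add_mem_states (hm : m.Admissible) (hb : Bornology.IsBounded Ω)
    (hz : z ∈ m.states Ω) (k : ℕ) : ∀ᶠ q in jetFilter ν Ω k, z + q.1 ∈ m.states Ω := by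
  have hK : IsCompact (z '' closure Ω) :=
    (isCompact_closure_of_isBounded hb).image hz.1.continuous
  -- The values of z on the closed domain form a compact set, so that a whole thickening of it is
  -- admissible.
  obtain ⟨δ, hδ, H⟩ := hK.exists_thickening_subset_open (m.isOpen_valDom hm)
    (image_subset_iff.2 hz.2)
  refine eventually_jetFilter.2 ⟨δ, hδ, fun h r hr h1 h2 => ⟨hz.1.add h1, fun x hx => H ?_⟩⟩
  refine Metric.mem_thickening_iff.2 ⟨z x, mem_image_of_mem _ hx, ?_⟩
  have := norm_le_of_jet_le h2 hx
  simp only [Pi.add_apply, dist_self_add_left]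
  exact (this.trans (le_abs_self r)).trans_lt hr

end Mixture

end OpenMixture

end

noncomputable section
namespace OpenMixture

variable {ν n : ℕ}

/-! ### Smoothness of the constitutive functions along a state -/

section Smoothness

variable {V : Set E} {F : Type*} [NormedAddCommGroup F] [NormedSpace ℝ F]

lemma contDiffOn_fderiv {f : E → F} (hV : IsOpen V) (hf : ContDiffOn ℝ ∞ f V) :
    ContDiffOn ℝ ∞ (fderiv ℝ f) V :=
  ((contDiffOn_infty_iff_fderiv_of_isOpen hV).1 hf).2

lemma contDiffOn_fderiv_apply {f : E → F} {u : E → E} (hV : IsOpen V) (hf : ContDiffOn ℝ ∞ f V)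
    (hu : ContDiffOn ℝ ∞ u V) : ContDiffOn ℝ ∞ (fun x => fderiv ℝ f x (u x)) V :=
  (contDiffOn_fderiv hV hf).clm_apply hu

lemma contDiffOn_gradient {f : E → ℝ} (hV : IsOpen V) (hf : ContDiffOn ℝ ∞ f V) :
    ContDiffOn ℝ ∞ (gradient f) V :=
  (InnerProductSpace.toDual ℝ E).symm.contDiff.comp_contDiffOn (contDiffOn_fderiv hV hf)

lemma contDiffOn_jac {φ : E → E} (hV : IsOpen V) (hφ : ContDiffOn ℝ ∞ φ V) (i j : Fin 3) :
    ContDiffOn ℝ ∞ (fun x => jac φ x i j) V :=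
  (EuclideanSpace.proj (𝕜 := ℝ) i).contDiff.comp_contDiffOn
    (contDiffOn_fderiv_apply hV hφ contDiffOn_const)

lemma contDiffOn_div {φ : E → E} (hV : IsOpen V) (hφ : ContDiffOn ℝ ∞ φ V) :
    ContDiffOn ℝ ∞ (div φ) V := by
  have : div φ = fun x => ∑ i, jac φ x i i := rfl
  rw [this]
  exact ContDiffOn.sum fun i _ => contDiffOn_jac hV hφ i i

lemma contDiffOn_symGrad {φ : E → E} (hV : IsOpen V) (hφ : ContDiffOn ℝ ∞ φ V) (i j : Fin 3) :
    ContDiffOn ℝ ∞ (fun x => symGrad φ x i j) V :=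
  (contDiffOn_jac hV hφ i j).add (contDiffOn_jac hV hφ j i)

end Smoothness

namespace Mixture

variable {m : Mixture ν n}

section Constitutive

lemma contDiffOn_dPhi (hm : m.Admissible) : ContDiffOn ℝ ∞ m.dPhi m.dom :=
  ((contDiffOn_infty_iff_fderiv_of_isOpen hm.isOpen_dom).1 hm.smooth_phi).2.clm_apply contDiffOn_const

lemma contDiffOn_dPhiRho (hm : m.Admissible) (α : Fin ν) : ContDiffOn ℝ ∞ (m.dPhiRho α) m.dom :=
  ((contDiffOn_infty_iff_fderiv_of_isOpen hm.isOpen_dom).1 hm.smooth_phi).2.clm_apply contDiffOn_const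

lemma dPhi_pos (hm : m.Admissible) {θ : Thermo ν} (hθ : θ ∈ m.dom) : 0 < m.dPhi θ := by
  have h := hm.temp_pos θ hθ
  unfold temp at h
  split at h
  · exact h
  · exact inv_pos.1 h

lemma contDiffOn_temp (hm : m.Admissible) : ContDiffOn ℝ ∞ m.temp m.dom := by
  unfold temp
  split
  · exact contDiffOn_dPhi hm
  · exact (contDiffOn_dPhi hm).inv fun θ hθ => (dPhi_pos hm hθ).ne'

lemma contDiffOn_mu (hm : m.Admissible) (α : Fin ν) : ContDiffOn ℝ ∞ (m.mu α) m.dom := by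
  unfold mu
  split
  · exact contDiffOn_dPhiRho hm α
  · exact ((contDiffOn_temp hm).mul (contDiffOn_dPhiRho hm α)).neg

lemma contDiffOn_intEnergy (hm : m.Admissible) : ContDiffOn ℝ ∞ m.intEnergy m.dom := by
  unfold intEnergy
  split
  · exact hm.smooth_phi
  · exact contDiffOn_snd

lemma contDiffOn_entropyDensity (hm : m.Admissible) : ContDiffOn ℝ ∞ m.entropyDensity m.dom := by
  unfold entropyDensity
  split
  · exact contDiffOn_snd
  · exact hm.smooth_phi

lemma contDiffOn_press (hm : m.Admissible) : ContDiffOn ℝ ∞ m.press m.dom := by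
  unfold press
  refine ((contDiffOn_intEnergy hm).neg.add
    ((contDiffOn_temp hm).mul (contDiffOn_entropyDensity hm))).add (ContDiffOn.sum fun α _ => ?_)
  exact (((ContinuousLinearMap.proj (R := ℝ) (φ := fun _ : Fin ν => ℝ) α).comp
    (ContinuousLinearMap.fst ℝ (Fin ν → ℝ) ℝ)).contDiff.contDiffOn).mul (contDiffOn_mu hm α)

lemma contDiffOn_LL₁ (hm : m.Admissible) (α : Fin ν) : ContDiffOn ℝ ∞ (m.LL₁ α) m.dom :=
  ContDiffOn.sum fun k _ => contDiffOn_const.mul (hm.smooth_L₁ k)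

lemma contDiffOn_LL₂ (hm : m.Admissible) (α β : Fin ν) : ContDiffOn ℝ ∞ (m.LL₂ α β) m.dom :=
  ContDiffOn.sum fun k _ => ContDiffOn.sum fun b _ =>
    (contDiffOn_const.mul (hm.smooth_L₂ k b)).mul contDiffOn_const

lemma contDiffOn_chemPress (hm : m.Admissible) : ContDiffOn ℝ ∞ m.chemPress m.dom :=
  ContDiffOn.sum fun β _ => (contDiffOn_LL₁ hm β).mul (contDiffOn_mu hm β)

lemma contDiffOn_bracketPress (hm : m.Admissible) : ContDiffOn ℝ ∞ m.bracketPress m.dom := by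
  unfold bracketPress
  split
  · exact contDiffOn_const
  · exact (contDiffOn_press hm).sub (contDiffOn_chemPress hm)

end Constitutive

section Along

variable {Ω : Set E} {z : E → Val ν}

lemma thermo_mem_dom {x : E} (hx : x ∈ m.regular z) : thermo z x ∈ m.dom := hx.2

lemma density_pos {x : E} (hx : x ∈ m.regular z) : 0 < density z x := hx.1

lemma contDiff_thermo (hz : z ∈ m.states Ω) : ContDiff ℝ ∞ (thermo z) :=
  thermoL.contDiff.comp hz.1

lemma contDiffOn_comp_thermo {f : Thermo ν → ℝ} (hf : ContDiffOn ℝ ∞ f m.dom)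
    (hz : z ∈ m.states Ω) : ContDiffOn ℝ ∞ (fun x => f (thermo z x)) (m.regular z) :=
  hf.comp (contDiff_thermo hz).contDiffOn fun _ hx => thermo_mem_dom hx

end Along

end Mixture

section Components

variable {a : E → Val ν}

lemma contDiff_rho (ha : ContDiff ℝ ∞ a) (α : Fin ν) : ContDiff ℝ ∞ (rho a α) :=
  (rhoL α).contDiff.comp ha

lemma contDiff_mom (ha : ContDiff ℝ ∞ a) : ContDiff ℝ ∞ (mom a) := momL.contDiff.comp ha

lemma contDiff_density (ha : ContDiff ℝ ∞ a) : ContDiff ℝ ∞ (density a) :=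
  ContDiff.sum fun α _ => contDiff_rho ha α

end Components

namespace Mixture

variable {m : Mixture ν n} {Ω : Set E} {z : E → Val ν}

lemma contDiffOn_vel (hz : z ∈ m.states Ω) : ContDiffOn ℝ ∞ (vel z) (m.regular z) :=
  ((contDiff_density hz.1).contDiffOn.inv fun _ hx => (density_pos hx).ne').smul
    (contDiff_mom hz.1).contDiffOn

/-! ### Energy and entropy -/

variable (m) in
/-- The functional derivative of the energy. -/
def energyGrad (z : E → Val ν) (x : E) : Val ν :=
  match m.pot with
  | .energy => (fun α => -(inner ℝ (vel z x) (vel z x) / 2) + m.mu α (thermo z x), vel z x,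
      m.temp (thermo z x))
  | .entropy => (fun _ => -(inner ℝ (vel z x) (vel z x) / 2), vel z x, 1)

variable (m) in
/-- The functional derivative of the entropy. -/
def entropyGrad (z : E → Val ν) (x : E) : Val ν :=
  match m.pot with
  | .energy => (fun _ => 0, 0, 1)
  | .entropy => (fun α => -(m.mu α (thermo z x) / m.temp (thermo z x)), 0, (m.temp (thermo z x))⁻¹)

lemma contDiffOn_energyGrad (hm : m.Admissible) (hz : z ∈ m.states Ω) :
    ContDiffOn ℝ ∞ (m.energyGrad z) (m.regular z) := by
  have hv := contDiffOn_vel hz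
  have hvv : ContDiffOn ℝ ∞ (fun x => -(inner ℝ (vel z x) (vel z x) / 2)) (m.regular z) :=
    ((hv.inner ℝ hv).div_const 2).neg
  unfold energyGrad
  split
  · exact (contDiffOn_pi.2 fun α => hvv.add (contDiffOn_comp_thermo (contDiffOn_mu hm α) hz)).prodMk
      (hv.prodMk (contDiffOn_comp_thermo (contDiffOn_temp hm) hz))
  · exact (contDiffOn_pi.2 fun α => hvv).prodMk (hv.prodMk contDiffOn_const)

lemma contDiffOn_entropyGrad (hm : m.Admissible) (hz : z ∈ m.states Ω) :
    ContDiffOn ℝ ∞ (m.entropyGrad z) (m.regular z) := by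
  have hT := contDiffOn_comp_thermo (contDiffOn_temp hm) hz
  have hT0 : ∀ x ∈ m.regular z, m.temp (thermo z x) ≠ 0 := fun x hx =>
    (hm.temp_pos _ (thermo_mem_dom hx)).ne'
  unfold entropyGrad
  split
  · exact contDiffOn_const
  · exact (contDiffOn_pi.2 fun α =>
      ((contDiffOn_comp_thermo (contDiffOn_mu hm α) hz).div hT hT0).neg).prodMk
        (contDiffOn_const.prodMk (hT.inv hT0))

lemma fderiv_phi_apply (θ h : Thermo ν) :
    fderiv ℝ m.phi θ h = (∑ α, m.dPhiRho α θ * h.1 α) + m.dPhi θ * h.2 := by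
  have h1 : h = (∑ α, h.1 α • ((Pi.single α 1, 0) : Thermo ν)) + h.2 • ((0, 1) : Thermo ν) := by
    refine Prod.ext ?_ ?_
    · ext α
      simp [Prod.fst_sum, Finset.sum_apply, Pi.single_apply]
    · simp [Prod.snd_sum]
  conv_lhs => rw [h1]
  simp only [map_add, map_sum, map_smul, smul_eq_mul, dPhiRho, dPhi, mul_comm]

lemma dPhi_eq (θ : Thermo ν) : m.dPhi θ = match m.pot with
    | .energy => m.temp θ
    | .entropy => (m.temp θ)⁻¹ := by
  cases h : m.pot <;> simp [temp, h]

lemma dPhiRho_eq {θ : Thermo ν} (hT : m.temp θ ≠ 0) (α : Fin ν) : m.dPhiRho α θ = match m.pot with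
    | .energy => m.mu α θ
    | .entropy => -(m.mu α θ / m.temp θ) := by
  cases h : m.pot
  · simp [mu, h]
  · simp only [mu, h]
    field_simp

end Mixture

section IntegralFunctional

variable {m : Mixture ν n} {Ω : Set E} {z : E → Val ν}

/-- Small perturbations of a state are states, so that values of functionals elsewhere do not
matter. -/
lemma HasVarDeriv.congr_of_states (hm : m.Admissible) (hne : Ω.Nonempty)
    (hb : Bornology.IsBounded Ω) {A B : (E → Val ν) → ℝ} {a : E → Val ν} (hz : z ∈ m.states Ω)
    (hA : HasVarDeriv Ω A z a) (h : ∀ z ∈ m.states Ω, B z = A z) : HasVarDeriv Ω B z a := by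
  obtain ⟨h1, k, h2⟩ := (hasVarDeriv_iff hne).1 hA
  refine (hasVarDeriv_iff hne).2 ⟨h1, k, h2.congr' ?_ Filter.EventuallyEq.rfl⟩
  filter_upwards [Mixture.eventually_add_mem_states hm hb hz k] with q hq
  rw [h _ hq, h _ hz]

/-- The functional derivative of an integral functional. -/
lemma hasVarDeriv_integral (hm : m.Admissible) (hne : Ω.Nonempty)
    (hb : Bornology.IsBounded Ω) {F : Val ν → ℝ} (hF : ContDiffOn ℝ ∞ F m.valDom)
    (hz : z ∈ m.states Ω) {a : E → Val ν} (ha : ContDiff ℝ ∞ a)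
    (hFa : ∀ x ∈ closure Ω, ∀ v, dot (a x) v = fderiv ℝ F (z x) v) :
    HasVarDeriv Ω (fun z => ∫ x in Ω, F (z x)) z a := by
  have hO := m.isOpen_valDom hm
  refine (hasVarDeriv_iff hne).2 ⟨ha, 0, Asymptotics.isLittleO_iff.2 fun c hc => ?_⟩
  have hfin : volume Ω < ⊤ := hb.measure_lt_top
  -- Chosen so that c' times the volume of Ω is at most c; the summand 1 keeps the denominator
  -- positive.
  set c' : ℝ := c / (volume.real Ω + 1) with hc'
  have hvol : 0 ≤ volume.real Ω := measureReal_nonneg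
  have hc'0 : 0 < c' := by positivity
  have hK : IsCompact (z '' closure Ω) :=
    (isCompact_closure_of_isBounded hb).image hz.1.continuous
  obtain ⟨δ, hδ, H⟩ := hK.exists_cthickening_subset_open hO (image_subset_iff.2 hz.2)
  have hK' : IsCompact (Metric.cthickening δ (z '' closure Ω)) := hK.cthickening
  have hF' : ContinuousOn (fderiv ℝ F) m.valDom :=
    hF.continuousOn_fderiv_of_isOpen hO (by exact_mod_cast le_top)
  have huc := hK'.uniformContinuousOn_of_continuous (hF'.mono H)
  rw [Metric.uniformContinuousOn_iff] at huc
  obtain ⟨η, hη, huc⟩ := huc c' hc'0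
  -- A first-order Taylor estimate, uniform in x: the derivative of F is uniformly continuous on a
  -- compact neighbourhood of the values of z.
  have hT : ∀ x ∈ closure Ω, ∀ v : Val ν, ‖v‖ < min δ η →
      ‖F (z x + v) - F (z x) - dot (a x) v‖ ≤ c' * ‖v‖ := by
    intro x hx v hv
    have hball : ∀ y ∈ Metric.ball (z x) (min δ η), y ∈ Metric.cthickening δ (z '' closure Ω) :=
      fun y hy => Metric.mem_cthickening_of_dist_le y (z x) δ _ (mem_image_of_mem _ hx)
        ((Metric.mem_ball.1 hy).le.trans (min_le_left _ _))
    have hxb : z x ∈ Metric.ball (z x) (min δ η) := Metric.mem_ball_self (lt_min hδ hη)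
    have h := (convex_ball (z x) (min δ η)).norm_image_sub_le_of_norm_fderiv_le' (𝕜 := ℝ) (f := F)
      (φ := fderiv ℝ F (z x)) (C := c') (x := z x) (y := z x + v)
      (fun y hy => (hF.differentiableOn (by simp)).differentiableAt
        (hO.mem_nhds (H (hball y hy))))
      (fun y hy => ?_) hxb (by simpa using hv)
    · rw [hFa x hx]
      simpa using h
    · rw [← dist_eq_norm]
      exact (huc y (hball y hy) (z x) (hball _ hxb)
        ((Metric.mem_ball.1 hy).trans_le (min_le_right _ _))).le
  have hint : ∀ w ∈ m.states Ω, IntegrableOn (fun x => F (w x)) Ω := fun w hw =>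
    integrableOn_of_continuousOn_closure hb
      (hF.continuousOn.comp hw.1.continuous.continuousOn hw.2)
  have hsmall : ∀ᶠ q in jetFilter ν Ω 0, ContDiff ℝ ∞ q.1 ∧ ∀ x ∈ closure Ω,
      ‖q.1 x‖ ≤ |q.2| ∧ ‖q.1 x‖ < min δ η :=
    eventually_jetFilter.2 ⟨min δ η, lt_min hδ hη, fun h r hr h1 h2 => ⟨h1, fun x hx =>
      ⟨(norm_le_of_jet_le h2 hx).trans (le_abs_self r),
        ((norm_le_of_jet_le h2 hx).trans (le_abs_self r)).trans_lt hr⟩⟩⟩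
  filter_upwards [Mixture.eventually_add_mem_states hm hb hz 0, hsmall] with q hq h
  rw [pairing_eq, ← integral_sub (hint _ hq) (hint _ hz),
    ← integral_sub (f := fun x => F ((z + q.1) x) - F (z x)) ((hint _ hq).sub (hint _ hz))
      (integrableOn_dot hb ha.continuous h.1.continuous)]
  refine (norm_setIntegral_le_of_norm_le_const (C := c' * |q.2|) hfin fun x hx => ?_).trans ?_
  · refine (hT x (subset_closure hx) (q.1 x) (h.2 x (subset_closure hx)).2).trans ?_
    gcongr
    exact (h.2 x (subset_closure hx)).1
  · rw [Real.norm_eq_abs, hc']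
    have : c / (volume.real Ω + 1) * |q.2| * volume.real Ω =
      c * |q.2| * (volume.real Ω / (volume.real Ω + 1)) := by ring
    rw [this]
    refine mul_le_of_le_one_right (by positivity) ?_
    rw [div_le_one (by positivity)]
    linarith

end IntegralFunctional

namespace Mixture

variable {m : Mixture ν n} {Ω : Set E} {z : E → Val ν}

lemma entropyGrad_spec (hm : m.Admissible) {x : E} (hx : x ∈ m.regular z) (v : Val ν) :
    dot (m.entropyGrad z x) v =
      fderiv ℝ (fun v : Val ν => m.entropyDensity (thermoL v)) (z x) v := by
  have hθ := thermo_mem_dom hx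
  have hT := (hm.temp_pos _ hθ).ne'
  cases h : m.pot
  · have h1 : (fun v : Val ν => m.entropyDensity (thermoL v)) = scaL := by
      ext v; simp [entropyDensity, h]
    rw [h1, ContinuousLinearMap.fderiv]
    simp [entropyGrad, h, dot_apply]
  · have h1 : (fun v : Val ν => m.entropyDensity (thermoL v)) = m.phi ∘ thermoL := by
      ext v; simp [entropyDensity, h]
    have h2 : DifferentiableAt ℝ m.phi (thermoL (z x)) :=
      (hm.smooth_phi.differentiableOn (by simp)).differentiableAt (hm.isOpen_dom.mem_nhds hθ)
    rw [h1, (h2.hasFDerivAt.comp (z x) thermoL.hasFDerivAt).fderiv, ContinuousLinearMap.comp_apply,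
      fderiv_phi_apply]
    have h3 : thermoL (z x) = thermo z x := rfl
    simp only [h3, dPhi_eq, dPhiRho_eq hT, entropyGrad, h, dot_apply, thermoL_apply]
    simp

variable (m) in
/-- The density of the total energy. -/
def energyDensity (v : Val ν) : ℝ :=
  inner ℝ v.2.1 v.2.1 / (2 * ∑ α, v.1 α) + m.intEnergy (thermoL v)

lemma contDiffOn_energyDensity (hm : m.Admissible) :
    ContDiffOn ℝ ∞ m.energyDensity m.valDom := by
  have h1 : ContDiff ℝ ∞ fun v : Val ν => ∑ α, v.1 α := ContDiff.sum fun α _ => (rhoL α).contDiff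
  have h2 : ContDiff ℝ ∞ fun v : Val ν => v.2.1 := momL.contDiff
  refine ContDiffOn.add (ContDiffOn.div ((h2.inner ℝ h2).contDiffOn)
    (contDiff_const.mul h1).contDiffOn fun v hv => ?_) ?_
  · have : 0 < ∑ α, v.1 α := hv.1
    positivity
  · exact (contDiffOn_intEnergy hm).comp thermoL.contDiff.contDiffOn fun v hv => hv.2

/-- The kinetic energy |M|²/(2ρ) has derivative −|v|²/2 in each ρ_α and v in M. The remaining terms
are the first derivatives of the internal energy. -/
lemma energyGrad_spec (hm : m.Admissible) {x : E} (hx : x ∈ m.regular z) (v : Val ν) :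
    dot (m.energyGrad z x) v = fderiv ℝ m.energyDensity (z x) v := by
  have hθ := thermo_mem_dom hx
  have hT := (hm.temp_pos _ hθ).ne'
  have hρ : 0 < ∑ α, (z x).1 α := hx.1
  have e1 : HasFDerivAt (fun v : Val ν => ∑ α, v.1 α) (∑ α, rhoL α) (z x) :=
    HasFDerivAt.fun_sum fun α _ => (rhoL α).hasFDerivAt
  have e2 : HasFDerivAt (fun v : Val ν => v.2.1) momL (z x) := momL.hasFDerivAt
  have e3 := (e2.inner ℝ e2).mul ((hasDerivAt_inv (x := 2 * ∑ α, (z x).1 α)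
    (by positivity)).comp_hasFDerivAt (z x) (e1.const_mul 2))
  have hint : HasFDerivAt (fun v : Val ν => m.intEnergy (thermoL v))
      (fderiv ℝ (fun v : Val ν => m.intEnergy (thermoL v)) (z x)) (z x) := by
    have h2 : DifferentiableAt ℝ m.intEnergy (thermoL (z x)) :=
      ((contDiffOn_intEnergy hm).differentiableOn (by simp)).differentiableAt
        (hm.isOpen_dom.mem_nhds hθ)
    exact (h2.comp (z x) thermoL.differentiableAt).hasFDerivAt
  have e4 : fderiv ℝ m.energyDensity (z x) v = _ :=
    DFunLike.congr_fun (e3.add hint).fderiv v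
  rw [e4]
  have hkin : ∀ c : Fin ν → ℝ, ∀ s : ℝ, dot ((fun α => -(inner ℝ (vel z x) (vel z x) / 2) + c α,
      vel z x, s) : Val ν) v = (∑ α, c α * v.1 α) + s * v.2.2 +
        (inner ℝ (vel z x) v.2.1 - inner ℝ (vel z x) (vel z x) / 2 * ∑ α, v.1 α) := fun c s => by
    simp only [dot_apply, add_mul, Finset.sum_add_distrib, ← Finset.mul_sum]
    ring
  have hvel : vel z x = (∑ α, (z x).1 α)⁻¹ • (z x).2.1 := rfl
  -- The left-hand side is the derivative of |M|² (2ρ)⁻¹ in the shape in which the product rule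
  -- delivers it.
  have hkin' : inner ℝ (z x).2.1 (z x).2.1 • -((2 * ∑ α, (z x).1 α) ^ 2)⁻¹ • (2 : ℝ) •
        (∑ α, rhoL α : Val ν →L[ℝ] ℝ) v +
      ((fun y : ℝ => y⁻¹) ∘ fun y : Val ν => 2 * ∑ α, y.1 α) (z x) •
        (fderivInnerCLM ℝ ((z x).2.1, (z x).2.1)) ((momL.prod momL) v) =
      inner ℝ (vel z x) v.2.1 - inner ℝ (vel z x) (vel z x) / 2 * ∑ α, v.1 α := by
    simp only [hvel, Function.comp_apply, fderivInnerCLM_apply, ContinuousLinearMap.prod_apply,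
      momL_apply, sum_apply, rhoL_apply, real_inner_smul_left, real_inner_smul_right, smul_eq_mul,
      real_inner_comm (z x).2.1 v.2.1]
    field_simp
    ring
  simp only [add_apply, smul_apply, ContinuousLinearMap.comp_apply]
  rw [hkin']
  cases h : m.pot
  · have h1 : (fun v : Val ν => m.intEnergy (thermoL v)) = m.phi ∘ thermoL := by
      ext v; simp [intEnergy, h]
    have h2 : DifferentiableAt ℝ m.phi (thermoL (z x)) :=
      (hm.smooth_phi.differentiableOn (by simp)).differentiableAt (hm.isOpen_dom.mem_nhds hθ)
    have h3 : thermoL (z x) = thermo z x := rfl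
    rw [h1, (h2.hasFDerivAt.comp (z x) thermoL.hasFDerivAt).fderiv, ContinuousLinearMap.comp_apply,
      fderiv_phi_apply]
    simp only [h3, dPhi_eq, dPhiRho_eq hT, h, thermoL_apply, energyGrad]
    rw [hkin]
    simp only [thermo]
    ring
  · have h1 : (fun v : Val ν => m.intEnergy (thermoL v)) = scaL := by
      ext v; simp [intEnergy, h]
    rw [h1, ContinuousLinearMap.fderiv]
    have := hkin 0 1
    simp only [Pi.zero_apply, add_zero] at this
    simp only [energyGrad, h]
    rw [this, scaL_apply]
    ring_nf
    simp

end Mixture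

end OpenMixture

end

noncomputable section
namespace OpenMixture

variable {ν n : ℕ}

/-! ### Vector calculus -/

section VectorCalculus

variable {x : E}

lemma div_smul {f : E → ℝ} {φ : E → E} (hf : DifferentiableAt ℝ f x) (hφ : DifferentiableAt ℝ φ x) :
    div (fun y => f y • φ y) x = f x * div φ x + fderiv ℝ f x (φ x) := by
  have h1 : φ x = ∑ i, φ x i • (EuclideanSpace.single i 1 : E) := by
    ext j; simp [Pi.single_apply]
  conv_rhs => rw [h1]
  simp only [div_eq_sum, map_sum, map_smul, Finset.mul_sum, ← Finset.sum_add_distrib]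
  refine Finset.sum_congr rfl fun i _ => ?_
  rw [fderiv_fun_smul hf hφ]
  simp [mul_comm]

lemma div_add {φ ψ : E → E} (hφ : DifferentiableAt ℝ φ x) (hψ : DifferentiableAt ℝ ψ x) :
    div (fun y => φ y + ψ y) x = div φ x + div ψ x := by
  simp only [div_eq_sum, fderiv_fun_add hφ hψ, ← Finset.sum_add_distrib]
  rfl

lemma div_sub {φ ψ : E → E} (hφ : DifferentiableAt ℝ φ x) (hψ : DifferentiableAt ℝ ψ x) :
    div (fun y => φ y - ψ y) x = div φ x - div ψ x := by
  simp only [div_eq_sum, fderiv_fun_sub hφ hψ, ← Finset.sum_sub_distrib]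
  rfl

lemma div_sum {ι : Type*} (s : Finset ι) {φ : ι → E → E} (hφ : ∀ i ∈ s, DifferentiableAt ℝ (φ i) x) :
    div (fun y => ∑ i ∈ s, φ i y) x = ∑ i ∈ s, div (φ i) x := by
  simp only [div_eq_sum, fderiv_fun_sum hφ]
  rw [Finset.sum_comm]
  refine Finset.sum_congr rfl fun i _ => ?_
  simp [sum_apply]

lemma inner_gradient (f : E → ℝ) (x u : E) : inner ℝ (gradient f x) u = fderiv ℝ f x u := by
  rw [gradient, InnerProductSpace.toDual_symm_apply]

end VectorCalculus

section Fields

variable {a b y z : E → Val ν} {x : E}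

lemma fderiv_rho (ha : DifferentiableAt ℝ a x) (α : Fin ν) (u : E) :
    fderiv ℝ (rho a α) x u = (fderiv ℝ a x u).1 α := by
  have h := ((rhoL α).hasFDerivAt.comp x ha.hasFDerivAt).fderiv
  exact DFunLike.congr_fun h u

lemma fderiv_mom (ha : DifferentiableAt ℝ a x) (u : E) :
    fderiv ℝ (mom a) x u = (fderiv ℝ a x u).2.1 :=
  DFunLike.congr_fun ((momL.hasFDerivAt.comp x ha.hasFDerivAt).fderiv) u

lemma fderiv_sca (ha : DifferentiableAt ℝ a x) (u : E) :
    fderiv ℝ (sca a) x u = (fderiv ℝ a x u).2.2 :=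
  DFunLike.congr_fun ((scaL.hasFDerivAt.comp x ha.hasFDerivAt).fderiv) u

lemma differentiableAt_rho (ha : DifferentiableAt ℝ a x) (α : Fin ν) :
    DifferentiableAt ℝ (rho a α) x := (rhoL α).differentiableAt.comp x ha

lemma differentiableAt_mom (ha : DifferentiableAt ℝ a x) : DifferentiableAt ℝ (mom a) x :=
  momL.differentiableAt.comp x ha

lemma differentiableAt_sca (ha : DifferentiableAt ℝ a x) : DifferentiableAt ℝ (sca a) x :=
  scaL.differentiableAt.comp x ha

lemma hasFDerivAt_dot (ha : DifferentiableAt ℝ a x) (hb : DifferentiableAt ℝ b x) :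
    HasFDerivAt (fun x => dot (a x) (b x))
      ((dot (a x)).comp (fderiv ℝ b x) + (dot (b x)).comp (fderiv ℝ a x)) x := by
  have h := dot.hasFDerivAt_of_bilinear ha.hasFDerivAt hb.hasFDerivAt
  refine h.congr_fderiv (ContinuousLinearMap.ext fun u => ?_)
  simp [dot_comm (b x)]

lemma fderiv_dot (ha : DifferentiableAt ℝ a x) (hb : DifferentiableAt ℝ b x) (u : E) :
    fderiv ℝ (fun x => dot (a x) (b x)) x u =
      dot (a x) (fderiv ℝ b x u) + dot (b x) (fderiv ℝ a x u) := by
  rw [(hasFDerivAt_dot ha hb).fderiv]; rfl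

/-- The embedding of momentum densities into the values. -/
def momEmb : E →L[ℝ] Val ν :=
  (0 : E →L[ℝ] (Fin ν → ℝ)).prod ((ContinuousLinearMap.id ℝ E).prod 0)

lemma dot_momEmb (a : Val ν) (u : E) : dot a (momEmb u) = inner ℝ a.2.1 u := by
  simp [dot_apply, momEmb]

/-- The covector `d⟨b, y⟩ - ⟨b, dz⟩`. -/
def transport (y z b : E → Val ν) (x : E) : E →L[ℝ] ℝ :=
  fderiv ℝ (fun x => dot (b x) (y x)) x - (dot (b x)).comp (fderiv ℝ z x)

lemma transport_apply (y z b : E → Val ν) (x u : E) : transport y z b x u =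
    fderiv ℝ (fun x => dot (b x) (y x)) x u - dot (b x) (fderiv ℝ z x u) := rfl

/-- The integrand of the Poisson bracket, `y` being the field of the quantities transported. -/
def bracketDensity (y z a b : E → Val ν) (x : E) : ℝ :=
  transport y z a x (mom b x) - transport y z b x (mom a x)

/-- The Hamiltonian vector field of a functional with functional derivative `a`. -/
def hamField (y z a : E → Val ν) (x : E) : Val ν :=
  div (mom a) x • y x + fderiv ℝ z x (mom a x) +
    momEmb ((InnerProductSpace.toDual ℝ E).symm (transport y z a x))

lemma bracketDensity_antisymm (y z a b : E → Val ν) (x : E) :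
    bracketDensity y z a b x = -bracketDensity y z b a x := by
  simp only [bracketDensity]; ring

/-- Partial integration in the Poisson bracket. -/
lemma bracketDensity_eq (hy : DifferentiableAt ℝ y x) (ha : DifferentiableAt ℝ a x)
    (hb : DifferentiableAt ℝ b x) : bracketDensity y z a b x =
      dot (b x) (hamField y z a x) - div (fun x => dot (b x) (y x) • mom a x) x := by
  rw [div_smul (hasFDerivAt_dot hb hy).differentiableAt (differentiableAt_mom ha)]
  simp only [bracketDensity, hamField, map_add, map_smul, dot_momEmb]
  rw [real_inner_comm, InnerProductSpace.toDual_symm_apply, transport_apply y z b]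
  simp only [smul_eq_mul, mom]
  ring

lemma transport_smul_add (hy : DifferentiableAt ℝ y x) (ha : DifferentiableAt ℝ a x)
    (hb : DifferentiableAt ℝ b x) (c d : ℝ) (u : E) :
    transport y z (c • a + d • b) x u = c * transport y z a x u + d * transport y z b x u := by
  simp only [transport_apply, Pi.add_apply, Pi.smul_apply]
  have h : (fun x => dot (c • a x + d • b x) (y x)) =
      fun x => c * dot (a x) (y x) + d * dot (b x) (y x) := by
    ext; simp
  rw [h, fderiv_fun_add ((hasFDerivAt_dot ha hy).differentiableAt.const_mul c)
    ((hasFDerivAt_dot hb hy).differentiableAt.const_mul d),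
    fderiv_const_mul (hasFDerivAt_dot ha hy).differentiableAt,
    fderiv_const_mul (hasFDerivAt_dot hb hy).differentiableAt]
  simp
  ring

lemma bracketDensity_smul_add_left {e : E → Val ν} (hy : DifferentiableAt ℝ y x)
    (ha : DifferentiableAt ℝ a x) (hb : DifferentiableAt ℝ b x) (c d : ℝ) :
    bracketDensity y z (c • a + d • b) e x =
      c * bracketDensity y z a e x + d * bracketDensity y z b e x := by
  have h : mom (c • a + d • b) x = c • mom a x + d • mom b x := rfl
  simp only [bracketDensity, transport_smul_add hy ha hb, h, map_add, map_smul, smul_eq_mul]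
  ring

end Fields

/-! ### The Poisson bracket of the mixture -/

namespace Mixture

variable (m : Mixture ν n)

/-- The quantities `(ρ_α - 𝕃_α, M, w + P)` that are transported by the flow. -/
def carried (v : Val ν) : Val ν :=
  (fun α => v.1 α - m.LL₁ α (thermoL v), v.2.1, v.2.2 + m.bracketPress (thermoL v))

variable {m} {Ω : Set E} {z a b : E → Val ν}

lemma contDiffOn_carried (hm : m.Admissible) : ContDiffOn ℝ ∞ m.carried m.valDom := by
  have h : ∀ {f : Thermo ν → ℝ}, ContDiffOn ℝ ∞ f m.dom →
      ContDiffOn ℝ ∞ (fun v : Val ν => f (thermoL v)) m.valDom := fun hf =>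
    hf.comp thermoL.contDiff.contDiffOn fun v hv => hv.2
  exact (contDiffOn_pi.2 fun α => (rhoL α).contDiff.contDiffOn.sub (h (contDiffOn_LL₁ hm α))).prodMk
    (momL.contDiff.contDiffOn.prodMk (scaL.contDiff.contDiffOn.add (h (contDiffOn_bracketPress hm))))

variable (m) in
/-- The transported quantities along a state. -/
def carriedField (z : E → Val ν) (x : E) : Val ν := m.carried (z x)

lemma contDiffOn_carriedField (hm : m.Admissible) (hz : z ∈ m.states Ω) :
    ContDiffOn ℝ ∞ (m.carriedField z) (m.regular z) :=
  (contDiffOn_carried hm).comp hz.1.contDiffOn fun _ hx => hx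

lemma dot_carriedField (z b : E → Val ν) (x : E) : dot (b x) (m.carriedField z x) =
    (∑ α, rho b α x * rho z α x) - (∑ α, rho b α x * m.LL₁ α (thermo z x))
      + inner ℝ (mom b x) (mom z x) + sca b x * sca z x
      + sca b x * m.bracketPress (thermo z x) := by
  simp only [dot_apply, carriedField, carried, mul_sub, Finset.sum_sub_distrib, mul_add, ← add_assoc]
  rfl

lemma differentiableAt_comp_thermo (hm : m.Admissible) {f : Thermo ν → ℝ}
    (hf : ContDiffOn ℝ ∞ f m.dom) (hz : z ∈ m.states Ω) {x : E} (hx : x ∈ m.regular z) :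
    DifferentiableAt ℝ (fun x => f (thermo z x)) x :=
  ((contDiffOn_comp_thermo hf hz).differentiableOn (by simp)).differentiableAt
    ((isOpen_regular hm hz).mem_nhds hx)

/-- In d⟨b, y⟩ the derivatives that fall on ρ, M and w are removed by ⟨b, dz⟩. What remains are the
terms of the Poisson bracket, in which b, b_α 𝕃_α and b_w P are differentiated. -/
lemma transport_carriedField (hm : m.Admissible) (hz : z ∈ m.states Ω) {x : E}
    (hx : x ∈ m.regular z) (hb : DifferentiableAt ℝ b x) (u : E) :
    transport (m.carriedField z) z b x u =
      (∑ α, rho z α x * fderiv ℝ (rho b α) x u)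
      - (∑ α, fderiv ℝ (fun y => rho b α y * m.LL₁ α (thermo z y)) x u)
      + inner ℝ (mom z x) (fderiv ℝ (mom b) x u) + sca z x * fderiv ℝ (sca b) x u
      + fderiv ℝ (fun y => sca b y * m.bracketPress (thermo z y)) x u := by
  have hzd : DifferentiableAt ℝ z x := hz.1.differentiable (by simp) x
  have hL := fun α => differentiableAt_comp_thermo hm (contDiffOn_LL₁ hm α) hz hx
  have hP := differentiableAt_comp_thermo hm (contDiffOn_bracketPress hm) hz hx
  have hbr := fun α => differentiableAt_rho hb α
  have hzr := fun α => differentiableAt_rho hzd α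
  rw [transport_apply]
  simp only [dot_carriedField]
  have e1 : ∀ α, HasFDerivAt (fun x => rho b α x * rho z α x) _ x :=
    fun α => (hbr α).hasFDerivAt.fun_mul (hzr α).hasFDerivAt
  have e2 : ∀ α, HasFDerivAt (fun x => rho b α x * m.LL₁ α (thermo z x)) _ x :=
    fun α => ((hbr α).fun_mul (hL α)).hasFDerivAt
  have e3 : HasFDerivAt (fun x => inner ℝ (mom b x) (mom z x)) _ x :=
    (differentiableAt_mom hb).hasFDerivAt.inner ℝ (differentiableAt_mom hzd).hasFDerivAt
  have e4 : HasFDerivAt (fun x => sca b x * sca z x) _ x :=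
    (differentiableAt_sca hb).hasFDerivAt.fun_mul (differentiableAt_sca hzd).hasFDerivAt
  have e5 : HasFDerivAt (fun x => sca b x * m.bracketPress (thermo z x)) _ x :=
    ((differentiableAt_sca hb).fun_mul hP).hasFDerivAt
  have e := (((((HasFDerivAt.fun_sum (u := Finset.univ) fun α _ => e1 α).fun_sub
    (HasFDerivAt.fun_sum (u := Finset.univ) fun α _ => e2 α)).fun_add e3).fun_add e4).fun_add e5 :
      HasFDerivAt _ _ x)
  rw [e.fderiv]
  simp only [add_apply, sub_apply, sum_apply, smul_apply, ContinuousLinearMap.comp_apply,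
    fderivInnerCLM_apply, ContinuousLinearMap.prod_apply, smul_eq_mul, dot_apply, fderiv_rho hzd,
    fderiv_rho hb, fderiv_mom hzd, fderiv_mom hb, fderiv_sca hb, fderiv_sca hzd,
    Finset.sum_add_distrib, real_inner_comm (mom z x)]
  simp only [rho, mom, sca]
  ring

/-- As far as the Poisson bracket is concerned, the representations differ from here on only in the
field of transported quantities. -/
lemma poissonDensity_eq (hm : m.Admissible) (hz : z ∈ m.states Ω) {x : E}
    (hx : x ∈ m.regular z) (ha : DifferentiableAt ℝ a x) (hb : DifferentiableAt ℝ b x) :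
    m.poissonDensity z a b x = bracketDensity (m.carriedField z) z a b x := by
  rw [bracketDensity, transport_carriedField hm hz hx ha, transport_carriedField hm hz hx hb,
    poissonDensity]
  simp only [mul_sub, inner_sub_right, Finset.sum_sub_distrib]
  ring

lemma poissonBdryDensity_eq (nrm : E → E) (z a b : E → Val ν) (x : E) :
    m.poissonBdryDensity nrm z a b x =
      inner ℝ (dot (a x) (m.carriedField z x) • mom b x) (nrm x) := by
  rw [real_inner_smul_left, dot_carriedField, poissonBdryDensity]
  simp only [mul_sub, Finset.sum_sub_distrib]
  ring

end Mixture

end OpenMixture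

end

noncomputable section
namespace OpenMixture

variable {ν n : ℕ}

/-! ### The integrand of the dissipation bracket -/

lemma contract_comm (A B : Matrix (Fin 3) (Fin 3) ℝ) : contract A B = contract B A := by
  simp only [contract, mul_comm]

lemma contract_add_left (A B C : Matrix (Fin 3) (Fin 3) ℝ) :
    contract (A + B) C = contract A C + contract B C := by
  simp only [contract, Matrix.add_apply, add_mul, Finset.sum_add_distrib]

lemma contract_smul_left (c : ℝ) (A B : Matrix (Fin 3) (Fin 3) ℝ) :
    contract (c • A) B = c * contract A B := by
  simp only [contract, Matrix.smul_apply, smul_eq_mul, Finset.mul_sum, mul_assoc]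

/-- Cauchy–Schwarz on the diagonal; the off-diagonal squares only help. -/
lemma trace_sq_le_contract (A : Matrix (Fin 3) (Fin 3) ℝ) :
    A.trace ^ 2 ≤ 3 * contract A A := by
  simp only [Matrix.trace, contract, Fin.sum_univ_three, Matrix.diag]
  nlinarith [sq_nonneg (A 0 0 - A 1 1), sq_nonneg (A 0 0 - A 2 2), sq_nonneg (A 1 1 - A 2 2),
    sq_nonneg (A 0 1), sq_nonneg (A 0 2), sq_nonneg (A 1 0), sq_nonneg (A 1 2), sq_nonneg (A 2 0),
    sq_nonneg (A 2 1)]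

lemma trace_symGrad (φ : E → E) (x : E) : (symGrad φ x).trace = 2 * div φ x := by
  rw [symGrad, Matrix.trace_add, Matrix.trace_transpose, div, two_mul]

lemma jac_congr {φ ψ : E → E} {x : E} (h : fderiv ℝ φ x = fderiv ℝ ψ x) : jac φ x = jac ψ x := by
  simp only [jac, h]

lemma gradient_congr {f g : E → ℝ} {x : E} (h : fderiv ℝ f x = fderiv ℝ g x) :
    gradient f x = gradient g x := by
  simp only [gradient, h]

lemma jac_smul_add {φ ψ : E → E} {x : E} (hφ : DifferentiableAt ℝ φ x)
    (hψ : DifferentiableAt ℝ ψ x) (c d : ℝ) :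
    jac (fun y => c • φ y + d • ψ y) x = c • jac φ x + d • jac ψ x := by
  ext i j
  simp only [jac, Matrix.of_apply, Matrix.add_apply, Matrix.smul_apply]
  rw [fderiv_fun_add (f := fun y => c • φ y) (g := fun y => d • ψ y) (hφ.const_smul c)
    (hψ.const_smul d), fderiv_fun_const_smul hφ,
    fderiv_fun_const_smul hψ]
  simp

lemma gradient_smul_add {f g : E → ℝ} {x : E} (hf : DifferentiableAt ℝ f x)
    (hg : DifferentiableAt ℝ g x) (c d : ℝ) :
    gradient (fun y => c * f y + d * g y) x = c • gradient f x + d • gradient g x := by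
  simp only [gradient]
  rw [fderiv_fun_add (hf.const_mul c) (hg.const_mul d), fderiv_const_mul hf, fderiv_const_mul hg,
    map_add, map_smul, map_smul]

namespace Mixture

variable {m : Mixture ν n} {Ω : Set E} {z a b : E → Val ν}

/-! ### Smoothness of the forces, fluxes and bracket integrands. -/

section Smooth

lemma contDiffOn_forceHeat (hm : m.Admissible) (hz : z ∈ m.states Ω)
    (ha : ContDiffOn ℝ ∞ a (m.regular z)) : ContDiffOn ℝ ∞ (m.forceHeat z a) (m.regular z) := by
  have hs : ContDiffOn ℝ ∞ (sca a) (m.regular z) := scaL.contDiff.comp_contDiffOn ha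
  have hT := contDiffOn_comp_thermo (contDiffOn_temp hm) hz
  unfold forceHeat
  split
  · exact (hT.inv fun x hx => (hm.temp_pos _ (thermo_mem_dom hx)).ne').mul hs
  · exact hs

lemma contDiffOn_forceDiff (hm : m.Admissible) (hz : z ∈ m.states Ω)
    (ha : ContDiffOn ℝ ∞ a (m.regular z)) (α : Fin ν) :
    ContDiffOn ℝ ∞ (m.forceDiff z a α) (m.regular z) := by
  have hs : ContDiffOn ℝ ∞ (sca a) (m.regular z) := scaL.contDiff.comp_contDiffOn ha
  have hr : ContDiffOn ℝ ∞ (rho a α) (m.regular z) := (rhoL α).contDiff.comp_contDiffOn ha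
  have hT := contDiffOn_comp_thermo (contDiffOn_temp hm) hz
  have hμ := contDiffOn_comp_thermo (contDiffOn_mu hm α) hz
  unfold forceDiff
  split
  · exact hr.sub ((hμ.div hT fun x hx => (hm.temp_pos _ (thermo_mem_dom hx)).ne').mul hs)
  · exact hr

lemma contDiffOn_forceShear (hm : m.Admissible) (hz : z ∈ m.states Ω)
    (ha : ContDiffOn ℝ ∞ a (m.regular z)) (i j : Fin 3) :
    ContDiffOn ℝ ∞ (fun x => m.forceShear z a x i j) (m.regular z) :=
  (contDiffOn_symGrad (isOpen_regular hm hz) (momL.contDiff.comp_contDiffOn ha) i j).sub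
    ((contDiffOn_forceHeat hm hz ha).mul
      (contDiffOn_symGrad (isOpen_regular hm hz) (contDiffOn_vel hz) i j))

lemma contDiffOn_forceBulk (hm : m.Admissible) (hz : z ∈ m.states Ω)
    (ha : ContDiffOn ℝ ∞ a (m.regular z)) : ContDiffOn ℝ ∞ (m.forceBulk z a) (m.regular z) :=
  (contDiffOn_div (isOpen_regular hm hz) (momL.contDiff.comp_contDiffOn ha)).sub
    ((contDiffOn_div (isOpen_regular hm hz) (contDiffOn_vel hz)).mul (contDiffOn_forceHeat hm hz ha))

lemma contDiffOn_fluxHeat (hm : m.Admissible) (hz : z ∈ m.states Ω)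
    (ha : ContDiffOn ℝ ∞ a (m.regular z)) : ContDiffOn ℝ ∞ (m.fluxHeat z a) (m.regular z) := by
  have hV := isOpen_regular hm hz
  exact (((contDiffOn_comp_thermo hm.smooth_kappa hz).mul
    ((contDiffOn_comp_thermo (contDiffOn_temp hm) hz).pow 2)).smul
      (contDiffOn_gradient hV (contDiffOn_forceHeat hm hz ha))).add
    (ContDiffOn.sum fun β _ => (contDiffOn_comp_thermo (hm.smooth_B₁ β) hz).smul
      (contDiffOn_gradient hV (contDiffOn_forceDiff hm hz ha β)))

lemma contDiffOn_fluxDiff (hm : m.Admissible) (hz : z ∈ m.states Ω)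
    (ha : ContDiffOn ℝ ∞ a (m.regular z)) (α : Fin ν) :
    ContDiffOn ℝ ∞ (m.fluxDiff z a α) (m.regular z) := by
  have hV := isOpen_regular hm hz
  exact ((contDiffOn_comp_thermo (hm.smooth_B₁ α) hz).smul
      (contDiffOn_gradient hV (contDiffOn_forceHeat hm hz ha))).add
    (ContDiffOn.sum fun β _ => (contDiffOn_comp_thermo (hm.smooth_B₂ α β) hz).smul
      (contDiffOn_gradient hV (contDiffOn_forceDiff hm hz ha β)))

lemma contDiffOn_dissipationDensity (hm : m.Admissible) (hz : z ∈ m.states Ω)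
    (ha : ContDiffOn ℝ ∞ a (m.regular z)) (hb : ContDiffOn ℝ ∞ b (m.regular z)) :
    ContDiffOn ℝ ∞ (m.dissipationDensity z a b) (m.regular z) := by
  have hV := isOpen_regular hm hz
  have hT := contDiffOn_comp_thermo (contDiffOn_temp hm) hz
  have hζ := contDiffOn_comp_thermo hm.smooth_zeta hz
  have hlam := contDiffOn_comp_thermo hm.smooth_lam hz
  refine ContDiffOn.add (ContDiffOn.add (ContDiffOn.add ?_ ?_) ?_) ?_
  · refine ((hζ.mul hT).div_const 2).mul (ContDiffOn.sum fun i _ => ContDiffOn.sum fun j _ => ?_)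
    exact (contDiffOn_forceShear hm hz ha i j).mul (contDiffOn_forceShear hm hz hb i j)
  · exact ((hT.mul (hlam.sub ((contDiffOn_const.mul hζ).div_const 3))).mul
      (contDiffOn_forceBulk hm hz ha)).mul (contDiffOn_forceBulk hm hz hb)
  · exact ((contDiffOn_gradient hV (contDiffOn_forceHeat hm hz ha)).inner ℝ
      (contDiffOn_fluxHeat hm hz hb)).add (ContDiffOn.sum fun α _ =>
        (contDiffOn_gradient hV (contDiffOn_forceDiff hm hz ha α)).inner ℝ
          (contDiffOn_fluxDiff hm hz hb α))
  · exact hT.mul (ContDiffOn.sum fun α _ => ContDiffOn.sum fun β _ =>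
      ((contDiffOn_forceDiff hm hz ha α).mul (contDiffOn_comp_thermo (contDiffOn_LL₂ hm α β) hz)).mul
        (contDiffOn_forceDiff hm hz hb β))

lemma contDiffOn_transport {y : E → Val ν} {V : Set E} (hV : IsOpen V) (hy : ContDiffOn ℝ ∞ y V)
    (hz : ContDiffOn ℝ ∞ z V) (ha : ContDiffOn ℝ ∞ a V) : ContDiffOn ℝ ∞ (transport y z a) V := by
  have h1 : ContDiffOn ℝ ∞ (fun x => dot (a x)) V := dot.contDiff.comp_contDiffOn ha
  exact (contDiffOn_fderiv hV (h1.clm_apply hy)).sub (h1.clm_comp (contDiffOn_fderiv hV hz))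

lemma contDiffOn_bracketDensity {y : E → Val ν} {V : Set E} (hV : IsOpen V)
    (hy : ContDiffOn ℝ ∞ y V) (hz : ContDiffOn ℝ ∞ z V) (ha : ContDiffOn ℝ ∞ a V)
    (hb : ContDiffOn ℝ ∞ b V) : ContDiffOn ℝ ∞ (bracketDensity y z a b) V :=
  ((contDiffOn_transport hV hy hz ha).clm_apply (momL.contDiff.comp_contDiffOn hb)).sub
    ((contDiffOn_transport hV hy hz hb).clm_apply (momL.contDiff.comp_contDiffOn ha))

end Smooth

/-! ### Independence of the values of functional derivatives outside the closed domain. -/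

section Congr

variable {a' b' : E → Val ν}

lemma forceHeat_congr (hab : EqOn a a' (closure Ω)) :
    EqOn (m.forceHeat z a) (m.forceHeat z a') (closure Ω) := fun x hx => by
  simp only [forceHeat, sca, hab hx]

lemma forceDiff_congr (hab : EqOn a a' (closure Ω)) (α : Fin ν) :
    EqOn (m.forceDiff z a α) (m.forceDiff z a' α) (closure Ω) := fun x hx => by
  simp only [forceDiff, sca, rho, hab hx]

lemma fderiv_congr_closure (hm : m.Admissible) (hΩ : IsOpen Ω) (hz : z ∈ m.states Ω) {F : Type*}
    [NormedAddCommGroup F] [NormedSpace ℝ F] {f g : E → F} (hf : ContDiffOn ℝ ∞ f (m.regular z))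
    (hg : ContDiffOn ℝ ∞ g (m.regular z)) (h : EqOn f g (closure Ω)) :
    EqOn (fderiv ℝ f) (fderiv ℝ g) (closure Ω) :=
  fderiv_eq_of_eqOn hΩ (isOpen_regular hm hz) (closure_subset_regular hz)
    (hf.of_le (by exact_mod_cast le_top)) (hg.of_le (by exact_mod_cast le_top))
    (h.mono subset_closure)

lemma gradient_forceHeat_congr (hm : m.Admissible) (hΩ : IsOpen Ω) (hz : z ∈ m.states Ω)
    (ha : ContDiffOn ℝ ∞ a (m.regular z)) (ha' : ContDiffOn ℝ ∞ a' (m.regular z))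
    (hab : EqOn a a' (closure Ω)) :
    EqOn (gradient (m.forceHeat z a)) (gradient (m.forceHeat z a')) (closure Ω) := fun _ hx =>
  gradient_congr (fderiv_congr_closure hm hΩ hz (contDiffOn_forceHeat hm hz ha)
    (contDiffOn_forceHeat hm hz ha') (forceHeat_congr hab) hx)

lemma gradient_forceDiff_congr (hm : m.Admissible) (hΩ : IsOpen Ω) (hz : z ∈ m.states Ω)
    (ha : ContDiffOn ℝ ∞ a (m.regular z)) (ha' : ContDiffOn ℝ ∞ a' (m.regular z))
    (hab : EqOn a a' (closure Ω)) (α : Fin ν) :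
    EqOn (gradient (m.forceDiff z a α)) (gradient (m.forceDiff z a' α)) (closure Ω) := fun _ hx =>
  gradient_congr (fderiv_congr_closure hm hΩ hz (contDiffOn_forceDiff hm hz ha α)
    (contDiffOn_forceDiff hm hz ha' α) (forceDiff_congr hab α) hx)

lemma jac_mom_congr (hm : m.Admissible) (hΩ : IsOpen Ω) (hz : z ∈ m.states Ω)
    (ha : ContDiffOn ℝ ∞ a (m.regular z)) (ha' : ContDiffOn ℝ ∞ a' (m.regular z))
    (hab : EqOn a a' (closure Ω)) : EqOn (jac (mom a)) (jac (mom a')) (closure Ω) := fun _ hx =>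
  jac_congr (fderiv_congr_closure hm hΩ hz (momL.contDiff.comp_contDiffOn ha)
    (momL.contDiff.comp_contDiffOn ha') (fun y hy => by simp only [Function.comp_apply, hab hy]) hx)

lemma forceShear_congr (hm : m.Admissible) (hΩ : IsOpen Ω) (hz : z ∈ m.states Ω)
    (ha : ContDiffOn ℝ ∞ a (m.regular z)) (ha' : ContDiffOn ℝ ∞ a' (m.regular z))
    (hab : EqOn a a' (closure Ω)) :
    EqOn (m.forceShear z a) (m.forceShear z a') (closure Ω) := fun x hx => by
  simp only [forceShear, symGrad, jac_mom_congr hm hΩ hz ha ha' hab hx, forceHeat_congr hab hx]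

lemma forceBulk_congr (hm : m.Admissible) (hΩ : IsOpen Ω) (hz : z ∈ m.states Ω)
    (ha : ContDiffOn ℝ ∞ a (m.regular z)) (ha' : ContDiffOn ℝ ∞ a' (m.regular z))
    (hab : EqOn a a' (closure Ω)) :
    EqOn (m.forceBulk z a) (m.forceBulk z a') (closure Ω) := fun x hx => by
  simp only [forceBulk, div, jac_mom_congr hm hΩ hz ha ha' hab hx, forceHeat_congr hab hx]

lemma fluxHeat_congr (hm : m.Admissible) (hΩ : IsOpen Ω) (hz : z ∈ m.states Ω)
    (ha : ContDiffOn ℝ ∞ a (m.regular z)) (ha' : ContDiffOn ℝ ∞ a' (m.regular z))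
    (hab : EqOn a a' (closure Ω)) :
    EqOn (m.fluxHeat z a) (m.fluxHeat z a') (closure Ω) := fun x hx => by
  simp only [fluxHeat, gradient_forceHeat_congr hm hΩ hz ha ha' hab hx,
    gradient_forceDiff_congr hm hΩ hz ha ha' hab _ hx]

lemma fluxDiff_congr (hm : m.Admissible) (hΩ : IsOpen Ω) (hz : z ∈ m.states Ω)
    (ha : ContDiffOn ℝ ∞ a (m.regular z)) (ha' : ContDiffOn ℝ ∞ a' (m.regular z))
    (hab : EqOn a a' (closure Ω)) (α : Fin ν) :
    EqOn (m.fluxDiff z a α) (m.fluxDiff z a' α) (closure Ω) := fun x hx => by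
  simp only [fluxDiff, gradient_forceHeat_congr hm hΩ hz ha ha' hab hx,
    gradient_forceDiff_congr hm hΩ hz ha ha' hab _ hx]

lemma dissipationDensity_congr (hm : m.Admissible) (hΩ : IsOpen Ω) (hz : z ∈ m.states Ω)
    (ha : ContDiffOn ℝ ∞ a (m.regular z)) (ha' : ContDiffOn ℝ ∞ a' (m.regular z))
    (hab : EqOn a a' (closure Ω)) (hb : ContDiffOn ℝ ∞ b (m.regular z))
    (hb' : ContDiffOn ℝ ∞ b' (m.regular z)) (hbb : EqOn b b' (closure Ω)) :
    EqOn (m.dissipationDensity z a b) (m.dissipationDensity z a' b') (closure Ω) := fun x hx => by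
  simp only [dissipationDensity, forceShear_congr hm hΩ hz ha ha' hab hx,
    forceShear_congr hm hΩ hz hb hb' hbb hx, forceBulk_congr hm hΩ hz ha ha' hab hx,
    forceBulk_congr hm hΩ hz hb hb' hbb hx, gradient_forceHeat_congr hm hΩ hz ha ha' hab hx,
    gradient_forceDiff_congr hm hΩ hz ha ha' hab _ hx, fluxHeat_congr hm hΩ hz hb hb' hbb hx,
    fluxDiff_congr hm hΩ hz hb hb' hbb _ hx, forceDiff_congr hab _ hx, forceDiff_congr hbb _ hx]

lemma dissipationBdryDensity_congr (hm : m.Admissible) (hΩ : IsOpen Ω) (hz : z ∈ m.states Ω)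
    (nrm : E → E) (hb : ContDiffOn ℝ ∞ b (m.regular z))
    (hb' : ContDiffOn ℝ ∞ b' (m.regular z)) (hbb : EqOn b b' (closure Ω)) :
    EqOn (m.dissipationBdryDensity nrm z a b) (m.dissipationBdryDensity nrm z a b')
      (closure Ω) := fun x hx => by
  simp only [dissipationBdryDensity, forceShear_congr hm hΩ hz hb hb' hbb hx,
    forceBulk_congr hm hΩ hz hb hb' hbb hx, fluxHeat_congr hm hΩ hz hb hb' hbb hx,
    fluxDiff_congr hm hΩ hz hb hb' hbb _ hx]

lemma transport_congr {y : E → Val ν} {V : Set E} (hV : IsOpen V) (hΩ : IsOpen Ω)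
    (hΩV : closure Ω ⊆ V) (hy : ContDiffOn ℝ ∞ y V)
    (ha : ContDiffOn ℝ ∞ a V) (ha' : ContDiffOn ℝ ∞ a' V) (hab : EqOn a a' (closure Ω)) :
    EqOn (transport y z a) (transport y z a') (closure Ω) := fun x hx => by
  have h : ∀ {a : E → Val ν}, ContDiffOn ℝ ∞ a V → ContDiffOn ℝ 1 (fun x => dot (a x) (y x)) V :=
    fun ha => ((dot.contDiff.comp_contDiffOn ha).clm_apply hy).of_le (by exact_mod_cast le_top)
  rw [transport, transport, hab hx, fderiv_eq_of_eqOn hΩ hV hΩV (h ha) (h ha')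
    (fun x hx => by simp only [hab (subset_closure hx)]) hx]

lemma bracketDensity_congr {y : E → Val ν} {V : Set E} (hV : IsOpen V) (hΩ : IsOpen Ω)
    (hΩV : closure Ω ⊆ V) (hy : ContDiffOn ℝ ∞ y V)
    (ha : ContDiffOn ℝ ∞ a V) (ha' : ContDiffOn ℝ ∞ a' V) (hab : EqOn a a' (closure Ω))
    (hb : ContDiffOn ℝ ∞ b V) (hb' : ContDiffOn ℝ ∞ b' V) (hbb : EqOn b b' (closure Ω)) :
    EqOn (bracketDensity y z a b) (bracketDensity y z a' b') (closure Ω) := fun x hx => by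
  simp only [bracketDensity, transport_congr hV hΩ hΩV hy ha ha' hab hx,
    transport_congr hV hΩ hΩV hy hb hb' hbb hx, mom, hab hx, hbb hx]

end Congr

/-! ### Symmetry, positivity and linearity of the dissipation integrand. -/

section Algebra

lemma dissipationDensity_symm (hm : m.Admissible) {x : E} (hx : x ∈ m.regular z) :
    m.dissipationDensity z a b x = m.dissipationDensity z b a x := by
  have hθ := thermo_mem_dom hx
  simp only [dissipationDensity, contract_comm (m.forceShear z a x), fluxHeat, fluxDiff,
    inner_add_right, inner_sum, real_inner_smul_right, Finset.sum_add_distrib]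
  have h1 : ∑ α, ∑ β, m.B₂ α β (thermo z x) * inner ℝ (gradient (m.forceDiff z a α) x)
        (gradient (m.forceDiff z b β) x) =
      ∑ α, ∑ β, m.B₂ α β (thermo z x) * inner ℝ (gradient (m.forceDiff z b α) x)
        (gradient (m.forceDiff z a β) x) := by
    rw [Finset.sum_comm]
    refine Finset.sum_congr rfl fun α _ => Finset.sum_congr rfl fun β _ => ?_
    rw [hm.symm_B₂ _ hθ, real_inner_comm]
  have h2 : ∑ α, ∑ β, m.forceDiff z a α x * m.LL₂ α β (thermo z x) * m.forceDiff z b β x =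
      ∑ α, ∑ β, m.forceDiff z b α x * m.LL₂ α β (thermo z x) * m.forceDiff z a β x := by
    rw [Finset.sum_comm]
    refine Finset.sum_congr rfl fun α _ => Finset.sum_congr rfl fun β _ => ?_
    rw [hm.symm_LL₂ _ hθ]; ring
  rw [h1, h2]
  have h3 : ∀ α, inner ℝ (gradient (m.forceDiff z a α) x) (gradient (m.forceHeat z b) x) =
      inner ℝ (gradient (m.forceHeat z b) x) (gradient (m.forceDiff z a α) x) :=
    fun α => real_inner_comm _ _
  simp only [real_inner_comm (gradient (m.forceHeat z a) x), h3]
  ring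

lemma trace_forceShear (z a : E → Val ν) (x : E) :
    (m.forceShear z a x).trace = 2 * m.forceBulk z a x := by
  rw [forceShear, Matrix.trace_sub, Matrix.trace_smul, trace_symGrad, trace_symGrad, forceBulk,
    smul_eq_mul]
  ring

/-- The trace of D_a is 2 d_a, so that (tr D_a)² ≤ 3 D_a : D_a gives (ζT/2) D_a : D_a ≥ (2ζT/3)
d_a², which compensates the negative part of the bulk coefficient. The terms with λ and 𝕃_{αβ} come
from the second quadratic form with one of its two arguments zero. -/
lemma dissipationDensity_nonneg (hm : m.Admissible) {x : E} (hx : x ∈ m.regular z) :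
    0 ≤ m.dissipationDensity z a a x := by
  have hθ := thermo_mem_dom hx
  have hT := hm.temp_pos _ hθ
  have hζ := hm.zeta_nonneg _ hθ
  have h1 : 0 ≤ m.lam (thermo z x) := by
    simpa using hm.psd_L _ hθ 1 0
  have h2 := trace_sq_le_contract (m.forceShear z a x)
  rw [trace_forceShear] at h2
  have h3 : 0 ≤ m.temp (thermo z x) * ∑ α, ∑ β,
      m.forceDiff z a α x * m.LL₂ α β (thermo z x) * m.forceDiff z a β x := by
    refine mul_nonneg hT.le ?_
    simpa using hm.psd_L _ hθ 0 fun α => m.forceDiff z a α x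
  have h4 : 0 ≤ inner ℝ (gradient (m.forceHeat z a) x) (m.fluxHeat z a x)
      + ∑ α, inner ℝ (gradient (m.forceDiff z a α) x) (m.fluxDiff z a α x) := by
    -- The form of 𝔹 acts on scalars; it is applied to each Cartesian component of the gradients,
    -- and the results are summed.
    have h5 := fun i : Fin 3 => hm.psd_B _ hθ (gradient (m.forceHeat z a) x i)
      fun α => gradient (m.forceDiff z a α) x i
    have h6 := Finset.sum_nonneg fun i (_ : i ∈ Finset.univ) => h5 i
    refine h6.trans_eq ?_
    simp only [fluxHeat, fluxDiff, PiLp.inner_apply, PiLp.add_apply, PiLp.smul_apply,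
      Finset.sum_add_distrib, RCLike.inner_apply, conj_trivial, smul_eq_mul, add_mul,
      WithLp.ofLp_sum, Finset.sum_apply, Finset.sum_mul]
    have c1 : ∑ i : Fin 3, ∑ α, gradient (m.forceHeat z a) x i * m.B₁ α (thermo z x) *
        gradient (m.forceDiff z a α) x i = ∑ i : Fin 3, ∑ β, m.B₁ β (thermo z x) *
        gradient (m.forceDiff z a β) x i * gradient (m.forceHeat z a) x i :=
      Finset.sum_congr rfl fun i _ => Finset.sum_congr rfl fun α _ => by ring
    have c2 : ∑ i : Fin 3, ∑ α, gradient (m.forceDiff z a α) x i * m.B₁ α (thermo z x) *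
        gradient (m.forceHeat z a) x i = ∑ α, ∑ i : Fin 3, m.B₁ α (thermo z x) *
        gradient (m.forceHeat z a) x i * gradient (m.forceDiff z a α) x i := by
      rw [Finset.sum_comm]
      exact Finset.sum_congr rfl fun i _ => Finset.sum_congr rfl fun α _ => by ring
    have c3 : ∑ i : Fin 3, ∑ α, ∑ β, gradient (m.forceDiff z a α) x i * m.B₂ α β (thermo z x) *
        gradient (m.forceDiff z a β) x i = ∑ α, ∑ i : Fin 3, ∑ β, m.B₂ α β (thermo z x) *
        gradient (m.forceDiff z a β) x i * gradient (m.forceDiff z a α) x i := by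
      rw [Finset.sum_comm]
      exact Finset.sum_congr rfl fun i _ => Finset.sum_congr rfl fun α _ =>
        Finset.sum_congr rfl fun β _ => by ring
    rw [c1, c2, c3]
    have c4 : ∀ i : Fin 3, m.kappa (thermo z x) * m.temp (thermo z x) ^ 2 *
        gradient (m.forceHeat z a) x i ^ 2 = m.kappa (thermo z x) * m.temp (thermo z x) ^ 2 *
        gradient (m.forceHeat z a) x i * gradient (m.forceHeat z a) x i := fun i => by ring
    simp only [c4]
    ring
  have h5 : 0 ≤ m.zeta (thermo z x) * m.temp (thermo z x) := mul_nonneg hζ hT.le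
  have h6 : 0 ≤ m.temp (thermo z x) * m.lam (thermo z x) * m.forceBulk z a x ^ 2 := by positivity
  unfold dissipationDensity
  nlinarith [mul_le_mul_of_nonneg_left h2 h5]

variable {e : E → Val ν}

lemma forceHeat_smul_add (c d : ℝ) (x : E) : m.forceHeat z (c • a + d • b) x =
    c * m.forceHeat z a x + d * m.forceHeat z b x := by
  cases h : m.pot <;> simp only [forceHeat, h, sca, Pi.add_apply, Pi.smul_apply, Prod.snd_add,
    Prod.smul_snd, smul_eq_mul]
  ring

lemma forceDiff_smul_add (c d : ℝ) (α : Fin ν) (x : E) : m.forceDiff z (c • a + d • b) α x =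
    c * m.forceDiff z a α x + d * m.forceDiff z b α x := by
  cases h : m.pot <;> simp only [forceDiff, h, sca, rho, Pi.add_apply, Pi.smul_apply, Prod.snd_add,
    Prod.smul_snd, Prod.fst_add, Prod.smul_fst, smul_eq_mul]
  ring

lemma dissipationDensity_smul_add_left (hm : m.Admissible) (hz : z ∈ m.states Ω)
    (ha : ContDiffOn ℝ ∞ a (m.regular z)) (hb : ContDiffOn ℝ ∞ b (m.regular z)) (c d : ℝ) {x : E}
    (hx : x ∈ m.regular z) : m.dissipationDensity z (c • a + d • b) e x =
      c * m.dissipationDensity z a e x + d * m.dissipationDensity z b e x := by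
  have hV := isOpen_regular hm hz
  have hd : ∀ {F : Type} [NormedAddCommGroup F] [NormedSpace ℝ F] {f : E → F},
      ContDiffOn ℝ ∞ f (m.regular z) → DifferentiableAt ℝ f x := fun ha =>
    (ha.differentiableOn (by simp)).differentiableAt (hV.mem_nhds hx)
  have h1 : jac (mom (c • a + d • b)) x = c • jac (mom a) x + d • jac (mom b) x :=
    jac_smul_add (differentiableAt_mom (hd ha)) (differentiableAt_mom (hd hb)) c d
  have h2 : gradient (m.forceHeat z (c • a + d • b)) x =
      c • gradient (m.forceHeat z a) x + d • gradient (m.forceHeat z b) x := by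
    rw [← gradient_smul_add (hd (contDiffOn_forceHeat hm hz ha)) (hd (contDiffOn_forceHeat hm hz hb))]
    congr 1
    exact funext fun y => forceHeat_smul_add c d y
  have h3 : ∀ α, gradient (m.forceDiff z (c • a + d • b) α) x =
      c • gradient (m.forceDiff z a α) x + d • gradient (m.forceDiff z b α) x := fun α => by
    rw [← gradient_smul_add (hd (contDiffOn_forceDiff hm hz ha α))
      (hd (contDiffOn_forceDiff hm hz hb α))]
    congr 1
    exact funext fun y => forceDiff_smul_add c d α y
  have h4 : m.forceShear z (c • a + d • b) x = c • m.forceShear z a x + d • m.forceShear z b x := by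
    simp only [forceShear, symGrad, h1, forceHeat_smul_add]
    ext i j
    simp only [Matrix.sub_apply, Matrix.add_apply, Matrix.smul_apply, Matrix.transpose_apply,
      smul_eq_mul]
    ring
  have h5 : m.forceBulk z (c • a + d • b) x = c * m.forceBulk z a x + d * m.forceBulk z b x := by
    simp only [forceBulk, div, h1, forceHeat_smul_add, Matrix.trace_add, Matrix.trace_smul, smul_eq_mul]
    ring
  simp only [dissipationDensity, h2, h3, h4, h5, forceDiff_smul_add, contract_add_left,
    contract_smul_left, inner_add_left, real_inner_smul_left, Finset.sum_add_distrib, add_mul,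
    mul_assoc, ← Finset.mul_sum]
  ring

end Algebra

end Mixture

end OpenMixture

end

noncomputable section
namespace OpenMixture

variable {ν n : ℕ}

namespace Mixture

variable {m : Mixture ν n} {Ω : Set E} {z a : E → Val ν}

/-! ### Energy and entropy are observables -/

/-- `entropyGrad` is smooth only where z takes admissible values, while a functional derivative has
to be smooth on all of space. A smooth extension that agrees with it near the closed domain is
therefore used, and similarly for the energy. -/
lemma exists_hasVarDeriv_entropy (hm : m.Admissible) (hne : Ω.Nonempty)
    (hb : Bornology.IsBounded Ω) (hz : z ∈ m.states Ω) :
    ∃ a, HasVarDeriv Ω (m.entropy Ω) z a ∧ EqOn a (m.entropyGrad z) (closure Ω) := by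
  obtain ⟨a, ha, h⟩ := exists_contDiff_eventuallyEq (r := ⊤) isClosed_closure
    (isOpen_regular hm hz) (closure_subset_regular hz) (contDiffOn_entropyGrad hm hz)
  rw [eventually_nhdsSet_iff_forall] at h
  have h' : EqOn a (m.entropyGrad z) (closure Ω) := fun x hx => (h x hx).self_of_nhds
  refine ⟨a, ?_, h'⟩
  refine hasVarDeriv_integral (F := fun v => m.entropyDensity (thermoL v)) hm hne hb
    ((contDiffOn_entropyDensity hm).comp thermoL.contDiff.contDiffOn fun v hv => hv.2) hz ha
    fun x hx v => ?_
  rw [h' hx, entropyGrad_spec hm (closure_subset_regular hz hx)]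

lemma energy_eq (hm : m.Admissible) (hb : Bornology.IsBounded Ω) (hz : z ∈ m.states Ω) :
    m.energy Ω z = ∫ x in Ω, m.energyDensity (z x) := by
  have h1 : ContDiffOn ℝ ∞ (fun x => inner ℝ (mom z x) (mom z x) / (2 * density z x))
      (m.regular z) := by
    refine ((contDiff_mom hz.1).inner ℝ (contDiff_mom hz.1)).contDiffOn.div
      (contDiff_const.mul (contDiff_density hz.1)).contDiffOn fun x hx => ?_
    have := density_pos hx
    positivity
  have h2 := contDiffOn_comp_thermo (contDiffOn_intEnergy hm) hz
  exact (integral_add (integrableOn_of_continuousOn_closure hb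
    (h1.continuousOn.mono (closure_subset_regular hz))) (integrableOn_of_continuousOn_closure hb
    (h2.continuousOn.mono (closure_subset_regular hz)))).symm

lemma exists_hasVarDeriv_energy (hm : m.Admissible) (hne : Ω.Nonempty)
    (hb : Bornology.IsBounded Ω) (hz : z ∈ m.states Ω) :
    ∃ a, HasVarDeriv Ω (m.energy Ω) z a ∧ EqOn a (m.energyGrad z) (closure Ω) := by
  obtain ⟨a, ha, h⟩ := exists_contDiff_eventuallyEq (r := ⊤) isClosed_closure
    (isOpen_regular hm hz) (closure_subset_regular hz) (contDiffOn_energyGrad hm hz)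
  rw [eventually_nhdsSet_iff_forall] at h
  have h' : EqOn a (m.energyGrad z) (closure Ω) := fun x hx => (h x hx).self_of_nhds
  refine ⟨a, ?_, h'⟩
  refine (hasVarDeriv_integral hm hne hb (contDiffOn_energyDensity hm) hz ha fun x hx v =>
    ?_).congr_of_states hm hne hb hz fun w hw => energy_eq hm hb hw
  rw [h' hx, energyGrad_spec hm (closure_subset_regular hz hx)]

/-! ### Conservation of mass -/

/-- Reactions conserve mass. This removes the contribution of −|v|²/2, the part of δH that is common
to all constituents. -/
lemma sum_LL₁ (hm : m.Admissible) (θ : Thermo ν) : ∑ α, m.LL₁ α θ = 0 := by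
  simp only [LL₁]
  rw [Finset.sum_comm]
  refine Finset.sum_eq_zero fun k _ => ?_
  rw [← Finset.sum_mul, hm.mass_reaction, zero_mul]

lemma sum_LL₂ (hm : m.Admissible) (α : Fin ν) (θ : Thermo ν) : ∑ β, m.LL₂ α β θ = 0 := by
  simp only [LL₂]
  rw [Finset.sum_comm]
  refine Finset.sum_eq_zero fun k _ => ?_
  rw [Finset.sum_comm]
  refine Finset.sum_eq_zero fun b _ => ?_
  rw [← Finset.mul_sum, hm.mass_reaction, mul_zero]

/-! ### The thermodynamic forces of energy and entropy -/

lemma mom_energyGrad (z : E → Val ν) : mom (m.energyGrad z) = vel z := by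
  ext1 x
  cases h : m.pot <;> simp only [mom, energyGrad, h]

lemma mom_entropyGrad (z : E → Val ν) : mom (m.entropyGrad z) = fun _ => 0 := by
  ext1 x
  cases h : m.pot <;> simp only [mom, entropyGrad, h]

lemma forceHeat_entropyGrad (z : E → Val ν) :
    m.forceHeat z (m.entropyGrad z) = fun x => (m.temp (thermo z x))⁻¹ := by
  ext1 x
  cases h : m.pot <;> simp [sca, forceHeat, entropyGrad, h]

lemma forceDiff_entropyGrad (z : E → Val ν) (α : Fin ν) :
    m.forceDiff z (m.entropyGrad z) α = fun x => -(m.mu α (thermo z x) / m.temp (thermo z x)) := by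
  ext1 x
  cases h : m.pot <;> simp [sca, rho, forceDiff, entropyGrad, h]

lemma forceHeat_energyGrad (hm : m.Admissible) {x : E} (hx : x ∈ m.regular z) :
    m.forceHeat z (m.energyGrad z) x = 1 := by
  have hT := (hm.temp_pos _ (thermo_mem_dom hx)).ne'
  cases h : m.pot <;> simp [sca, forceHeat, energyGrad, h, hT]

/-- The chemical potential cancels in the energy representation and does not occur in the other one.
What matters is that the result does not depend on α. -/
lemma forceDiff_energyGrad (hm : m.Admissible) {x : E} (hx : x ∈ m.regular z) (α : Fin ν) :
    m.forceDiff z (m.energyGrad z) α x = -(inner ℝ (vel z x) (vel z x) / 2) := by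
  have hT := (hm.temp_pos _ (thermo_mem_dom hx)).ne'
  cases h : m.pot <;> simp [sca, rho, forceDiff, energyGrad, h, hT]

lemma gradient_neg (f : E → ℝ) (x : E) : gradient (fun y => -f y) x = -gradient f x := by
  simp [gradient, fderiv_fun_neg]

lemma fluxHeat_entropyGrad (z : E → Val ν) (x : E) :
    m.fluxHeat z (m.entropyGrad z) x = m.heatFlux z x := by
  simp only [fluxHeat, heatFlux, forceHeat_entropyGrad, forceDiff_entropyGrad, gradient_neg,
    smul_neg, Finset.sum_neg_distrib, sub_eq_add_neg]

lemma fluxDiff_entropyGrad (z : E → Val ν) (α : Fin ν) (x : E) :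
    m.fluxDiff z (m.entropyGrad z) α x = m.diffFlux z α x := by
  simp only [fluxDiff, diffFlux, forceHeat_entropyGrad, forceDiff_entropyGrad, gradient_neg,
    smul_neg, Finset.sum_neg_distrib, sub_eq_add_neg]

lemma jac_zero (x : E) : jac (fun _ => (0 : E)) x = 0 := by
  ext i j; simp [jac]

lemma forceShear_entropyGrad (z : E → Val ν) (x : E) : m.forceShear z (m.entropyGrad z) x =
    -((m.temp (thermo z x))⁻¹ • symGrad (vel z) x) := by
  rw [forceShear, mom_entropyGrad, forceHeat_entropyGrad, symGrad, jac_zero]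
  simp

lemma forceBulk_entropyGrad (z : E → Val ν) (x : E) : m.forceBulk z (m.entropyGrad z) x =
    -(div (vel z) x * (m.temp (thermo z x))⁻¹) := by
  rw [forceBulk, mom_entropyGrad, forceHeat_entropyGrad, div, jac_zero]
  simp

lemma gradient_forceHeat_energyGrad (hm : m.Admissible) (hz : z ∈ m.states Ω) {x : E}
    (hx : x ∈ m.regular z) : gradient (m.forceHeat z (m.energyGrad z)) x = 0 := by
  have h : m.forceHeat z (m.energyGrad z) =ᶠ[𝓝 x] fun _ => 1 := by
    filter_upwards [(isOpen_regular hm hz).mem_nhds hx] with y hy using forceHeat_energyGrad hm hy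
  simp [gradient, h.fderiv_eq]

lemma gradient_forceDiff_energyGrad (hm : m.Admissible) (hz : z ∈ m.states Ω) {x : E}
    (hx : x ∈ m.regular z) (α : Fin ν) : gradient (m.forceDiff z (m.energyGrad z) α) x =
      gradient (fun y => -(inner ℝ (vel z y) (vel z y) / 2)) x := by
  have h : m.forceDiff z (m.energyGrad z) α =ᶠ[𝓝 x] fun y => -(inner ℝ (vel z y) (vel z y) / 2) := by
    filter_upwards [(isOpen_regular hm hz).mem_nhds hx] with y hy using forceDiff_energyGrad hm hy α
  exact gradient_congr h.fderiv_eq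

lemma forceShear_energyGrad (hm : m.Admissible) {x : E} (hx : x ∈ m.regular z) :
    m.forceShear z (m.energyGrad z) x = 0 := by
  rw [forceShear, mom_energyGrad, forceHeat_energyGrad hm hx, one_smul, sub_self]

lemma forceBulk_energyGrad (hm : m.Admissible) {x : E} (hx : x ∈ m.regular z) :
    m.forceBulk z (m.energyGrad z) x = 0 := by
  rw [forceBulk, mom_energyGrad, forceHeat_energyGrad hm hx, mul_one, sub_self]

/-- The heat force of the energy is constant, and its diffusion forces have one common gradient,
which is multiplied by the vanishing sum of the B_β. -/
lemma fluxHeat_energyGrad (hm : m.Admissible) (hz : z ∈ m.states Ω) {x : E}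
    (hx : x ∈ m.regular z) : m.fluxHeat z (m.energyGrad z) x = 0 := by
  simp only [fluxHeat, gradient_forceHeat_energyGrad hm hz hx,
    gradient_forceDiff_energyGrad hm hz hx, ← Finset.sum_smul,
    hm.mass_diffusion₁ _ (thermo_mem_dom hx), smul_zero, zero_smul, add_zero]

lemma fluxDiff_energyGrad (hm : m.Admissible) (hz : z ∈ m.states Ω) {x : E}
    (hx : x ∈ m.regular z) (α : Fin ν) : m.fluxDiff z (m.energyGrad z) α x = 0 := by
  simp only [fluxDiff, gradient_forceHeat_energyGrad hm hz hx,
    gradient_forceDiff_energyGrad hm hz hx, ← Finset.sum_smul,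
    hm.mass_diffusion₂ _ (thermo_mem_dom hx), smul_zero, zero_smul, add_zero]

/-- All factors that belong to the energy vanish except its diffusion forces; these are all equal
and meet the rows of 𝕃_{αβ}, whose sums are zero. -/
lemma dissipationDensity_energyGrad (hm : m.Admissible) (hz : z ∈ m.states Ω) {x : E}
    (hx : x ∈ m.regular z) : m.dissipationDensity z a (m.energyGrad z) x = 0 := by
  have h : ∑ α, ∑ β, m.forceDiff z a α x * m.LL₂ α β (thermo z x) *
      -(inner ℝ (vel z x) (vel z x) / 2) = 0 := by
    refine Finset.sum_eq_zero fun α _ => ?_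
    rw [← Finset.sum_mul, ← Finset.mul_sum, sum_LL₂ hm, mul_zero, zero_mul]
  simp only [dissipationDensity, forceShear_energyGrad hm hx, forceBulk_energyGrad hm hx,
    fluxHeat_energyGrad hm hz hx, fluxDiff_energyGrad hm hz hx, forceDiff_energyGrad hm hx, h]
  simp [contract]

lemma dissipationBdryDensity_energyGrad (hm : m.Admissible) (hz : z ∈ m.states Ω) (nrm : E → E)
    {x : E} (hx : x ∈ m.regular z) :
    m.dissipationBdryDensity nrm z a (m.energyGrad z) x = 0 := by
  have h : apply 0 (nrm x) = 0 := by ext i; simp [apply]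
  simp only [dissipationBdryDensity, forceShear_energyGrad hm hx, forceBulk_energyGrad hm hx,
    fluxHeat_energyGrad hm hz hx, fluxDiff_energyGrad hm hz hx, h]
  simp

/-! ### The Euler relations -/

/-- Immediate in the energy representation. In the entropy representation it is the definition of
the pressure, (u + p − Σ ρ_α μ_α)/T = s: the term P of the bracket supplies p, and its part −Σ μ_β
𝕃_β cancels the contribution of the ρ_α − 𝕃_α. -/
lemma dot_entropyGrad_carriedField (hm : m.Admissible) {x : E} (hx : x ∈ m.regular z) :
    dot (m.entropyGrad z x) (m.carriedField z x) = m.entropyDensity (thermo z x) := by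
  have hT := (hm.temp_pos _ (thermo_mem_dom hx)).ne'
  rw [dot_carriedField]
  cases h : m.pot
  · simp [rho, mom, sca, entropyGrad, bracketPress, h, entropyDensity, thermo]
  · have h1 : m.bracketPress (thermo z x) = m.press (thermo z x) - m.chemPress (thermo z x) := by
      simp only [bracketPress, h]
    have h2 : m.intEnergy (thermo z x) = sca z x := by simp only [intEnergy, h]; rfl
    have h3 : m.chemPress (thermo z x) =
        m.temp (thermo z x) * ∑ β, m.mu β (thermo z x) / m.temp (thermo z x) * m.LL₁ β (thermo z x) := by
      rw [chemPress, Finset.mul_sum]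
      exact Finset.sum_congr rfl fun β _ => by field_simp
    have h4 : ∑ α, (thermo z x).1 α * m.mu α (thermo z x) = m.temp (thermo z x) *
        ∑ α, m.mu α (thermo z x) / m.temp (thermo z x) * rho z α x := by
      rw [Finset.mul_sum]
      exact Finset.sum_congr rfl fun β _ => by field_simp; exact mul_comm _ _
    have h5 : ∀ α, rho (m.entropyGrad z) α x = -(m.mu α (thermo z x) / m.temp (thermo z x)) :=
      fun α => by simp only [rho, entropyGrad, h]
    have h6 : sca (m.entropyGrad z) x = (m.temp (thermo z x))⁻¹ := by
      simp only [sca, entropyGrad, h]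
    rw [h1, press, h2, h3, h4, mom_entropyGrad, h6]
    simp only [h5, neg_mul, Finset.sum_neg_distrib, inner_zero_left]
    field_simp
    ring

/-- The Euler relation gives d⟨δS, y⟩ = ds, and the chain rule gives ⟨δS, dz⟩ = ds. This is why the
entropy is a Casimir functional. -/
lemma transport_entropyGrad (hm : m.Admissible) (hz : z ∈ m.states Ω) {x : E}
    (hx : x ∈ m.regular z) : transport (m.carriedField z) z (m.entropyGrad z) x = 0 := by
  have hV := (isOpen_regular hm hz).mem_nhds hx
  have hzd : DifferentiableAt ℝ z x := hz.1.differentiable (by simp) x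
  have h1 : (fun x => dot (m.entropyGrad z x) (m.carriedField z x)) =ᶠ[𝓝 x]
      (fun v : Val ν => m.entropyDensity (thermoL v)) ∘ z := by
    filter_upwards [hV] with y hy using dot_entropyGrad_carriedField hm hy
  have h2 : DifferentiableAt ℝ (fun v : Val ν => m.entropyDensity (thermoL v)) (z x) := by
    have h3 : DifferentiableAt ℝ m.entropyDensity (thermoL (z x)) :=
      ((contDiffOn_entropyDensity hm).differentiableOn (by simp)).differentiableAt
        (hm.isOpen_dom.mem_nhds hx.2)
    exact h3.comp (z x) thermoL.differentiableAt
  ext u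
  rw [transport_apply, h1.fderiv_eq, fderiv_comp x h2 hzd, entropyGrad_spec hm hx]
  simp

lemma inner_mom_vel {x : E} (hx : x ∈ m.regular z) :
    inner ℝ (vel z x) (mom z x) = density z x * inner ℝ (vel z x) (vel z x) := by
  have h : mom z x = density z x • vel z x := by
    rw [vel, smul_smul, mul_inv_cancel₀ (density_pos hx).ne', one_smul]
  rw [h, real_inner_smul_right]

lemma energyDensity_eq {x : E} (hx : x ∈ m.regular z) : m.energyDensity (z x) =
    density z x * inner ℝ (vel z x) (vel z x) / 2 + m.intEnergy (thermo z x) := by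
  have h : mom z x = density z x • vel z x := by
    rw [vel, smul_smul, mul_inv_cancel₀ (density_pos hx).ne', one_smul]
  have h1 : m.energyDensity (z x) = inner ℝ (mom z x) (mom z x) / (2 * density z x) +
    m.intEnergy (thermo z x) := rfl
  have h2 := (density_pos hx).ne'
  rw [h1, h, real_inner_smul_right, real_inner_smul_left]
  field_simp

/-- The Euler relation of the energy. Since the 𝕃_α sum to zero, −(|v|²/2) Σ (ρ_α − 𝕃_α) + v·M is
the kinetic energy density. The remainder is the definition of p in the energy representation and is
contributed by P in the other. -/
lemma dot_energyGrad_carriedField (hm : m.Admissible) {x : E} (hx : x ∈ m.regular z) :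
    dot (m.energyGrad z x) (m.carriedField z x) =
      m.energyDensity (z x) + (m.press (thermo z x) - m.chemPress (thermo z x)) := by
  have hT := (hm.temp_pos _ (thermo_mem_dom hx)).ne'
  have hρ : density z x = ∑ α, rho z α x := rfl
  rw [dot_carriedField, energyDensity_eq hx, mom_energyGrad, inner_mom_vel hx]
  cases h : m.pot
  · have h1 : m.bracketPress (thermo z x) = 0 := by simp only [bracketPress, h]
    have h2 : m.entropyDensity (thermo z x) = sca z x := by simp only [entropyDensity, h]; rfl
    have h5 : ∀ α, rho (m.energyGrad z) α x =
        -(inner ℝ (vel z x) (vel z x) / 2) + m.mu α (thermo z x) :=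
      fun α => by simp only [rho, energyGrad, h]
    have h6 : sca (m.energyGrad z) x = m.temp (thermo z x) := by simp only [sca, energyGrad, h]
    have h7 : ∑ α, m.mu α (thermo z x) * rho z α x =
        ∑ α, (thermo z x).1 α * m.mu α (thermo z x) :=
      Finset.sum_congr rfl fun α _ => mul_comm _ _
    have h8 : ∑ α, m.mu α (thermo z x) * m.LL₁ α (thermo z x) = m.chemPress (thermo z x) :=
      Finset.sum_congr rfl fun α _ => mul_comm _ _
    rw [h1, press, h2, h6]
    simp only [h5, add_mul, Finset.sum_add_distrib, ← Finset.mul_sum, sum_LL₁ hm, h7, h8, ← hρ]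
    ring
  · have h1 : m.bracketPress (thermo z x) = m.press (thermo z x) - m.chemPress (thermo z x) := by
      simp only [bracketPress, h]
    have h2 : m.intEnergy (thermo z x) = sca z x := by simp only [intEnergy, h]; rfl
    have h5 : ∀ α, rho (m.energyGrad z) α x = -(inner ℝ (vel z x) (vel z x) / 2) :=
      fun α => by simp only [rho, energyGrad, h]
    have h6 : sca (m.energyGrad z) x = 1 := by simp only [sca, energyGrad, h]
    rw [h1, h2, h6]
    simp only [h5, ← Finset.mul_sum, sum_LL₁ hm, ← hρ]
    ring

/-- The differential of the energy density cancels against ⟨δH, dz⟩. What survives is the pressure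
gradient of the momentum balance, chemical part included. -/
lemma transport_energyGrad (hm : m.Admissible) (hz : z ∈ m.states Ω) {x : E}
    (hx : x ∈ m.regular z) : transport (m.carriedField z) z (m.energyGrad z) x =
      fderiv ℝ (fun y => m.press (thermo z y) - m.chemPress (thermo z y)) x := by
  have hV := (isOpen_regular hm hz).mem_nhds hx
  have hzd : DifferentiableAt ℝ z x := hz.1.differentiable (by simp) x
  have h1 : (fun x => dot (m.energyGrad z x) (m.carriedField z x)) =ᶠ[𝓝 x]
      fun y => (m.energyDensity ∘ z) y + (m.press (thermo z y) - m.chemPress (thermo z y)) := by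
    filter_upwards [hV] with y hy using dot_energyGrad_carriedField hm hy
  have h2 : DifferentiableAt ℝ m.energyDensity (z x) :=
    ((contDiffOn_energyDensity hm).differentiableOn (by simp)).differentiableAt
        ((m.isOpen_valDom hm).mem_nhds hx)
  have h3 : DifferentiableAt ℝ (fun y => m.press (thermo z y) - m.chemPress (thermo z y)) x :=
    (differentiableAt_comp_thermo hm (contDiffOn_press hm) hz hx).sub
      (differentiableAt_comp_thermo hm (contDiffOn_chemPress hm) hz hx)
  ext u
  rw [transport_apply, h1.fderiv_eq, fderiv_fun_add (h2.comp x hzd) h3, fderiv_comp x h2 hzd,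
    energyGrad_spec hm hx]
  simp

/-! ### The boundary operator -/

/-- In (𝐓 + p I)·n − u₁ n only the viscous traction is left, which is the momentum flux of the
dissipation bracket with S. The terms with v·n are those of the Poisson bracket with H, and the
remaining ones are the heat and diffusion fluxes. -/
lemma bdryDensity_eq (hm : m.Admissible) (nrm : E → E) {x : E} (hx : x ∈ m.regular z) :
    m.poissonBdryDensity nrm z a (m.energyGrad z) x +
      m.dissipationBdryDensity nrm z a (m.entropyGrad z) x =
    -((∑ α, rho a α x * ((m.LL₁ α (thermo z x) - rho z α x) * (m.port nrm z).u₂ x -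
        (m.port nrm z).uJ α x))
      + inner ℝ (mom a x) ((m.port nrm z).uS x - (m.port nrm z).u₂ x • mom z x -
        (m.port nrm z).u₁ x • nrm x)
      - sca a x * m.portScalar z (m.port nrm z) x) := by
  have hT := (hm.temp_pos _ (thermo_mem_dom hx)).ne'
  have happ : ∀ (A B : Matrix (Fin 3) (Fin 3) ℝ) (v : E), apply (A + B) v = apply A v + apply B v :=
    fun A B v => by ext i; simp [apply, add_mul, Finset.sum_add_distrib]
  have hsm : ∀ (c : ℝ) (A : Matrix (Fin 3) (Fin 3) ℝ) (v : E), apply (c • A) v = c • apply A v :=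
    fun c A v => by ext i; simp [apply, Finset.mul_sum, mul_assoc]
  have hone : ∀ v : E, apply 1 v = v := fun v => by ext i; simp [apply, Matrix.one_apply]
  have hneg : ∀ (A : Matrix (Fin 3) (Fin 3) ℝ) (v : E), apply (-A) v = -apply A v :=
    fun A v => by ext i; simp [apply]
  simp only [poissonBdryDensity, dissipationBdryDensity, fluxHeat_entropyGrad,
    fluxDiff_entropyGrad, forceShear_entropyGrad, forceBulk_entropyGrad, mom_energyGrad, port,
    stress, viscousStress, happ, hsm, hone, hneg, inner_sub_right, inner_add_right, inner_neg_right,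
    real_inner_smul_right, mul_sub, Finset.sum_sub_distrib]
  have s1 : ∀ c : ℝ, ∑ α, rho a α x * (m.LL₁ α (thermo z x) * c) =
      (∑ α, rho a α x * m.LL₁ α (thermo z x)) * c := fun c => by
    rw [Finset.sum_mul]; exact Finset.sum_congr rfl fun α _ => by ring
  have s2 : ∀ c : ℝ, ∑ α, rho a α x * (rho z α x * c) =
      (∑ α, rho a α x * rho z α x) * c := fun c => by
    rw [Finset.sum_mul]; exact Finset.sum_congr rfl fun α _ => by ring
  have s3 : ∑ α, m.mu α (thermo z x) / m.temp (thermo z x) * sca a x *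
        inner ℝ (m.diffFlux z α x) (nrm x) = sca a x * ∑ α, (m.mu α (thermo z x) /
          m.temp (thermo z x) * inner ℝ (m.diffFlux z α x) (nrm x)) := by
    rw [Finset.mul_sum]; exact Finset.sum_congr rfl fun α _ => by ring
  cases h : m.pot
  · simp only [forceHeat, forceDiff, portScalar, bracketPress, h, sub_mul, mul_sub, Finset.sum_sub_distrib,
      s1, s2, s3]
    -- With the sums as atoms the identity is a rational one in scalars.
    generalize ∑ α, rho a α x * rho z α x = t1
    generalize ∑ α, rho a α x * m.LL₁ α (thermo z x) = t2
    generalize ∑ α, rho a α x * inner ℝ (m.diffFlux z α x) (nrm x) = t3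
    generalize ∑ α, m.mu α (thermo z x) / m.temp (thermo z x) *
      inner ℝ (m.diffFlux z α x) (nrm x) = t4
    field_simp
    ring
  · simp only [forceHeat, forceDiff, portScalar, bracketPress, h, sub_mul, mul_sub, Finset.sum_sub_distrib,
      s1, s2]
    generalize ∑ α, rho a α x * rho z α x = t1
    generalize ∑ α, rho a α x * m.LL₁ α (thermo z x) = t2
    generalize ∑ α, rho a α x * inner ℝ (m.diffFlux z α x) (nrm x) = t3
    field_simp
    ring

end Mixture

end OpenMixture

end

noncomputable section
namespace OpenMixture

variable {ν n : ℕ}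

namespace Mixture

variable {m : Mixture ν n} {Ω : Set E} {σ : Measure E} {nrm : E → E} {z : E → Val ν}
  {A B C : (E → Val ν) → ℝ} {a b a' b' : E → Val ν}

/-! ### The brackets in terms of arbitrary representatives of the functional derivatives -/

lemma poisson_eq (hm : m.Admissible) (hΩ : IsOpen Ω) (hz : z ∈ m.states Ω)
    (hA : ∃ a, HasVarDeriv Ω A z a) (hB : ∃ b, HasVarDeriv Ω B z b)
    (ha : ContDiffOn ℝ ∞ a (m.regular z)) (hAa : EqOn (varDeriv Ω A z) a (closure Ω))
    (hb : ContDiffOn ℝ ∞ b (m.regular z)) (hBb : EqOn (varDeriv Ω B z) b (closure Ω)) :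
    m.poisson Ω A B z = ∫ x in Ω, bracketDensity (m.carriedField z) z a b x := by
  refine setIntegral_congr_fun hΩ.measurableSet fun x hx => ?_
  have hx' := subset_closure hx
  have hA' := contDiff_varDeriv hA
  have hB' := contDiff_varDeriv hB
  rw [poissonDensity_eq hm hz (closure_subset_regular hz hx')
    (hA'.differentiable (by simp) x) (hB'.differentiable (by simp) x)]
  exact bracketDensity_congr (isOpen_regular hm hz) hΩ (closure_subset_regular hz)
    (contDiffOn_carriedField hm hz) hA'.contDiffOn ha hAa hB'.contDiffOn hb hBb hx'

lemma dissipation_eq (hm : m.Admissible) (hΩ : IsOpen Ω) (hz : z ∈ m.states Ω)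
    (hA : ∃ a, HasVarDeriv Ω A z a) (hB : ∃ b, HasVarDeriv Ω B z b)
    (ha : ContDiffOn ℝ ∞ a (m.regular z)) (hAa : EqOn (varDeriv Ω A z) a (closure Ω))
    (hb : ContDiffOn ℝ ∞ b (m.regular z)) (hBb : EqOn (varDeriv Ω B z) b (closure Ω)) :
    m.dissipation Ω A B z = ∫ x in Ω, m.dissipationDensity z a b x :=
  setIntegral_congr_fun hΩ.measurableSet fun _ hx =>
    dissipationDensity_congr hm hΩ hz (contDiff_varDeriv hA).contDiffOn ha hAa
      (contDiff_varDeriv hB).contDiffOn hb hBb (subset_closure hx)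

lemma poissonBdry_eq (hΩ : IsLipschitzDomain Ω σ nrm)
    (hBb : EqOn (varDeriv Ω B z) b (closure Ω)) :
    m.poissonBdry Ω σ nrm A B z = ∫ x, m.poissonBdryDensity nrm z (varDeriv Ω A z) b x ∂σ := by
  refine integral_congr_ae ?_
  filter_upwards [hΩ.ae_mem_frontier] with x hx
  simp only [poissonBdryDensity, mom, hBb (frontier_subset_closure hx)]

lemma dissipationBdry_eq (hm : m.Admissible) (hΩ : IsLipschitzDomain Ω σ nrm)
    (hz : z ∈ m.states Ω) (hB : ∃ b, HasVarDeriv Ω B z b)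
    (hb : ContDiffOn ℝ ∞ b (m.regular z)) (hBb : EqOn (varDeriv Ω B z) b (closure Ω)) :
    m.dissipationBdry Ω σ nrm A B z =
      ∫ x, m.dissipationBdryDensity nrm z (varDeriv Ω A z) b x ∂σ := by
  refine integral_congr_ae ?_
  filter_upwards [hΩ.ae_mem_frontier] with x hx
  exact dissipationBdryDensity_congr hm hΩ.isOpen hz nrm (contDiff_varDeriv hB).contDiffOn hb hBb
    (frontier_subset_closure hx)

/-! ### Energy and entropy -/

lemma isObservable_energy (hm : m.Admissible) (hΩ : IsLipschitzDomain Ω σ nrm) :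
    m.IsObservable Ω (m.energy Ω) := fun _ hz =>
  (exists_hasVarDeriv_energy hm hΩ.isConnected.nonempty hΩ.isBounded hz).imp fun _ h => h.1

lemma isObservable_entropy (hm : m.Admissible) (hΩ : IsLipschitzDomain Ω σ nrm) :
    m.IsObservable Ω (m.entropy Ω) := fun _ hz =>
  (exists_hasVarDeriv_entropy hm hΩ.isConnected.nonempty hΩ.isBounded hz).imp fun _ h => h.1

lemma varDeriv_energy (hm : m.Admissible) (hΩ : IsLipschitzDomain Ω σ nrm)
    (hz : z ∈ m.states Ω) : EqOn (varDeriv Ω (m.energy Ω) z) (m.energyGrad z) (closure Ω) := by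
  obtain ⟨a, h, h'⟩ := exists_hasVarDeriv_energy hm hΩ.isConnected.nonempty hΩ.isBounded hz
  exact (h.varDeriv_eqOn hΩ.isConnected.nonempty hΩ.isOpen hΩ.isBounded).trans h'

lemma varDeriv_entropy (hm : m.Admissible) (hΩ : IsLipschitzDomain Ω σ nrm)
    (hz : z ∈ m.states Ω) : EqOn (varDeriv Ω (m.entropy Ω) z) (m.entropyGrad z) (closure Ω) := by
  obtain ⟨a, h, h'⟩ := exists_hasVarDeriv_entropy hm hΩ.isConnected.nonempty hΩ.isBounded hz
  exact (h.varDeriv_eqOn hΩ.isConnected.nonempty hΩ.isOpen hΩ.isBounded).trans h'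

/-! ### Algebraic properties of the brackets -/

lemma poisson_antisymm (A B : (E → Val ν) → ℝ) (z : E → Val ν) :
    m.poisson Ω A B z = -m.poisson Ω B A z := by
  rw [poisson, poisson, ← integral_neg]
  congr 1 with x
  have h1 : ∀ a b : E → Val ν, (∑ α, rho z α x * (fderiv ℝ (rho b α) x (mom a x) -
      fderiv ℝ (rho a α) x (mom b x))) = -∑ α, rho z α x * (fderiv ℝ (rho a α) x (mom b x) -
      fderiv ℝ (rho b α) x (mom a x)) := fun a b => by
    rw [← Finset.sum_neg_distrib]
    exact Finset.sum_congr rfl fun α _ => by ring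
  have h2 : ∀ a b : E → Val ν, (∑ α, (fderiv ℝ (fun y => rho b α y * m.LL₁ α (thermo z y)) x (mom a x)
      - fderiv ℝ (fun y => rho a α y * m.LL₁ α (thermo z y)) x (mom b x))) =
      -∑ α, (fderiv ℝ (fun y => rho a α y * m.LL₁ α (thermo z y)) x (mom b x)
      - fderiv ℝ (fun y => rho b α y * m.LL₁ α (thermo z y)) x (mom a x)) := fun a b => by
    rw [← Finset.sum_neg_distrib]
    exact Finset.sum_congr rfl fun α _ => by ring
  rw [poissonDensity, poissonDensity, h1, h2, ← neg_sub (fderiv ℝ (mom (varDeriv Ω A z)) x _),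
    inner_neg_right]
  ring

lemma isObservable_mul (hΩ : IsLipschitzDomain Ω σ nrm) (hA : m.IsObservable Ω A)
    (hB : m.IsObservable Ω B) : m.IsObservable Ω (A * B) := fun z hz => by
  obtain ⟨a, ha⟩ := hA z hz
  obtain ⟨b, hb⟩ := hB z hz
  exact ⟨_, ha.mul hΩ.isConnected.nonempty hΩ.isBounded hb⟩

lemma varDeriv_mul (hΩ : IsLipschitzDomain Ω σ nrm) (hA : ∃ a, HasVarDeriv Ω A z a)
    (hB : ∃ b, HasVarDeriv Ω B z b) : EqOn (varDeriv Ω (A * B) z)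
      (A z • varDeriv Ω B z + B z • varDeriv Ω A z) (closure Ω) :=
  ((hasVarDeriv_varDeriv hA).mul hΩ.isConnected.nonempty hΩ.isBounded
    (hasVarDeriv_varDeriv hB)).varDeriv_eqOn hΩ.isConnected.nonempty hΩ.isOpen hΩ.isBounded

lemma contDiffOn_smul_add (ha : ContDiff ℝ ∞ a) (hb : ContDiff ℝ ∞ b) (c d : ℝ) (V : Set E) :
    ContDiffOn ℝ ∞ (c • a + d • b) V :=
  ((ha.const_smul c).add (hb.const_smul d)).contDiffOn

lemma integral_eq_smul_add {f g h : E → ℝ} {V : Set E} (hΩ : IsLipschitzDomain Ω σ nrm)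
    (hV : closure Ω ⊆ V) (hf : ContDiffOn ℝ ∞ f V) (hg : ContDiffOn ℝ ∞ g V) (c d : ℝ)
    (h_eq : ∀ x ∈ Ω, h x = c * f x + d * g x) :
    ∫ x in Ω, h x = c * (∫ x in Ω, f x) + d * ∫ x in Ω, g x := by
  rw [setIntegral_congr_fun hΩ.isOpen.measurableSet h_eq, integral_add, integral_const_mul,
    integral_const_mul]
  · exact (integrableOn_of_continuousOn_closure hΩ.isBounded (hf.continuousOn.mono hV)).const_mul c
  · exact (integrableOn_of_continuousOn_closure hΩ.isBounded (hg.continuousOn.mono hV)).const_mul d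

/-- The functional derivative of a product is A δB + B δA on the closed domain, and the integrand is
linear in its first argument. -/
lemma poisson_leibniz (hm : m.Admissible) (hΩ : IsLipschitzDomain Ω σ nrm) (hz : z ∈ m.states Ω)
    (hA : m.IsObservable Ω A) (hB : m.IsObservable Ω B) (hC : m.IsObservable Ω C) :
    m.poisson Ω (A * B) C z = A z * m.poisson Ω B C z + B z * m.poisson Ω A C z := by
  have hA' := contDiff_varDeriv (hA z hz)
  have hB' := contDiff_varDeriv (hB z hz)
  have hC' := contDiff_varDeriv (hC z hz)
  have hr := closure_subset_regular hz
  have hy := contDiffOn_carriedField hm hz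
  have hV := isOpen_regular hm hz
  rw [poisson_eq hm hΩ.isOpen hz (isObservable_mul hΩ hA hB z hz) (hC z hz)
      (contDiffOn_smul_add hB' hA' _ _ _) (varDeriv_mul hΩ (hA z hz) (hB z hz)) hC'.contDiffOn
      fun _ _ => rfl,
    poisson_eq hm hΩ.isOpen hz (hB z hz) (hC z hz) hB'.contDiffOn (fun _ _ => rfl) hC'.contDiffOn
      fun _ _ => rfl,
    poisson_eq hm hΩ.isOpen hz (hA z hz) (hC z hz) hA'.contDiffOn (fun _ _ => rfl) hC'.contDiffOn
      fun _ _ => rfl]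
  refine integral_eq_smul_add hΩ hr
    (contDiffOn_bracketDensity hV hy hz.1.contDiffOn hB'.contDiffOn hC'.contDiffOn)
    (contDiffOn_bracketDensity hV hy hz.1.contDiffOn hA'.contDiffOn hC'.contDiffOn) _ _
    fun x hx => ?_
  exact bracketDensity_smul_add_left
    ((hy.differentiableOn (by simp)).differentiableAt (hV.mem_nhds (hr (subset_closure hx))))
    (hB'.differentiable (by simp) x) (hA'.differentiable (by simp) x) _ _

lemma dissipation_leibniz (hm : m.Admissible) (hΩ : IsLipschitzDomain Ω σ nrm)
    (hz : z ∈ m.states Ω) (hA : m.IsObservable Ω A) (hB : m.IsObservable Ω B)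
    (hC : m.IsObservable Ω C) :
    m.dissipation Ω (A * B) C z = A z * m.dissipation Ω B C z + B z * m.dissipation Ω A C z := by
  have hA' := contDiff_varDeriv (hA z hz)
  have hB' := contDiff_varDeriv (hB z hz)
  have hC' := contDiff_varDeriv (hC z hz)
  have hr := closure_subset_regular hz
  rw [dissipation_eq hm hΩ.isOpen hz (isObservable_mul hΩ hA hB z hz) (hC z hz)
      (contDiffOn_smul_add hB' hA' _ _ _) (varDeriv_mul hΩ (hA z hz) (hB z hz)) hC'.contDiffOn
      fun _ _ => rfl]
  exact integral_eq_smul_add hΩ hr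
    (contDiffOn_dissipationDensity hm hz hB'.contDiffOn hC'.contDiffOn)
    (contDiffOn_dissipationDensity hm hz hA'.contDiffOn hC'.contDiffOn) _ _
    fun x hx => dissipationDensity_smul_add_left hm hz hB'.contDiffOn hA'.contDiffOn _ _
      (hr (subset_closure hx))

lemma dissipation_symm (hm : m.Admissible) (hΩ : IsOpen Ω) (hz : z ∈ m.states Ω)
    (A B : (E → Val ν) → ℝ) : m.dissipation Ω A B z = m.dissipation Ω B A z :=
  setIntegral_congr_fun hΩ.measurableSet fun _ hx =>
    dissipationDensity_symm hm (closure_subset_regular hz (subset_closure hx))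

lemma dissipation_nonneg (hm : m.Admissible) (hΩ : IsOpen Ω) (hz : z ∈ m.states Ω)
    (A : (E → Val ν) → ℝ) : 0 ≤ m.dissipation Ω A A z :=
  setIntegral_nonneg hΩ.measurableSet fun _ hx =>
    dissipationDensity_nonneg hm (closure_subset_regular hz (subset_closure hx))

/-! ### Non-interaction -/

/-- Both the covector and the momentum component of the entropy vanish, so that the bracket and its
boundary contribution are zero separately. -/
lemma poissonBulk_entropy (hm : m.Admissible) (hΩ : IsLipschitzDomain Ω σ nrm)
    (hz : z ∈ m.states Ω) (hA : m.IsObservable Ω A) :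
    m.poissonBulk Ω σ nrm A (m.entropy Ω) z = 0 := by
  have hA' := contDiff_varDeriv (hA z hz)
  rw [poissonBulk, poissonBdry_eq hΩ (varDeriv_entropy hm hΩ hz),
    poisson_eq hm hΩ.isOpen hz (hA z hz) (isObservable_entropy hm hΩ z hz) hA'.contDiffOn
      (fun _ _ => rfl) (contDiffOn_entropyGrad hm hz) (varDeriv_entropy hm hΩ hz),
    setIntegral_congr_fun (g := fun _ => 0) hΩ.isOpen.measurableSet fun x hx => ?_]
  · simp [poissonBdryDensity, mom_entropyGrad]
  · have hx' := closure_subset_regular hz (subset_closure hx)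
    simp [bracketDensity, transport_entropyGrad hm hz hx', mom_entropyGrad]

lemma dissipationBulk_energy (hm : m.Admissible) (hΩ : IsLipschitzDomain Ω σ nrm)
    (hz : z ∈ m.states Ω) (hA : m.IsObservable Ω A) :
    m.dissipationBulk Ω σ nrm A (m.energy Ω) z = 0 := by
  have hA' := contDiff_varDeriv (hA z hz)
  rw [dissipationBulk, dissipationBdry_eq hm hΩ hz (isObservable_energy hm hΩ z hz)
      (contDiffOn_energyGrad hm hz) (varDeriv_energy hm hΩ hz),
    dissipation_eq hm hΩ.isOpen hz (hA z hz) (isObservable_energy hm hΩ z hz) hA'.contDiffOn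
      (fun _ _ => rfl) (contDiffOn_energyGrad hm hz) (varDeriv_energy hm hΩ hz),
    setIntegral_congr_fun (g := fun _ => 0) hΩ.isOpen.measurableSet fun x hx =>
      dissipationDensity_energyGrad hm hz (closure_subset_regular hz (subset_closure hx)),
    integral_congr_ae (g := fun _ => 0) (hΩ.ae_mem_frontier.mono fun x hx =>
      dissipationBdryDensity_energyGrad hm hz nrm (closure_subset_regular hz
        (frontier_subset_closure hx)))]
  simp

/-! ### The boundary contributions -/

variable (m) in
/-- The flux through the boundary in the dissipation bracket. -/
def dissipationFlux (z a b : E → Val ν) (x : E) : E :=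
  (m.zeta (thermo z x) * m.temp (thermo z x)) • apply (m.forceShear z b x) (mom a x)
  + (m.temp (thermo z x) * (m.lam (thermo z x) - 2 * m.zeta (thermo z x) / 3)
      * m.forceBulk z b x) • mom a x
  + (m.forceHeat z a x • m.fluxHeat z b x + ∑ α, m.forceDiff z a α x • m.fluxDiff z b α x)

lemma inner_apply_comm (S : Matrix (Fin 3) (Fin 3) ℝ) (hS : S.transpose = S) (u v : E) :
    inner ℝ u (apply S v) = inner ℝ (apply S u) v := by
  have h : ∀ i j, S i j = S j i := fun i j => by rw [← Matrix.transpose_apply S, hS]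
  simp only [apply, PiLp.inner_apply, RCLike.inner_apply, conj_trivial, Finset.sum_mul,
    Finset.mul_sum]
  rw [Finset.sum_comm]
  refine Finset.sum_congr rfl fun i _ => Finset.sum_congr rfl fun j _ => ?_
  rw [h i j]; ring

lemma transpose_forceShear (z a : E → Val ν) (x : E) :
    (m.forceShear z a x).transpose = m.forceShear z a x := by
  simp [forceShear, symGrad, add_comm]

/-- As the shear matrix is symmetric, it can be moved from n to a_M; the boundary integrand is then
the normal component of a vector field, to which the divergence theorem applies. -/
lemma dissipationBdryDensity_eq (nrm : E → E) (z a b : E → Val ν) (x : E) :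
    m.dissipationBdryDensity nrm z a b x = inner ℝ (m.dissipationFlux z a b x) (nrm x) := by
  simp only [dissipationBdryDensity, dissipationFlux, inner_add_left, real_inner_smul_left,
    sum_inner, inner_apply_comm _ (transpose_forceShear z b x)]
  ring

lemma contDiffOn_apply {S : E → Matrix (Fin 3) (Fin 3) ℝ} {u : E → E} {V : Set E}
    (hS : ∀ i j, ContDiffOn ℝ ∞ (fun x => S x i j) V) (hu : ContDiffOn ℝ ∞ u V) :
    ContDiffOn ℝ ∞ (fun x => apply (S x) (u x)) V := by
  rw [contDiffOn_euclidean] at hu ⊢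
  exact fun i => ContDiffOn.sum (s := Finset.univ) fun j _ => (hS i j).mul (hu j)

lemma contDiffOn_dissipationFlux (hm : m.Admissible) (hz : z ∈ m.states Ω)
    (ha : ContDiff ℝ ∞ a) (hb : ContDiffOn ℝ ∞ b (m.regular z)) :
    ContDiffOn ℝ ∞ (m.dissipationFlux z a b) (m.regular z) := by
  have h1 := contDiffOn_comp_thermo hm.smooth_zeta hz
  have h2 := contDiffOn_comp_thermo (contDiffOn_temp hm) hz
  have h3 := contDiffOn_comp_thermo hm.smooth_lam hz
  have h4 := (contDiff_mom ha).contDiffOn (s := m.regular z)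
  refine (((h1.mul h2).smul (contDiffOn_apply (contDiffOn_forceShear hm hz hb) h4)).add
    (((h2.mul (h3.sub ((contDiffOn_const.mul h1).div_const 3))).mul
      (contDiffOn_forceBulk hm hz hb)).smul h4)).add
    (((contDiffOn_forceHeat hm hz ha.contDiffOn).smul (contDiffOn_fluxHeat hm hz hb)).add
      (ContDiffOn.sum fun α _ => (contDiffOn_forceDiff hm hz ha.contDiffOn α).smul
        (contDiffOn_fluxDiff hm hz hb α)))

variable (m) in
/-- The flux through the boundary in the Poisson bracket. -/
def poissonFlux (z a b : E → Val ν) (x : E) : E := dot (a x) (m.carriedField z x) • mom b x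

lemma contDiffOn_mom {V : Set E} (hb : ContDiffOn ℝ ∞ b V) : ContDiffOn ℝ ∞ (mom b) V :=
  momL.contDiff.comp_contDiffOn hb

lemma contDiffOn_poissonFlux (hm : m.Admissible) (hz : z ∈ m.states Ω)
    (ha : ContDiff ℝ ∞ a) (hb : ContDiffOn ℝ ∞ b (m.regular z)) :
    ContDiffOn ℝ ∞ (m.poissonFlux z a b) (m.regular z) :=
  ((dot.contDiff.comp_contDiffOn ha.contDiffOn).clm_apply (contDiffOn_carriedField hm hz)).smul
    (contDiffOn_mom hb)

lemma poissonBdry_energy (hm : m.Admissible) (hΩ : IsLipschitzDomain Ω σ nrm)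
    (hz : z ∈ m.states Ω) : m.poissonBdry Ω σ nrm A (m.energy Ω) z =
      ∫ x, inner ℝ (m.poissonFlux z (varDeriv Ω A z) (m.energyGrad z) x) (nrm x) ∂σ := by
  rw [poissonBdry_eq hΩ (varDeriv_energy hm hΩ hz)]
  simp only [poissonBdryDensity_eq, poissonFlux]

lemma dissipationBdry_entropy (hm : m.Admissible) (hΩ : IsLipschitzDomain Ω σ nrm)
    (hz : z ∈ m.states Ω) : m.dissipationBdry Ω σ nrm A (m.entropy Ω) z =
      ∫ x, inner ℝ (m.dissipationFlux z (varDeriv Ω A z) (m.entropyGrad z) x) (nrm x) ∂σ := by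
  rw [dissipationBdry_eq hm hΩ hz (isObservable_entropy hm hΩ z hz)
      (contDiffOn_entropyGrad hm hz) (varDeriv_entropy hm hΩ hz)]
  simp only [dissipationBdryDensity_eq]

lemma bdry_eq_bdryOperator (hm : m.Admissible) (hΩ : IsLipschitzDomain Ω σ nrm)
    (hz : z ∈ m.states Ω) (hA : m.IsObservable Ω A) :
    m.poissonBdry Ω σ nrm A (m.energy Ω) z + m.dissipationBdry Ω σ nrm A (m.entropy Ω) z =
      -m.bdryOperator σ nrm z (varDeriv Ω A z) (m.port nrm z) := by
  have hA' := contDiff_varDeriv (hA z hz)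
  rw [poissonBdry_energy hm hΩ hz, dissipationBdry_entropy hm hΩ hz, ← integral_add,
    bdryOperator, ← integral_neg]
  · refine integral_congr_ae ?_
    filter_upwards [hΩ.ae_mem_frontier] with x hx
    rw [← bdryDensity_eq hm nrm (closure_subset_regular hz (frontier_subset_closure hx)),
      poissonBdryDensity_eq, dissipationBdryDensity_eq, poissonFlux]
  · exact hΩ.integrable_inner_normal ((contDiffOn_poissonFlux hm hz hA'
      (contDiffOn_energyGrad hm hz)).continuousOn.mono (closure_subset_regular hz))
  · exact hΩ.integrable_inner_normal ((contDiffOn_dissipationFlux hm hz hA'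
      (contDiffOn_entropyGrad hm hz)).continuousOn.mono (closure_subset_regular hz))

end Mixture

end OpenMixture

end

noncomputable section
namespace OpenMixture

variable {ν n : ℕ}

/-! ### The divergence of matrix fields -/

section MatDiv

variable {x : E}

lemma contract_symGrad (φ ψ : E → E) (x : E) :
    contract (symGrad φ x) (jac ψ x) = contract (symGrad φ x) (symGrad ψ x) / 2 := by
  simp only [contract, symGrad, Matrix.add_apply, Matrix.transpose_apply, Fin.sum_univ_three]
  ring

lemma contract_one (A : Matrix (Fin 3) (Fin 3) ℝ) : contract 1 A = A.trace := by
  simp [contract, Matrix.one_apply, Matrix.trace]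

lemma inner_eq_sum (u v : E) : inner ℝ u v = ∑ i, u i * v i := by
  simp [PiLp.inner_apply, mul_comm]

lemma fderiv_coord {φ : E → E} (hφ : DifferentiableAt ℝ φ x) (i : Fin 3) (u : E) :
    fderiv ℝ (fun y => φ y i) x u = fderiv ℝ φ x u i := by
  have := ((EuclideanSpace.proj (𝕜 := ℝ) i).hasFDerivAt.comp x hφ.hasFDerivAt).fderiv
  exact DFunLike.congr_fun this u

lemma differentiableAt_coord {φ : E → E} (hφ : DifferentiableAt ℝ φ x) (i : Fin 3) :
    DifferentiableAt ℝ (fun y => φ y i) x :=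
  (EuclideanSpace.proj (𝕜 := ℝ) i).differentiableAt.comp x hφ

/-- The product rule; the symmetry of S exchanges the row and column indices in both terms. -/
lemma div_apply {S : E → Matrix (Fin 3) (Fin 3) ℝ} {u : E → E}
    (hS : ∀ i j, DifferentiableAt ℝ (fun y => S y i j) x) (hsymm : ∀ y, (S y).transpose = S y)
    (hu : DifferentiableAt ℝ u x) : div (fun y => apply (S y) (u y)) x =
      inner ℝ (u x) (matDiv S x) + contract (S x) (jac u x) := by
  have hs : ∀ y i j, S y i j = S y j i := fun y i j => by
    rw [← Matrix.transpose_apply (S y), hsymm y]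
  have hu' := fun i => differentiableAt_coord hu i
  have h1 : DifferentiableAt ℝ (fun y => apply (S y) (u y)) x := by
    rw [differentiableAt_euclidean]
    exact fun i => DifferentiableAt.fun_sum (u := Finset.univ) fun j _ => (hS i j).mul (hu' j)
  have h2 : ∀ (i : Fin 3) (w : E), fderiv ℝ (fun y => apply (S y) (u y)) x w i =
      ∑ j, (S x i j * fderiv ℝ u x w j + u x j * fderiv ℝ (fun y => S y i j) x w) := fun i w => by
    rw [← fderiv_coord h1]
    have : (fun y => (apply (S y) (u y)) i) = fun y => ∑ j, S y i j * u y j := rfl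
    rw [this, fderiv_fun_sum fun j _ => (hS i j).fun_mul (hu' j)]
    simp only [sum_apply]
    refine Finset.sum_congr rfl fun j _ => ?_
    rw [fderiv_fun_mul (hS i j) (hu' j)]
    simp [fderiv_coord hu]
  have h3 : ∀ i j, (fun y => S y i j) = fun y => S y j i := fun i j => funext fun y => hs y i j
  rw [div_eq_sum, inner_eq_sum]
  simp only [h2, matDiv, contract, jac, Matrix.of_apply, Finset.sum_add_distrib]
  rw [add_comm]
  congr 1
  · rw [Finset.sum_comm]
    refine Finset.sum_congr rfl fun i _ => ?_
    rw [Finset.mul_sum]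
    exact Finset.sum_congr rfl fun j _ => by rw [h3 i j]
  · rw [Finset.sum_comm]
    exact Finset.sum_congr rfl fun i _ => Finset.sum_congr rfl fun j _ => by rw [hs x i j]

lemma matDiv_sub {A B : E → Matrix (Fin 3) (Fin 3) ℝ}
    (hA : ∀ i j, DifferentiableAt ℝ (fun y => A y i j) x)
    (hB : ∀ i j, DifferentiableAt ℝ (fun y => B y i j) x) :
    matDiv (fun y => A y - B y) x = matDiv A x - matDiv B x := by
  ext i
  simp only [matDiv, Matrix.sub_apply, PiLp.sub_apply, ← Finset.sum_sub_distrib]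
  refine Finset.sum_congr rfl fun j _ => ?_
  rw [fderiv_fun_sub (hA i j) (hB i j)]
  rfl

lemma matDiv_add {A B : E → Matrix (Fin 3) (Fin 3) ℝ}
    (hA : ∀ i j, DifferentiableAt ℝ (fun y => A y i j) x)
    (hB : ∀ i j, DifferentiableAt ℝ (fun y => B y i j) x) :
    matDiv (fun y => A y + B y) x = matDiv A x + matDiv B x := by
  ext i
  simp only [matDiv, Matrix.add_apply, PiLp.add_apply, ← Finset.sum_add_distrib]
  refine Finset.sum_congr rfl fun j _ => ?_
  rw [fderiv_fun_add (hA i j) (hB i j)]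
  rfl

lemma inner_matDiv_smul_one {f : E → ℝ} (hf : DifferentiableAt ℝ f x) (u : E) :
    inner ℝ u (matDiv (fun y => f y • (1 : Matrix (Fin 3) (Fin 3) ℝ)) x) = fderiv ℝ f x u := by
  have h1 : ∀ i j : Fin 3, fderiv ℝ (fun y => (f y • (1 : Matrix (Fin 3) (Fin 3) ℝ)) i j) x =
      (1 : Matrix (Fin 3) (Fin 3) ℝ) i j • fderiv ℝ f x := fun i j => by
    simp only [Matrix.smul_apply, smul_eq_mul]
    rw [fderiv_mul_const hf]
  have h2 : u = ∑ i, u i • EuclideanSpace.single i (1 : ℝ) := by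
    ext j; simp [Finset.sum_apply, Pi.single_apply]
  rw [inner_eq_sum]
  conv_rhs => rw [h2, map_sum]
  refine Finset.sum_congr rfl fun i _ => ?_
  simp only [matDiv, h1, smul_apply, map_smul, smul_eq_mul]
  simp [Matrix.one_apply]

lemma matDiv_outer {u v : E → E} (hu : DifferentiableAt ℝ u x) (hv : DifferentiableAt ℝ v x) :
    matDiv (fun y => Matrix.of fun i j => u y i * v y j) x =
      div v x • u x + fderiv ℝ u x (v x) := by
  have h2 : v x = ∑ j, v x j • EuclideanSpace.single j (1 : ℝ) := by
    ext j; simp [Finset.sum_apply, Pi.single_apply]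
  ext i
  simp only [matDiv, Matrix.of_apply, PiLp.add_apply, PiLp.smul_apply, smul_eq_mul]
  conv_rhs => rw [h2, map_sum]
  rw [div_eq_sum, Finset.sum_mul]
  simp only [map_smul, WithLp.ofLp_sum, Finset.sum_apply, PiLp.smul_apply, smul_eq_mul,
    ← Finset.sum_add_distrib]
  refine Finset.sum_congr rfl fun j _ => ?_
  rw [fderiv_fun_mul (differentiableAt_coord hu i) (differentiableAt_coord hv j)]
  simp [fderiv_coord hu, fderiv_coord hv]
  ring

end MatDiv

/-! ### Constitutive relations and the weak form of the field equations. -/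

namespace Mixture

variable {m : Mixture ν n} {Ω : Set E} {z a : E → Val ν} {x : E}

/-- After exchanging sums, the individual reactions enter only through the contracted coefficients
𝕃. -/
lemma massProduction_eq (z : E → Val ν) (α : Fin ν) (x : E) : m.massProduction z α x =
    -(∑ β, m.LL₂ α β (thermo z x) * m.mu β (thermo z x)) + m.LL₁ α (thermo z x) * div (vel z) x := by
  simp only [massProduction, reactionRate, LL₂, LL₁, mul_add, Finset.sum_add_distrib,
    mul_neg, Finset.sum_neg_distrib, Finset.sum_mul, Finset.mul_sum]
  congr 1
  · rw [neg_inj]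
    conv_rhs => rw [Finset.sum_comm]
    refine Finset.sum_congr rfl fun k _ => ?_
    rw [Finset.sum_comm]
    refine Finset.sum_congr rfl fun β _ => Finset.sum_congr rfl fun b _ => ?_
    ring
  · exact Finset.sum_congr rfl fun k _ => by ring

lemma contDiffOn_viscousStress (hm : m.Admissible) (hz : z ∈ m.states Ω) (i j : Fin 3) :
    ContDiffOn ℝ ∞ (fun x => m.viscousStress z x i j) (m.regular z) := by
  have h1 := contDiffOn_comp_thermo hm.smooth_zeta hz
  have h3 := contDiffOn_comp_thermo hm.smooth_lam hz
  have hV := isOpen_regular hm hz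
  exact (((h3.sub ((contDiffOn_const.mul h1).div_const 3)).mul
    (contDiffOn_div hV (contDiffOn_vel hz))).mul contDiffOn_const).add
    (h1.mul (contDiffOn_symGrad hV (contDiffOn_vel hz) i j))

lemma transpose_viscousStress (z : E → Val ν) (x : E) :
    (m.viscousStress z x).transpose = m.viscousStress z x := by
  simp [viscousStress, symGrad, add_comm]

lemma contDiffOn_heatFlux (hm : m.Admissible) (hz : z ∈ m.states Ω) :
    ContDiffOn ℝ ∞ (m.heatFlux z) (m.regular z) :=
  (contDiffOn_fluxHeat hm hz (contDiffOn_entropyGrad hm hz)).congr fun y _ =>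
    (fluxHeat_entropyGrad z y).symm

lemma contDiffOn_diffFlux (hm : m.Admissible) (hz : z ∈ m.states Ω) (α : Fin ν) :
    ContDiffOn ℝ ∞ (m.diffFlux z α) (m.regular z) :=
  (contDiffOn_fluxDiff hm hz (contDiffOn_entropyGrad hm hz) α).congr fun y _ =>
    (fluxDiff_entropyGrad z α y).symm

/-- The mechanical forces of the entropy carry the factor −1/T, which cancels T in the coefficients
and leaves minus the viscous stress. -/
lemma dissipationFlux_entropyGrad (hm : m.Admissible) (hx : x ∈ m.regular z) :
    m.dissipationFlux z a (m.entropyGrad z) x =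
      (m.forceHeat z a x • m.heatFlux z x + ∑ α, m.forceDiff z a α x • m.diffFlux z α x) -
      apply (m.viscousStress z x) (mom a x) := by
  have hT := (hm.temp_pos _ (thermo_mem_dom hx)).ne'
  have happ : ∀ (A B : Matrix (Fin 3) (Fin 3) ℝ) (v : E), apply (A + B) v = apply A v + apply B v :=
    fun A B v => by ext i; simp [apply, add_mul, Finset.sum_add_distrib]
  have hsm : ∀ (c : ℝ) (A : Matrix (Fin 3) (Fin 3) ℝ) (v : E), apply (c • A) v = c • apply A v :=
    fun c A v => by ext i; simp [apply, Finset.mul_sum, mul_assoc]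
  have hone : ∀ v : E, apply 1 v = v := fun v => by ext i; simp [apply, Matrix.one_apply]
  have hneg : ∀ (A : Matrix (Fin 3) (Fin 3) ℝ) (v : E), apply (-A) v = -apply A v :=
    fun A v => by ext i; simp [apply]
  simp only [dissipationFlux, fluxHeat_entropyGrad, fluxDiff_entropyGrad, forceShear_entropyGrad,
    forceBulk_entropyGrad, viscousStress, happ, hsm, hone, hneg, smul_neg, smul_smul,
    mul_inv_cancel_right₀ hT]
  have h : m.temp (thermo z x) * (m.lam (thermo z x) - 2 * m.zeta (thermo z x) / 3) *
      -(div (vel z) x * (m.temp (thermo z x))⁻¹) =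
      -((m.lam (thermo z x) - 2 * m.zeta (thermo z x) / 3) * div (vel z) x) := by
    field_simp
  rw [h]
  module

/-- The shear and bulk forces of the entropy are −D/T and −(div v)/T. The viscous stress, being
symmetric, is contracted with a₀ ∇v − ∇a_M. -/
lemma mechanical_dissipation_entropyGrad (hm : m.Admissible) (hx : x ∈ m.regular z) :
    m.zeta (thermo z x) * m.temp (thermo z x) / 2
      * contract (m.forceShear z a x) (m.forceShear z (m.entropyGrad z) x)
    + m.temp (thermo z x) * (m.lam (thermo z x) - 2 * m.zeta (thermo z x) / 3)
      * m.forceBulk z a x * m.forceBulk z (m.entropyGrad z) x =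
    m.forceHeat z a x * contract (m.viscousStress z x) (jac (vel z) x) -
      contract (m.viscousStress z x) (jac (mom a) x) := by
  have hT := (hm.temp_pos _ (thermo_mem_dom hx)).ne'
  have h1 : contract (m.forceShear z a x) (m.forceShear z (m.entropyGrad z) x) =
      -((m.temp (thermo z x))⁻¹ * (contract (symGrad (vel z) x) (symGrad (mom a) x) -
        m.forceHeat z a x * contract (symGrad (vel z) x) (symGrad (vel z) x))) := by
    rw [contract_comm, forceShear_entropyGrad, ← neg_smul, contract_smul_left,
      contract_comm, forceShear, sub_eq_add_neg, ← neg_smul, contract_add_left,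
      contract_smul_left, contract_comm (symGrad (mom a) x)]
    ring
  have h2 : ∀ φ : E → E, contract (m.viscousStress z x) (jac φ x) =
      (m.lam (thermo z x) - 2 * m.zeta (thermo z x) / 3) * div (vel z) x * div φ x +
      m.zeta (thermo z x) * (contract (symGrad (vel z) x) (symGrad φ x) / 2) := fun φ => by
    rw [viscousStress, contract_add_left, contract_smul_left, contract_smul_left, contract_one,
      contract_symGrad, div, div]
  rw [h1, h2, h2, forceBulk_entropyGrad, forceBulk]
  field_simp
  ring

/-- Subtracting the divergence of the flux removes all derivatives from a: by the product rule the
gradients of its forces and ∇a_M cancel. What is left is a paired with irreversible terms of the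
balance equations. -/
lemma dissipation_sub_div (hm : m.Admissible) (hz : z ∈ m.states Ω) (hx : x ∈ m.regular z)
    (ha : ContDiff ℝ ∞ a) :
    m.dissipationDensity z a (m.entropyGrad z) x -
      div (m.dissipationFlux z a (m.entropyGrad z)) x =
    inner ℝ (mom a x) (matDiv (m.viscousStress z) x) +
      m.forceHeat z a x * (contract (m.viscousStress z x) (jac (vel z) x) - div (m.heatFlux z) x) -
      ∑ α, m.forceDiff z a α x * (div (m.diffFlux z α) x +
        ∑ β, m.LL₂ α β (thermo z x) * m.mu β (thermo z x)) := by
  have hT := (hm.temp_pos _ (thermo_mem_dom hx)).ne'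
  have hV := (isOpen_regular hm hz).mem_nhds hx
  have hd : ∀ {F : Type} [NormedAddCommGroup F] [NormedSpace ℝ F] {f : E → F},
      ContDiffOn ℝ ∞ f (m.regular z) → DifferentiableAt ℝ f x := fun h =>
    (h.differentiableOn (by simp)).differentiableAt hV
  have h0 := hd (contDiffOn_forceHeat hm hz ha.contDiffOn)
  have h1 := fun α => hd (contDiffOn_forceDiff hm hz ha.contDiffOn α)
  have h2 := hd (contDiffOn_heatFlux hm hz)
  have h3 := fun α => hd (contDiffOn_diffFlux hm hz α)
  have h4 := fun i j => hd (contDiffOn_viscousStress hm hz i j)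
  have h5 : DifferentiableAt ℝ (mom a) x := (contDiff_mom ha).differentiable (by simp) x
  have h6 : div (m.dissipationFlux z a (m.entropyGrad z)) x =
      div (fun y => (m.forceHeat z a y • m.heatFlux z y +
        ∑ α, m.forceDiff z a α y • m.diffFlux z α y) -
        apply (m.viscousStress z y) (mom a y)) x := by
    have : m.dissipationFlux z a (m.entropyGrad z) =ᶠ[𝓝 x] fun y => (m.forceHeat z a y •
        m.heatFlux z y + ∑ α, m.forceDiff z a α y • m.diffFlux z α y) -
        apply (m.viscousStress z y) (mom a y) := by
      filter_upwards [hV] with y hy using dissipationFlux_entropyGrad hm hy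
    rw [div, div, jac_congr this.fderiv_eq]
  have h7 : ∀ α ∈ Finset.univ, DifferentiableAt ℝ (fun y => m.forceDiff z a α y • m.diffFlux z α y) x :=
    fun α _ => (h1 α).fun_smul (h3 α)
  have h8 : DifferentiableAt ℝ (fun y => ∑ α, m.forceDiff z a α y • m.diffFlux z α y) x :=
    DifferentiableAt.fun_sum h7
  have h9 : DifferentiableAt ℝ (fun y => apply (m.viscousStress z y) (mom a y)) x := by
    have := contDiffOn_apply (contDiffOn_viscousStress hm hz) (contDiff_mom ha).contDiffOn
    exact hd this
  rw [h6, div_sub ((h0.fun_smul h2).fun_add h8) h9, div_add (h0.fun_smul h2) h8, div_sum _ h7, div_smul h0 h2,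
    div_apply h4 (transpose_viscousStress z) h5, dissipationDensity,
    mechanical_dissipation_entropyGrad hm hx, Finset.sum_congr rfl fun α _ => div_smul (h1 α) (h3 α)]
  have h10 : m.temp (thermo z x) * ∑ α, ∑ β, m.forceDiff z a α x * m.LL₂ α β (thermo z x) *
      m.forceDiff z (m.entropyGrad z) β x =
      -∑ α, m.forceDiff z a α x * ∑ β, m.LL₂ α β (thermo z x) * m.mu β (thermo z x) := by
    simp only [Finset.mul_sum, forceDiff_entropyGrad, ← Finset.sum_neg_distrib]
    exact Finset.sum_congr rfl fun α _ => Finset.sum_congr rfl fun β _ => by field_simp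
  rw [h10]
  simp only [fluxHeat_entropyGrad, fluxDiff_entropyGrad, inner_gradient, mul_add,
    Finset.sum_add_distrib]
  ring

variable (m) in
/-- The rate of change of a state according to the field equations. -/
def rate (z : E → Val ν) (x : E) : Val ν :=
  (fun α => -div (fun y => rho z α y • vel z y + m.diffFlux z α y) x + m.massProduction z α x,
    -matDiv (fun y => Matrix.of (fun i j => mom z y i * vel z y j) - m.stress z y) x,
    m.scalarRate z x)

/-- The field equations in terms of the brackets. -/
lemma dot_rate (hm : m.Admissible) (hz : z ∈ m.states Ω) (hx : x ∈ m.regular z)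
    (ha : ContDiff ℝ ∞ a) : dot (a x) (m.rate z x) =
      -dot (a x) (hamField (m.carriedField z) z (m.energyGrad z) x) +
      (m.dissipationDensity z a (m.entropyGrad z) x -
        div (m.dissipationFlux z a (m.entropyGrad z)) x) := by
  have hT := (hm.temp_pos _ (thermo_mem_dom hx)).ne'
  have hV := (isOpen_regular hm hz).mem_nhds hx
  have hd : ∀ {F : Type} [NormedAddCommGroup F] [NormedSpace ℝ F] {f : E → F},
      ContDiffOn ℝ ∞ f (m.regular z) → DifferentiableAt ℝ f x := fun h =>
    (h.differentiableOn (by simp)).differentiableAt hV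
  have hzd : DifferentiableAt ℝ z x := hz.1.differentiable (by simp) x
  have hv := hd (contDiffOn_vel hz)
  have hq := hd (contDiffOn_heatFlux hm hz)
  have hJ := fun α => hd (contDiffOn_diffFlux hm hz α)
  have hS := fun i j => hd (contDiffOn_viscousStress hm hz i j)
  have hp := differentiableAt_comp_thermo hm (contDiffOn_press hm) hz hx
  have hc := differentiableAt_comp_thermo hm (contDiffOn_chemPress hm) hz hx
  have hμ := fun α => differentiableAt_comp_thermo hm (contDiffOn_mu hm α) hz hx
  have hTd := differentiableAt_comp_thermo hm (contDiffOn_temp hm) hz hx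
  have hconv : ∀ f : E → ℝ, DifferentiableAt ℝ f x → ∀ φ : E → E, DifferentiableAt ℝ φ x →
      div (fun y => f y • vel z y + φ y) x = f x * div (vel z) x + fderiv ℝ f x (vel z x) +
        div φ x := fun f hf φ hφ => by rw [div_add (hf.fun_smul hv) hφ, div_smul hf hv]
  -- The momentum balance, split into convection, the gradient of p − Σ 𝕃_β μ_β, and the divergence
  -- of the viscous stress.
  have hmom : inner ℝ (mom a x) (m.rate z x).2.1 =
      -(div (vel z) x * inner ℝ (mom a x) (mom z x) +
        inner ℝ (mom a x) (fderiv ℝ z x (vel z x)).2.1)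
      - fderiv ℝ (fun y => m.press (thermo z y) - m.chemPress (thermo z y)) x (mom a x)
      + inner ℝ (mom a x) (matDiv (m.viscousStress z) x) := by
    have e1 : ∀ i j, DifferentiableAt ℝ (fun y => (Matrix.of fun i j => mom z y i * vel z y j) i j) x :=
      fun i j => (differentiableAt_coord (differentiableAt_mom hzd) i).mul
        (differentiableAt_coord hv j)
    have e2 : ∀ i j, DifferentiableAt ℝ (fun y => ((-m.press (thermo z y) + m.chemPress (thermo z y)) •
        (1 : Matrix (Fin 3) (Fin 3) ℝ)) i j) x :=
      fun i j => (hp.neg.add hc).mul_const _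
    have e3 : ∀ i j, DifferentiableAt ℝ (fun y => m.stress z y i j) x :=
      fun i j => (e2 i j).add (hS i j)
    have e4 : matDiv (m.stress z) x = _ := matDiv_add e2 hS
    have e5 : (fun y => m.press (thermo z y) - m.chemPress (thermo z y)) =
      fun y => -(-m.press (thermo z y) + m.chemPress (thermo z y)) := by ext y; ring
    simp only [rate]
    rw [matDiv_sub e1 e3, matDiv_outer (differentiableAt_mom hzd) hv, e4, inner_neg_right,
      inner_sub_right, inner_add_right, inner_add_right, real_inner_smul_right,
      inner_matDiv_smul_one (hp.fun_neg.fun_add hc), fderiv_mom hzd, e5, fderiv_fun_neg]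
    simp only [neg_apply]
    ring
  have hrho : ∑ α, (a x).1 α * (m.rate z x).1 α =
      -(div (vel z) x * ∑ α, rho a α x * rho z α x)
      - (∑ α, (a x).1 α * (fderiv ℝ z x (vel z x)).1 α)
      - (∑ α, rho a α x * (div (m.diffFlux z α) x +
        ∑ β, m.LL₂ α β (thermo z x) * m.mu β (thermo z x)))
      + div (vel z) x * ∑ α, rho a α x * m.LL₁ α (thermo z x) := by
    simp only [Finset.mul_sum (a := div (vel z) x), ← Finset.sum_neg_distrib,
      ← Finset.sum_sub_distrib, ← Finset.sum_add_distrib]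
    refine Finset.sum_congr rfl fun α _ => ?_
    simp only [rate]
    rw [hconv _ (differentiableAt_rho hzd α) _ (hJ α), massProduction_eq, fderiv_rho hzd]
    simp only [rho]
    ring
  have hstress : contract (m.stress z x) (jac (vel z) x) =
      (-m.press (thermo z x) + m.chemPress (thermo z x)) * div (vel z) x +
        contract (m.viscousStress z x) (jac (vel z) x) := by
    rw [stress, contract_add_left, contract_smul_left, contract_one, div]
  rw [dissipation_sub_div hm hz hx ha, hamField, transport_energyGrad hm hz hx, map_add, map_add,
    map_smul, dot_momEmb, dot_carriedField, dot_apply, dot_apply, hrho, mom_energyGrad]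
  have e2 : inner ℝ (a x).2.1 ((InnerProductSpace.toDual ℝ E).symm
      (fderiv ℝ (fun y => m.press (thermo z y) - m.chemPress (thermo z y)) x)) =
      fderiv ℝ (fun y => m.press (thermo z y) - m.chemPress (thermo z y)) x (mom a x) := by
    rw [real_inner_comm, InnerProductSpace.toDual_symm_apply]; rfl
  have e0 : (a x).2.1 = mom a x := rfl
  have e1 : (a x).2.2 = sca a x := rfl
  rw [e2, e0, hmom, e1, smul_eq_mul]
  cases h : m.pot
  · have hw : (m.rate z x).2.2 = -(sca z x * div (vel z) x + (fderiv ℝ z x (vel z x)).2.2)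
        + (m.temp (thermo z x))⁻¹ * (contract (m.viscousStress z x) (jac (vel z) x) -
          div (m.heatFlux z) x) + ∑ α, m.mu α (thermo z x) / m.temp (thermo z x) *
          (div (m.diffFlux z α) x + ∑ β, m.LL₂ α β (thermo z x) * m.mu β (thermo z x)) := by
      have f1 : (m.rate z x).2.2 = -div (fun y => sca z y • vel z y + m.entropyFlux z y) x +
        m.entropyProduction z x := by simp only [rate, scalarRate, h]
      have hTi : DifferentiableAt ℝ (fun y => (m.temp (thermo z y))⁻¹) x := hTd.fun_inv hT
      have hmT : ∀ α, DifferentiableAt ℝ (fun y => m.mu α (thermo z y) / m.temp (thermo z y)) x :=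
        fun α => by simpa only [div_eq_mul_inv] using (hμ α).fun_mul hTi
      have f2 : m.entropyFlux z = fun y => (m.temp (thermo z y))⁻¹ • m.heatFlux z y -
          ∑ α, (m.mu α (thermo z y) / m.temp (thermo z y)) • m.diffFlux z α y := by
        ext1 y
        simp only [entropyFlux, smul_sub, Finset.smul_sum, smul_smul, div_eq_inv_mul]
      have f3 : ∀ α ∈ Finset.univ, DifferentiableAt ℝ
          (fun y => (m.mu α (thermo z y) / m.temp (thermo z y)) • m.diffFlux z α y) x :=
        fun α _ => (hmT α).fun_smul (hJ α)
      have f4 := DifferentiableAt.fun_sum f3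
      have f5 : DifferentiableAt ℝ (m.entropyFlux z) x := by
        rw [f2]; exact (hTi.fun_smul hq).fun_sub f4
      -- The term with div v in the mass productions yields (1/T) (Σ 𝕃_β μ_β) div v, which cancels
      -- the chemical part of the stress power.
      have f6 : ∑ α, (inner ℝ (m.diffFlux z α x)
            (gradient (fun y => m.mu α (thermo z y) / m.temp (thermo z y)) x) +
          m.massProduction z α x * (m.mu α (thermo z x) / m.temp (thermo z x))) =
          (∑ α, fderiv ℝ (fun y => m.mu α (thermo z y) / m.temp (thermo z y)) x
            (m.diffFlux z α x)) - (∑ α, m.mu α (thermo z x) / m.temp (thermo z x) *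
            ∑ β, m.LL₂ α β (thermo z x) * m.mu β (thermo z x)) +
          (m.temp (thermo z x))⁻¹ * m.chemPress (thermo z x) * div (vel z) x := by
        rw [chemPress, Finset.mul_sum, Finset.sum_mul, ← Finset.sum_sub_distrib,
          ← Finset.sum_add_distrib]
        refine Finset.sum_congr rfl fun α _ => ?_
        rw [massProduction_eq, real_inner_comm, inner_gradient]
        ring
      rw [f1, hconv _ (differentiableAt_sca hzd) _ f5, fderiv_sca hzd, f2,
        div_sub (hTi.fun_smul hq) f4, div_sum _ f3, div_smul hTi hq,
        Finset.sum_congr rfl fun α _ => div_smul (hmT α) (hJ α), entropyProduction, f6, hstress,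
        real_inner_comm, inner_gradient]
      simp only [mul_add, Finset.sum_add_distrib]
      ring
    -- The part −(μ_α/T) a_w of the diffusion forces accounts for the chemical terms of the entropy
    -- balance.
    have hs : ∑ α, m.forceDiff z a α x * (div (m.diffFlux z α) x +
        ∑ β, m.LL₂ α β (thermo z x) * m.mu β (thermo z x)) =
        (∑ α, rho a α x * (div (m.diffFlux z α) x +
        ∑ β, m.LL₂ α β (thermo z x) * m.mu β (thermo z x))) -
        sca a x * ∑ α, m.mu α (thermo z x) / m.temp (thermo z x) * (div (m.diffFlux z α) x +
        ∑ β, m.LL₂ α β (thermo z x) * m.mu β (thermo z x)) := by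
      rw [Finset.mul_sum, ← Finset.sum_sub_distrib]
      refine Finset.sum_congr rfl fun α _ => ?_
      simp only [forceDiff, h]
      ring
    have h0 : m.forceHeat z a x = (m.temp (thermo z x))⁻¹ * sca a x := by
      simp only [forceHeat, h]
    have hP : m.bracketPress (thermo z x) = 0 := by simp only [bracketPress, h]
    rw [hw, hs, h0, hP]
    ring
  -- Here the stress power contains −(p − Σ 𝕃_β μ_β) div v, which is the contribution of P to the
  -- transported quantity w + P.
  · have hw : (m.rate z x).2.2 = -(sca z x * div (vel z) x + (fderiv ℝ z x (vel z x)).2.2) -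
        div (m.heatFlux z) x - (m.press (thermo z x) - m.chemPress (thermo z x)) * div (vel z) x +
        contract (m.viscousStress z x) (jac (vel z) x) := by
      have f1 : (m.rate z x).2.2 = -div (fun y => sca z y • vel z y + m.heatFlux z y) x +
        contract (m.stress z x) (jac (vel z) x) := by simp only [rate, scalarRate, h]
      rw [f1, hconv _ (differentiableAt_sca hzd) _ hq, fderiv_sca hzd, hstress]
      ring
    have hs : ∀ α, m.forceDiff z a α x = rho a α x := fun α => by simp only [forceDiff, h]
    have h0 : m.forceHeat z a x = sca a x := by simp only [forceHeat, h]
    have hP : m.bracketPress (thermo z x) = m.press (thermo z x) - m.chemPress (thermo z x) := by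
      simp only [bracketPress, h]
    simp only [hs]
    rw [hw, h0, hP]
    ring

end Mixture

end OpenMixture

end

noncomputable section
namespace OpenMixture

variable {ν n : ℕ}

/-! ### Families of fields -/

section Families

variable {P G : Type*} [NormedAddCommGroup P] [NormedSpace ℝ P] [NormedAddCommGroup G]
  [NormedSpace ℝ G] {V : Set (P × E)} {Ω : Set E}

lemma fderiv_slice {f : P × E → G} {q : P × E} (hf : DifferentiableAt ℝ f q) :
    fderiv ℝ (fun x => f (q.1, x)) q.2 = (fderiv ℝ f q).comp (ContinuousLinearMap.inr ℝ P E) := by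
  have h : HasFDerivAt (fun x : E => (q.1, x)) (ContinuousLinearMap.inr ℝ P E) q.2 :=
    hasFDerivAt_prodMk_right q.1 q.2
  exact (HasFDerivAt.comp q.2 (f := fun x : E => (q.1, x)) hf.hasFDerivAt h).fderiv

lemma contDiffOn_fderiv_slice {f : P × E → G} (hV : IsOpen V) (hf : ContDiffOn ℝ ∞ f V) :
    ContDiffOn ℝ ∞ (fun q : P × E => fderiv ℝ (fun x => f (q.1, x)) q.2) V := by
  have h1 : ContDiffOn ℝ ∞ (fderiv ℝ f) V := hf.fderiv_of_isOpen hV (by simp)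
  have h2 : ContDiffOn ℝ ∞ (fun q => (fderiv ℝ f q).comp (ContinuousLinearMap.inr ℝ P E)) V :=
    h1.clm_comp contDiffOn_const
  exact h2.congr fun q hq =>
    fderiv_slice ((hf.differentiableOn (by simp)).differentiableAt (hV.mem_nhds hq))

lemma contDiffOn_iteratedFDeriv_slice {f : P × E → G} (hV : IsOpen V) (hf : ContDiffOn ℝ ∞ f V)
    (i : ℕ) : ContDiffOn ℝ ∞ (fun q : P × E => iteratedFDeriv ℝ i (fun x => f (q.1, x)) q.2) V := by
  induction i with
  | zero =>
    simp only [iteratedFDeriv_zero_eq_comp]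
    exact (continuousMultilinearCurryFin0 ℝ E G).symm.contDiff.comp_contDiffOn hf
  | succ i ih =>
    simp only [iteratedFDeriv_succ_eq_comp_left]
    exact (continuousMultilinearCurryLeftEquiv ℝ (fun _ => E) G).symm.contDiff.comp_contDiffOn
      (contDiffOn_fderiv_slice hV ih)

/-- Compact neighbourhoods in the parameter space. -/
lemma exists_closedBall_prod_subset [FiniteDimensional ℝ P] (hb : Bornology.IsBounded Ω)
    (hV : IsOpen V) {p₀ : P} (hΩV : {p₀} ×ˢ closure Ω ⊆ V) :
    ∃ ε > 0, Metric.closedBall p₀ ε ×ˢ closure Ω ⊆ V ∧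
      IsCompact (Metric.closedBall p₀ ε ×ˢ closure Ω) := by
  obtain ⟨u, v, hu, -, hpu, hΩv, huv⟩ := generalized_tube_lemma isCompact_singleton
    (isCompact_closure_of_isBounded hb) hV hΩV
  obtain ⟨ε, hε, h⟩ := Metric.nhds_basis_closedBall.mem_iff.1 (hu.mem_nhds (hpu rfl))
  have : ProperSpace P := FiniteDimensional.proper ℝ P
  exact ⟨ε, hε, (prod_mono h hΩv).trans huv,
    (isCompact_closedBall _ _).prod (isCompact_closure_of_isBounded hb)⟩

omit [NormedSpace ℝ P] [NormedSpace ℝ G] in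
lemma integrableOn_slice (hb : Bornology.IsBounded Ω) {f : P × E → G} (hf : ContinuousOn f V)
    {p : P} (hΩV : {p} ×ˢ closure Ω ⊆ V) : IntegrableOn (fun x => f (p, x)) Ω :=
  integrableOn_of_continuousOn_closure hb
    (hf.comp (by fun_prop : Continuous fun x : E => (p, x)).continuousOn fun _ hx => hΩV ⟨rfl, hx⟩)

/-- Differentiation of integrals depending on a parameter. -/
lemma exists_hasFDerivAt_setIntegral [FiniteDimensional ℝ P] (hb : Bornology.IsBounded Ω)
    (hV : IsOpen V) {p₀ : P} (hΩV : {p₀} ×ˢ closure Ω ⊆ V) {f : P × E → ℝ}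
    (hf : ContDiffOn ℝ ∞ f V) :
    ∃ L : P →L[ℝ] ℝ, HasFDerivAt (fun p => ∫ x in Ω, f (p, x)) L p₀ ∧
      ∀ v, L v = ∫ x in Ω, fderiv ℝ f (p₀, x) (v, 0) := by
  obtain ⟨ε, hε, hK, hKc⟩ := exists_closedBall_prod_subset hb hV hΩV
  have h1 : ContDiffOn ℝ ∞ (fderiv ℝ f) V := hf.fderiv_of_isOpen hV (by simp)
  have h2 : ContDiffOn ℝ ∞ (fun q => (fderiv ℝ f q).comp (ContinuousLinearMap.inl ℝ P E)) V :=
    h1.clm_comp contDiffOn_const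
  obtain ⟨C, hC⟩ := hKc.exists_bound_of_continuousOn (h2.continuousOn.mono hK)
  have hs : Metric.closedBall p₀ ε ∈ 𝓝 p₀ := Metric.closedBall_mem_nhds p₀ hε
  have h3 := integrableOn_slice hb h2.continuousOn hΩV
  have hfin : volume Ω < ⊤ := hb.measure_lt_top
  have hae : ∀ᵐ x ∂volume.restrict Ω, x ∈ closure Ω :=
    ae_restrict_of_ae_restrict_of_subset subset_closure
      (ae_restrict_mem isClosed_closure.measurableSet)
  refine ⟨_, hasFDerivAt_integral_of_dominated_of_fderiv_le (F := fun p x => f (p, x))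
    (F' := fun p x => (fderiv ℝ f (p, x)).comp (ContinuousLinearMap.inl ℝ P E)) (bound := fun _ => C)
    hs ?_ (integrableOn_slice hb hf.continuousOn hΩV) h3.aestronglyMeasurable ?_ ?_ ?_, fun v => ?_⟩
  · filter_upwards [hs] with p hp using (integrableOn_slice hb hf.continuousOn
      ((prod_mono (singleton_subset_iff.2 hp) Subset.rfl).trans hK)).aestronglyMeasurable
  · filter_upwards [hae] with x hx p hp using hC (p, x) ⟨hp, hx⟩
  · exact integrableOn_const hfin.ne
  · filter_upwards [hae] with x hx p hp
    have h4 : DifferentiableAt ℝ f (p, x) :=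
      (hf.differentiableOn (by simp)).differentiableAt (hV.mem_nhds (hK ⟨hp, hx⟩))
    exact HasFDerivAt.comp p (f := fun p : P => (p, x)) h4.hasFDerivAt
      (hasFDerivAt_prodMk_left p x)
  · rw [ContinuousLinearMap.integral_apply h3]
    rfl

/-- The mean value inequality in the parameter, whose derivative is bounded on a compact
neighbourhood of the slice. -/
lemma exists_sub_bound [FiniteDimensional ℝ P] (hb : Bornology.IsBounded Ω)
    (hV : IsOpen V) {p₀ : P} (hΩV : {p₀} ×ˢ closure Ω ⊆ V) {g : P × E → G}
    (hgs : ContDiffOn ℝ ∞ g V) :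
    ∃ C : ℝ, ∀ᶠ p in 𝓝 p₀, ∀ x ∈ closure Ω, ‖g (p, x) - g (p₀, x)‖ ≤ C * ‖p - p₀‖ := by
  obtain ⟨ε, hε, hK, hKc⟩ := exists_closedBall_prod_subset hb hV hΩV
  have h1 : ContDiffOn ℝ ∞ (fderiv ℝ g) V := hgs.fderiv_of_isOpen hV (by simp)
  have h2 : ContDiffOn ℝ ∞ (fun q => (fderiv ℝ g q).comp (ContinuousLinearMap.inl ℝ P E)) V :=
    h1.clm_comp contDiffOn_const
  obtain ⟨C, hC⟩ := hKc.exists_bound_of_continuousOn (h2.continuousOn.mono hK)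
  refine ⟨C, ?_⟩
  filter_upwards [Metric.closedBall_mem_nhds p₀ hε] with p hp x hx
  refine Convex.norm_image_sub_le_of_norm_hasFDerivWithin_le (𝕜 := ℝ) (f := fun p => g (p, x))
    (f' := fun p => (fderiv ℝ g (p, x)).comp (ContinuousLinearMap.inl ℝ P E))
    (s := Metric.closedBall p₀ ε) (fun q hq => ?_) (fun q hq => hC (q, x) ⟨hq, hx⟩)
    (convex_closedBall p₀ ε) (Metric.mem_closedBall_self hε.le) hp
  have h4 : DifferentiableAt ℝ g (q, x) :=
    (hgs.differentiableOn (by simp)).differentiableAt (hV.mem_nhds (hK ⟨hq, hx⟩))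
  exact (HasFDerivAt.comp q (f := fun p : P => (p, x)) h4.hasFDerivAt
    (hasFDerivAt_prodMk_left q x)).hasFDerivWithinAt

/-- A smooth family of fields varies at most linearly in every `C^k` norm. -/
lemma exists_jet_sub_bound [FiniteDimensional ℝ P] (hb : Bornology.IsBounded Ω)
    (hV : IsOpen V) {p₀ : P} (hΩV : {p₀} ×ˢ closure Ω ⊆ V) {f : P × E → G}
    (hf : ContDiffOn ℝ ∞ f V) (i : ℕ) :
    ∃ C : ℝ, ∀ᶠ p in 𝓝 p₀, ∀ x ∈ closure Ω, ‖iteratedFDeriv ℝ i (fun x => f (p, x)) x -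
      iteratedFDeriv ℝ i (fun x => f (p₀, x)) x‖ ≤ C * ‖p - p₀‖ :=
  exists_sub_bound hb hV hΩV (contDiffOn_iteratedFDeriv_slice hV hf i)

end Families

section TimeDerivative

variable {Ω : Set E} {A : (E → Val ν) → ℝ}

/-- The derivative of a functional along a smooth curve of fields. -/
lemma HasVarDeriv.hasDerivAt_comp (hne : Ω.Nonempty) (hb : Bornology.IsBounded Ω)
    {I : Set ℝ} (hI : IsOpen I) {z : ℝ → E → Val ν}
    (hz : ContDiffOn ℝ ∞ (fun q : ℝ × E => z q.1 q.2) (I ×ˢ univ)) {t : ℝ} (ht : t ∈ I)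
    {a : E → Val ν} (hA : HasVarDeriv Ω A (z t) a) :
    HasDerivAt (fun τ => A (z τ)) (pairing Ω a fun x => deriv (fun τ => z τ x) t) t := by
  have hV : IsOpen (I ×ˢ (univ : Set E)) := hI.prod isOpen_univ
  have hΩV : {t} ×ˢ closure Ω ⊆ I ×ˢ (univ : Set E) :=
    prod_mono (singleton_subset_iff.2 ht) (subset_univ _)
  have hslice : ∀ s ∈ I, ContDiff ℝ ∞ (z s) := fun s hs => by
    rw [← contDiffOn_univ]
    exact hz.comp (f := fun x : E => (s, x)) (by fun_prop) fun x _ => ⟨hs, mem_univ x⟩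
  have hnear : ∀ᶠ s in 𝓝 (0 : ℝ), t + s ∈ I := by
    have : Filter.Tendsto (fun s => t + s) (𝓝 (0 : ℝ)) (𝓝 t) := by
      simpa using (continuous_const_add t).tendsto 0
    exact this (hI.mem_nhds ht)
  -- The increment z(t + s) − z(t) is O(s) in every C^k norm, so that the functional derivative
  -- expands A along the curve up to o(s), whatever its order k.
  have h1 := hA.isLittleO_family hne (h := fun s => z (t + s) - z t)
    (hnear.mono fun s hs => (hslice _ hs).sub (hslice t ht)) fun k => by
      have := fun i => exists_jet_sub_bound hb hV hΩV hz i
      choose C hC using this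
      refine ⟨∑ i ∈ Finset.range (k + 1), |C i|, ?_⟩
      have htend : Filter.Tendsto (fun s => t + s) (𝓝 (0 : ℝ)) (𝓝 t) := by
        simpa using (continuous_const_add t).tendsto 0
      have hall : ∀ᶠ s in 𝓝 t, ∀ i ∈ Finset.range (k + 1), ∀ x ∈ closure Ω,
          ‖iteratedFDeriv ℝ i (z s) x - iteratedFDeriv ℝ i (z t) x‖ ≤ C i * ‖s - t‖ :=
        (Filter.eventually_all_finset _).2 fun i _ => hC i
      filter_upwards [htend.eventually hall, hnear] with s hs hsI i hi x hx
      have h2 : ContDiffAt ℝ i (z (t + s)) x :=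
        ((hslice _ hsI).of_le (by exact_mod_cast le_top)).contDiffAt
      have h3 : ContDiffAt ℝ i (z t) x :=
        ((hslice _ ht).of_le (by exact_mod_cast le_top)).contDiffAt
      rw [iteratedFDeriv_sub_apply h2 h3]
      have hi' : i ∈ Finset.range (k + 1) := Finset.mem_range.2 (by omega)
      have h4 := hs i hi' x hx
      rw [add_sub_cancel_left] at h4
      refine h4.trans (mul_le_mul_of_nonneg_right ((le_abs_self _).trans ?_) (norm_nonneg _))
      exact Finset.single_le_sum (f := fun i => |C i|) (fun _ _ => abs_nonneg _) hi'
  -- The linear term of the expansion is differentiated under the integral sign.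
  have ha : ContDiffOn ℝ ∞ (fun q : ℝ × E => dot (a q.2) (z q.1 q.2)) (I ×ˢ univ) :=
    (dot.contDiff.comp_contDiffOn (hA.1.comp contDiff_snd).contDiffOn).clm_apply hz
  obtain ⟨L, hL, hL'⟩ := exists_hasFDerivAt_setIntegral hb hV hΩV ha
  have h2 : pairing Ω a (fun x => deriv (fun τ => z τ x) t) = L 1 := by
    rw [hL', pairing_eq]
    refine integral_congr_ae (Filter.Eventually.of_forall fun x => ?_)
    have hd : DifferentiableAt ℝ (fun q : ℝ × E => z q.1 q.2) (t, x) :=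
      (hz.differentiableOn (by simp)).differentiableAt (hV.mem_nhds ⟨ht, mem_univ x⟩)
    have hd' : DifferentiableAt ℝ (fun q : ℝ × E => dot (a q.2) (z q.1 q.2)) (t, x) :=
      (ha.differentiableOn (by simp)).differentiableAt (hV.mem_nhds ⟨ht, mem_univ x⟩)
    have hl : HasDerivAt (fun τ : ℝ => (τ, x)) ((1 : ℝ), (0 : E)) t :=
      (hasDerivAt_id t).prodMk (hasDerivAt_const t x)
    have e1 := HasFDerivAt.comp_hasDerivAt (f := fun τ : ℝ => (τ, x)) t hd.hasFDerivAt hl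
    have e2 := HasFDerivAt.comp_hasDerivAt (f := fun τ : ℝ => (τ, x)) t hd'.hasFDerivAt hl
    have e3 := (dot (a x)).hasFDerivAt.comp_hasDerivAt t e1
    have e4 : deriv (fun τ => z τ x) t = _ := e1.deriv
    show dot (a x) (deriv (fun τ => z τ x) t) = _
    rw [e4]
    exact e3.unique e2
  have h3 : HasDerivAt (fun τ => pairing Ω a (z τ)) (L 1) t := by
    simp only [pairing_eq]
    exact hL.hasDerivAt
  rw [h2, hasDerivAt_iff_isLittleO_nhds_zero]
  rw [hasDerivAt_iff_isLittleO_nhds_zero] at h3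
  refine (h1.add h3).congr' ?_ Filter.EventuallyEq.rfl
  filter_upwards [hnear] with s hs
  have e1 : pairing Ω a (z (t + s)) = pairing Ω a (z t) + pairing Ω a (z (t + s) - z t) := by
    rw [← pairing_add hb hA.1.continuous (hslice t ht).continuous
      (((hslice _ hs).continuous.sub (hslice t ht).continuous :) : Continuous (z (t + s) - z t)),
      add_sub_cancel]
  rw [e1, add_sub_cancel]
  ring

end TimeDerivative

/-! ### The evolution of observables. -/

namespace Mixture

variable {m : Mixture ν n} {Ω : Set E} {σ : Measure E} {nrm : E → E} {z a : E → Val ν}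
  {A : (E → Val ν) → ℝ}

/-- The integral of `dot_rate`. The identity `bracketDensity_eq`, applied to δH and a in this order,
accounts for the Hamiltonian field, and the divergence theorem converts the two divergences into the
boundary contributions. -/
lemma pairing_rate (hm : m.Admissible) (hΩ : IsLipschitzDomain Ω σ nrm) (hz : z ∈ m.states Ω)
    (hA : m.IsObservable Ω A) : pairing Ω (varDeriv Ω A z) (m.rate z) =
      m.poisson Ω A (m.energy Ω) z - m.poissonBdry Ω σ nrm A (m.energy Ω) z
        + m.dissipation Ω A (m.entropy Ω) z - m.dissipationBdry Ω σ nrm A (m.entropy Ω) z := by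
  have ha := contDiff_varDeriv (hA z hz)
  set a := varDeriv Ω A z with ha_def
  have hV := isOpen_regular hm hz
  have hr := closure_subset_regular hz
  have he := contDiffOn_energyGrad hm hz
  have hs := contDiffOn_entropyGrad hm hz
  have hy := contDiffOn_carriedField hm hz
  have hPF := contDiffOn_poissonFlux hm hz ha he
  have hDF := contDiffOn_dissipationFlux hm hz ha hs
  have hint : ∀ {f : E → ℝ}, ContDiffOn ℝ ∞ f (m.regular z) → IntegrableOn f Ω := fun hf =>
    integrableOn_of_continuousOn_closure hΩ.isBounded (hf.continuousOn.mono hr)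
  have h1 := hint (contDiffOn_bracketDensity hV hy hz.1.contDiffOn ha.contDiffOn he)
  have h2 := hint (contDiffOn_dissipationDensity hm hz ha.contDiffOn hs)
  have h3 := hint (contDiffOn_div hV hPF)
  have h4 := hint (contDiffOn_div hV hDF)
  have h13 : IntegrableOn (fun x => bracketDensity (m.carriedField z) z a (m.energyGrad z) x -
    div (m.poissonFlux z a (m.energyGrad z)) x) Ω := h1.sub h3
  have h132 : IntegrableOn (fun x => bracketDensity (m.carriedField z) z a (m.energyGrad z) x -
    div (m.poissonFlux z a (m.energyGrad z)) x +
    m.dissipationDensity z a (m.entropyGrad z) x) Ω := h13.add h2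
  rw [pairing_eq, poisson_eq hm hΩ.isOpen hz (hA z hz) (isObservable_energy hm hΩ z hz)
      ha.contDiffOn (fun _ _ => rfl) he (varDeriv_energy hm hΩ hz),
    dissipation_eq hm hΩ.isOpen hz (hA z hz) (isObservable_entropy hm hΩ z hz)
      ha.contDiffOn (fun _ _ => rfl) hs (varDeriv_entropy hm hΩ hz),
    poissonBdry_energy hm hΩ hz, dissipationBdry_entropy hm hΩ hz,
    ← hΩ.setIntegral_div_of_contDiffOn hV hr (hPF.of_le (by simp)),
    ← hΩ.setIntegral_div_of_contDiffOn hV hr (hDF.of_le (by simp)),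
    ← integral_sub h1 h3, ← integral_add h13 h2, ← integral_sub h132 h4]
  refine setIntegral_congr_fun hΩ.isOpen.measurableSet fun x hx => ?_
  have hx' := hr (subset_closure hx)
  have hd : ∀ {F : Type} [NormedAddCommGroup F] [NormedSpace ℝ F] {f : E → F},
      ContDiffOn ℝ ∞ f (m.regular z) → DifferentiableAt ℝ f x := fun h =>
    (h.differentiableOn (by simp)).differentiableAt (hV.mem_nhds hx')
  have h5 := bracketDensity_eq (z := z) (hd hy) (hd he) (hd ha.contDiffOn)
  rw [bracketDensity_antisymm] at h5
  beta_reduce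
  rw [dot_rate hm hz hx' ha]
  have h6 : div (m.poissonFlux z a (m.energyGrad z)) x =
    div (fun x => dot (a x) (m.carriedField z x) • mom (m.energyGrad z) x) x := rfl
  rw [h6]
  linarith

theorem hasDerivAt_of_isSolution (hm : m.Admissible) (hΩ : IsLipschitzDomain Ω σ nrm)
    {I : Set ℝ} {z : ℝ → E → Val ν} (hI : IsOpen I) (hz : m.IsSolution Ω I z)
    (hA : m.IsObservable Ω A) {t : ℝ} (ht : t ∈ I) :
    HasDerivAt (fun τ => A (z τ))
      (m.poisson Ω A (m.energy Ω) (z t) - m.poissonBdry Ω σ nrm A (m.energy Ω) (z t)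
        + m.dissipation Ω A (m.entropy Ω) (z t)
        - m.dissipationBdry Ω σ nrm A (m.entropy Ω) (z t)) t := by
  rw [← pairing_rate hm hΩ (hz.mem_states t ht) hA]
  have h := (hasVarDeriv_varDeriv (hA _ (hz.mem_states t ht))).hasDerivAt_comp
    hΩ.isConnected.nonempty hΩ.isBounded hI hz.smooth ht
  convert h using 1
  rw [pairing_eq, pairing_eq]
  refine setIntegral_congr_fun hΩ.isOpen.measurableSet fun x hx => ?_
  have hd : DifferentiableAt ℝ (fun q : ℝ × E => z q.1 q.2) (t, x) :=
    (hz.smooth.differentiableOn (by simp)).differentiableAt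
      ((hI.prod isOpen_univ).mem_nhds ⟨ht, mem_univ x⟩)
  have e1 : DifferentiableAt ℝ (fun τ => z τ x) t :=
    DifferentiableAt.comp t (f := fun τ : ℝ => (τ, x)) hd (by fun_prop)
  have e2 := e1.hasDerivAt
  have h1 : m.rate (z t) x = deriv (fun τ => z τ x) t := by
    refine Prod.ext (funext fun α => ?_) (Prod.ext ?_ ?_)
    · have := (rhoL α).hasFDerivAt.comp_hasDerivAt t e2
      exact (hz.mass_balance t ht x hx α).symm.trans this.deriv
    · have := momL.hasFDerivAt.comp_hasDerivAt t e2
      exact (hz.momentum_balance t ht x hx).symm.trans this.deriv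
    · have := scaL.hasFDerivAt.comp_hasDerivAt t e2
      exact (hz.scalar_balance t ht x hx).symm.trans this.deriv
  simp only [h1]

end Mixture

end OpenMixture

end

noncomputable section
namespace OpenMixture

variable {ν n : ℕ}

/-! ### Directional derivatives along vector fields -/

section DirDeriv

variable {F : Type*} [NormedAddCommGroup F] [NormedSpace ℝ F]

/-- The derivative of `f` along the vector field `u`. -/
def dirDeriv (u : E → E) (f : E → F) (x : E) : F := fderiv ℝ f x (u x)

lemma contDiff_dirDeriv {u : E → E} {f : E → F} (hu : ContDiff ℝ ∞ u) (hf : ContDiff ℝ ∞ f) :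
    ContDiff ℝ ∞ (dirDeriv u f) :=
  (hf.fderiv_right (by simp)).clm_apply hu

/-- The commutator of two directional derivatives. -/
lemma dirDeriv_comm {u v : E → E} {f : E → F} (hu : ContDiff ℝ ∞ u) (hv : ContDiff ℝ ∞ v)
    (hf : ContDiff ℝ ∞ f) (x : E) :
    dirDeriv v (dirDeriv u f) x - dirDeriv u (dirDeriv v f) x =
      fderiv ℝ f x (dirDeriv v u x - dirDeriv u v x) := by
  have h1 : DifferentiableAt ℝ (fderiv ℝ f) x :=
    (hf.fderiv_right (m := ∞) (by simp)).differentiable (by simp) x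
  have h2 : ∀ {u : E → E}, ContDiff ℝ ∞ u → ∀ w, fderiv ℝ (dirDeriv u f) x w =
      fderiv ℝ (fderiv ℝ f) x w (u x) + fderiv ℝ f x (fderiv ℝ u x w) := fun hu w => by
    rw [show dirDeriv _ f = fun x => fderiv ℝ f x (_ : E) from rfl,
      fderiv_clm_apply h1 (hu.differentiable (by simp) x)]
    simp [add_comm]
  have h3 : IsSymmSndFDerivAt ℝ f x :=
    hf.contDiffAt.isSymmSndFDerivAt (by
      simpa only [minSmoothness_of_isRCLikeNormedField] using ENat.LEInfty.out)
  rw [dirDeriv, dirDeriv, h2 hu, h2 hv, h3.eq (v x) (u x), map_sub]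
  simp only [dirDeriv]
  abel

lemma dirDeriv_add {u : E → E} {f g : E → F} {x : E} (hf : DifferentiableAt ℝ f x)
    (hg : DifferentiableAt ℝ g x) :
    dirDeriv u (fun x => f x + g x) x = dirDeriv u f x + dirDeriv u g x := by
  simp [dirDeriv, fderiv_fun_add hf hg]

lemma dirDeriv_sub {u : E → E} {f g : E → F} {x : E} (hf : DifferentiableAt ℝ f x)
    (hg : DifferentiableAt ℝ g x) :
    dirDeriv u (fun x => f x - g x) x = dirDeriv u f x - dirDeriv u g x := by
  simp [dirDeriv, fderiv_fun_sub hf hg]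

lemma dirDeriv_mul {u : E → E} {f g : E → ℝ} {x : E} (hf : DifferentiableAt ℝ f x)
    (hg : DifferentiableAt ℝ g x) :
    dirDeriv u (fun x => f x * g x) x = f x * dirDeriv u g x + g x * dirDeriv u f x := by
  simp [dirDeriv, fderiv_fun_mul hf hg]

lemma contDiff_div {u : E → E} (hu : ContDiff ℝ ∞ u) : ContDiff ℝ ∞ (div u) := by
  rw [← contDiffOn_univ] at hu ⊢
  exact contDiffOn_div isOpen_univ hu

lemma dirDeriv_dot {u : E → E} {a b : E → Val ν} {x : E} (ha : DifferentiableAt ℝ a x)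
    (hb : DifferentiableAt ℝ b x) : dirDeriv u (fun x => dot (a x) (b x)) x =
      dot (a x) (dirDeriv u b x) + dot (dirDeriv u a x) (b x) := by
  rw [dirDeriv, fderiv_dot ha hb, dot_comm (b x)]
  rfl

lemma contDiff_dot {a b : E → Val ν} (ha : ContDiff ℝ ∞ a) (hb : ContDiff ℝ ∞ b) :
    ContDiff ℝ ∞ fun x => dot (a x) (b x) :=
  (dot.contDiff.comp ha).clm_apply hb

end DirDeriv

/-! ### The pointwise identity behind the Jacobi identity -/

section Jacobi

variable {y z k a b c e : E → Val ν} {u v w : E → E}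

/-- The variation of `⟨·, y⟩` in the second bracket. -/
def momVariation (y k e : E → Val ν) (w : E → E) (x : E) : ℝ :=
  dot (dirDeriv w e x) (y x) - div w x * dot (e x) (k x)

/-- The terms of the iterated bracket in which `e` is differentiated. -/
def iteratedTerm (y z k e : E → Val ν) (v w : E → E) (x : E) : ℝ :=
  dirDeriv v (fun x => dot (e x) (div w x • k x + dirDeriv w (fun x => y x - z x) x)) x
    + div w x * dot (dirDeriv v e x) (y x) + dot (dirDeriv v e x) (dirDeriv w z x)
    - div (fun x => momVariation y k e v x • w x) x

lemma contDiff_momVariation (hy : ContDiff ℝ ∞ y) (hk : ContDiff ℝ ∞ k) (he : ContDiff ℝ ∞ e)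
    (hw : ContDiff ℝ ∞ w) : ContDiff ℝ ∞ (momVariation y k e w) :=
  (contDiff_dot (contDiff_dirDeriv hw he) hy).sub ((contDiff_div hw).mul (contDiff_dot he hk))

/-- All terms containing k are symmetric in v and w. The others are second directional derivatives
of y − z and of e, whose antisymmetric parts are derivatives along the commutator of v and w;
together they form θ_e evaluated on it. -/
lemma iteratedTerm_sub (hy : ContDiff ℝ ∞ y) (hz : ContDiff ℝ ∞ z) (hk : ContDiff ℝ ∞ k)
    (he : ContDiff ℝ ∞ e) (hv : ContDiff ℝ ∞ v) (hw : ContDiff ℝ ∞ w) (x : E) :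
    iteratedTerm y z k e v w x - iteratedTerm y z k e w v x =
      transport y z e x (dirDeriv v w x - dirDeriv w v x) := by
  have hd : ∀ {G : Type} [NormedAddCommGroup G] [NormedSpace ℝ G] {f : E → G},
      ContDiff ℝ ∞ f → DifferentiableAt ℝ f x := fun h => h.differentiable (by simp) x
  have hn : ContDiff ℝ ∞ fun x => y x - z x := hy.sub hz
  have key : ∀ {v w : E → E}, ContDiff ℝ ∞ v → ContDiff ℝ ∞ w → iteratedTerm y z k e v w x =
      (div w x * dirDeriv v (fun x => dot (e x) (k x)) x +
        dot (e x) (k x) * dirDeriv v (div w) x + div w x * div v x * dot (e x) (k x) +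
        dot (e x) (k x) * dirDeriv w (div v) x + div v x * dirDeriv w (fun x => dot (e x) (k x)) x) +
      (dot (e x) (dirDeriv v (dirDeriv w fun x => y x - z x) x) -
        dot (dirDeriv w (dirDeriv v e) x) (y x)) := fun {v w} hv hw => by
    have h1 : (fun x => dot (e x) (div w x • k x + dirDeriv w (fun x => y x - z x) x)) =
        fun x => div w x * dot (e x) (k x) + dot (e x) (dirDeriv w (fun x => y x - z x) x) := by
      ext1 x; simp
    have h2 := dirDeriv_add (u := v) (hd ((contDiff_div hw).mul (contDiff_dot he hk)))
      (hd (contDiff_dot he (contDiff_dirDeriv hw hn)))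
    have h3 : dirDeriv w (momVariation y k e v) x = _ := dirDeriv_sub (u := w)
      (hd (contDiff_dot (contDiff_dirDeriv hv he) hy))
      (hd ((contDiff_div hv).mul (contDiff_dot he hk)))
    have h4 := dirDeriv_sub (u := w) (hd hy) (hd hz)
    rw [iteratedTerm, h1, h2, div_smul (hd (contDiff_momVariation hy hk he hv)) (hd hw),
      show fderiv ℝ (momVariation y k e v) x (w x) = dirDeriv w (momVariation y k e v) x from rfl,
      h3, dirDeriv_mul (hd (contDiff_div hw)) (hd (contDiff_dot he hk)),
      dirDeriv_mul (hd (contDiff_div hv)) (hd (contDiff_dot he hk)),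
      dirDeriv_dot (hd he) (hd (contDiff_dirDeriv hw hn)),
      dirDeriv_dot (hd (contDiff_dirDeriv hv he)) (hd hy), h4, momVariation, map_sub]
    ring
  have h5 := dirDeriv_comm hw hv hn x
  have h6 := dirDeriv_comm hw hv he x
  have h7 : dot (e x) (fderiv ℝ (fun x => y x - z x) x (dirDeriv v w x - dirDeriv w v x)) =
      dot (e x) (fderiv ℝ y x (dirDeriv v w x - dirDeriv w v x)) -
      dot (e x) (fderiv ℝ z x (dirDeriv v w x - dirDeriv w v x)) := by
    rw [fderiv_fun_sub (hd hy) (hd hz), ← map_sub]; rfl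
  have h8 : dot (fderiv ℝ e x (dirDeriv v w x - dirDeriv w v x)) (y x) =
      dot (dirDeriv v (dirDeriv w e) x) (y x) - dot (dirDeriv w (dirDeriv v e) x) (y x) := by
    rw [← h6, map_sub]; rfl
  rw [← h5, map_sub] at h7
  rw [key hv hw, key hw hv, transport_apply, fderiv_dot (hd he) (hd hy), dot_comm (y x), h8]
  linear_combination h7

/-- The derivative of the transported quantities along the Hamiltonian vector field of `a`. -/
def hamFieldDeriv (y z k a : E → Val ν) (x : E) : Val ν :=
  div (mom a) x • (k x + y x) + fderiv ℝ y x (mom a x) +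
    momEmb ((InnerProductSpace.toDual ℝ E).symm (transport y z a x))

lemma contDiff_transport (hy : ContDiff ℝ ∞ y) (hz : ContDiff ℝ ∞ z) (ha : ContDiff ℝ ∞ a) :
    ContDiff ℝ ∞ (transport y z a) := by
  rw [← contDiffOn_univ]
  exact Mixture.contDiffOn_transport isOpen_univ hy.contDiffOn hz.contDiffOn ha.contDiffOn

lemma contDiff_hamField (hy : ContDiff ℝ ∞ y) (hz : ContDiff ℝ ∞ z) (ha : ContDiff ℝ ∞ a) :
    ContDiff ℝ ∞ (hamField y z a) :=
  (((contDiff_div (contDiff_mom ha)).smul hy).add (contDiff_dirDeriv (contDiff_mom ha) hz)).add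
    (momEmb.contDiff.comp ((InnerProductSpace.toDual ℝ E).symm.contDiff.comp
      (contDiff_transport hy hz ha)))

lemma contDiff_hamFieldDeriv (hy : ContDiff ℝ ∞ y) (hz : ContDiff ℝ ∞ z) (hk : ContDiff ℝ ∞ k)
    (ha : ContDiff ℝ ∞ a) : ContDiff ℝ ∞ (hamFieldDeriv y z k a) :=
  (((contDiff_div (contDiff_mom ha)).smul (hk.add hy)).add
    (contDiff_dirDeriv (contDiff_mom ha) hy)).add
    (momEmb.contDiff.comp ((InnerProductSpace.toDual ℝ E).symm.contDiff.comp
      (contDiff_transport hy hz ha)))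

/-- `hamFieldDeriv` exceeds `hamField` by div(a_M) k plus the derivative of y − z along a_M, the
covector θ_a being common to both. Of ⟨e, X_a⟩ the derivative of X_a cancels; only e is
differentiated, and the momentum component of its derivative meets θ_a. -/
lemma transport_hamField (hy : ContDiff ℝ ∞ y) (hz : ContDiff ℝ ∞ z) (hk : ContDiff ℝ ∞ k)
    (ha : ContDiff ℝ ∞ a) (he : ContDiff ℝ ∞ e) (v : E → E) (x : E) :
    transport (hamFieldDeriv y z k a) (hamField y z a) e x (v x) -
      div (fun x => momVariation y k e v x • mom a x) x =
    iteratedTerm y z k e v (mom a) x + transport y z a x (dirDeriv v (mom e) x) := by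
  have hd : ∀ {G : Type} [NormedAddCommGroup G] [NormedSpace ℝ G] {f : E → G},
      ContDiff ℝ ∞ f → DifferentiableAt ℝ f x := fun h => h.differentiable (by simp) x
  have hn : ContDiff ℝ ∞ fun x => y x - z x := hy.sub hz
  have hX := contDiff_hamField hy hz ha
  have h1 : (fun x => dot (e x) (hamFieldDeriv y z k a x)) = fun x =>
      dot (e x) (div (mom a) x • k x + dirDeriv (mom a) (fun x => y x - z x) x) +
      dot (e x) (hamField y z a x) := by
    ext1 x
    rw [← map_add]
    congr 1
    rw [hamFieldDeriv, hamField, dirDeriv, fderiv_fun_sub (hy.differentiable (by simp) x)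
      (hz.differentiable (by simp) x)]
    simp only [sub_apply]
    module
  have h2 : ContDiff ℝ ∞ fun x => dot (e x) (div (mom a) x • k x +
      dirDeriv (mom a) (fun x => y x - z x) x) :=
    contDiff_dot he (((contDiff_div (contDiff_mom ha)).smul hk).add
      (contDiff_dirDeriv (contDiff_mom ha) hn))
  have h3 : dot (dirDeriv v e x) (hamField y z a x) =
      div (mom a) x * dot (dirDeriv v e x) (y x) + dot (dirDeriv v e x) (dirDeriv (mom a) z x) +
        transport y z a x (dirDeriv v (mom e) x) := by
    rw [hamField, map_add, map_add, map_smul, dot_momEmb, real_inner_comm,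
      InnerProductSpace.toDual_symm_apply, smul_eq_mul]
    rw [show dirDeriv v (mom e) x = (dirDeriv v e x).2.1 from fderiv_mom (hd he) _]
    rfl
  rw [transport_apply, h1, fderiv_fun_add (hd h2) (hd (contDiff_dot he hX)), add_apply,
    fderiv_dot (hd he) (hd hX), dot_comm (hamField y z a x),
    show fderiv ℝ e x (v x) = dirDeriv v e x from rfl, h3, iteratedTerm]
  simp only [dirDeriv]
  ring

/-- The pointwise identity behind the Jacobi identity. -/
lemma bracketDensity_jacobi (hy : ContDiff ℝ ∞ y) (hz : ContDiff ℝ ∞ z) (hk : ContDiff ℝ ∞ k)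
    (ha : ContDiff ℝ ∞ a) (hb : ContDiff ℝ ∞ b) (hc : ContDiff ℝ ∞ c) (x : E) :
    (bracketDensity (hamFieldDeriv y z k a) (hamField y z a) b c x -
      div (fun x => (momVariation y k b (mom c) x - momVariation y k c (mom b) x) • mom a x) x) +
    (bracketDensity (hamFieldDeriv y z k b) (hamField y z b) c a x -
      div (fun x => (momVariation y k c (mom a) x - momVariation y k a (mom c) x) • mom b x) x) +
    (bracketDensity (hamFieldDeriv y z k c) (hamField y z c) a b x -
      div (fun x => (momVariation y k a (mom b) x - momVariation y k b (mom a) x) • mom c x) x)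
      = 0 := by
  have hd : ∀ {G : Type} [NormedAddCommGroup G] [NormedSpace ℝ G] {f : E → G},
      ContDiff ℝ ∞ f → DifferentiableAt ℝ f x := fun h => h.differentiable (by simp) x
  have hm := @contDiff_mom ν
  -- Each summand contains θ_a on the commutator of c_M and b_M. In the cyclic sum the two terms
  -- `iteratedTerm` with e = a produce the same with the opposite sign.
  have key : ∀ {a b c : E → Val ν}, ContDiff ℝ ∞ a → ContDiff ℝ ∞ b → ContDiff ℝ ∞ c →
      bracketDensity (hamFieldDeriv y z k a) (hamField y z a) b c x -
      div (fun x => (momVariation y k b (mom c) x - momVariation y k c (mom b) x) • mom a x) x =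
      iteratedTerm y z k b (mom c) (mom a) x + transport y z a x (dirDeriv (mom c) (mom b) x) -
      (iteratedTerm y z k c (mom b) (mom a) x + transport y z a x (dirDeriv (mom b) (mom c) x)) :=
    fun {a b c} ha hb hc => by
    rw [← transport_hamField hy hz hk ha hb, ← transport_hamField hy hz hk ha hc, bracketDensity]
    have h1 : ContDiff ℝ ∞ fun x => momVariation y k b (mom c) x • mom a x :=
      (contDiff_momVariation hy hk hb (hm hc)).smul (hm ha)
    have h2 : ContDiff ℝ ∞ fun x => momVariation y k c (mom b) x • mom a x :=
      (contDiff_momVariation hy hk hc (hm hb)).smul (hm ha)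
    simp only [sub_smul]
    rw [div_sub (hd h1) (hd h2)]
    ring
  have h1 := iteratedTerm_sub hy hz hk ha (hm hb) (hm hc) x
  have h2 := iteratedTerm_sub hy hz hk hb (hm hc) (hm ha) x
  have h3 := iteratedTerm_sub hy hz hk hc (hm ha) (hm hb) x
  rw [map_sub] at h1 h2 h3
  rw [key ha hb hc, key hb hc ha, key hc ha hb]
  linear_combination h1 + h2 + h3

end Jacobi

end OpenMixture

end

noncomputable section
namespace OpenMixture

variable {ν n : ℕ}

/-! ### Smooth dependence of integrals on a parameter -/

section Parameter

variable {Ω : Set E} {V : Set (ℝ × E)} {S : Set ℝ}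

lemma exists_hasDerivAt_setIntegral (hb : Bornology.IsBounded Ω) (hV : IsOpen V)
    {s : ℝ} (hΩV : {s} ×ˢ closure Ω ⊆ V) {f : ℝ × E → ℝ} (hf : ContDiffOn ℝ ∞ f V) :
    HasDerivAt (fun s => ∫ x in Ω, f (s, x)) (∫ x in Ω, fderiv ℝ f (s, x) (1, 0)) s := by
  obtain ⟨L, h1, h2⟩ := exists_hasFDerivAt_setIntegral hb hV hΩV hf
  rw [← h2 1]
  exact h1.hasDerivAt

/-- The derivative is again the integral of a smooth integrand; induction on the order of
differentiability. -/
lemma contDiffOn_setIntegral (hb : Bornology.IsBounded Ω) (hV : IsOpen V) (hS : IsOpen S)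
    (hΩV : S ×ˢ closure Ω ⊆ V) {f : ℝ × E → ℝ} (hf : ContDiffOn ℝ ∞ f V) :
    ContDiffOn ℝ ∞ (fun s => ∫ x in Ω, f (s, x)) S := by
  have h1 : ∀ {f : ℝ × E → ℝ}, ContDiffOn ℝ ∞ f V → ∀ s ∈ S, HasDerivAt
      (fun s => ∫ x in Ω, f (s, x)) (∫ x in Ω, fderiv ℝ f (s, x) (1, 0)) s := fun hf s hs =>
    exists_hasDerivAt_setIntegral hb hV
      ((prod_mono (singleton_subset_iff.2 hs) Subset.rfl).trans hΩV) hf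
  have h2 : ∀ k : ℕ, ∀ f : ℝ × E → ℝ, ContDiffOn ℝ ∞ f V →
      ContDiffOn ℝ k (fun s => ∫ x in Ω, f (s, x)) S := fun k => by
    induction k with
    | zero => exact fun f hf => contDiffOn_zero.2 fun s hs =>
        (h1 hf s hs).continuousAt.continuousWithinAt
    | succ k ih =>
      intro f hf
      rw [Nat.cast_succ, contDiffOn_succ_iff_deriv_of_isOpen hS]
      refine ⟨fun s hs => (h1 hf s hs).differentiableAt.differentiableWithinAt, by simp, ?_⟩
      have h3 : ContDiffOn ℝ ∞ (fun q => fderiv ℝ f q (1, 0)) V :=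
        (hf.fderiv_of_isOpen hV (by simp)).clm_apply contDiffOn_const
      exact (ih _ h3).congr fun s hs => (h1 hf s hs).deriv
  exact contDiffOn_infty.2 fun k => h2 k f hf

end Parameter

/-! ### The second variation of a local functional -/

section LocalVariation

variable {Ω : Set E} {J : Type*} [NormedAddCommGroup J] [NormedSpace ℝ J] {W : Set (E × J)}
  {β : E × J → Val ν} {jz : E → J}

/-- The linearisation of β along the jet of z makes sense only near the closed domain. It is
extended, so that the resulting differential operator maps smooth fields on all of space to such
fields. -/
lemma exists_contDiff_linearization (hW : IsOpen W) (hβ : ContDiffOn ℝ ∞ β W)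
    (hj : ContDiff ℝ ∞ jz) (hz : ∀ x ∈ closure Ω, (x, jz x) ∈ W) :
    ∃ L : E → J →L[ℝ] Val ν, ContDiff ℝ ∞ L ∧
      ∀ x ∈ closure Ω, ∀ v, L x v = fderiv ℝ β (x, jz x) (0, v) := by
  have h1 : ContDiff ℝ ∞ fun x => (x, jz x) := contDiff_id.prodMk hj
  have h2 : ContDiffOn ℝ ∞ (fun x => (fderiv ℝ β (x, jz x)).comp (ContinuousLinearMap.inr ℝ E J))
      ((fun x => (x, jz x)) ⁻¹' W) :=
    ((hβ.fderiv_of_isOpen hW (by simp)).comp h1.contDiffOn fun x hx => hx).clm_comp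
      contDiffOn_const
  obtain ⟨L, hL, h⟩ := exists_contDiff_eventuallyEq (r := ⊤) isClosed_closure
    (hW.preimage h1.continuous) hz h2
  rw [eventually_nhdsSet_iff_forall] at h
  refine ⟨L, hL, fun x hx v => ?_⟩
  rw [(h x hx).self_of_nhds]
  rfl

/-- A two-parameter affine family of jets. -/
def jetFamily (jz jh jk : E → J) (q : (ℝ × ℝ) × E) : E × J :=
  (q.2, jz q.2 + q.1.1 • jh q.2 + q.1.2 • jk q.2)

lemma contDiff_jetFamily {jh jk : E → J} (hj : ContDiff ℝ ∞ jz) (hh : ContDiff ℝ ∞ jh)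
    (hk : ContDiff ℝ ∞ jk) : ContDiff ℝ ∞ (jetFamily jz jh jk) := by
  unfold jetFamily
  fun_prop

lemma jetFamily_zero (jz jh jk : E → J) (x : E) : jetFamily jz jh jk (0, x) = (x, jz x) := by
  simp [jetFamily]

/-- The family is affine in its parameters, so that the derivative can be read off on the line s ↦ s
p. -/
lemma fderiv_jetFamily (hW : IsOpen W) (hβ : ContDiffOn ℝ ∞ β W) (hj : ContDiff ℝ ∞ jz)
    {jh jk : E → J} (hh : ContDiff ℝ ∞ jh) (hk : ContDiff ℝ ∞ jk) {x : E} (hx : (x, jz x) ∈ W)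
    (p : ℝ × ℝ) :
    fderiv ℝ (β ∘ jetFamily jz jh jk) (0, x) (p, 0)
      = fderiv ℝ β (x, jz x) (0, p.1 • jh x + p.2 • jk x) := by
  set g := jetFamily jz jh jk with hg
  have hgd : ContDiff ℝ ∞ g := contDiff_jetFamily hj hh hk
  have hg0 : g (0, x) = (x, jz x) := jetFamily_zero jz jh jk x
  have hβd : DifferentiableAt ℝ β (g (0, x)) := by
    rw [hg0]
    exact (hβ.differentiableOn (by simp)).differentiableAt (hW.mem_nhds hx)
  have h1 : HasDerivAt (fun s : ℝ => ((s • p, x) : (ℝ × ℝ) × E)) (p, 0) 0 := by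
    have := ((hasDerivAt_id (0 : ℝ)).smul_const p).prodMk (hasDerivAt_const (0 : ℝ) x)
    simpa using this
  have h2 : HasDerivAt (fun s : ℝ => g (s • p, x)) (fderiv ℝ g (0, x) (p, 0)) 0 := by
    have h3 : HasFDerivAt g (fderiv ℝ g (0, x)) ((0 : ℝ) • p, x) := by
      rw [zero_smul]
      exact (hgd.differentiable (by simp) _).hasFDerivAt
    exact h3.comp_hasDerivAt (0 : ℝ) h1
  have h4 : HasDerivAt (fun s : ℝ => g (s • p, x)) (0, p.1 • jh x + p.2 • jk x) 0 := by
    have e : (fun s : ℝ => g (s • p, x)) =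
        fun s : ℝ => (x, jz x + s • (p.1 • jh x + p.2 • jk x)) := by
      ext1 s
      simp [hg, jetFamily, smul_smul, smul_add, add_assoc]
    rw [e]
    have := (hasDerivAt_const (0 : ℝ) x).prodMk
      (((hasDerivAt_id (0 : ℝ)).smul_const (p.1 • jh x + p.2 • jk x)).const_add (jz x))
    simpa using this
  have h5 : fderiv ℝ (β ∘ g) (0, x) = _ :=
    fderiv_comp (0, x) hβd (hgd.differentiable (by simp) _)
  rw [h5, ContinuousLinearMap.comp_apply, h2.unique h4, hg0]

end LocalVariation

section Jets

variable {z h k : E → Val ν}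

lemma contDiff_jet (hz : ContDiff ℝ ∞ z) (r : ℕ) : ContDiff ℝ ∞ (Mixture.jet r z) :=
  contDiff_pi.2 fun i => hz.iteratedFDeriv_right (m := ∞) (i := (i : ℕ)) (by
    exact_mod_cast le_top)

lemma jet_span2 (hz : ContDiff ℝ ∞ z) (hh : ContDiff ℝ ∞ h) (hk : ContDiff ℝ ∞ k) (r : ℕ)
    (p : ℝ × ℝ) (x : E) : Mixture.jet r (z + span2 h k p) x =
      Mixture.jet r z x + p.1 • Mixture.jet r h x + p.2 • Mixture.jet r k x := by
  ext1 i
  have hc : ∀ {f : E → Val ν}, ContDiff ℝ ∞ f → ContDiffAt ℝ (i : ℕ) f x := fun hf =>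
    (hf.of_le (by exact_mod_cast le_top)).contDiffAt
  have h1 : ContDiff ℝ ∞ (p.1 • h) := hh.const_smul p.1
  have h2 : ContDiff ℝ ∞ (p.2 • k) := hk.const_smul p.2
  have h3 : ContDiff ℝ ∞ (p.1 • h + p.2 • k) := h1.add h2
  simp only [Mixture.jet, Pi.add_apply, Pi.smul_apply, span2]
  rw [iteratedFDeriv_add_apply (hc hz) (hc h3), iteratedFDeriv_add_apply (hc h1) (hc h2),
    iteratedFDeriv_const_smul_apply (hc hh), iteratedFDeriv_const_smul_apply (hc hk), add_assoc]

lemma jet_eq_zero (r : ℕ) {x : E} (hx : x ∉ tsupport h) : Mixture.jet r h x = 0 := by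
  ext1 i
  have : x ∉ tsupport (iteratedFDeriv ℝ (i : ℕ) h) :=
    fun h' => hx (tsupport_iteratedFDeriv_subset _ h')
  exact image_eq_zero_of_notMem_tsupport this

end Jets

section SecondVariation

variable {m : Mixture ν n} {Ω : Set E} {z : E → Val ν} {A : (E → Val ν) → ℝ}

lemma eventually_span2_mem_states (hm : m.Admissible) (hb : Bornology.IsBounded Ω)
    (hz : z ∈ m.states Ω) {h k : E → Val ν} (hh : ContDiff ℝ ∞ h) (hk : ContDiff ℝ ∞ k) :
    ∀ᶠ p in 𝓝 (0 : ℝ × ℝ), z + span2 h k p ∈ m.states Ω := by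
  obtain ⟨C, hC⟩ := span2_jet_bound hb hh hk 0
  exact (tendsto_jetFilter (h := span2 h k) (Filter.Eventually.of_forall (contDiff_span2 hh hk))
    (Filter.Eventually.of_forall hC)).eventually (Mixture.eventually_add_mem_states hm hb hz 0)

/-- The second variation of a local functional. -/
lemma Mixture.IsLocal.exists_variation (hm : m.Admissible) (hb : Bornology.IsBounded Ω)
    (hz : z ∈ m.states Ω) (hA : m.IsLocal Ω A) : ∃ loc : (E → Val ν) → E → Val ν,
      (∀ h, ContDiff ℝ ∞ h → ContDiff ℝ ∞ (loc h)) ∧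
      (∀ h, ∀ x ∉ tsupport h, loc h x = 0) ∧
      ∀ h k, ContDiff ℝ ∞ h → ContDiff ℝ ∞ k → ∃ (V : Set ((ℝ × ℝ) × E))
        (G : (ℝ × ℝ) × E → Val ν), IsOpen V ∧ {0} ×ˢ closure Ω ⊆ V ∧ ContDiffOn ℝ ∞ G V ∧
        (∀ᶠ p in 𝓝 (0 : ℝ × ℝ), EqOn (varDeriv Ω A (z + span2 h k p)) (fun x => G (p, x))
          (closure Ω)) ∧
        ∀ x ∈ closure Ω, ∀ p, fderiv ℝ G (0, x) (p, 0) = p.1 • loc h x + p.2 • loc k x := by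
  obtain ⟨-, r, W, β, hW, hβ, H⟩ := hA
  have hj := contDiff_jet hz.1 r
  obtain ⟨L, hL, hLβ⟩ := exists_contDiff_linearization hW hβ hj fun x hx => (H z hz x hx).1
  -- The local part is the linearisation of β applied to the r-jet of h: a differential operator,
  -- which cannot enlarge supports.
  refine ⟨fun h x => L x (jet r h x), fun h hh => hL.clm_apply (contDiff_jet hh r),
    fun h x hx => by simp only [jet_eq_zero r hx, map_zero], fun h k hh hk => ?_⟩
  have hjh := contDiff_jet hh r
  have hjk := contDiff_jet hk r
  have hg := contDiff_jetFamily hj hjh hjk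
  refine ⟨_, β ∘ jetFamily (jet r z) (jet r h) (jet r k), hW.preimage hg.continuous, ?_,
    hβ.comp hg.contDiffOn fun q hq => hq, ?_, fun x hx p => ?_⟩
  · rintro ⟨p, x⟩ ⟨hp, hx⟩
    obtain rfl : p = 0 := hp
    rw [mem_preimage, jetFamily_zero]
    exact (H z hz x hx).1
  · filter_upwards [eventually_span2_mem_states hm hb hz hh hk] with p hp x hx
    rw [(H _ hp x hx).2, jet_span2 hz.1 hh hk]
    rfl
  · rw [fderiv_jetFamily hW hβ hj hjh hjk (H z hz x hx).1, ← hLβ x hx, map_add, map_smul, map_smul]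

/-- The second variation of a local functional is symmetric. -/
lemma pairing_variation_symm (hne : Ω.Nonempty) (hΩ : IsOpen Ω)
    (hb : Bornology.IsBounded Ω) (hm : m.Admissible) (hz : z ∈ m.states Ω)
    (hA : m.IsObservable Ω A) {h k lh lk : E → Val ν} (hh : ContDiff ℝ ∞ h) (hk : ContDiff ℝ ∞ k)
    {V : Set ((ℝ × ℝ) × E)} {G : (ℝ × ℝ) × E → Val ν} (hV : IsOpen V)
    (hΩV : {0} ×ˢ closure Ω ⊆ V) (hG : ContDiffOn ℝ ∞ G V)
    (hAG : ∀ᶠ p in 𝓝 (0 : ℝ × ℝ), EqOn (varDeriv Ω A (z + span2 h k p)) (fun x => G (p, x))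
      (closure Ω))
    (hloc : ∀ x ∈ closure Ω, ∀ p, fderiv ℝ G (0, x) (p, 0) = p.1 • lh x + p.2 • lk x) :
    pairing Ω lh k = pairing Ω lk h := by
  have h1 : ∀ {k : E → Val ν}, ContDiff ℝ ∞ k → ∃ L : ℝ × ℝ →L[ℝ] ℝ,
      HasFDerivAt (fun p => ∫ x in Ω, dot (G (p, x)) (k x)) L 0 ∧
      ∀ v, L v = ∫ x in Ω, dot (v.1 • lh x + v.2 • lk x) (k x) := fun {k} hk => by
    have hf : ContDiffOn ℝ ∞ (fun q : (ℝ × ℝ) × E => dot (G q) (k q.2)) V :=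
      (dot.contDiff.comp_contDiffOn hG).clm_apply (hk.comp contDiff_snd).contDiffOn
    obtain ⟨L, hL, hL'⟩ := exists_hasFDerivAt_setIntegral hb hV hΩV hf
    refine ⟨L, hL, fun v => ?_⟩
    rw [hL']
    refine setIntegral_congr_fun hΩ.measurableSet fun x hx => ?_
    have hx' := subset_closure hx
    have hGd : DifferentiableAt ℝ G (0, x) :=
      (hG.differentiableOn (by simp)).differentiableAt (hV.mem_nhds (hΩV ⟨rfl, hx'⟩))
    have e1 : HasFDerivAt (fun q : (ℝ × ℝ) × E => dot (G q)) _ (0, x) :=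
      dot.hasFDerivAt.comp (0, x) hGd.hasFDerivAt
    have hkd : HasFDerivAt (fun q : (ℝ × ℝ) × E => k q.2) _ ((0 : ℝ × ℝ), x) :=
      HasFDerivAt.comp ((0 : ℝ × ℝ), x) (hk.differentiable (by simp) x).hasFDerivAt hasFDerivAt_snd
    rw [(e1.clm_apply hkd).fderiv]
    simp [← hloc x hx']
  obtain ⟨L₁, hL₁, hL₁'⟩ := h1 hh
  obtain ⟨L₂, hL₂, hL₂'⟩ := h1 hk
  have h2 : ∀ᶠ p in 𝓝 (0 : ℝ × ℝ), HasFDerivAt (fun p => A (z + span2 h k p))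
      ((∫ x in Ω, dot (G (p, x)) (h x)) • ContinuousLinearMap.fst ℝ ℝ ℝ +
        (∫ x in Ω, dot (G (p, x)) (k x)) • ContinuousLinearMap.snd ℝ ℝ ℝ) p := by
    filter_upwards [eventually_span2_mem_states hm hb hz hh hk, hAG] with p hp hp'
    have h3 := (hasVarDeriv_varDeriv (hA _ hp)).hasFDerivAt_span2 hne hb hh hk
    rw [pairing_eq, pairing_eq] at h3
    have h5 : ∀ k' : E → Val ν, ∫ x in Ω, dot (varDeriv Ω A (z + span2 h k p) x) (k' x) =
        ∫ x in Ω, dot (G (p, x)) (k' x) := fun k' =>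
      setIntegral_congr_fun hΩ.measurableSet fun x hx => by
        simp only [hp' (subset_closure hx)]
    rwa [h5, h5] at h3
  have h3 := (hL₁.smul_const (ContinuousLinearMap.fst ℝ ℝ ℝ)).add
    (hL₂.smul_const (ContinuousLinearMap.snd ℝ ℝ ℝ))
  -- Schwarz's theorem for the function p ↦ A(z + p₁ h + p₂ k); its partial derivatives are pairings
  -- with h and k.
  have h4 := second_derivative_symmetric_of_eventually h2 h3 (1, 0) (0, 1)
  simp only [add_apply, ContinuousLinearMap.smulRight_apply, smul_apply, hL₁', hL₂'] at h4
  simpa [pairing_eq] using h4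

end SecondVariation

end OpenMixture

end

/-! ### The second variation of a smooth function of local functionals. -/

noncomputable section
namespace OpenMixture

variable {ν n : ℕ}

/-- The second variation of a functional: a local operator, and a symmetric operator of finite
rank. -/
structure SecondVariation (Ω : Set E) (A : (E → Val ν) → ℝ) (z : E → Val ν) where
  /-- the rank of the nonlocal part -/
  rank : ℕ
  /-- the fields that span the range of the nonlocal part -/
  field : Fin rank → E → Val ν
  /-- the coefficients of the nonlocal part -/
  coeff : Fin rank → Fin rank → ℝ
  /-- the local part -/
  loc : (E → Val ν) → E → Val ν
  contDiff_field : ∀ i, ContDiff ℝ ∞ (field i)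
  coeff_symm : ∀ i j, coeff i j = coeff j i
  contDiff_loc : ∀ h, ContDiff ℝ ∞ h → ContDiff ℝ ∞ (loc h)
  loc_eq_zero : ∀ h, ∀ x ∉ tsupport h, loc h x = 0
  loc_symm : ∀ h k, ContDiff ℝ ∞ h → ContDiff ℝ ∞ k → pairing Ω (loc h) k = pairing Ω (loc k) h
  exists_family : ∀ h, ContDiff ℝ ∞ h → ∃ (V : Set (ℝ × E)) (b : ℝ × E → Val ν), IsOpen V ∧
    {0} ×ˢ closure Ω ⊆ V ∧ ContDiffOn ℝ ∞ b V ∧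
    (∀ᶠ s in 𝓝 (0 : ℝ), EqOn (varDeriv Ω A (z + s • h)) (fun x => b (s, x)) (closure Ω)) ∧
    ∀ x ∈ closure Ω, fderiv ℝ b (0, x) (1, 0) =
      loc h x + ∑ i, ∑ j, (coeff i j * pairing Ω (field j) h) • field i x

lemma hasDerivAt_fderiv_apply {N : ℕ} {F : (Fin N → ℝ) → ℝ} {φ : ℝ → Fin N → ℝ} {s : ℝ}
    {φ' : Fin N → ℝ} (hF : DifferentiableAt ℝ (fderiv ℝ F) (φ s)) (hφ : HasDerivAt φ φ' s)
    (v : Fin N → ℝ) : HasDerivAt (fun s => fderiv ℝ F (φ s) v)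
      (∑ j, fderiv ℝ (fderiv ℝ F) (φ s) (Pi.single j 1) v * φ' j) s := by
  have h1 : HasDerivAt (fun s => fderiv ℝ F (φ s)) (fderiv ℝ (fderiv ℝ F) (φ s) φ') s :=
    hF.hasFDerivAt.comp_hasDerivAt s hφ
  have h2 : HasDerivAt (fun s => fderiv ℝ F (φ s) v) (fderiv ℝ (fderiv ℝ F) (φ s) φ' v) s := by
    simpa using h1.clm_apply (hasDerivAt_const s v)
  have h3 : φ' = ∑ j, φ' j • (Pi.single j 1 : Fin N → ℝ) := by
    ext i
    simp [Finset.sum_apply, Pi.single_apply]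
  convert h2 using 1
  conv_rhs => rw [h3, map_sum, sum_apply]
  simp [mul_comm]

section Generated

variable {m : Mixture ν n} {Ω : Set E} {z : E → Val ν} {A : (E → Val ν) → ℝ} {N : ℕ}
  {F : (Fin N → ℝ) → ℝ} {ℓ : Fin N → (E → Val ν) → ℝ}

lemma hasVarDeriv_generated (hm : m.Admissible) (hne : Ω.Nonempty) (hb : Bornology.IsBounded Ω)
    (hF : ContDiff ℝ ∞ F) (hℓ : ∀ i, m.IsObservable Ω (ℓ i))
    (hA : ∀ z ∈ m.states Ω, A z = F fun i => ℓ i z) (hz : z ∈ m.states Ω) :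
    HasVarDeriv Ω A z fun x => ∑ i, fderiv ℝ F (fun i => ℓ i z) (Pi.single i 1) •
      varDeriv Ω (ℓ i) z x :=
  HasVarDeriv.chain hne hb (hF.differentiable (by simp) _).hasFDerivAt
    (fun i => hasVarDeriv_varDeriv (hℓ i z hz)) (hA z hz)
    ((Mixture.eventually_add_mem_states hm hb hz 0).mono fun _ hq => hA _ hq)

lemma Mixture.IsLocallyGenerated.isObservable (hm : m.Admissible) (hne : Ω.Nonempty)
    (hb : Bornology.IsBounded Ω) (hA : m.IsLocallyGenerated Ω A) : m.IsObservable Ω A :=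
  fun _ hz => by
    obtain ⟨N, F, ℓ, hF, hℓ, h⟩ := hA
    exact ⟨_, hasVarDeriv_generated hm hne hb hF (fun i => (hℓ i).1) h hz⟩

lemma eventually_line_mem_states (hm : m.Admissible) (hb : Bornology.IsBounded Ω)
    (hz : z ∈ m.states Ω) {h : E → Val ν} (hh : ContDiff ℝ ∞ h) :
    ∀ᶠ s in 𝓝 (0 : ℝ), z + s • h ∈ m.states Ω := by
  have h1 : Filter.Tendsto (fun s : ℝ => (s, (0 : ℝ))) (𝓝 0) (𝓝 0) :=
    (by fun_prop : Continuous fun s : ℝ => (s, (0 : ℝ))).tendsto 0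
  filter_upwards [h1.eventually (eventually_span2_mem_states hm hb hz hh hh)] with s hs
  simpa [span2] using hs

/-- The derivative of a functional along a line of states. -/
lemma HasVarDeriv.hasDerivAt_line (hne : Ω.Nonempty) (hb : Bornology.IsBounded Ω)
    {h : E → Val ν} (hz : ContDiff ℝ ∞ z) (hh : ContDiff ℝ ∞ h) {s : ℝ} {a : E → Val ν}
    (hA : HasVarDeriv Ω A (z + s • h) a) :
    HasDerivAt (fun s : ℝ => A (z + s • h)) (pairing Ω a h) s := by
  have h1 : ContDiff ℝ ∞ fun q : ℝ × E => (z + q.1 • h) q.2 :=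
    (hz.comp contDiff_snd).add (contDiff_fst.smul (hh.comp contDiff_snd))
  have h2 := HasVarDeriv.hasDerivAt_comp (z := fun s : ℝ => z + s • h) hne hb isOpen_univ
    h1.contDiffOn (mem_univ s) hA
  have h3 : (fun x => deriv (fun τ : ℝ => (z + τ • h) x) s) = h := by
    ext1 x
    have := ((hasDerivAt_id s).smul_const (h x)).const_add (z x)
    simpa using this.deriv
  rwa [h3] at h2

/-- Functions of local observables have a second variation. -/
lemma Mixture.IsLocallyGenerated.exists_secondVariation (hm : m.Admissible) (hne : Ω.Nonempty)
    (hΩ : IsOpen Ω) (hb : Bornology.IsBounded Ω) (hz : z ∈ m.states Ω)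
    (hA : m.IsLocallyGenerated Ω A) : Nonempty (SecondVariation Ω A z) := by
  obtain ⟨N, F, ℓ, hF, hℓ, hA⟩ := hA
  choose loc h1 h2 h3 using fun i => (hℓ i).exists_variation hm hb hz
  set p₀ : Fin N → ℝ := fun i => ℓ i z with hp₀
  have hF1 : ContDiff ℝ ∞ (fderiv ℝ F) := hF.fderiv_right (by simp)
  have hF1d : DifferentiableAt ℝ (fderiv ℝ F) p₀ := hF1.differentiable (by simp) p₀
  -- Differentiation of δA = Σᵢ ∂ᵢF δℓᵢ: the fields δℓᵢ contribute their local operators, weighted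
  -- with ∂ᵢF, and the coefficients contribute the Hessian of F, paired with the fields δℓⱼ.
  refine ⟨{
    rank := N
    field := fun i => varDeriv Ω (ℓ i) z
    coeff := fun i j => fderiv ℝ (fderiv ℝ F) p₀ (Pi.single j 1) (Pi.single i 1)
    loc := fun h x => ∑ i, fderiv ℝ F p₀ (Pi.single i 1) • loc i h x
    contDiff_field := fun i => contDiff_varDeriv ((hℓ i).1 z hz)
    coeff_symm := fun i j => (hF.contDiffAt.isSymmSndFDerivAt (by
      simpa only [minSmoothness_of_isRCLikeNormedField] using ENat.LEInfty.out)).eq _ _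
    contDiff_loc := fun h hh => ContDiff.sum fun i _ => (h1 i h hh).const_smul _
    loc_eq_zero := fun h x hx => Finset.sum_eq_zero fun i _ => by rw [h2 i h x hx, smul_zero]
    loc_symm := fun h k hh hk => ?_
    exists_family := fun h hh => ?_ }⟩
  · have e1 : ∀ h k : E → Val ν, ContDiff ℝ ∞ h → ContDiff ℝ ∞ k →
        pairing Ω (fun x => ∑ i, fderiv ℝ F p₀ (Pi.single i 1) • loc i h x) k =
        ∑ i, fderiv ℝ F p₀ (Pi.single i 1) * pairing Ω (loc i h) k := fun h k hh hk => by
      simp only [pairing_eq, map_sum, map_smul, sum_apply, smul_apply, smul_eq_mul]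
      rw [integral_finsetSum _ fun i _ => (integrableOn_dot hb (h1 i h hh).continuous
        hk.continuous).const_mul _]
      simp only [integral_const_mul]
    rw [e1 h k hh hk, e1 k h hk hh]
    refine Finset.sum_congr rfl fun i _ => ?_
    obtain ⟨V, G, hV, hΩV, hG, hAG, hloc⟩ := h3 i h k hh hk
    rw [pairing_variation_symm hne hΩ hb hm hz (hℓ i).1 hh hk hV hΩV hG hAG hloc]
  · choose V G hV hΩV hG hAG hloc using fun i => h3 i h h hh hh
    -- The families given by the local functionals have two parameters; the second one is frozen at
    -- 0.
    set ι : ℝ × E → (ℝ × ℝ) × E := fun q => ((q.1, 0), q.2) with hι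
    have hιs : ContDiff ℝ ∞ ι := by fun_prop
    set V₁ : Set (ℝ × E) := ⋂ i, ι ⁻¹' V i with hV₁
    have hV₁o : IsOpen V₁ := isOpen_iInter_of_finite fun i => (hV i).preimage hιs.continuous
    have hΩV₁ : {0} ×ˢ closure Ω ⊆ V₁ := by
      rintro ⟨s, x⟩ ⟨hs, hx⟩
      obtain rfl : s = 0 := hs
      exact mem_iInter.2 fun i => hΩV i ⟨rfl, hx⟩
    have hG' : ∀ i, ContDiffOn ℝ ∞ (G i ∘ ι) V₁ := fun i =>
      (hG i).comp hιs.contDiffOn fun q hq => mem_iInter.1 hq i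
    obtain ⟨ε, hε, hεV, -⟩ := exists_closedBall_prod_subset hb hV₁o hΩV₁
    have htend : Filter.Tendsto (fun s : ℝ => (s, (0 : ℝ))) (𝓝 0) (𝓝 0) :=
      (by fun_prop : Continuous fun s : ℝ => (s, (0 : ℝ))).tendsto 0
    have hgood : ∀ᶠ s in 𝓝 (0 : ℝ), z + s • h ∈ m.states Ω ∧
        ∀ i, EqOn (varDeriv Ω (ℓ i) (z + s • h)) (fun x => G i (ι (s, x))) (closure Ω) := by
      filter_upwards [eventually_line_mem_states hm hb hz hh,
        htend.eventually (Filter.eventually_all.2 hAG)] with s hs hs'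
      refine ⟨hs, fun i x hx => ?_⟩
      simpa [span2] using hs' i hx
    obtain ⟨ε', hε', hε'S⟩ := Metric.eventually_nhds_iff_ball.1 hgood
    -- For s in `S` the field z + s h is a state, δℓᵢ has the smooth representative `G i`, and the
    -- slice over the closed domain stays where all the `G i` are smooth.
    set S := Metric.ball (0 : ℝ) (min ε ε') with hS
    have hSo : IsOpen S := Metric.isOpen_ball
    have hS0 : (0 : ℝ) ∈ S := Metric.mem_ball_self (lt_min hε hε')
    have hSgood : ∀ s ∈ S, _ := fun s hs => hε'S s (Metric.ball_subset_ball (min_le_right _ _) hs)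
    have hSV : S ×ˢ closure Ω ⊆ V₁ := (prod_mono ((Metric.ball_subset_ball (min_le_left _ _)).trans
      Metric.ball_subset_closedBall) Subset.rfl).trans hεV
    have hφ : ∀ i, ∀ s ∈ S, HasDerivAt (fun s : ℝ => ℓ i (z + s • h))
        (∫ x in Ω, dot (G i (ι (s, x))) (h x)) s := fun i s hs => by
      have e1 := (hasVarDeriv_varDeriv ((hℓ i).1 _ (hSgood s hs).1)).hasDerivAt_line hne hb hz.1 hh
      rw [pairing_eq] at e1
      rwa [setIntegral_congr_fun hΩ.measurableSet fun x hx => by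
        rw [(hSgood s hs).2 i (subset_closure hx)]] at e1
    -- The derivative of s ↦ ℓᵢ(z + s h) is an integral with a smooth integrand; hence it is smooth,
    -- and so is the function itself.
    have hφs : ContDiffOn ℝ ∞ (fun s : ℝ => fun i => ℓ i (z + s • h)) S := by
      refine contDiffOn_pi.2 fun i => ?_
      rw [contDiffOn_infty_iff_deriv_of_isOpen hSo]
      refine ⟨fun s hs => (hφ i s hs).differentiableAt.differentiableWithinAt, ?_⟩
      have e1 : ContDiffOn ℝ ∞ (fun q : ℝ × E => dot (G i (ι q)) (h q.2)) V₁ :=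
        (dot.contDiff.comp_contDiffOn (hG' i)).clm_apply (hh.comp contDiff_snd).contDiffOn
      exact (contDiffOn_setIntegral hb hV₁o hSo hSV e1).congr fun s hs => (hφ i s hs).deriv
    have hg : ∀ i, ContDiffOn ℝ ∞
        (fun s : ℝ => fderiv ℝ F (fun i => ℓ i (z + s • h)) (Pi.single i 1)) S := fun i =>
      (hF1.comp_contDiffOn hφs).clm_apply contDiffOn_const
    have hbs : ContDiffOn ℝ ∞ (fun q : ℝ × E => ∑ i,
        fderiv ℝ F (fun i => ℓ i (z + q.1 • h)) (Pi.single i 1) • G i (ι q))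
        (V₁ ∩ S ×ˢ univ) :=
      ContDiffOn.sum fun i _ => ((hg i).comp contDiff_fst.contDiffOn fun q hq => hq.2.1).smul
        ((hG' i).mono inter_subset_left)
    have hVo : IsOpen (V₁ ∩ S ×ˢ (univ : Set E)) := hV₁o.inter (hSo.prod isOpen_univ)
    have hΩVS : {0} ×ˢ closure Ω ⊆ V₁ ∩ S ×ˢ (univ : Set E) :=
      subset_inter hΩV₁ (prod_mono (singleton_subset_iff.2 hS0) (subset_univ _))
    refine ⟨_, _, hVo, hΩVS, hbs, ?_, fun x hx => ?_⟩
    · filter_upwards [hSo.mem_nhds hS0] with s hs x hx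
      rw [(hasVarDeriv_generated hm hne hb hF (fun i => (hℓ i).1) hA
        (hSgood s hs).1).varDeriv_eqOn hne hΩ hb hx]
      exact Finset.sum_congr rfl fun i _ => by rw [(hSgood s hs).2 i hx]
    · have hl : HasDerivAt (fun s : ℝ => (s, x)) ((1 : ℝ), (0 : E)) 0 :=
        (hasDerivAt_id (0 : ℝ)).prodMk (hasDerivAt_const (0 : ℝ) x)
      have hbd : DifferentiableAt ℝ (fun q : ℝ × E => ∑ i,
        fderiv ℝ F (fun i => ℓ i (z + q.1 • h)) (Pi.single i 1) • G i (ι q)) (0, x) :=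
        (hbs.differentiableOn (by simp)).differentiableAt (hVo.mem_nhds (hΩVS ⟨rfl, hx⟩))
      have e1 := HasFDerivAt.comp_hasDerivAt (f := fun s : ℝ => (s, x)) 0 hbd.hasFDerivAt hl
      have hG0 : ∀ i, HasDerivAt (fun s : ℝ => G i (ι (s, x))) (loc i h x) 0 := fun i => by
        have e2 : DifferentiableAt ℝ (G i) (0, x) :=
          ((hG i).differentiableOn (by simp)).differentiableAt ((hV i).mem_nhds (hΩV i ⟨rfl, hx⟩))
        have e3 : HasDerivAt (fun s : ℝ => ((s, 0), x)) (((1 : ℝ), (0 : ℝ)), (0 : E)) 0 :=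
          ((hasDerivAt_id (0 : ℝ)).prodMk (hasDerivAt_const (0 : ℝ) (0 : ℝ))).prodMk
            (hasDerivAt_const (0 : ℝ) x)
        have e4 := HasFDerivAt.comp_hasDerivAt (f := fun s : ℝ => (((s, 0), x) : (ℝ × ℝ) × E)) 0
          e2.hasFDerivAt e3
        rw [hloc i x hx (1, 0)] at e4
        simp only [one_smul, zero_smul, add_zero] at e4
        exact e4
      have hφ0 : HasDerivAt (fun s : ℝ => fun i => ℓ i (z + s • h))
          (fun i => pairing Ω (varDeriv Ω (ℓ i) z) h) 0 := by
        refine hasDerivAt_pi.2 fun i => ?_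
        refine HasVarDeriv.hasDerivAt_line hne hb hz.1 hh ?_
        rw [zero_smul, add_zero]
        exact hasVarDeriv_varDeriv ((hℓ i).1 z hz)
      have hφ00 : (fun i => ℓ i (z + (0 : ℝ) • h)) = p₀ := by simp [hp₀]
      have hg0 : ∀ i, HasDerivAt (fun s : ℝ => fderiv ℝ F (fun i => ℓ i (z + s • h)) (Pi.single i 1))
          (∑ j, fderiv ℝ (fderiv ℝ F) p₀ (Pi.single j 1) (Pi.single i 1) *
            pairing Ω (varDeriv Ω (ℓ j) z) h) 0 := fun i => by
        have e2 := hasDerivAt_fderiv_apply (φ := fun s : ℝ => fun i => ℓ i (z + s • h))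
          (s := 0) (by rw [hφ00]; exact hF1d) hφ0 (Pi.single i 1)
        rwa [hφ00] at e2
      have e5 := HasDerivAt.fun_sum (u := Finset.univ) fun i _ => (hg0 i).smul (hG0 i)
      refine (e1.unique e5).trans ?_
      rw [Finset.sum_add_distrib]
      congr 1
      · simp only [hφ00]
      · refine Finset.sum_congr rfl fun i _ => ?_
        have e6 : G i (ι (0, x)) = varDeriv Ω (ℓ i) z x := by
          have := (hSgood 0 hS0).2 i hx
          rw [zero_smul, add_zero] at this
          exact this.symm
        rw [e6, Finset.sum_smul]

end Generated

end OpenMixture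

end

noncomputable section
namespace OpenMixture

variable {ν n : ℕ}

/-! ### The bracket density along a family of fields -/

section BracketFamily

variable {V : Set (ℝ × E)}

lemma hasDerivAt_slice {G : Type*} [NormedAddCommGroup G] [NormedSpace ℝ G] {f : ℝ × E → G}
    {s : ℝ} {x : E} (hf : DifferentiableAt ℝ f (s, x)) :
    HasDerivAt (fun s => f (s, x)) (fderiv ℝ f (s, x) (1, 0)) s :=
  HasFDerivAt.comp_hasDerivAt (f := fun s : ℝ => (s, x)) s hf.hasFDerivAt
    ((hasDerivAt_id s).prodMk (hasDerivAt_const s x))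

/-- Derivatives with respect to space and to a parameter commute. -/
lemma hasDerivAt_fderiv_slice {G : Type*} [NormedAddCommGroup G] [NormedSpace ℝ G]
    {f : ℝ × E → G} (hV : IsOpen V) (hf : ContDiffOn ℝ ∞ f V) {s : ℝ} {x : E} (hx : (s, x) ∈ V) :
    HasDerivAt (fun s => fderiv ℝ (fun x => f (s, x)) x)
      (fderiv ℝ (fun x => fderiv ℝ f (s, x) (1, 0)) x) s := by
  have hd : ∀ q ∈ V, DifferentiableAt ℝ f q := fun q hq =>
    (hf.differentiableOn (by simp)).differentiableAt (hV.mem_nhds hq)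
  have h1 : DifferentiableAt ℝ (fderiv ℝ f) (s, x) :=
    ((hf.fderiv_of_isOpen (m := ∞) hV (by simp)).differentiableOn (by simp)).differentiableAt
      (hV.mem_nhds hx)
  have h2 : HasDerivAt (fun s => (fderiv ℝ f (s, x)).comp (ContinuousLinearMap.inr ℝ ℝ E))
      ((fderiv ℝ (fderiv ℝ f) (s, x) (1, 0)).comp (ContinuousLinearMap.inr ℝ ℝ E)) s := by
    simpa using (hasDerivAt_slice h1).clm_comp (hasDerivAt_const s (ContinuousLinearMap.inr ℝ ℝ E))
  have h3 : (fun s => fderiv ℝ (fun x => f (s, x)) x) =ᶠ[𝓝 s]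
      fun s => (fderiv ℝ f (s, x)).comp (ContinuousLinearMap.inr ℝ ℝ E) := by
    have h4 : ∀ᶠ t in 𝓝 s, (t, x) ∈ V :=
      (by fun_prop : Continuous fun t : ℝ => (t, x)).continuousAt.eventually (hV.mem_nhds hx)
    filter_upwards [h4] with t ht using fderiv_slice (hd _ ht)
  have h5 : HasFDerivAt (fun x => fderiv ℝ f (s, x) (1, 0))
      (((fderiv ℝ (fderiv ℝ f) (s, x)).comp (ContinuousLinearMap.inr ℝ ℝ E)).flip (1, 0)) x := by
    have h6 := HasFDerivAt.comp x (f := fun x : E => (s, x)) h1.hasFDerivAt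
      (hasFDerivAt_prodMk_right s x)
    exact (h6.clm_apply (hasFDerivAt_const ((1 : ℝ), (0 : E)) x)).congr_fderiv (by ext; simp)
  have h7 : IsSymmSndFDerivAt ℝ f (s, x) :=
    (hf.contDiffAt (hV.mem_nhds hx)).isSymmSndFDerivAt (by
      simpa only [minSmoothness_of_isRCLikeNormedField] using ENat.LEInfty.out)
  refine (h2.congr_of_eventuallyEq h3).congr_deriv ?_
  rw [h5.fderiv]
  ext v
  exact h7.eq _ _

variable {y z b c : ℝ × E → Val ν}

/-- The density of the Poisson bracket for a family of fields. -/
def bracketFamily (y z b c : ℝ × E → Val ν) (q : ℝ × E) : ℝ :=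
  bracketDensity (fun x => y (q.1, x)) (fun x => z (q.1, x)) (fun x => b (q.1, x))
    (fun x => c (q.1, x)) q.2

/-- The derivative of a family with respect to the parameter. -/
def paramDeriv (f : ℝ × E → Val ν) (s : ℝ) (x : E) : Val ν := fderiv ℝ f (s, x) (1, 0)

lemma contDiffOn_dot (hb : ContDiffOn ℝ ∞ b V) (hy : ContDiffOn ℝ ∞ y V) :
    ContDiffOn ℝ ∞ (fun q => dot (b q) (y q)) V :=
  (dot.contDiff.comp_contDiffOn hb).clm_apply hy

lemma contDiffOn_bracketFamily (hV : IsOpen V) (hy : ContDiffOn ℝ ∞ y V)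
    (hz : ContDiffOn ℝ ∞ z V) (hb : ContDiffOn ℝ ∞ b V) (hc : ContDiffOn ℝ ∞ c V) :
    ContDiffOn ℝ ∞ (bracketFamily y z b c) V := by
  have h1 : ∀ {b c : ℝ × E → Val ν}, ContDiffOn ℝ ∞ b V → ContDiffOn ℝ ∞ c V → ContDiffOn ℝ ∞
      (fun q : ℝ × E => transport (fun x => y (q.1, x)) (fun x => z (q.1, x))
        (fun x => b (q.1, x)) q.2 (c q).2.1) V := fun hb hc => by
    have h2 := momL.contDiff.comp_contDiffOn hc
    exact ((contDiffOn_fderiv_slice hV (contDiffOn_dot hb hy)).clm_apply h2).sub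
      (contDiffOn_dot hb ((contDiffOn_fderiv_slice hV hz).clm_apply h2))
  exact (h1 hb hc).sub (h1 hc hb)

/-- θ_b(c_M) is linear in b, in c and in the pair (y, z), so that the product rule yields three
terms. -/
lemma hasDerivAt_transport (hV : IsOpen V) (hy : ContDiffOn ℝ ∞ y V)
    (hz : ContDiffOn ℝ ∞ z V) (hb : ContDiffOn ℝ ∞ b V) (hc : ContDiffOn ℝ ∞ c V) {s : ℝ} {x : E}
    (hx : (s, x) ∈ V) :
    HasDerivAt (fun s => transport (fun x => y (s, x)) (fun x => z (s, x)) (fun x => b (s, x)) x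
        (mom (fun x => c (s, x)) x))
      (transport (fun x => y (s, x)) (fun x => z (s, x)) (paramDeriv b s) x
          (mom (fun x => c (s, x)) x) +
        transport (fun x => y (s, x)) (fun x => z (s, x)) (fun x => b (s, x)) x
          (mom (paramDeriv c s) x) +
        transport (paramDeriv y s) (paramDeriv z s) (fun x => b (s, x)) x
          (mom (fun x => c (s, x)) x)) s := by
  have hd : ∀ {G : Type} [NormedAddCommGroup G] [NormedSpace ℝ G] {f : ℝ × E → G},
      ContDiffOn ℝ ∞ f V → ∀ q ∈ V, DifferentiableAt ℝ f q := fun hf q hq =>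
    (hf.differentiableOn (by simp)).differentiableAt (hV.mem_nhds hq)
  have hps : ∀ {f : ℝ × E → Val ν}, ContDiffOn ℝ ∞ f V → DifferentiableAt ℝ (paramDeriv f s) x :=
    fun {f} hf => by
    have h1 : ContDiffOn ℝ ∞ (fun q => fderiv ℝ f q (1, 0)) V :=
      (hf.fderiv_of_isOpen hV (by simp)).clm_apply contDiffOn_const
    exact DifferentiableAt.comp x (f := fun x : E => (s, x)) (hd h1 _ hx) (by fun_prop)
  have hsl : ∀ {f : ℝ × E → Val ν}, ContDiffOn ℝ ∞ f V →
      DifferentiableAt ℝ (fun x => f (s, x)) x := fun hf =>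
    DifferentiableAt.comp x (f := fun x : E => (s, x)) (hd hf _ hx) (by fun_prop)
  have hmom : HasDerivAt (fun s => mom (fun x => c (s, x)) x) (mom (paramDeriv c s) x) s :=
    momL.hasFDerivAt.comp_hasDerivAt s (hasDerivAt_slice (hd hc _ hx))
  have h1 := hasDerivAt_fderiv_slice hV (contDiffOn_dot hb hy) hx
  have h2 : fderiv ℝ (fun x => fderiv ℝ (fun q => dot (b q) (y q)) (s, x) (1, 0)) x =
      fderiv ℝ (fun x => dot (paramDeriv b s x) (y (s, x))) x +
      fderiv ℝ (fun x => dot (b (s, x)) (paramDeriv y s x)) x := by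
    have h3 : (fun x => fderiv ℝ (fun q => dot (b q) (y q)) (s, x) (1, 0)) =ᶠ[𝓝 x]
        fun x => dot (paramDeriv b s x) (y (s, x)) + dot (b (s, x)) (paramDeriv y s x) := by
      have h4 : ∀ᶠ t in 𝓝 x, (s, t) ∈ V :=
        (by fun_prop : Continuous fun t : E => (s, t)).continuousAt.eventually (hV.mem_nhds hx)
      filter_upwards [h4] with t ht
      have h5 := (dot.hasFDerivAt.comp_hasDerivAt s (hasDerivAt_slice (hd hb _ ht))).clm_apply
        (hasDerivAt_slice (hd hy _ ht))
      exact (hasDerivAt_slice (hd (contDiffOn_dot hb hy) _ ht)).unique h5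
    rw [h3.fderiv_eq]
    exact fderiv_fun_add (hasFDerivAt_dot (hps hb) (hsl hy)).differentiableAt
      (hasFDerivAt_dot (hsl hb) (hps hy)).differentiableAt
  have h3 := (h1.clm_apply hmom).sub
    (((dot.hasFDerivAt.comp_hasDerivAt s (hasDerivAt_slice (hd hb _ hx)))).clm_apply
      ((hasDerivAt_fderiv_slice hV hz hx).clm_apply hmom))
  refine h3.congr_deriv ?_
  rw [h2]
  have h4 : ∀ f : ℝ × E → Val ν, paramDeriv f s = fun x => fderiv ℝ f (s, x) (1, 0) :=
    fun _ => rfl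
  simp only [transport_apply, add_apply, map_add, h4, Function.comp_apply]
  ring

lemma hasDerivAt_bracketFamily (hV : IsOpen V) (hy : ContDiffOn ℝ ∞ y V)
    (hz : ContDiffOn ℝ ∞ z V) (hb : ContDiffOn ℝ ∞ b V) (hc : ContDiffOn ℝ ∞ c V) {s : ℝ} {x : E}
    (hx : (s, x) ∈ V) :
    HasDerivAt (fun s => bracketFamily y z b c (s, x))
      (bracketDensity (fun x => y (s, x)) (fun x => z (s, x)) (paramDeriv b s) (fun x => c (s, x)) x
        + bracketDensity (fun x => y (s, x)) (fun x => z (s, x)) (fun x => b (s, x))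
          (paramDeriv c s) x
        + bracketDensity (paramDeriv y s) (paramDeriv z s) (fun x => b (s, x))
          (fun x => c (s, x)) x) s := by
  refine ((hasDerivAt_transport hV hy hz hb hc hx).sub
    (hasDerivAt_transport hV hy hz hc hb hx)).congr_deriv ?_
  simp only [bracketDensity]
  ring

lemma bracketDensity_eq_of_eqOn {Ω : Set E} (hΩ : IsOpen Ω) {y y' z z' b b' c c' : E → Val ν}
    (hy : EqOn y y' Ω) (hz : EqOn z z' Ω) (hb : EqOn b b' Ω) (hc : EqOn c c' Ω) {x : E}
    (hx : x ∈ Ω) : bracketDensity y z b c x = bracketDensity y' z' b' c' x := by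
  have hd : ∀ {G : Type} [NormedAddCommGroup G] [NormedSpace ℝ G] {f g : E → G}, EqOn f g Ω →
      fderiv ℝ f x = fderiv ℝ g x := fun h =>
    (Filter.eventuallyEq_of_mem (hΩ.mem_nhds hx) h).fderiv_eq
  have h1 : ∀ {b b' : E → Val ν}, EqOn b b' Ω → transport y z b x = transport y' z' b' x :=
    fun {b b'} hb => by
    rw [transport, transport, hd (f := fun x => dot (b x) (y x))
      (g := fun x => dot (b' x) (y' x)) fun x hx => by simp only [hb hx, hy hx], hd hz, hb hx]
  simp only [bracketDensity, h1 hb, h1 hc, mom, hb hx, hc hx]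

end BracketFamily

/-! ### The variation of the Poisson bracket -/

namespace SecondVariation

variable {Ω : Set E} {A : (E → Val ν) → ℝ} {z : E → Val ν}

/-- The derivative of the functional derivative in a direction. -/
def deriv (v : SecondVariation Ω A z) (h : E → Val ν) (x : E) : Val ν :=
  v.loc h x + ∑ i, ∑ j, (v.coeff i j * pairing Ω (v.field j) h) • v.field i x

lemma contDiff_deriv (v : SecondVariation Ω A z) {h : E → Val ν} (hh : ContDiff ℝ ∞ h) :
    ContDiff ℝ ∞ (v.deriv h) :=
  (v.contDiff_loc h hh).add (ContDiff.sum fun i _ => ContDiff.sum fun _ _ =>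
    (v.contDiff_field i).const_smul _)

end SecondVariation

namespace Mixture

variable {m : Mixture ν n} {Ω : Set E} {z h : E → Val ν} {B C : (E → Val ν) → ℝ}

variable (m) in
/-- The derivative of the transported quantities in a direction. -/
def carriedDeriv (z h : E → Val ν) (x : E) : Val ν := fderiv ℝ m.carried (z x) (h x)

/-- The state enters through δB, through δC and through the pair (y, z), whence the three terms. The
families provided by the second variations are jointly smooth in the parameter and in space, which
permits differentiation under the integral sign. -/
lemma hasDerivAt_poisson (hm : m.Admissible) (hΩ : IsOpen Ω) (hb : Bornology.IsBounded Ω)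
    (hz : z ∈ m.states Ω) (hB : m.IsObservable Ω B) (hC : m.IsObservable Ω C)
    (vB : SecondVariation Ω B z) (vC : SecondVariation Ω C z) (hh : ContDiff ℝ ∞ h) :
    HasDerivAt (fun s : ℝ => m.poisson Ω B C (z + s • h))
      (∫ x in Ω, (bracketDensity (m.carriedField z) z (vB.deriv h) (varDeriv Ω C z) x
        + bracketDensity (m.carriedField z) z (varDeriv Ω B z) (vC.deriv h) x
        + bracketDensity (m.carriedDeriv z h) h (varDeriv Ω B z) (varDeriv Ω C z) x)) 0 := by
  obtain ⟨V₁, b, hV₁, hΩV₁, hbs, hBb, hb'⟩ := vB.exists_family h hh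
  obtain ⟨V₂, c, hV₂, hΩV₂, hcs, hCc, hc'⟩ := vC.exists_family h hh
  set Z : ℝ × E → Val ν := fun q => z q.2 + q.1 • h q.2 with hZ
  have hZs : ContDiff ℝ ∞ Z := (hz.1.comp contDiff_snd).add
    (contDiff_fst.smul (hh.comp contDiff_snd))
  set V := V₁ ∩ V₂ ∩ Z ⁻¹' m.valDom with hV_def
  have hV : IsOpen V := (hV₁.inter hV₂).inter ((m.isOpen_valDom hm).preimage hZs.continuous)
  have hΩV : {0} ×ˢ closure Ω ⊆ V := by
    refine subset_inter (subset_inter hΩV₁ hΩV₂) ?_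
    rintro ⟨s, x⟩ ⟨hs, hx⟩
    obtain rfl : s = 0 := hs
    change z x + (0 : ℝ) • h x ∈ m.valDom
    rw [zero_smul, add_zero]
    exact hz.2 x hx
  have hbs' : ContDiffOn ℝ ∞ b V := hbs.mono fun q hq => hq.1.1
  have hcs' : ContDiffOn ℝ ∞ c V := hcs.mono fun q hq => hq.1.2
  have hZs' : ContDiffOn ℝ ∞ Z V := hZs.contDiffOn
  have hys : ContDiffOn ℝ ∞ (m.carried ∘ Z) V :=
    (contDiffOn_carried hm).comp hZs' fun q hq => hq.2
  have hf := contDiffOn_bracketFamily hV hys hZs' hbs' hcs'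
  obtain ⟨ε, hε, hεV, -⟩ := exists_closedBall_prod_subset hb hV hΩV
  have h1 : (fun s : ℝ => m.poisson Ω B C (z + s • h)) =ᶠ[𝓝 0]
      fun s => ∫ x in Ω, bracketFamily (m.carried ∘ Z) Z b c (s, x) := by
    filter_upwards [hBb, hCc, eventually_line_mem_states hm hb hz hh,
      Metric.closedBall_mem_nhds (0 : ℝ) hε] with s hs1 hs2 hs3 hs4
    refine setIntegral_congr_fun hΩ.measurableSet fun x hx => ?_
    have hx' := subset_closure hx
    have hB' := contDiff_varDeriv (hB _ hs3)
    have hC' := contDiff_varDeriv (hC _ hs3)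
    rw [poissonDensity_eq hm hs3 (closure_subset_regular hs3 hx')
      (hB'.differentiable (by simp) x) (hC'.differentiable (by simp) x)]
    have hι : ContDiff ℝ ∞ fun x : E => (s, x) := by fun_prop
    exact bracketDensity_congr (V := (fun x => (s, x)) ⁻¹' V) (hV.preimage hι.continuous) hΩ
      (fun x hx => hεV ⟨hs4, hx⟩) (hys.comp hι.contDiffOn fun x hx => hx) hB'.contDiffOn
      (hbs'.comp hι.contDiffOn fun x hx => hx) hs1 hC'.contDiffOn
      (hcs'.comp hι.contDiffOn fun x hx => hx) hs2 hx'
  refine ((exists_hasDerivAt_setIntegral hb hV hΩV hf).congr_of_eventuallyEq h1).congr_deriv ?_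
  refine setIntegral_congr_fun hΩ.measurableSet fun x hx => ?_
  have hx0 : ∀ {x}, x ∈ Ω → ((0 : ℝ), x) ∈ V := fun hx => hΩV ⟨rfl, subset_closure hx⟩
  have h2 := (hasDerivAt_slice ((hf.differentiableOn (by simp)).differentiableAt
    (hV.mem_nhds (hx0 hx)))).unique (hasDerivAt_bracketFamily hV hys hZs' hbs' hcs' (hx0 hx))
  refine h2.trans ?_
  have e1 : EqOn (fun x => (m.carried ∘ Z) (0, x)) (m.carriedField z) Ω := fun x _ => by
    simp [hZ, carriedField]
  have e2 : EqOn (fun x => Z (0, x)) z Ω := fun x _ => by simp [hZ]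
  have e3 : EqOn (fun x => b (0, x)) (varDeriv Ω B z) Ω := fun x hx => by
    simpa using (hBb.self_of_nhds (subset_closure hx)).symm
  have e4 : EqOn (fun x => c (0, x)) (varDeriv Ω C z) Ω := fun x hx => by
    simpa using (hCc.self_of_nhds (subset_closure hx)).symm
  have e5 : EqOn (paramDeriv b 0) (vB.deriv h) Ω := fun x hx => hb' x (subset_closure hx)
  have e6 : EqOn (paramDeriv c 0) (vC.deriv h) Ω := fun x hx => hc' x (subset_closure hx)
  have e8 : ∀ x, HasDerivAt (fun s : ℝ => Z (s, x)) (h x) 0 := fun x => by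
    have e := ((hasDerivAt_id (0 : ℝ)).smul_const (h x)).const_add (z x)
    rw [one_smul] at e
    exact e
  have e7 : EqOn (paramDeriv Z 0) h Ω := fun x _ =>
    (hasDerivAt_slice (hZs.differentiable (by simp) (0, x))).unique (e8 x)
  have e9 : EqOn (paramDeriv (m.carried ∘ Z) 0) (m.carriedDeriv z h) Ω := fun x hx => by
    have f1 : DifferentiableAt ℝ m.carried (Z (0, x)) :=
      ((contDiffOn_carried hm).differentiableOn (by simp)).differentiableAt
        ((m.isOpen_valDom hm).mem_nhds (hx0 hx).2)
    have f2 := f1.hasFDerivAt.comp_hasDerivAt (0 : ℝ) (e8 x)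
    have f3 : Z (0, x) = z x := e2 hx
    rw [f3] at f2
    exact (hasDerivAt_slice ((hys.differentiableOn (by simp)).differentiableAt
      (hV.mem_nhds (hx0 hx)))).unique f2
  rw [bracketDensity_eq_of_eqOn hΩ e1 e2 e5 e4 hx, bracketDensity_eq_of_eqOn hΩ e1 e2 e3 e6 hx,
    bracketDensity_eq_of_eqOn hΩ e9 e7 e3 e4 hx]

end Mixture

end OpenMixture

end

noncomputable section
namespace OpenMixture

variable {ν n : ℕ}

/-! ### Fluxes of fields -/

section Flux

variable {Ω : Set E} {y z b e e' : E → Val ν}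

/-- The integral of the divergence of the flux of `⟨e, y⟩` along the momentum part of `b`. -/
def fluxIntegral (Ω : Set E) (y b e : E → Val ν) : ℝ :=
  ∫ x in Ω, div (fun x => dot (e x) (y x) • mom b x) x

lemma integrableOn_of_contDiff (hb : Bornology.IsBounded Ω) {f : E → ℝ} (hf : ContDiff ℝ ∞ f) :
    IntegrableOn f Ω :=
  integrableOn_of_continuousOn_closure hb hf.continuous.continuousOn

lemma setIntegral_div_add (hb : Bornology.IsBounded Ω) {φ ψ : E → E} (hφ : ContDiff ℝ ∞ φ)
    (hψ : ContDiff ℝ ∞ ψ) : ∫ x in Ω, div (fun x => φ x + ψ x) x =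
      (∫ x in Ω, div φ x) + ∫ x in Ω, div ψ x := by
  rw [← integral_add (integrableOn_of_contDiff hb (contDiff_div hφ))
    (integrableOn_of_contDiff hb (contDiff_div hψ))]
  congr 1 with x
  exact div_add (hφ.differentiable (by simp) x) (hψ.differentiable (by simp) x)

lemma setIntegral_div_eq_zero (hb : Bornology.IsBounded Ω) {φ : E → E} (hφ : ContDiff ℝ ∞ φ)
    (hc : HasCompactSupport φ) (hs : tsupport φ ⊆ Ω) : ∫ x in Ω, div φ x = 0 := by
  have hφi : ∀ i, ContDiff ℝ ∞ fun x => φ x i := fun i =>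
    (EuclideanSpace.proj (𝕜 := ℝ) i).contDiff.comp hφ
  have h1 : ∀ i x, fderiv ℝ φ x (EuclideanSpace.single i 1) i =
      fderiv ℝ (fun x => φ x i) x (EuclideanSpace.single i 1) := fun i x =>
    (DFunLike.congr_fun ((EuclideanSpace.proj i : E →L[ℝ] ℝ).hasFDerivAt.comp x
      (hφ.differentiable (by simp) x).hasFDerivAt).fderiv (EuclideanSpace.single i 1)).symm
  have hsub : ∀ i : Fin 3, tsupport (fun x => φ x i) ⊆ tsupport φ := fun i =>
    closure_mono fun x hx h => hx (by simp [h])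
  simp only [div_eq_sum, h1]
  rw [integral_finsetSum]
  · exact Finset.sum_eq_zero fun i _ => setIntegral_fderiv_eq_zero ((hφi i).of_le (by simp))
      (hc.of_isClosed_subset (isClosed_tsupport _) (hsub i)) ((hsub i).trans hs) _
  · exact fun i _ => integrableOn_of_contDiff hb
      (((hφi i).fderiv_right (by simp)).clm_apply contDiff_const)

lemma contDiff_flux (hy : ContDiff ℝ ∞ y) (hb : ContDiff ℝ ∞ b) (he : ContDiff ℝ ∞ e) :
    ContDiff ℝ ∞ fun x => dot (e x) (y x) • mom b x :=
  (contDiff_dot he hy).smul (contDiff_mom hb)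

lemma fluxIntegral_add (hΩ : Bornology.IsBounded Ω) (hy : ContDiff ℝ ∞ y) (hb : ContDiff ℝ ∞ b)
    (he : ContDiff ℝ ∞ e) (he' : ContDiff ℝ ∞ e') :
    fluxIntegral Ω y b (fun x => e x + e' x) = fluxIntegral Ω y b e + fluxIntegral Ω y b e' := by
  rw [fluxIntegral, fluxIntegral, fluxIntegral,
    ← setIntegral_div_add hΩ (contDiff_flux hy hb he) (contDiff_flux hy hb he')]
  simp only [map_add, add_apply, add_smul]

lemma fluxIntegral_smul (hy : ContDiff ℝ ∞ y) (hb : ContDiff ℝ ∞ b) (he : ContDiff ℝ ∞ e) (c : ℝ) :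
    fluxIntegral Ω y b (fun x => c • e x) = c * fluxIntegral Ω y b e := by
  rw [fluxIntegral, fluxIntegral, ← integral_const_mul]
  congr 1 with x
  have h := div_smul (x := x) (f := fun _ => c) (differentiableAt_const c)
    ((contDiff_flux hy hb he).differentiable (by simp) x)
  simp only [fderiv_fun_const, Pi.zero_apply, zero_apply, add_zero] at h
  rw [← h]
  simp only [map_smul, smul_apply, smul_eq_mul, mul_smul]

/-- Partial integration in the Poisson bracket. -/
lemma setIntegral_bracketDensity (hΩ : Bornology.IsBounded Ω) (hy : ContDiff ℝ ∞ y)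
    (hz : ContDiff ℝ ∞ z) (hb : ContDiff ℝ ∞ b) (he : ContDiff ℝ ∞ e) :
    ∫ x in Ω, bracketDensity y z b e x =
      pairing Ω e (hamField y z b) - fluxIntegral Ω y b e := by
  rw [pairing_eq, fluxIntegral, ← integral_sub
    (integrableOn_of_contDiff hΩ (contDiff_dot he (contDiff_hamField hy hz hb)))
    (integrableOn_of_contDiff hΩ (contDiff_div (contDiff_flux hy hb he)))]
  congr 1 with x
  exact bracketDensity_eq (hy.differentiable (by simp) x) (hb.differentiable (by simp) x)
    (he.differentiable (by simp) x)

lemma contDiff_bracketDensity (hy : ContDiff ℝ ∞ y) (hz : ContDiff ℝ ∞ z) (hb : ContDiff ℝ ∞ b)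
    (he : ContDiff ℝ ∞ e) : ContDiff ℝ ∞ (bracketDensity y z b e) :=
  ((contDiff_transport hy hz hb).clm_apply (contDiff_mom he)).sub
    ((contDiff_transport hy hz he).clm_apply (contDiff_mom hb))

end Flux

namespace SecondVariation

variable {Ω : Set E} {A : (E → Val ν) → ℝ} {y z b c h : E → Val ν}

/-- The quadratic form of the nonlocal part. -/
def form (v : SecondVariation Ω A z) (s t : Fin v.rank → ℝ) : ℝ :=
  ∑ i, ∑ j, v.coeff i j * s i * t j

lemma form_comm (v : SecondVariation Ω A z) (s t : Fin v.rank → ℝ) : v.form s t = v.form t s := by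
  unfold form
  rw [Finset.sum_comm]
  refine Finset.sum_congr rfl fun i _ => Finset.sum_congr rfl fun j _ => ?_
  rw [v.coeff_symm]
  ring

/-- A combination of the fields that span the range of the nonlocal part. -/
def nonlocal (v : SecondVariation Ω A z) (t : Fin v.rank → ℝ) (x : E) : Val ν :=
  ∑ i, ∑ j, (v.coeff i j * t j) • v.field i x

lemma contDiff_nonlocal (v : SecondVariation Ω A z) (t : Fin v.rank → ℝ) :
    ContDiff ℝ ∞ (v.nonlocal t) :=
  ContDiff.sum fun i _ => ContDiff.sum fun _ _ => (v.contDiff_field i).const_smul _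

/-- A linear functional passes through the finite sums; it is applied to the pairing with a field
and to the flux. -/
lemma map_nonlocal (v : SecondVariation Ω A z) {Λ : (E → Val ν) → ℝ}
    (h_add : ∀ e e', ContDiff ℝ ∞ e → ContDiff ℝ ∞ e' → Λ (fun x => e x + e' x) = Λ e + Λ e')
    (h_smul : ∀ (c : ℝ) e, ContDiff ℝ ∞ e → Λ (fun x => c • e x) = c * Λ e)
    (t : Fin v.rank → ℝ) : Λ (v.nonlocal t) = v.form (fun i => Λ (v.field i)) t := by
  have h0 : Λ (fun _ => 0) = 0 := by simpa using h_smul 0 (fun _ => 0) contDiff_const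
  have h_sum : ∀ (s : Finset (Fin v.rank)) (f : Fin v.rank → E → Val ν),
      (∀ i, ContDiff ℝ ∞ (f i)) → Λ (fun x => ∑ i ∈ s, f i x) = ∑ i ∈ s, Λ (f i) := by
    intro s f hf
    induction s using Finset.induction_on with
    | empty => simpa using h0
    | insert i s hi ih =>
      simp only [Finset.sum_insert hi]
      rw [h_add _ _ (hf i) (ContDiff.sum fun i _ => hf i), ih]
  have hs : ∀ (i : Fin v.rank) (c : ℝ), ContDiff ℝ ∞ fun x => c • v.field i x := fun i c =>
    (v.contDiff_field i).const_smul c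
  refine (h_sum _ (fun i x => ∑ j, (v.coeff i j * t j) • v.field i x)
    fun i => ContDiff.sum fun _ _ => hs i _).trans ?_
  refine Finset.sum_congr rfl fun i _ => ?_
  rw [h_sum _ (fun j x => (v.coeff i j * t j) • v.field i x) fun j => hs i _]
  refine Finset.sum_congr rfl fun j _ => ?_
  rw [h_smul _ _ (v.contDiff_field i)]
  ring

lemma pairing_nonlocal (hΩ : Bornology.IsBounded Ω) (v : SecondVariation Ω A z)
    (hh : ContDiff ℝ ∞ h) (t : Fin v.rank → ℝ) :
    pairing Ω (v.nonlocal t) h = v.form (fun i => pairing Ω (v.field i) h) t :=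
  v.map_nonlocal (Λ := fun e => pairing Ω e h)
    (fun _ _ he he' => add_pairing hΩ hh.continuous he.continuous he'.continuous)
    (fun c e _ => smul_pairing h e c) t

lemma fluxIntegral_nonlocal (hΩ : Bornology.IsBounded Ω) (v : SecondVariation Ω A z)
    (hy : ContDiff ℝ ∞ y) (hb : ContDiff ℝ ∞ b) (t : Fin v.rank → ℝ) :
    fluxIntegral Ω y b (v.nonlocal t) = v.form (fun i => fluxIntegral Ω y b (v.field i)) t :=
  v.map_nonlocal (Λ := fluxIntegral Ω y b) (fun _ _ => fluxIntegral_add hΩ hy hb)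
    (fun c _ he => fluxIntegral_smul hy hb he c) t

/-- The local part and the coefficient matrix of the finite rank part are both symmetric. -/
lemma pairing_deriv_comm (hΩ : Bornology.IsBounded Ω) (v : SecondVariation Ω A z)
    (hb : ContDiff ℝ ∞ b) (hc : ContDiff ℝ ∞ c) :
    pairing Ω (v.deriv b) c = pairing Ω (v.deriv c) b := by
  have h1 : ∀ {b c : E → Val ν}, ContDiff ℝ ∞ b → ContDiff ℝ ∞ c → pairing Ω (v.deriv b) c =
      pairing Ω (v.loc b) c + v.form (fun i => pairing Ω (v.field i) c)
        (fun i => pairing Ω (v.field i) b) := fun {b c} hb hc => by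
    rw [← v.pairing_nonlocal hΩ hc]
    exact add_pairing hΩ hc.continuous (v.contDiff_loc b hb).continuous
      (v.contDiff_nonlocal _).continuous
  rw [h1 hb hc, h1 hc hb, v.loc_symm b c hb hc, v.form_comm]

/-- In directions that vanish near the boundary only the nonlocal part contributes to the flux. -/
lemma fluxIntegral_deriv (hΩ : Bornology.IsBounded Ω) (v : SecondVariation Ω A z)
    (hy : ContDiff ℝ ∞ y) (hb : ContDiff ℝ ∞ b) (hh : ContDiff ℝ ∞ h) (hc : HasCompactSupport h)
    (hs : tsupport h ⊆ Ω) : fluxIntegral Ω y b (v.deriv h) =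
      pairing Ω (v.nonlocal fun i => fluxIntegral Ω y b (v.field i)) h := by
  -- The local part keeps the support of h away from the boundary, so that its flux integrates to
  -- zero.
  have h1 : fluxIntegral Ω y b (v.loc h) = 0 := by
    have h2 : tsupport (fun x => dot (v.loc h x) (y x) • mom b x) ⊆ tsupport h :=
      closure_minimal (fun x hx => by
        by_contra h3
        exact hx (by simp [v.loc_eq_zero h x h3])) (isClosed_tsupport h)
    exact setIntegral_div_eq_zero hΩ (contDiff_flux hy hb (v.contDiff_loc h hh))
      (hc.of_isClosed_subset (isClosed_tsupport _) h2) (h2.trans hs)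
  rw [v.pairing_nonlocal hΩ hh, v.form_comm, ← v.fluxIntegral_nonlocal hΩ hy hb]
  refine (fluxIntegral_add hΩ hy hb (v.contDiff_loc h hh) (v.contDiff_nonlocal _)).trans ?_
  rw [h1, zero_add]

/-- The contribution of the second variation to the iterated bracket. -/
def bracketForm (v : SecondVariation Ω A z) (y b c : E → Val ν) : ℝ :=
  pairing Ω (v.deriv (hamField y z b)) (hamField y z c)
    - fluxIntegral Ω y b (v.deriv (hamField y z c))
    - fluxIntegral Ω y c (v.deriv (hamField y z b))
    + v.form (fun i => fluxIntegral Ω y b (v.field i)) (fun i => fluxIntegral Ω y c (v.field i))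

end SecondVariation

/-! ### The transported quantities -/

namespace Mixture

variable {m : Mixture ν n} {Ω : Set E} {y z k : E → Val ν}

/-- 𝕃_α and P do not depend on M, so that a change of momentum is carried over unchanged. -/
lemma fderiv_carried_momEmb (hm : m.Admissible) {v : Val ν} (hv : v ∈ m.valDom) (u : E) :
    fderiv ℝ m.carried v (momEmb u) = momEmb u := by
  have h1 : DifferentiableAt ℝ m.carried v :=
    ((contDiffOn_carried hm).differentiableOn (by simp)).differentiableAt
      ((m.isOpen_valDom hm).mem_nhds hv)
  have h2 : (fun w : E => m.carried (v + momEmb w)) =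
      fun w => m.carried v + (momEmb : E →L[ℝ] Val ν) w := by
    ext1 w
    simp [carried, momEmb, thermoL, scaL]
  have h3 : HasFDerivAt (fun w : E => m.carried (v + (momEmb : E →L[ℝ] Val ν) w))
      ((fderiv ℝ m.carried v).comp (momEmb : E →L[ℝ] Val ν)) 0 := by
    have h4 : HasFDerivAt (fun w : E => v + (momEmb : E →L[ℝ] Val ν) w) momEmb 0 :=
      (momEmb : E →L[ℝ] Val ν).hasFDerivAt.const_add v
    have h5 : HasFDerivAt m.carried (fderiv ℝ m.carried v)
        (v + (momEmb : E →L[ℝ] Val ν) 0) := by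
      rw [map_zero, add_zero]
      exact h1.hasFDerivAt
    exact h5.comp (0 : E) h4
  rw [h2] at h3
  exact DFunLike.congr_fun (h3.unique
    ((momEmb : E →L[ℝ] Val ν).hasFDerivAt.const_add _)) u

variable (m Ω) in
/-- `y` extends the transported quantities smoothly to all of space, and `k + y` extends their
derivative in the direction `y`. -/
structure IsCarriedExtension (z y k : E → Val ν) : Prop where
  contDiff : ContDiff ℝ ∞ y
  contDiff_variation : ContDiff ℝ ∞ k
  eqOn : EqOn (m.carriedField z) y Ω
  variation_eq : ∀ x ∈ Ω, fderiv ℝ m.carried (z x) (y x) = k x + y x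

/-- Extensions to all of space spare the later calculus any restriction to neighbourhoods of the
closed domain. On Ω, k is the derivative in the direction y of the nonlinear part (−𝕃_α, 0, P) of
the transported quantities. -/
lemma exists_isCarriedExtension (hm : m.Admissible) (hz : z ∈ m.states Ω) :
    ∃ y k, m.IsCarriedExtension Ω z y k := by
  have hV := isOpen_regular hm hz
  have hc := contDiffOn_carriedField hm hz
  have hk : ContDiffOn ℝ ∞ (fun x => fderiv ℝ m.carried (z x) (m.carriedField z x) -
      m.carriedField z x) (m.regular z) :=
    ((((contDiffOn_carried hm).fderiv_of_isOpen (m.isOpen_valDom hm) (by simp)).comp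
      hz.1.contDiffOn fun _ hx => hx).clm_apply hc).sub hc
  obtain ⟨y, hy, hy'⟩ := exists_contDiff_eventuallyEq isClosed_closure hV
    (closure_subset_regular hz) hc
  obtain ⟨k, hk, hk'⟩ := exists_contDiff_eventuallyEq isClosed_closure hV
    (closure_subset_regular hz) hk
  rw [eventually_nhdsSet_iff_forall] at hy' hk'
  have hy1 : ∀ x ∈ Ω, y x = m.carriedField z x := fun x hx =>
    (hy' x (subset_closure hx)).self_of_nhds
  refine ⟨y, k, hy, hk, fun x hx => (hy1 x hx).symm, fun x hx => ?_⟩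
  rw [(hk' x (subset_closure hx)).self_of_nhds, hy1 x hx, sub_add_cancel]

variable {a : E → Val ν}

/-- The derivative of `carried` acts on the three summands of X_a separately: y becomes k + y, dz
becomes dy by the chain rule, and momentum vectors are fixed. -/
lemma IsCarriedExtension.carriedDeriv_hamField (hE : m.IsCarriedExtension Ω z y k)
    (hm : m.Admissible) (hΩ : IsOpen Ω) (hz : z ∈ m.states Ω) :
    EqOn (m.carriedDeriv z (hamField y z a)) (hamFieldDeriv y z k a) Ω := fun x hx => by
  have hx' : z x ∈ m.valDom := hz.2 x (subset_closure hx)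
  have h1 : DifferentiableAt ℝ m.carried (z x) :=
    ((contDiffOn_carried hm).differentiableOn (by simp)).differentiableAt
      ((m.isOpen_valDom hm).mem_nhds hx')
  have h2 : fderiv ℝ y x = (fderiv ℝ m.carried (z x)).comp (fderiv ℝ z x) := by
    rw [← (Filter.eventuallyEq_of_mem (hΩ.mem_nhds hx) hE.eqOn).fderiv_eq]
    exact (h1.hasFDerivAt.comp x (hz.1.differentiable (by simp) x).hasFDerivAt).fderiv
  simp only [carriedDeriv, hamField, hamFieldDeriv, map_add, map_smul, hE.variation_eq x hx, h2,
    fderiv_carried_momEmb hm hx', ContinuousLinearMap.comp_apply]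

end Mixture

end OpenMixture

end

noncomputable section
namespace OpenMixture

variable {ν n : ℕ}

/-! ### The functional derivative of the Poisson bracket -/

section Localization

variable {Ω : Set E} {y z k b c : E → Val ν} {χ : E → ℝ}

/-- The fundamental lemma of the calculus of variations. -/
lemma eqOn_of_forall_setIntegral_eq (hΩ : IsOpen Ω) {f g : E → ℝ} (hf : Continuous f)
    (hg : Continuous g) (h : ∀ χ : E → ℝ, ContDiff ℝ ∞ χ → HasCompactSupport χ →
      tsupport χ ⊆ Ω → ∫ x in Ω, χ x * f x = ∫ x in Ω, χ x * g x) : EqOn f g Ω := by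
  have h1 : ∀ᵐ x, x ∈ Ω → f x - g x = 0 := by
    refine hΩ.ae_eq_zero_of_integral_contDiff_smul_eq_zero
      ((hf.sub hg).continuousOn.locallyIntegrableOn hΩ.measurableSet) fun χ hχ hc hs => ?_
    have h2 : ∀ {f : E → ℝ}, Continuous f → Integrable fun x => χ x * f x := fun hf =>
      (hχ.continuous.mul hf).integrable_of_hasCompactSupport hc.mul_right
    have h3 : ∀ f : E → ℝ, ∫ x in Ω, χ x * f x = ∫ x, χ x * f x := fun f =>
      setIntegral_eq_integral_of_forall_compl_eq_zero fun x hx => by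
        rw [image_eq_zero_of_notMem_tsupport fun hx' => hx (hs hx'), zero_mul]
    have h4 := h χ hχ hc hs
    rw [h3, h3] at h4
    simp only [smul_eq_mul, mul_sub]
    rw [integral_sub (h2 hf) (h2 hg), h4, sub_self]
  exact Measure.eqOn_open_of_ae_eq ((ae_restrict_iff' hΩ.measurableSet).2
    (h1.mono fun x hx hx' => sub_eq_zero.1 (hx hx'))) hΩ hf.continuousOn hg.continuousOn

/-- In the direction χ y all derivatives of χ can be collected in divergences. The coefficient of χ
that remains is the variation of the bracket with the functional derivatives of both arguments held
fixed. -/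
lemma bracketDensity_smul_variation (hy : ContDiff ℝ ∞ y) (hk : ContDiff ℝ ∞ k)
    (hb : ContDiff ℝ ∞ b) (hc : ContDiff ℝ ∞ c) (hχ : ContDiff ℝ ∞ χ) (x : E) :
    bracketDensity (fun x => χ x • (k x + y x)) (fun x => χ x • y x) b c x =
      χ x * (momVariation y k b (mom c) x - momVariation y k c (mom b) x) +
      (div (fun x => (χ x * dot (b x) (k x)) • mom c x) x -
        div (fun x => (χ x * dot (c x) (k x)) • mom b x) x) := by
  have hd : ∀ {G : Type} [NormedAddCommGroup G] [NormedSpace ℝ G] {f : E → G},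
      ContDiff ℝ ∞ f → DifferentiableAt ℝ f x := fun h => h.differentiable (by simp) x
  have key : ∀ {b c : E → Val ν}, ContDiff ℝ ∞ b → ContDiff ℝ ∞ c →
      transport (fun x => χ x • (k x + y x)) (fun x => χ x • y x) b x (mom c x) =
        χ x * momVariation y k b (mom c) x +
          div (fun x => (χ x * dot (b x) (k x)) • mom c x) x := fun {b c} hb hc => by
    have h1 : (fun x => dot (b x) (χ x • (k x + y x))) =
        fun x => χ x * dot (b x) (k x) + dot (b x) (χ x • y x) := by
      ext; simp
    have h2 := hχ.mul (contDiff_dot hb hk)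
    have h4 : ContDiff ℝ ∞ fun x => χ x • y x := hχ.smul hy
    have h3 := contDiff_dot hb h4
    rw [transport_apply, h1, fderiv_fun_add (hd h2) (hd h3), add_apply,
      fderiv_dot (hd hb) (hd h4), div_smul (hd h2) (hd (contDiff_mom hc))]
    simp only [momVariation, dirDeriv, map_smul, smul_apply, smul_eq_mul, dot_comm (y x)]
    ring
  rw [bracketDensity, key hb hc, key hc hb]
  ring

end Localization

namespace Mixture

variable {m : Mixture ν n} {Ω : Set E} {y z k a h δ : E → Val ν} {A B C : (E → Val ν) → ℝ}

/-- The derivative of the Poisson bracket in a direction. -/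
lemma IsCarriedExtension.pairing_poisson (hE : m.IsCarriedExtension Ω z y k) (hm : m.Admissible)
    (hne : Ω.Nonempty) (hΩ : IsOpen Ω) (hb : Bornology.IsBounded Ω) (hz : z ∈ m.states Ω)
    (hB : m.IsObservable Ω B) (hC : m.IsObservable Ω C) (vB : SecondVariation Ω B z)
    (vC : SecondVariation Ω C z) (hδ : HasVarDeriv Ω (m.poisson Ω B C) z δ)
    (hh : ContDiff ℝ ∞ h) {g : E → Val ν} (hg : ContDiff ℝ ∞ g)
    (hgh : EqOn (m.carriedDeriv z h) g Ω) :
    pairing Ω δ h = (∫ x in Ω, bracketDensity g h (varDeriv Ω B z) (varDeriv Ω C z) x)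
      + pairing Ω (vC.deriv h) (hamField y z (varDeriv Ω B z))
      - fluxIntegral Ω y (varDeriv Ω B z) (vC.deriv h)
      - pairing Ω (vB.deriv h) (hamField y z (varDeriv Ω C z))
      + fluxIntegral Ω y (varDeriv Ω C z) (vB.deriv h) := by
  have hb' := contDiff_varDeriv (hB z hz)
  have hc' := contDiff_varDeriv (hC z hz)
  have hBh := vB.contDiff_deriv hh
  have hCh := vC.contDiff_deriv hh
  have h0 : HasVarDeriv Ω (m.poisson Ω B C) (z + (0 : ℝ) • h) δ := by
    rwa [zero_smul, add_zero]
  -- The derivative of {B, C} in the direction h, computed once with δ and once under the integral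
  -- sign.
  rw [(h0.hasDerivAt_line hne hb hz.1 hh).unique (hasDerivAt_poisson hm hΩ hb hz hB hC vB vC hh)]
  have h1 : ∀ x ∈ Ω, bracketDensity (m.carriedField z) z (vB.deriv h) (varDeriv Ω C z) x
        + bracketDensity (m.carriedField z) z (varDeriv Ω B z) (vC.deriv h) x
        + bracketDensity (m.carriedDeriv z h) h (varDeriv Ω B z) (varDeriv Ω C z) x =
      -bracketDensity y z (varDeriv Ω C z) (vB.deriv h) x
        + bracketDensity y z (varDeriv Ω B z) (vC.deriv h) x
        + bracketDensity g h (varDeriv Ω B z) (varDeriv Ω C z) x := fun x hx => by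
    rw [← bracketDensity_antisymm,
      bracketDensity_eq_of_eqOn hΩ hE.eqOn (eqOn_refl z Ω) (eqOn_refl _ Ω) (eqOn_refl _ Ω) hx,
      bracketDensity_eq_of_eqOn hΩ hE.eqOn (eqOn_refl z Ω) (eqOn_refl _ Ω) (eqOn_refl _ Ω) hx,
      bracketDensity_eq_of_eqOn hΩ hgh (eqOn_refl h Ω) (eqOn_refl _ Ω) (eqOn_refl _ Ω) hx]
  have i1 := contDiff_bracketDensity hE.contDiff hz.1 hc' hBh
  have i2 := contDiff_bracketDensity hE.contDiff hz.1 hb' hCh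
  have i3 := contDiff_bracketDensity hg hh hb' hc'
  rw [setIntegral_congr_fun hΩ.measurableSet h1,
    integral_add (integrableOn_of_contDiff hb (i1.neg.add i2)) (integrableOn_of_contDiff hb i3),
    integral_add (integrableOn_of_contDiff hb i1.neg) (integrableOn_of_contDiff hb i2),
    integral_neg, setIntegral_bracketDensity hb hE.contDiff hz.1 hc' hBh,
    setIntegral_bracketDensity hb hE.contDiff hz.1 hb' hCh]
  ring

/-- The part of the functional derivative of `{B, C}` that depends on the second variations of
`B` and `C`. -/
def secondVariationPart (y : E → Val ν) (vB : SecondVariation Ω B z) (vC : SecondVariation Ω C z)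
    (x : E) : Val ν :=
  (vC.deriv (hamField y z (varDeriv Ω B z)) x
      + vB.nonlocal (fun i => fluxIntegral Ω y (varDeriv Ω C z) (vB.field i)) x)
    + (-1 : ℝ) • (vB.deriv (hamField y z (varDeriv Ω C z)) x
      + vC.nonlocal (fun i => fluxIntegral Ω y (varDeriv Ω B z) (vC.field i)) x)

/-- The flux in the outer bracket involves δ only through ⟨δ, y⟩. This function is found by testing
with the directions χ y, χ compactly supported in Ω: divergences integrate to zero, the symmetric
second variations move onto the Hamiltonian fields, and only the finite rank parts leave fluxes
behind. -/
lemma IsCarriedExtension.dot_varDeriv_poisson (hE : m.IsCarriedExtension Ω z y k)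
    (hm : m.Admissible) (hne : Ω.Nonempty) (hΩ : IsOpen Ω) (hb : Bornology.IsBounded Ω)
    (hz : z ∈ m.states Ω) (hB : m.IsObservable Ω B) (hC : m.IsObservable Ω C)
    (vB : SecondVariation Ω B z) (vC : SecondVariation Ω C z)
    (hδ : HasVarDeriv Ω (m.poisson Ω B C) z δ) :
    EqOn (fun x => dot (δ x) (y x)) (fun x =>
      momVariation y k (varDeriv Ω B z) (mom (varDeriv Ω C z)) x
        - momVariation y k (varDeriv Ω C z) (mom (varDeriv Ω B z)) x
        + dot (secondVariationPart y vB vC x) (y x)) Ω := by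
  have hy := hE.contDiff
  have hk := hE.contDiff_variation
  have hb' := contDiff_varDeriv (hB z hz)
  have hc' := contDiff_varDeriv (hC z hz)
  have hXb := contDiff_hamField hy hz.1 hb'
  have hXc := contDiff_hamField hy hz.1 hc'
  have hq := (contDiff_momVariation hy hk hb' (contDiff_mom hc')).sub
    (contDiff_momVariation hy hk hc' (contDiff_mom hb'))
  have w1 := vC.contDiff_deriv hXb
  have w2 := vB.contDiff_nonlocal (fun i => fluxIntegral Ω y (varDeriv Ω C z) (vB.field i))
  have w3 := vB.contDiff_deriv hXc
  have w4 := vC.contDiff_nonlocal (fun i => fluxIntegral Ω y (varDeriv Ω B z) (vC.field i))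
  have hw : ContDiff ℝ ∞ (secondVariationPart y vB vC) := (w1.add w2).add ((w3.add w4).const_smul _)
  refine eqOn_of_forall_setIntegral_eq hΩ (contDiff_dot hδ.1 hy).continuous
    (hq.add (contDiff_dot hw hy)).continuous fun χ hχ hc hs => ?_
  have hh : ContDiff ℝ ∞ fun x => χ x • y x := hχ.smul hy
  have hsub : tsupport (fun x => χ x • y x) ⊆ tsupport χ := tsupport_smul_subset_left χ y
  have hhc : HasCompactSupport fun x => χ x • y x := hc.smul_right
  have hhs := hsub.trans hs
  have hg : ContDiff ℝ ∞ fun x => χ x • (k x + y x) := hχ.smul (hk.add hy)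
  have hgh : EqOn (m.carriedDeriv z fun x => χ x • y x) (fun x => χ x • (k x + y x)) Ω :=
    fun x hx => by simp only [carriedDeriv, map_smul, hE.variation_eq x hx]
  have key := hE.pairing_poisson hm hne hΩ hb hz hB hC vB vC hδ hh hg hgh
  have hflux : ∀ {b c : E → Val ν}, ContDiff ℝ ∞ b → ContDiff ℝ ∞ c →
      ∫ x in Ω, div (fun x => (χ x * dot (b x) (k x)) • mom c x) x = 0 := fun {b c} hb' hc' => by
    have h1 : (fun x => (χ x * dot (b x) (k x)) • mom c x) =
        fun x => χ x • (dot (b x) (k x) • mom c x) := by simp only [mul_smul]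
    rw [h1]
    exact setIntegral_div_eq_zero hb (hχ.smul (contDiff_flux hk hc' hb')) hc.smul_right
      ((tsupport_smul_subset_left χ _).trans hs)
  have hdiv : ∀ {b c : E → Val ν}, ContDiff ℝ ∞ b → ContDiff ℝ ∞ c →
      ContDiff ℝ ∞ (div fun x => (χ x * dot (b x) (k x)) • mom c x) := fun hb' hc' =>
    contDiff_div ((hχ.mul (contDiff_dot hb' hk)).smul (contDiff_mom hc'))
  have h1 : ∫ x in Ω, bracketDensity (fun x => χ x • (k x + y x)) (fun x => χ x • y x)
        (varDeriv Ω B z) (varDeriv Ω C z) x =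
      ∫ x in Ω, χ x * (momVariation y k (varDeriv Ω B z) (mom (varDeriv Ω C z)) x
        - momVariation y k (varDeriv Ω C z) (mom (varDeriv Ω B z)) x) := by
    simp only [bracketDensity_smul_variation hy hk hb' hc' hχ]
    rw [integral_add (integrableOn_of_contDiff hb (hχ.mul hq))
      (integrableOn_of_contDiff hb ((hdiv hb' hc').sub (hdiv hc' hb'))),
      integral_sub (integrableOn_of_contDiff hb (hdiv hb' hc'))
      (integrableOn_of_contDiff hb (hdiv hc' hb')), hflux hb' hc', hflux hc' hb']
    ring
  have h2 : ∀ e : E → Val ν, pairing Ω e (fun x => χ x • y x) =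
      ∫ x in Ω, χ x * dot (e x) (y x) := fun e => by
    simp only [pairing_eq, map_smul, smul_eq_mul]
  have h3 : pairing Ω (secondVariationPart y vB vC) (fun x => χ x • y x) =
      pairing Ω (vC.deriv (hamField y z (varDeriv Ω B z))) (fun x => χ x • y x)
      + pairing Ω (vB.nonlocal (fun i => fluxIntegral Ω y (varDeriv Ω C z) (vB.field i)))
        (fun x => χ x • y x)
      - (pairing Ω (vB.deriv (hamField y z (varDeriv Ω C z))) (fun x => χ x • y x)
      + pairing Ω (vC.nonlocal (fun i => fluxIntegral Ω y (varDeriv Ω B z) (vC.field i)))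
        (fun x => χ x • y x)) := by
    refine (add_pairing hb hh.continuous (w1.add w2).continuous
      ((w3.add w4).const_smul (-1 : ℝ)).continuous).trans ?_
    rw [sub_eq_add_neg]
    refine congrArg₂ _ (add_pairing hb hh.continuous w1.continuous w2.continuous) ?_
    refine (smul_pairing _ (fun x => vB.deriv (hamField y z (varDeriv Ω C z)) x
      + vC.nonlocal (fun i => fluxIntegral Ω y (varDeriv Ω B z) (vC.field i)) x) _).trans ?_
    rw [neg_one_mul]
    exact congrArg _ (add_pairing hb hh.continuous w3.continuous w4.continuous)
  rw [h1, vC.pairing_deriv_comm hb hh hXb, vB.pairing_deriv_comm hb hh hXc,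
    vC.fluxIntegral_deriv hb hy hb' hh hhc hhs, vB.fluxIntegral_deriv hb hy hc' hh hhc hhs] at key
  have h4 : ∫ x in Ω, χ x * (momVariation y k (varDeriv Ω B z) (mom (varDeriv Ω C z)) x
        - momVariation y k (varDeriv Ω C z) (mom (varDeriv Ω B z)) x
        + dot (secondVariationPart y vB vC x) (y x)) =
      (∫ x in Ω, χ x * (momVariation y k (varDeriv Ω B z) (mom (varDeriv Ω C z)) x
        - momVariation y k (varDeriv Ω C z) (mom (varDeriv Ω B z)) x)) +
      pairing Ω (secondVariationPart y vB vC) (fun x => χ x • y x) := by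
    rw [h2, ← integral_add (integrableOn_of_contDiff hb (hχ.mul hq))
      (integrableOn_of_contDiff hb (hχ.mul (contDiff_dot hw hy)))]
    simp only [mul_add]
  rw [h4, h3, ← h2, key]
  ring

/-- The iterated Poisson bracket. -/
lemma IsCarriedExtension.poisson_poisson (hE : m.IsCarriedExtension Ω z y k)
    (hm : m.Admissible) (hne : Ω.Nonempty) (hΩ : IsOpen Ω) (hb : Bornology.IsBounded Ω)
    (hz : z ∈ m.states Ω) (hA : m.IsObservable Ω A) (hB : m.IsObservable Ω B)
    (hC : m.IsObservable Ω C) (vB : SecondVariation Ω B z) (vC : SecondVariation Ω C z)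
    (hBC : m.IsObservable Ω (m.poisson Ω B C)) :
    m.poisson Ω A (m.poisson Ω B C) z =
      (∫ x in Ω, (bracketDensity (hamFieldDeriv y z k (varDeriv Ω A z))
          (hamField y z (varDeriv Ω A z)) (varDeriv Ω B z) (varDeriv Ω C z) x
        - div (fun x => (momVariation y k (varDeriv Ω B z) (mom (varDeriv Ω C z)) x
          - momVariation y k (varDeriv Ω C z) (mom (varDeriv Ω B z)) x)
            • mom (varDeriv Ω A z) x) x))
      + vC.bracketForm y (varDeriv Ω A z) (varDeriv Ω B z)
      - vB.bracketForm y (varDeriv Ω C z) (varDeriv Ω A z) := by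
  have hy := hE.contDiff
  have hk := hE.contDiff_variation
  have ha' := contDiff_varDeriv (hA z hz)
  have hb' := contDiff_varDeriv (hB z hz)
  have hc' := contDiff_varDeriv (hC z hz)
  have hδ := hasVarDeriv_varDeriv (hBC z hz)
  set δ := varDeriv Ω (m.poisson Ω B C) z with hδ_def
  have hXa := contDiff_hamField hy hz.1 ha'
  have hXb := contDiff_hamField hy hz.1 hb'
  have hXc := contDiff_hamField hy hz.1 hc'
  have hq := (contDiff_momVariation hy hk hb' (contDiff_mom hc')).sub
    (contDiff_momVariation hy hk hc' (contDiff_mom hb'))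
  have w1 := vC.contDiff_deriv hXb
  have w2 := vB.contDiff_nonlocal (fun i => fluxIntegral Ω y (varDeriv Ω C z) (vB.field i))
  have w3 := vB.contDiff_deriv hXc
  have w4 := vC.contDiff_nonlocal (fun i => fluxIntegral Ω y (varDeriv Ω B z) (vC.field i))
  have hw : ContDiff ℝ ∞ (secondVariationPart y vB vC) := (w1.add w2).add ((w3.add w4).const_smul _)
  have h1 : m.poisson Ω A (m.poisson Ω B C) z =
      ∫ x in Ω, bracketDensity y z (varDeriv Ω A z) δ x :=
    setIntegral_congr_fun hΩ.measurableSet fun x hx => by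
      rw [← hδ_def]
      exact (poissonDensity_eq hm hz (closure_subset_regular hz (subset_closure hx))
        (ha'.differentiable (by simp) x) (hδ.1.differentiable (by simp) x)).trans
        (bracketDensity_eq_of_eqOn hΩ hE.eqOn (eqOn_refl _ Ω) (eqOn_refl _ Ω) (eqOn_refl _ Ω) hx)
  have hqa : ContDiff ℝ ∞ fun x => (momVariation y k (varDeriv Ω B z) (mom (varDeriv Ω C z)) x
      - momVariation y k (varDeriv Ω C z) (mom (varDeriv Ω B z)) x) • mom (varDeriv Ω A z) x :=
    hq.smul (contDiff_mom ha')
  -- The flux is the integral of a divergence over the open set Ω, where ⟨δ, y⟩ is known.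
  have h2 : fluxIntegral Ω y (varDeriv Ω A z) δ =
      (∫ x in Ω, div (fun x => (momVariation y k (varDeriv Ω B z) (mom (varDeriv Ω C z)) x
          - momVariation y k (varDeriv Ω C z) (mom (varDeriv Ω B z)) x)
            • mom (varDeriv Ω A z) x) x) +
        fluxIntegral Ω y (varDeriv Ω A z) (secondVariationPart y vB vC) := by
    rw [fluxIntegral, fluxIntegral, ← setIntegral_div_add hb hqa
      (contDiff_flux hy ha' hw)]
    refine setIntegral_congr_fun hΩ.measurableSet fun x hx => ?_
    have h3 : EqOn (fun x => dot (δ x) (y x) • mom (varDeriv Ω A z) x) (fun x =>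
        (momVariation y k (varDeriv Ω B z) (mom (varDeriv Ω C z)) x
          - momVariation y k (varDeriv Ω C z) (mom (varDeriv Ω B z)) x)
            • mom (varDeriv Ω A z) x +
        dot (secondVariationPart y vB vC x) (y x) • mom (varDeriv Ω A z) x) Ω := fun x hx => by
      have h4 := hE.dot_varDeriv_poisson hm hne hΩ hb hz hB hC vB vC hδ hx
      simp only at h4 ⊢
      rw [h4, add_smul]
    simp only [div_eq_sum, (Filter.eventuallyEq_of_mem (hΩ.mem_nhds hx) h3).fderiv_eq]
  have h3 : fluxIntegral Ω y (varDeriv Ω A z) (secondVariationPart y vB vC) =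
      fluxIntegral Ω y (varDeriv Ω A z) (vC.deriv (hamField y z (varDeriv Ω B z)))
      + vB.form (fun i => fluxIntegral Ω y (varDeriv Ω A z) (vB.field i))
          (fun i => fluxIntegral Ω y (varDeriv Ω C z) (vB.field i))
      - (fluxIntegral Ω y (varDeriv Ω A z) (vB.deriv (hamField y z (varDeriv Ω C z)))
      + vC.form (fun i => fluxIntegral Ω y (varDeriv Ω A z) (vC.field i))
          (fun i => fluxIntegral Ω y (varDeriv Ω B z) (vC.field i))) := by
    refine (fluxIntegral_add hb hy ha' (w1.add w2) ((w3.add w4).const_smul (-1 : ℝ))).trans ?_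
    rw [fluxIntegral_smul hy ha' (w3.add w4), fluxIntegral_add hb hy ha' w1 w2,
      fluxIntegral_add hb hy ha' w3 w4]
    rw [vB.fluxIntegral_nonlocal hb hy ha', vC.fluxIntegral_nonlocal hb hy ha']
    ring
  have hd := contDiff_hamFieldDeriv hy hz.1 hk ha'
  -- ⟨δ, X_a⟩ is the derivative of {B, C} in the direction X_a, which need not vanish at the
  -- boundary. Its boundary terms and those of the flux combine into the two forms `bracketForm`.
  rw [h1, setIntegral_bracketDensity hb hy hz.1 ha' hδ.1, h2, h3,
    hE.pairing_poisson hm hne hΩ hb hz hB hC vB vC hδ hXa hd (hE.carriedDeriv_hamField hm hΩ hz),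
    integral_sub (integrableOn_of_contDiff hb (contDiff_bracketDensity hd hXa hb' hc'))
      (integrableOn_of_contDiff hb (contDiff_div hqa)),
    SecondVariation.bracketForm, SecondVariation.bracketForm, vB.pairing_deriv_comm hb hXc hXa,
    vB.form_comm (fun i => fluxIntegral Ω y (varDeriv Ω C z) (vB.field i))]
  ring

/-- The Jacobi identity. -/
theorem poisson_jacobi (hm : m.Admissible) (hne : Ω.Nonempty) (hΩ : IsOpen Ω)
    (hb : Bornology.IsBounded Ω) (hA : m.IsLocallyGenerated Ω A) (hB : m.IsLocallyGenerated Ω B)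
    (hC : m.IsLocallyGenerated Ω C) (hAB : m.IsObservable Ω (m.poisson Ω A B))
    (hBC : m.IsObservable Ω (m.poisson Ω B C)) (hCA : m.IsObservable Ω (m.poisson Ω C A))
    (hz : z ∈ m.states Ω) :
    m.poisson Ω A (m.poisson Ω B C) z + m.poisson Ω B (m.poisson Ω C A) z
      + m.poisson Ω C (m.poisson Ω A B) z = 0 := by
  obtain ⟨y, k, hE⟩ := exists_isCarriedExtension hm hz
  obtain ⟨vA⟩ := hA.exists_secondVariation hm hne hΩ hb hz
  obtain ⟨vB⟩ := hB.exists_secondVariation hm hne hΩ hb hz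
  obtain ⟨vC⟩ := hC.exists_secondVariation hm hne hΩ hb hz
  have hA' := hA.isObservable hm hne hb
  have hB' := hB.isObservable hm hne hb
  have hC' := hC.isObservable hm hne hb
  have hy := hE.contDiff
  have hk := hE.contDiff_variation
  have ha := contDiff_varDeriv (hA' z hz)
  have hb' := contDiff_varDeriv (hB' z hz)
  have hc := contDiff_varDeriv (hC' z hz)
  have hI : ∀ {a b c : E → Val ν}, ContDiff ℝ ∞ a → ContDiff ℝ ∞ b → ContDiff ℝ ∞ c →
      IntegrableOn (fun x => bracketDensity (hamFieldDeriv y z k a) (hamField y z a) b c x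
        - div (fun x => (momVariation y k b (mom c) x - momVariation y k c (mom b) x) • mom a x) x)
        Ω := fun ha hb' hc =>
    integrableOn_of_contDiff hb ((contDiff_bracketDensity (contDiff_hamFieldDeriv hy hz.1 hk ha)
      (contDiff_hamField hy hz.1 ha) hb' hc).sub (contDiff_div
        (((contDiff_momVariation hy hk hb' (contDiff_mom hc)).sub
          (contDiff_momVariation hy hk hc (contDiff_mom hb'))).smul (contDiff_mom ha))))
  have h1 := integral_add (hI ha hb' hc) (hI hb' hc ha)
  have h2 := integral_add ((hI ha hb' hc).add (hI hb' hc ha)) (hI hc ha hb')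
  -- The parts free of second variations add up to zero under the integral.
  simp only [Pi.add_apply, bracketDensity_jacobi hy hz.1 hk ha hb' hc, integral_zero] at h1 h2
  rw [hE.poisson_poisson hm hne hΩ hb hz hA' hB' hC' vB vC hBC,
    hE.poisson_poisson hm hne hΩ hb hz hB' hC' hA' vC vA hCA,
    hE.poisson_poisson hm hne hΩ hb hz hC' hA' hB' vA vB hAB]
  -- Each form `bracketForm` occurs twice in the cyclic sum, with opposite signs.
  linarith

end Mixture

end OpenMixture

end

theorem theorem4p13 {ν n : ℕ} (hν : 2 ≤ ν) (m : Mixture ν n) (hm : m.Admissible)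
    (Ω : Set E) (σ : Measure E) (nrm : E → E) (hΩ : IsLipschitzDomain Ω σ nrm) :
    -- energy and entropy are observables
    (m.IsObservable Ω (m.energy Ω) ∧ m.IsObservable Ω (m.entropy Ω)) ∧
    -- the Poisson bracket is anti-symmetric
    (∀ A B : StateField ν → ℝ, m.IsObservable Ω A → m.IsObservable Ω B →
      ∀ z ∈ m.states Ω, m.poisson Ω A B z = -m.poisson Ω B A z) ∧
    -- the Leibniz rule for both brackets
    (∀ A B C : StateField ν → ℝ, m.IsObservable Ω A → m.IsObservable Ω B → m.IsObservable Ω C →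
      m.IsObservable Ω (A * B) ∧ ∀ z ∈ m.states Ω,
        m.poisson Ω (A * B) C z = A z * m.poisson Ω B C z + B z * m.poisson Ω A C z ∧
        m.dissipation Ω (A * B) C z =
          A z * m.dissipation Ω B C z + B z * m.dissipation Ω A C z) ∧
    -- the Jacobi identity
    (∀ A B C : StateField ν → ℝ, m.IsLocallyGenerated Ω A → m.IsLocallyGenerated Ω B →
      m.IsLocallyGenerated Ω C → m.IsObservable Ω (m.poisson Ω A B) →
      m.IsObservable Ω (m.poisson Ω B C) → m.IsObservable Ω (m.poisson Ω C A) →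
      ∀ z ∈ m.states Ω,
        m.poisson Ω A (m.poisson Ω B C) z + m.poisson Ω B (m.poisson Ω C A) z
          + m.poisson Ω C (m.poisson Ω A B) z = 0) ∧
    -- the dissipation bracket is symmetric and non-negative
    (∀ A B : StateField ν → ℝ, m.IsObservable Ω A → m.IsObservable Ω B →
      ∀ z ∈ m.states Ω, m.dissipation Ω A B z = m.dissipation Ω B A z) ∧
    (∀ A : StateField ν → ℝ, m.IsObservable Ω A →
      ∀ z ∈ m.states Ω, 0 ≤ m.dissipation Ω A A z) ∧
    -- the non-interaction conditions for the bulk contributions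
    (∀ A : StateField ν → ℝ, m.IsObservable Ω A → ∀ z ∈ m.states Ω,
      m.poissonBulk Ω σ nrm A (m.entropy Ω) z = 0 ∧
      m.dissipationBulk Ω σ nrm A (m.energy Ω) z = 0) ∧
    -- the boundary contributions are given by the boundary operator and the port
    (∀ A : StateField ν → ℝ, m.IsObservable Ω A → ∀ z ∈ m.states Ω,
      m.poissonBdry Ω σ nrm A (m.energy Ω) z + m.dissipationBdry Ω σ nrm A (m.entropy Ω) z =
        -m.bdryOperator σ nrm z (varDeriv Ω A z) (m.port nrm z)) ∧
    -- the evolution of observables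
    (∀ (I : Set ℝ) (z : ℝ → StateField ν), IsOpen I → m.IsSolution Ω I z →
      ∀ A : StateField ν → ℝ, m.IsObservable Ω A → ∀ t ∈ I,
        HasDerivAt (fun τ => A (z τ))
          (m.poisson Ω A (m.energy Ω) (z t) - m.poissonBdry Ω σ nrm A (m.energy Ω) (z t)
            + m.dissipation Ω A (m.entropy Ω) (z t)
            - m.dissipationBdry Ω σ nrm A (m.entropy Ω) (z t)) t) := by
  refine ⟨⟨Mixture.isObservable_energy hm hΩ, Mixture.isObservable_entropy hm hΩ⟩,
    fun A B _ _ z _ => Mixture.poisson_antisymm A B z,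
    fun A B C hA hB hC => ⟨Mixture.isObservable_mul hΩ hA hB, fun z hz =>
      ⟨Mixture.poisson_leibniz hm hΩ hz hA hB hC, Mixture.dissipation_leibniz hm hΩ hz hA hB hC⟩⟩,
    ?_,
    fun A B _ _ z hz => Mixture.dissipation_symm hm hΩ.isOpen hz A B,
    fun A _ z hz => Mixture.dissipation_nonneg hm hΩ.isOpen hz A,
    fun A hA z hz => ⟨Mixture.poissonBulk_entropy hm hΩ hz hA,
      Mixture.dissipationBulk_energy hm hΩ hz hA⟩,
    fun A hA z hz => Mixture.bdry_eq_bdryOperator hm hΩ hz hA,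
    fun I z hI hz A hA t ht => Mixture.hasDerivAt_of_isSolution hm hΩ hI hz hA ht⟩
  exact fun A B C hA hB hC hAB hBC hCA z hz =>
    Mixture.poisson_jacobi hm hΩ.isConnected.nonempty hΩ.isOpen hΩ.isBounded hA hB hC hAB hBC hCA hz
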